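/- Let $\mathfrak n\cong\mathbb C^6$ be the space of nilpotent lower triangular complex $4\times 4$ matrices, with coordinates $y_{11},y_{22},y_{33},y_{12},y_{23},y_{13}$ ($y_{ab}$ being the entry in row $b$ and column $a-1$, where rows and columns are numbered $0,\dots,3$), regarded as an affine toric variety for the torus $T=(\mathbb C^*)^6$ scaling the coordinates. Its fan $\Sigma(\delta)$ in $N(T)_{\mathbb R}=\mathbb R^6$ consists of the faces of the positive orthant $\delta$. Let $H$ be the torus of diagonal $4\times4$ matrices modulo scalars, acting on $\mathfrak n$ by conjugation. (Via $Y\mapsto e^{Y}B$, with $B$ the group of upper triangular matrices, $\mathfrak n$ is $H$-equivariantly isomorphic to the open chart $F_e$ around the base point of the variety of complete flags in $\mathbb C^4$.) Let $N(H)\subset N(T)$ be the induced inclusion of lattices of one-parameter subgroups. The projection $\pi\colon N(T)\to N(T)/N(H)=N(T/H)$ is, for a suitable identification $N(T/H)=\mathbb Z^3$, given by the matrix $$\begin{pmatrix}-1&-1&0&1&0&0\\0&-1&-1&0&1&0\\-1&-1&-1&0&0&1\end{pmatrix},$$ that is, this matrix defines a surjection $\mathbb Z^6\to\mathbb Z^3$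 with kernel $N(H)$. The quotient fan $\Sigma=\pi(\Sigma(\delta))$ in $\mathbb R^3$ is the set of the cones $\bigcap_{\sigma\in\Sigma(\delta),\,x\in\pi(\sigma)}\pi(\sigma)$, for $x$ in the union of the projected cones, and the combinatorial quotient $X_e$ of $\mathfrak n\cong F_e$ by $H$ is the toric variety $X(\Sigma)$ over $\mathbb C$. **Proposition.** $\Sigma$ is a fan, and its rays are exactly the seven rays with primitive generators $$\rho_0=(-1,0,-1),\ \rho_1=(-1,-1,-1),\ \rho_2=(0,-1,-1),\ \rho_3=(1,0,0),\ \rho_4=(0,1,0),\ \rho_5=(0,0,1),\ \rho_6=(0,0,-1).$$ The toric variety $X_e=X(\Sigma)$ is smooth, projective, integral, of dimension $3$ and of Picard number $4$ (the rank of the group of Cartier divisors modulo numerical equivalence). Moreover, let $\mathbb P^3$ have homogeneous coordinates $y_0,\dots,y_3$, and let $P=[0:0:0:1]$, $\ell_1=\{y_0=y_2=0\}$, $\ell_2=\{y_0=y_1=0\}$. There are blowups over $\mathbb C$ $$X_e\xrightarrow{\,p_d\,}X_2\xrightarrow{\,p_b\,}X_1\xrightarrow{\,p_a\,}\mathbb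 P^3,$$ each along a closed subscheme isomorphic to $\mathbb P^1$: $p_a$ is the blowup of $\mathbb P^3$ along $\ell_1$, $p_b$ is the blowup of $X_1$ along the strict transform of $\ell_2$, and $p_d$ is the blowup of $X_2$ along the strict transform of $p_a^{-1}(P)$. The composition $X_e\to\mathbb P^3$ is toric: it restricts on the torus $T/H=(\mathbb C^*)^3$ of $X_e$ to the standard embedding $(t_1,t_2,t_3)\mapsto[1:t_1:t_2:t_3]$. -/

import Mathlib

open CategoryTheory CategoryTheory.Limits AlgebraicGeometry

noncomputable section

namespace FlagQuotient

/-! ### Cones and fans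

The lattice is `Fin n → ℤ`, sitting in the real vector space `Fin n → ℝ`. -/

/-- Convex cones containing the origin in `ℝⁿ`. -/
abbrev Cone (n : ℕ) : Type := PointedCone ℝ (Fin n → ℝ)

/-- The real vector attached to a lattice vector. -/
def realVec {n : ℕ} (v : Fin n → ℤ) : Fin n → ℝ := fun i => (v i : ℝ)

/-- The half-line spanned by a lattice vector. -/
def ray {n : ℕ} (v : Fin n → ℤ) : Cone n := PointedCone.hull ℝ {realVec v}

/-- A fan: a finite nonempty set of strongly convex rational polyhedral cones, closed under taking
faces, such that the intersection of two cones of the fan is a face of each. -/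
structure IsFan {n : ℕ} (Δ : Set (Cone n)) : Prop where
  finite : Δ.Finite
  nonempty : Δ.Nonempty
  rational : ∀ σ ∈ Δ, ∃ S : Finset (Fin n → ℤ), σ = PointedCone.hull ℝ (realVec '' (S : Set _))
  stronglyConvex : ∀ σ ∈ Δ, ∀ x ∈ σ, -x ∈ σ → x = 0
  face_mem : ∀ σ ∈ Δ, ∀ τ : Cone n, τ.IsFaceOf σ → τ ∈ Δ
  inter_face : ∀ σ ∈ Δ, ∀ τ ∈ Δ, (σ ⊓ τ).IsFaceOf σ

/-- A lattice vector is primitive if it is not a proper multiple of a lattice vector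
(in particular it is nonzero). -/
def IsPrimitive {n : ℕ} (v : Fin n → ℤ) : Prop :=
  ∀ (k : ℤ) (w : Fin n → ℤ), v = k • w → IsUnit k

/-- The primitive lattice generators of the one-dimensional cones of a set of cones. -/
def rayGenerators {n : ℕ} (Δ : Set (Cone n)) : Set (Fin n → ℤ) :=
  {v | IsPrimitive v ∧ ray v ∈ Δ}

/-- The fan formed by all the faces of a cone. -/
def faceFan {n : ℕ} (δ : Cone n) : Set (Cone n) := {τ | τ.IsFaceOf δ}

/-- The linear map of real vector spaces attached to an integral matrix. -/
def realMap {k n : ℕ} (A : Matrix (Fin k) (Fin n) ℤ) : (Fin n → ℝ) →ₗ[ℝ] (Fin k → ℝ) :=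
  Matrix.mulVecLin (A.map (fun a : ℤ => (a : ℝ)))

/-- The quotient fan: its cones are the cones `⋂_{σ ∈ Δ, x ∈ π(σ)} π(σ)`, where `x` runs through the
points of the union of the projected cones. -/
def quotientFan {k n : ℕ} (A : Matrix (Fin k) (Fin n) ℤ) (Δ : Set (Cone n)) : Set (Cone k) :=
  {C | ∃ x : Fin k → ℝ, (∃ σ ∈ Δ, x ∈ PointedCone.map (realMap A) σ) ∧
    C = sInf {D | ∃ σ ∈ Δ, D = PointedCone.map (realMap A) σ ∧ x ∈ D}}

/-! ### Toric varieties over `ℂ` -/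

/-- The base scheme. -/
abbrev SpecC : Scheme.{0} := Spec (CommRingCat.of ℂ)

/-- The monoid `σ^∨ ∩ M` of integral linear forms that are nonnegative on `σ`. -/
def dualMonoid {n : ℕ} (σ : Cone n) : AddSubmonoid (Fin n → ℤ) where
  carrier := {m | ∀ x ∈ σ, 0 ≤ ∑ i, (m i : ℝ) * x i}
  zero_mem' := by
    intro x _
    simp
  add_mem' := by
    intro a b ha hb x hx
    have h := add_nonneg (ha x hx) (hb x hx)
    rw [← Finset.sum_add_distrib] at h
    simpa [add_mul] using h

lemma dualMonoid_anti {n : ℕ} {τ σ : Cone n} (h : τ ≤ σ) : dualMonoid σ ≤ dualMonoid τ :=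
  fun _ hm x hx => hm x (h hx)

/-- The algebra `ℂ[σ^∨ ∩ M]`. -/
abbrev chartRing {n : ℕ} (σ : Cone n) : Type := AddMonoidAlgebra ℂ (dualMonoid σ)

/-- The affine toric variety `U_σ = Spec ℂ[σ^∨ ∩ M]`. -/
def chart {n : ℕ} (σ : Cone n) : Scheme.{0} := Spec (CommRingCat.of (chartRing σ))

/-- The structure morphism of `U_σ`. -/
def chartToSpecC {n : ℕ} (σ : Cone n) : chart σ ⟶ SpecC :=
  Spec.map (CommRingCat.ofHom (algebraMap ℂ (chartRing σ)))

/-- The morphism `U_τ ⟶ U_σ` given by the inclusion `ℂ[σ^∨ ∩ M] ⊆ ℂ[τ^∨ ∩ M]` for `τ ⊆ σ`. -/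
def chartMap {n : ℕ} {τ σ : Cone n} (h : τ ≤ σ) : chart τ ⟶ chart σ :=
  Spec.map (CommRingCat.ofHom
    (AddMonoidAlgebra.mapDomainRingHom ℂ (AddSubmonoid.inclusion (dualMonoid_anti h))))

/-- The torus `Spec ℂ[M] = (ℂ^*)ⁿ`. -/
def torus (n : ℕ) : Scheme.{0} := Spec (CommRingCat.of (AddMonoidAlgebra ℂ (Fin n → ℤ)))

/-- The embedding of the torus in `U_σ`. -/
def torusToChart {n : ℕ} (σ : Cone n) : torus n ⟶ chart σ :=
  Spec.map (CommRingCat.ofHom (AddMonoidAlgebra.mapDomainRingHom ℂ (dualMonoid σ).subtype))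

/-- `X`, with the structure morphism `s` and the morphisms `ι σ : U_σ ⟶ X`, is the toric variety of
the fan `Δ`: it is the gluing of the open subschemes `U_σ`, `σ ∈ Δ`, in which `U_σ` and `U_σ'` are
glued along the charts of the common faces of `σ` and `σ'`. This determines `X` up to a unique
isomorphism compatible with the charts. -/
structure IsToricVariety {n : ℕ} (Δ : Set (Cone n)) (X : Scheme.{0}) (s : X ⟶ SpecC)
    (ι : ∀ σ : Δ, chart σ.1 ⟶ X) : Prop where
  openImmersion : ∀ σ, IsOpenImmersion (ι σ)
  structureMap : ∀ σ, ι σ ≫ s = chartToSpecC σ.1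
  compatible : ∀ (τ σ : Δ) (h : τ.1 ≤ σ.1), chartMap h ≫ ι σ = ι τ
  cover : ∀ x : X, ∃ σ, x ∈ Set.range (ι σ)
  inter : ∀ (σ σ' : Δ) (x : X), x ∈ Set.range (ι σ) → x ∈ Set.range (ι σ') →
    ∃ τ : Δ, τ.1 ≤ σ.1 ∧ τ.1 ≤ σ'.1 ∧ x ∈ Set.range (ι τ)

/-! ### Projective spaces -/

/-- The standard grading of `ℂ[y₀, …, yₙ]`. -/
abbrev stdGrading (n : ℕ) : ℕ → Submodule ℂ (MvPolynomial (Fin (n + 1)) ℂ) :=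
  MvPolynomial.homogeneousSubmodule (Fin (n + 1)) ℂ

instance (n : ℕ) : GradedAlgebra (stdGrading n) := MvPolynomial.gradedAlgebra

/-- The projective space `ℙⁿ` over `ℂ`, with homogeneous coordinates `y₀, …, yₙ`. -/
def projSpace (n : ℕ) : Scheme.{0} := Proj (stdGrading n)

/-- The structure morphism of `ℙⁿ`. -/
def projSpaceToSpecC (n : ℕ) : projSpace n ⟶ SpecC :=
  Proj.toSpecZero (stdGrading n) ≫
    Spec.map (CommRingCat.ofHom (algebraMap ℂ (stdGrading n 0)))

/-- A morphism to `Spec ℂ` is projective if it factors through a closed immersion in some `ℙⁿ`. -/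
def IsProjective {X : Scheme.{0}} (s : X ⟶ SpecC) : Prop :=
  ∃ (n : ℕ) (i : X ⟶ projSpace n), IsClosedImmersion i ∧ i ≫ projSpaceToSpecC n = s

/-- The closed subset of `ℙⁿ` where the coordinates `y_i`, `i ∈ I`, vanish. -/
def coordLocus {n : ℕ} (I : Set (Fin (n + 1))) : Set (projSpace n) :=
  ProjectiveSpectrum.zeroLocus (stdGrading n) ((fun i => MvPolynomial.X i) '' I)

/-- The homomorphism `ℂ[y₀, …, yₙ] → ℂ[ℤⁿ]` sending `y₀` to `1` and `y_i` to the `i`-th coordinate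
of the torus, for `i ≥ 1`. -/
def torusCoords (n : ℕ) :
    MvPolynomial (Fin (n + 1)) ℂ →ₐ[ℂ] AddMonoidAlgebra ℂ (Fin n → ℤ) :=
  MvPolynomial.aeval (Fin.cons 1 fun i : Fin n => AddMonoidAlgebra.single (Pi.single i (1 : ℤ)) 1)

/-- The standard embedding `(t₁, …, tₙ) ↦ [1 : t₁ : … : tₙ]` of the torus in `ℙⁿ`. -/
def torusToProjSpace (n : ℕ) : torus n ⟶ projSpace n :=
  Spec.map (CommRingCat.ofHom
    ((Localization.awayLift (torusCoords n).toRingHom (MvPolynomial.X 0)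
        (by simp [torusCoords])).comp
      (algebraMap (HomogeneousLocalization.Away (stdGrading n) (MvPolynomial.X 0))
        (Localization.Away (MvPolynomial.X (0 : Fin (n + 1)) : MvPolynomial (Fin (n + 1)) ℂ))))) ≫
    Proj.awayι (stdGrading n) (MvPolynomial.X 0)
      (MvPolynomial.isHomogeneous_X ℂ (0 : Fin (n + 1))) Nat.one_pos

/-! ### Blowups -/

/-- The closed subscheme given by the closed immersion `i : E ⟶ Y` is an effective Cartier divisor:
locally it is cut out by one nonzerodivisor. -/
def IsEffectiveCartier {E Y : Scheme.{0}} (i : E ⟶ Y) : Prop :=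
  IsClosedImmersion i ∧ ∀ y : Y, ∃ U : Y.affineOpens, y ∈ U.1 ∧
    ∃ f ∈ nonZeroDivisors Γ(Y, U.1), i.ker.ideal U = Ideal.span {f}

/-- `p : Y ⟶ X` is the blowup of `X` along the closed subscheme given by `j : Z ⟶ X`: the inverse
image of `Z` in `Y` is an effective Cartier divisor, and `p` is universal with this property. -/
structure IsBlowup {Y X Z : Scheme.{0}} (p : Y ⟶ X) (j : Z ⟶ X) : Prop where
  closedImmersion : IsClosedImmersion j
  cartier : IsEffectiveCartier (pullback.fst p j)
  universal : ∀ (W : Scheme.{0}) (g : W ⟶ X), IsEffectiveCartier (pullback.fst g j) →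
    ∃! h : W ⟶ Y, h ≫ p = g

/-- `p : Y ⟶ X` is the blowup of `X` (over `ℂ`, with structure morphism `s`) along a closed
subscheme isomorphic to `ℙ¹`, with underlying closed set `Z`. -/
def IsBlowupAlongRationalCurve {Y X : Scheme.{0}} (p : Y ⟶ X) (s : X ⟶ SpecC) (Z : Set X) : Prop :=
  ∃ j : projSpace 1 ⟶ X, j ≫ s = projSpaceToSpecC 1 ∧ Set.range j = Z ∧ IsBlowup p j

/-- The strict transform of the closed set `Z` under the blowup `p` with center `C`. -/
def strictTransform {Y X : Scheme.{0}} (p : Y ⟶ X) (C Z : Set X) : Set Y :=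
  closure (p ⁻¹' (Z \ C))

/-! ### Cartier divisors, numerical equivalence and the Picard number -/

section Cartier

variable (X : Scheme.{0}) [IsIntegral X]

/-- The image of `O_{X,x}^*` in the multiplicative group of the function field. -/
def localUnits (x : X) : Subgroup (X.functionField)ˣ :=
  (Units.map (algebraMap (X.presheaf.stalk x) X.functionField).toMonoidHom).range

/-- The sections of `K^*/O^*` on an integral scheme: families of elements of `K^*/O_{X,x}^*` that
are locally given by one element of `K^*`. -/
def cartierSubgroup : Subgroup (∀ x : X, (X.functionField)ˣ ⧸ localUnits X x) where
  carrier := {D | ∀ x : X, ∃ U : X.Opens, x ∈ U ∧ ∃ f : (X.functionField)ˣ, ∀ y ∈ U,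
    D y = QuotientGroup.mk f}
  one_mem' := fun _ => ⟨⊤, trivial, 1, fun _ _ => rfl⟩
  mul_mem' := by
    intro D E hD hE x
    obtain ⟨U, hU, f, hf⟩ := hD x
    obtain ⟨V, hV, g, hg⟩ := hE x
    refine ⟨U ⊓ V, ⟨hU, hV⟩, f * g, fun y hy => ?_⟩
    rw [Pi.mul_apply, hf y hy.1, hg y hy.2, QuotientGroup.mk_mul]
  inv_mem' := by
    intro D hD x
    obtain ⟨U, hU, f, hf⟩ := hD x
    refine ⟨U, hU, f⁻¹, fun y hy => ?_⟩
    rw [Pi.inv_apply, hf y hy, QuotientGroup.mk_inv]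

/-- The group of Cartier divisors on an integral scheme, written additively. -/
def CartierDivisor : Type := Additive (cartierSubgroup X)

instance : AddCommGroup (CartierDivisor X) :=
  inferInstanceAs (AddCommGroup (Additive (cartierSubgroup X)))

variable {X} in
/-- The class in `K^*/O_{X,x}^*` of the local equations at `x` of a Cartier divisor. -/
def CartierDivisor.germ (D : CartierDivisor X) (x : X) : (X.functionField)ˣ ⧸ localUnits X x :=
  (Additive.toMul (α := cartierSubgroup X) D).1 x

/-- The principal divisor of a nonzero rational function. -/
def principalDivisor (f : (X.functionField)ˣ) : CartierDivisor X :=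
  Additive.ofMul (α := cartierSubgroup X)
    ⟨fun _ => QuotientGroup.mk f, fun _ => ⟨⊤, trivial, f, fun _ _ => rfl⟩⟩

variable [IsLocallyNoetherian X]

/-- The order of vanishing at `x` as a homomorphism on nonzero rational functions (it is zero if `x`
does not have codimension one). -/
def ordUnits (x : X) : (X.functionField)ˣ →* Multiplicative ℤ where
  toFun f := Multiplicative.ofAdd (Scheme.ord (f : X.functionField) x)
  map_one' := by
    have h := Scheme.ord_mul (X := X) (x := x) (one_ne_zero) (one_ne_zero)
    rw [mul_one] at h
    have h' : Scheme.ord (1 : X.functionField) x = 0 := by lia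
    simp [h']
  map_mul' f g := by
    simp [Scheme.ord_mul f.ne_zero g.ne_zero]

lemma localUnits_le_ker_ordUnits (x : X) : localUnits X x ≤ (ordUnits X x).ker := by
  rintro _ ⟨u, rfl⟩
  change Multiplicative.ofAdd (Scheme.ord (algebraMap (X.presheaf.stalk x) X.functionField u) x) = 1
  by_cases hx : Order.coheight x = 1
  · have h : Scheme.ordHom x hx (algebraMap (X.presheaf.stalk x) X.functionField u) = 1 := by
      have : Ring.KrullDimLE 1 (X.presheaf.stalk x) :=
        AlgebraicGeometry.krullDimLE_of_coheight_le hx.le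
      exact Ring.ordFrac_of_isUnit u.isUnit
    have h2 := Scheme.ord_eq_ordHom_of_coheight_eq_one hx
      (algebraMap (X.presheaf.stalk x) X.functionField u)
    rw [h2, h]
    rfl
  · rw [Scheme.ord_eq_zero_of_coheight_neq_one hx]
    rfl

/-- The order at `x` of a Cartier divisor. -/
def divisorOrd (D : CartierDivisor X) (x : X) : ℤ :=
  (QuotientGroup.lift (localUnits X x) (ordUnits X x) (localUnits_le_ker_ordUnits X x)
    (D.germ x)).toAdd

/-- The degree of a Cartier divisor on a complete integral curve over `ℂ` (all the closed points
of such a curve have residue field `ℂ`). -/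
def curveDegree (D : CartierDivisor X) : ℤ := ∑ᶠ x : X, divisorOrd X D x

end Cartier

section NumericalEquivalence

variable {X : Scheme.{0}} [IsIntegral X]

/-- The Cartier divisor `E` on `C` is the restriction along `i : C ⟶ X` of the Cartier divisor `D`,
which is trivial at the generic point of `C`: at each point `p` of `C`, the divisor `D` has a local
equation `u` that is a unit at the generic point of `C`, and the image of `u` in the function field
of `C` is a local equation of `E` at `p`. -/
def IsRestriction {C : Scheme.{0}} [IsIntegral C] (i : C ⟶ X) (D : CartierDivisor X)
    (E : CartierDivisor C) : Prop :=
  ∀ p : C, ∃ u : (X.presheaf.stalk (i (genericPoint C)))ˣ,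
    D.germ (i p) = QuotientGroup.mk (Units.map
      (algebraMap (X.presheaf.stalk (i (genericPoint C))) X.functionField).toMonoidHom u) ∧
    E.germ p = QuotientGroup.mk (Units.map (i.stalkMap (genericPoint C)).hom.toMonoidHom u)

/-- The intersection number of `D` with the complete integral curve `i : C ⟶ X` is `d`: for some
nonzero rational function `f`, the divisor `D - div f`, which is linearly equivalent to `D`,
restricts to a Cartier divisor of degree `d` on `C`. -/
def IntersectionNumber {C : Scheme.{0}} [IsIntegral C] [IsLocallyNoetherian C] (i : C ⟶ X)
    (D : CartierDivisor X) (d : ℤ) : Prop :=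
  ∃ (f : (X.functionField)ˣ) (E : CartierDivisor C),
    IsRestriction i (D - principalDivisor X f) E ∧ curveDegree C E = d

/-- A Cartier divisor is numerically trivial if its intersection number with every integral closed
curve is zero. -/
def NumericallyTrivial (D : CartierDivisor X) : Prop :=
  ∀ (C : Scheme.{0}) [IsIntegral C] [IsLocallyNoetherian C] (i : C ⟶ X), IsClosedImmersion i →
    topologicalKrullDim C = 1 → IntersectionNumber i D 0

variable (X) in
/-- The group of Cartier divisors modulo numerical equivalence. -/
abbrev NumClasses : Type :=
  CartierDivisor X ⧸ Submodule.span ℤ {D : CartierDivisor X | NumericallyTrivial D}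

variable (X) in
/-- The Picard number of a projective variety: the rank of the group of Cartier divisors modulo
numerical equivalence. -/
def picardNumber : ℕ := Module.finrank ℤ (NumClasses X)

end NumericalEquivalence

/-! ### The torus action on the nilpotent matrices -/

/-- The entries `(b, a - 1)` of the coordinates `y_{ab}`, in the order
`y₁₁, y₂₂, y₃₃, y₁₂, y₂₃, y₁₃`. -/
def entry : Fin 6 → Fin 4 × Fin 4 := ![(1, 0), (2, 1), (3, 2), (2, 0), (3, 1), (3, 0)]

/-- The nilpotent lower triangular matrix with given coordinates; this identifies the space `𝔫` of
these matrices with `ℂ⁶`, on which the torus `T = (ℂ^*)⁶` acts coordinatewise. -/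
def nilMatrix (y : Fin 6 → ℂ) : Matrix (Fin 4) (Fin 4) ℂ :=
  Matrix.of fun i j => ∑ k, if entry k = (i, j) then y k else 0

/-- The map from one-parameter subgroups `t ↦ diag (t ^ a₀, …, t ^ a₃)` of diagonal matrices to
one-parameter subgroups of `T`, given by the conjugation action on `𝔫`. Its image is the lattice
`N(H)` inside `N(T)`, for the torus `H` of diagonal matrices up to scalars. -/
def conjWeights : (Fin 4 → ℤ) →ₗ[ℤ] (Fin 6 → ℤ) where
  toFun a k := a (entry k).1 - a (entry k).2
  map_add' a b := by
    ext k
    simp only [Pi.add_apply]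
    ring
  map_smul' c a := by
    ext k
    simp only [Pi.smul_apply, smul_eq_mul, RingHom.id_apply]
    ring

/-- The conjugation action in coordinates. -/
lemma conj_nilMatrix (a : Fin 4 → ℤ) (t : ℂˣ) (y : Fin 6 → ℂ) :
    Matrix.diagonal (fun i => (t : ℂ) ^ a i) * nilMatrix y *
        (Matrix.diagonal (fun i => (t : ℂ) ^ a i))⁻¹ =
      nilMatrix (fun k => (t : ℂ) ^ conjWeights a k * y k) := by
  have hinv : (Matrix.diagonal (fun i => (t : ℂ) ^ a i))⁻¹ =
      Matrix.diagonal (fun i => (t : ℂ) ^ (-a i)) := by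
    apply Matrix.inv_eq_right_inv
    rw [Matrix.diagonal_mul_diagonal, ← Matrix.diagonal_one]
    congr 1
    ext i
    rw [← zpow_add₀ t.ne_zero, add_neg_cancel, zpow_zero]
  rw [hinv]
  ext i j
  rw [Matrix.mul_diagonal, Matrix.diagonal_mul]
  simp only [nilMatrix, Matrix.of_apply, Finset.mul_sum, Finset.sum_mul]
  refine Finset.sum_congr rfl fun k _ => ?_
  split_ifs with h
  · have h1 : conjWeights a k = a i - a j := by
      change a (entry k).1 - a (entry k).2 = _
      rw [h]
    rw [h1, sub_eq_add_neg, zpow_add₀ t.ne_zero]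
    ring
  · simp

/-- The matrix of the projection `N(T) → N(T/H) = ℤ³`. -/
def projMatrix : Matrix (Fin 3) (Fin 6) ℤ :=
  !![-1, -1, 0, 1, 0, 0;
     0, -1, -1, 0, 1, 0;
     -1, -1, -1, 0, 0, 1]

/-- The fan of `𝔫 = ℂ⁶`: the faces of the positive orthant in `N(T)_ℝ`. -/
def affineFan : Set (Cone 6) := faceFan (PointedCone.positive ℝ (Fin 6 → ℝ))

/-- The fan of the combinatorial quotient of `𝔫` by `H`. -/
def combFan : Set (Cone 3) := quotientFan projMatrix affineFan

/-- The vectors `ρ₀, …, ρ₆`. -/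
def rho : Fin 7 → Fin 3 → ℤ :=
  ![![-1, 0, -1], ![-1, -1, -1], ![0, -1, -1], ![1, 0, 0], ![0, 1, 0], ![0, 0, 1], ![0, 0, -1]]

end FlagQuotient

end

/-! The rays `rho 0`, …, `rho 5` are the images of the coordinate rays of the orthant, so the
projected cones are the cones over subsets of these six vectors; `rho 6` appears only through
intersections. The quotient fan is described by the complex `facets₃` of ten unimodular triples of
rays. It arises from the four facets of the fan of projective space by star subdivisions along three
edges, with ρ₀ = ρ₁ + ρ₄, ρ₂ = ρ₁ + ρ₃ and ρ₆ = ρ₀ + ρ₃. Star subdivision preserves completeness. A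
finite check with separating integral forms shows that every projected cone is a union of relative
interiors of cones of the complex, and that each cone of the complex is the intersection of the
projected cones containing it. This yields `mem_combFan_iff`, hence the fan axioms and the rays.

Each complex of unimodular triples has a toric variety glued from affine spaces (`exists_isToric`),
and each star subdivision has a toric morphism. In the chart of a facet containing the edge `{a,
b}`, the subdivision replaces the coordinates x_a, x_b by x_a, x_b/x_a or by x_b, x_a/x_b. So the
morphism is the blowup of the locus x_a = x_b = 0 (`IsToricMap.isBlowup`): where the pulled back
ideal of the center is generated by one nonzerodivisor, one generator locally divides the other, and
the quotient defines the lift. The center is a projective line, because the wall relation among the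
four rays around the edge makes the parameters of its two charts inverse to each other
(`edgeHom_opposite`). Projective space itself is the toric variety of `facets₀`, through the
vertices of the standard simplex. Strict transforms and the fiber over P are found by following
torus orbits under the toric morphisms (`IsToricMap.orbit_image`).

Smoothness, dimension and integrality are read off the charts. Projectivity comes from an explicit
lattice polytope whose normal fan is the given one. For the Picard number, factoriality of the
charts shows that every Cartier divisor is linearly equivalent to a toric divisor with multiplicity
zero along ρ₃, ρ₄, ρ₅ (`IsToric.exists_eq_divisor_add`), which leaves ℤ⁴. The degrees on four
invariant curves (`IsWallCurve.eq_wallDegree`) show that no nonzero element of ℤ⁴ becomes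
numerically trivial. Computing these degrees needs that principal divisors on the projective line
have degree zero (`degreeZero_eq_top`). -/

noncomputable section

namespace FlagQuotient

/-! ### Convex geometry: the seven rays and the separation of their cones. -/

section

/-! ### Simplicial complexes on the seven rays -/

/-- The cross product of lattice vectors. -/
def cross (u v : Fin 3 → ℤ) : Fin 3 → ℤ :=
  ![u 1 * v 2 - u 2 * v 1, u 2 * v 0 - u 0 * v 2, u 0 * v 1 - u 1 * v 0]

/-- The vector dual to the ray `r` in the basis formed by a unimodular set `c` of three rays. -/
def dualVec (c : Finset (Fin 7)) (r : Fin 7) : Fin 3 → ℤ :=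
  -- Since `c.erase r` has two elements, the double sum is a single cross product, orthogonal to
  -- both. Its pairing with `rho r` is ±1, and multiplying by this sign makes the pairing 1.
  let m := ∑ a ∈ c.erase r, ∑ b ∈ (c.erase r).filter (a < ·), cross (rho a) (rho b)
  (m ⬝ᵥ rho r) • m

/-- The rays in `c` form a lattice basis, with dual basis given by `dualVec c`. -/
structure Unimodular (c : Finset (Fin 7)) : Prop where
  card : c.card = 3
  dual : ∀ r ∈ c, ∀ r' ∈ c, dualVec c r ⬝ᵥ rho r' = if r = r' then 1 else 0
  span : ∀ i j, ∑ r ∈ c, dualVec c r i * rho r j = if i = j then 1 else 0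

instance (c : Finset (Fin 7)) : Decidable (Unimodular c) :=
  decidable_of_iff (c.card = 3 ∧
    (∀ r ∈ c, ∀ r' ∈ c, dualVec c r ⬝ᵥ rho r' = if r = r' then 1 else 0) ∧
    (∀ i j, ∑ r ∈ c, dualVec c r i * rho r j = if i = j then 1 else 0))
    ⟨fun h => ⟨h.1, h.2.1, h.2.2⟩, fun h => ⟨h.1, h.2, h.3⟩⟩

/-- The faces of the simplicial complex with facets `F`. -/
def faces (F : Finset (Finset (Fin 7))) : Set (Finset (Fin 7)) := {s | ∃ c ∈ F, s ⊆ c}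

instance (F : Finset (Finset (Fin 7))) (s) : Decidable (s ∈ faces F) :=
  inferInstanceAs (Decidable (∃ c ∈ F, s ⊆ c))

lemma faces_mono {F : Finset (Finset (Fin 7))} {s t : Finset (Fin 7)} (hs : s ∈ faces F)
    (h : t ⊆ s) : t ∈ faces F := by
  obtain ⟨c, hc, hsc⟩ := hs
  exact ⟨c, hc, h.trans hsc⟩

/-- The star subdivision along the edge `{a, b}`, with new vertex `n`. -/
def subdivide (F : Finset (Finset (Fin 7))) (a b n : Fin 7) : Finset (Finset (Fin 7)) :=
  F.biUnion fun c => if a ∈ c ∧ b ∈ c then {insert n (c.erase a), insert n (c.erase b)} else {c}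

/-- The facets of the fan of `ℙ³`, with `y₀, y₁, y₂, y₃` vanishing along `ρ₁, ρ₃, ρ₄, ρ₅`. -/
def facets₀ : Finset (Finset (Fin 7)) := {{3, 4, 5}, {1, 4, 5}, {1, 3, 5}, {1, 3, 4}}

/-- The facets of the fan of the blowup along the line `y₀ = y₂ = 0`. -/
def facets₁ : Finset (Finset (Fin 7)) := subdivide facets₀ 1 4 0

/-- The facets of the fan of the second blowup. -/
def facets₂ : Finset (Finset (Fin 7)) := subdivide facets₁ 1 3 2

/-- The facets of the fan of the third blowup. -/
def facets₃ : Finset (Finset (Fin 7)) := subdivide facets₂ 0 3 6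

/-- All maximal cones of the four complexes are spanned by lattice bases; smoothness and every
computation in coordinates of charts rest on these finite checks. -/
lemma unimodular₀ : ∀ c ∈ facets₀, Unimodular c := by decide +kernel
lemma unimodular₁ : ∀ c ∈ facets₁, Unimodular c := by decide +kernel
lemma unimodular₂ : ∀ c ∈ facets₂, Unimodular c := by decide +kernel
lemma unimodular₃ : ∀ c ∈ facets₃, Unimodular c := by decide +kernel

/-! ### Cones -/

/-- The cone spanned by a set of rays. -/
def cone (s : Finset (Fin 7)) : Cone 3 :=
  PointedCone.hull ℝ ((fun r => realVec (rho r)) '' (s : Set (Fin 7)))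

lemma rho_mem_cone {s : Finset (Fin 7)} {r : Fin 7} (h : r ∈ s) : realVec (rho r) ∈ cone s :=
  PointedCone.subset_hull ⟨r, h, rfl⟩

lemma cone_le {s : Finset (Fin 7)} {C : Cone 3} (h : ∀ r ∈ s, realVec (rho r) ∈ C) :
    cone s ≤ C := by
  refine Submodule.span_le.2 ?_
  rintro _ ⟨r, hr, rfl⟩
  exact h r hr

lemma cone_mono {s t : Finset (Fin 7)} (h : s ⊆ t) : cone s ≤ cone t :=
  cone_le fun _ hr => rho_mem_cone (h hr)

/-- The coefficients form a nonnegative function on the whole index type, so that combinations can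
be added and scaled pointwise. -/
lemma mem_hull_image_iff {ι V : Type*} [AddCommGroup V] [Module ℝ V] (v : ι → V) (s : Finset ι)
    (x : V) : x ∈ PointedCone.hull ℝ (v '' (s : Set ι)) ↔
      ∃ c : ι → ℝ, (∀ i, 0 ≤ c i) ∧ x = ∑ i ∈ s, c i • v i := by
  classical
  constructor
  · intro h
    induction h using Submodule.span_induction with
    | mem x hx =>
      obtain ⟨i, hi, rfl⟩ := hx
      refine ⟨fun j => if j = i then 1 else 0, fun j => by dsimp only; split_ifs <;> norm_num, ?_⟩
      simp [Finset.sum_ite_eq' s i, Finset.mem_coe.1 hi]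
    | zero => exact ⟨0, fun _ => le_rfl, by simp⟩
    | add x y _ _ hx hy =>
      obtain ⟨c, hc, rfl⟩ := hx
      obtain ⟨d, hd, rfl⟩ := hy
      exact ⟨c + d, fun i => add_nonneg (hc i) (hd i), by simp [add_smul, Finset.sum_add_distrib]⟩
    | smul a x _ hx =>
      obtain ⟨c, hc, rfl⟩ := hx
      refine ⟨fun i => a * c i, fun i => mul_nonneg a.2 (hc i), ?_⟩
      rw [Finset.smul_sum]
      refine Finset.sum_congr rfl fun i _ => ?_
      rw [mul_smul]
      rfl
  · rintro ⟨c, hc, rfl⟩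
    refine sum_mem fun i hi => ?_
    exact PointedCone.smul_mem _ (hc i) (PointedCone.subset_hull ⟨i, hi, rfl⟩)

/-- The pairing of an integral linear form with a real vector. -/
def pairing (m : Fin 3 → ℤ) : (Fin 3 → ℝ) →ₗ[ℝ] ℝ := ∑ i, (m i : ℝ) • LinearMap.proj i

lemma pairing_apply (m : Fin 3 → ℤ) (x : Fin 3 → ℝ) : pairing m x = ∑ i, (m i : ℝ) * x i := by
  simp [pairing]

lemma pairing_realVec (m v : Fin 3 → ℤ) : pairing m (realVec v) = ((m ⬝ᵥ v : ℤ) : ℝ) := by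
  simp [pairing_apply, realVec, dotProduct]

/-- Nonnegativity on a cone is tested on its generators. This turns every question about the monoids
of the charts into finitely many integer inequalities. -/
lemma mem_dualMonoid_cone {s : Finset (Fin 7)} {m : Fin 3 → ℤ} :
    m ∈ dualMonoid (cone s) ↔ ∀ r ∈ s, 0 ≤ m ⬝ᵥ rho r := by
  constructor
  · intro h r hr
    have := h _ (rho_mem_cone hr)
    rw [← pairing_apply, pairing_realVec] at this
    exact_mod_cast this
  · intro h x hx
    obtain ⟨c, hc, rfl⟩ := (mem_hull_image_iff _ _ _).1 hx
    rw [← pairing_apply, map_sum]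
    refine Finset.sum_nonneg fun r hr => ?_
    rw [map_smul, pairing_realVec]
    exact mul_nonneg (hc r) (by exact_mod_cast h r hr)

/-- The relative interior of the cone spanned by `s`, as the set of positive combinations. -/
def relInt (s : Finset (Fin 7)) : Set (Fin 3 → ℝ) :=
  {x | ∃ c : Fin 7 → ℝ, (∀ r ∈ s, 0 < c r) ∧ x = ∑ r ∈ s, c r • realVec (rho r)}

/-- Discarding the rays with coefficient zero leaves a strictly positive combination. -/
lemma exists_mem_relInt {s : Finset (Fin 7)} {x : Fin 3 → ℝ} (hx : x ∈ cone s) :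
    ∃ u ⊆ s, x ∈ relInt u := by
  obtain ⟨c, hc, rfl⟩ := (mem_hull_image_iff _ _ _).1 hx
  refine ⟨s.filter fun r => 0 < c r, Finset.filter_subset _ _, c, fun r hr =>
    (Finset.mem_filter.1 hr).2, ?_⟩
  rw [Finset.sum_filter]
  refine Finset.sum_congr rfl fun r _ => ?_
  split_ifs with h
  · rfl
  · rw [le_antisymm (not_lt.1 h) (hc r), zero_smul]

lemma relInt_subset_cone (s : Finset (Fin 7)) : relInt s ⊆ cone s := by
  rintro _ ⟨c, hc, rfl⟩
  exact sum_mem fun r hr => PointedCone.smul_mem _ (hc r hr).le (rho_mem_cone hr)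

lemma sum_mem_relInt (s : Finset (Fin 7)) : ∑ r ∈ s, realVec (rho r) ∈ relInt s :=
  ⟨fun _ => 1, fun _ _ => one_pos, by simp⟩

/-- An integral linear form that is nonnegative on `s` and nonpositive but not zero on `u`. -/
def Separates (m : Fin 3 → ℤ) (s u : Finset (Fin 7)) : Prop :=
  (∀ r ∈ s, 0 ≤ m ⬝ᵥ rho r) ∧ (∀ r ∈ u, m ⬝ᵥ rho r ≤ 0) ∧ ∃ r ∈ u, m ⬝ᵥ rho r < 0

instance (m s u) : Decidable (Separates m s u) :=
  inferInstanceAs (Decidable ((∀ r ∈ s, 0 ≤ m ⬝ᵥ rho r) ∧ (∀ r ∈ u, m ⬝ᵥ rho r ≤ 0) ∧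
    ∃ r ∈ u, m ⬝ᵥ rho r < 0))

/-- The form is nonnegative on `cone s`, but negative on a strictly positive combination of the rays
of `u`: no term is positive and one is negative. -/
lemma Separates.notMem {m : Fin 3 → ℤ} {s u : Finset (Fin 7)} (h : Separates m s u)
    {x : Fin 3 → ℝ} (hu : x ∈ relInt u) : x ∉ cone s := by
  intro hs
  have h1 : 0 ≤ pairing m x := by
    rw [pairing_apply]
    exact mem_dualMonoid_cone.2 h.1 x hs
  obtain ⟨c, hc, rfl⟩ := hu
  obtain ⟨-, h2, r, hr, h3⟩ := h
  rw [map_sum] at h1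
  refine absurd h1 (not_le.2 (Finset.sum_neg' (fun i hi => ?_) ⟨r, hr, ?_⟩))
  · rw [map_smul, pairing_realVec]
    exact mul_nonpos_of_nonneg_of_nonpos (hc i hi).le (by exact_mod_cast h2 i hi)
  · rw [map_smul, pairing_realVec]
    exact mul_neg_of_pos_of_neg (hc r hr) (by exact_mod_cast h3)

/-- The normal vectors of the walls of the projected cones. -/
def normals : List (Fin 3 → ℤ) :=
  [![0, -1, 0], ![0, 1, 0], ![-1, 0, 0], ![1, 0, -1], ![1, 0, 0], ![-1, 0, 1], ![0, -1, 1],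
    ![0, 1, -1], ![1, 1, -1], ![-1, -1, 1], ![-1, 1, 0], ![1, -1, 0], ![0, 0, 1], ![0, 0, -1]]

/-- The relations expressing one of the seven rays as a sum of others. -/
def rayRelations : List (Fin 7 × Finset (Fin 7)) :=
  [(0, {1, 4}), (1, {0, 2, 5}), (2, {1, 3}), (6, {0, 3}), (6, {2, 4}), (6, {1, 3, 4})]

lemma rayRelations_sum : ∀ p ∈ rayRelations, rho p.1 = ∑ i ∈ p.2, rho i := by decide +kernel

/-- The rays in `s` are sums of rays in `I`. -/
def Covers (I s : Finset (Fin 7)) : Prop :=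
  ∀ r ∈ s, r ∈ I ∨ ∃ p ∈ rayRelations, p.1 = r ∧ p.2 ⊆ I

instance (I s) : Decidable (Covers I s) :=
  inferInstanceAs (Decidable (∀ r ∈ s, r ∈ I ∨ ∃ p ∈ rayRelations, p.1 = r ∧ p.2 ⊆ I))

lemma Covers.cone_le {I s : Finset (Fin 7)} (h : Covers I s) : cone s ≤ cone I := by
  refine FlagQuotient.cone_le fun r hr => ?_
  obtain h | ⟨p, hp, rfl, hI⟩ := h r hr
  · exact rho_mem_cone h
  · have : realVec (rho p.1) = ∑ i ∈ p.2, realVec (rho i) := by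
      rw [rayRelations_sum p hp]
      ext j
      simp [realVec]
    rw [this]
    exact sum_mem fun i hi => rho_mem_cone (hI hi)

/-- Geometrically: `cone I` either contains `cone s` or misses its relative interior, so each
projected cone is a union of relative interiors of faces. The index 6 is excluded because ρ₆ is not
the image of a coordinate ray. -/
lemma covers_or_separates : ∀ s : Finset (Fin 7), s ∈ faces facets₃ → ∀ I : Finset (Fin 7), 6 ∉ I →
    Covers I s ∨ ∃ m ∈ normals, Separates m I s := by decide +kernel

/-- A face is determined by the projected cones containing it. This makes the intersection of those
cones no larger than `cone s`. -/
lemma subset_of_covers : ∀ s : Finset (Fin 7), s ∈ faces facets₃ → ∀ t : Finset (Fin 7),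
    t ∈ faces facets₃ → (∀ I : Finset (Fin 7), 6 ∉ I → Covers I s → Covers I t) → t ⊆ s := by
  decide +kernel

/-- It follows that a point interior to `cone u` lies in `cone s` only when `u` is a subset of `s`,
which gives the intersection property of the fan. -/
lemma subset_or_separates : ∀ s : Finset (Fin 7), s ∈ faces facets₃ → ∀ u : Finset (Fin 7),
    u ∈ faces facets₃ → u ⊆ s ∨ ∃ m ∈ normals, Separates m s u := by decide +kernel

end

/-! ### The cones of the complex form a complete fan, which is the quotient fan. -/

section

lemma subset_of_mem_relInt {s u : Finset (Fin 7)} (hs : s ∈ faces facets₃)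
    (hu : u ∈ faces facets₃) {x : Fin 3 → ℝ} (hxu : x ∈ relInt u) (hxs : x ∈ cone s) : u ⊆ s :=
  (subset_or_separates s hs u hu).elim id fun ⟨_, _, hm⟩ => absurd hxs (hm.notMem hxu)

lemma cone_le_iff {s t : Finset (Fin 7)} (hs : s ∈ faces facets₃) (ht : t ∈ faces facets₃) :
    cone t ≤ cone s ↔ t ⊆ s :=
  ⟨fun h => subset_of_mem_relInt hs ht (sum_mem_relInt t)
    (h (relInt_subset_cone _ (sum_mem_relInt t))), cone_mono⟩

/-- A common point is interior to `cone u` for some `u ⊆ s`, and separation excludes it from `cone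
t` unless also `u ⊆ t`. -/
lemma cone_inf {s t : Finset (Fin 7)} (hs : s ∈ faces facets₃) (ht : t ∈ faces facets₃) :
    cone s ⊓ cone t = cone (s ∩ t) := by
  refine le_antisymm (fun x hx => ?_)
    (le_inf (cone_mono Finset.inter_subset_left) (cone_mono Finset.inter_subset_right))
  obtain ⟨u, hu, hxu⟩ := exists_mem_relInt hx.1
  exact cone_mono (Finset.subset_inter hu (subset_of_mem_relInt ht (faces_mono hs hu) hxu hx.2))
    (relInt_subset_cone _ hxu)

/-! ### Faces of finitely generated cones -/

/-- If a nonnegative combination lies in a face, so does each generator with positive coefficient.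
Hence a face is spanned by the generators it contains. -/
lemma exists_eq_hull_of_isFaceOf {ι V : Type*} [AddCommGroup V] [Module ℝ V] {v : ι → V}
    {s : Finset ι} {τ : PointedCone ℝ V}
    (h : τ.IsFaceOf (PointedCone.hull ℝ (v '' (s : Set ι)))) :
    ∃ t ⊆ s, τ = PointedCone.hull ℝ (v '' (t : Set ι)) := by
  classical
  refine ⟨s.filter fun i => v i ∈ τ, Finset.filter_subset _ _, le_antisymm (fun x hx => ?_) ?_⟩
  · obtain ⟨c, hc, rfl⟩ := (mem_hull_image_iff _ _ _).1 (h.le hx)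
    refine sum_mem fun i hi => ?_
    rcases (hc i).eq_or_lt with h0 | h0
    · rw [← h0, zero_smul]
      exact zero_mem _
    · have hv : ∀ j ∈ s, v j ∈ PointedCone.hull ℝ (v '' (s : Set ι)) :=
        fun j hj => PointedCone.subset_hull ⟨j, hj, rfl⟩
      have : v i ∈ τ := by
        rw [← Finset.add_sum_erase _ _ hi] at hx
        exact h.mem_of_smul_add_mem (hv i hi) (sum_mem fun j hj =>
          PointedCone.smul_mem _ (hc j) (hv j (Finset.mem_of_mem_erase hj))) h0 hx
      exact PointedCone.smul_mem _ h0.le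
        (PointedCone.subset_hull ⟨i, by simp [hi, this], rfl⟩)
  · refine Submodule.span_le.2 ?_
    rintro _ ⟨i, hi, rfl⟩
    exact (Finset.mem_filter.1 hi).2

/-- The form `m` supports the face: `cone t` is its zero locus in `cone s`, and nonnegative numbers
with sum zero vanish. -/
lemma isFaceOf_of_dual {s : Finset (Fin 7)} {t : Finset (Fin 7)} (hts : t ⊆ s)
    {m : Fin 3 → ℤ} (hm : ∀ r ∈ s, 0 ≤ m ⬝ᵥ rho r) (hmt : ∀ r ∈ s, m ⬝ᵥ rho r = 0 ↔ r ∈ t) :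
    (cone t).IsFaceOf (cone s) := by
  have key : ∀ x, x ∈ cone t ↔ x ∈ cone s ∧ pairing m x = 0 := by
    intro x
    constructor
    · intro hx
      refine ⟨cone_mono hts hx, ?_⟩
      obtain ⟨c, hc, rfl⟩ := (mem_hull_image_iff _ _ _).1 hx
      rw [map_sum]
      refine Finset.sum_eq_zero fun r hr => ?_
      rw [map_smul, pairing_realVec, (hmt r (hts hr)).2 hr]
      simp
    · rintro ⟨hx, h0⟩
      obtain ⟨c, hc, rfl⟩ := (mem_hull_image_iff _ _ _).1 hx
      rw [map_sum, Finset.sum_eq_zero_iff_of_nonneg] at h0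
      · refine sum_mem fun r hr => ?_
        by_cases hrt : r ∈ t
        · exact PointedCone.smul_mem _ (hc r) (rho_mem_cone hrt)
        · have h1 := h0 r hr
          rw [map_smul, pairing_realVec, smul_eq_mul, mul_eq_zero] at h1
          rcases h1 with h1 | h1
          · rw [h1, zero_smul]
            exact zero_mem _
          · exact absurd ((hmt r hr).1 (by exact_mod_cast h1)) hrt
      · intro r hr
        rw [map_smul, pairing_realVec]
        exact mul_nonneg (hc r) (by exact_mod_cast hm r hr)
  refine ⟨cone_mono hts, fun {x y a} hx hy ha h => (key x).2 ⟨hx, ?_⟩⟩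
  have hnn : ∀ z ∈ cone s, 0 ≤ pairing m z := fun z hz => by
    rw [pairing_apply]
    exact mem_dualMonoid_cone.2 hm z hz
  have h1 := ((key _).1 h).2
  rw [map_add, map_smul, smul_eq_mul] at h1
  have h2 := hnn x hx
  have h3 := hnn y hy
  have h4 := mul_nonneg ha.le h2
  have h5 : a * pairing m x = 0 := by linarith
  exact (mul_eq_zero.1 h5).resolve_left ha.ne'

/-- The linear form that vanishes on `t` and is one on the other rays of the unimodular set `c`. -/
def faceForm (c t : Finset (Fin 7)) : Fin 3 → ℤ := ∑ r ∈ c \ t, dualVec c r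

lemma faceForm_dotProduct {c : Finset (Fin 7)} (hc : Unimodular c) (t : Finset (Fin 7))
    {r : Fin 7} (hr : r ∈ c) : faceForm c t ⬝ᵥ rho r = if r ∈ t then 0 else 1 := by
  rw [faceForm, sum_dotProduct,
    Finset.sum_congr rfl fun i hi => hc.dual i (Finset.mem_sdiff.1 hi).1 r hr]
  simp [hr]

lemma isFaceOf_cone {c s t : Finset (Fin 7)} (hc : Unimodular c) (hsc : s ⊆ c) (hts : t ⊆ s) :
    (cone t).IsFaceOf (cone s) := by
  refine isFaceOf_of_dual hts (m := faceForm c t) (fun r hr => ?_) fun r hr => ?_ <;>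
    rw [faceForm_dotProduct hc t (hsc hr)] <;> split_ifs <;> simp_all

/-! ### Completeness -/

/-- The cones of the complex cover the space. -/
def IsComplete (F : Finset (Finset (Fin 7))) : Prop := ∀ x, ∃ c ∈ F, x ∈ cone c

/-- If the coefficients satisfy `k a ≤ k b`, the relation ρ_n = ρ_a + ρ_b rewrites the point with
coefficient `k a` at `n` and `k b - k a` at `b`, so that `a` is no longer needed. The other case is
symmetric. -/
lemma IsComplete.subdivide {F : Finset (Finset (Fin 7))} (hF : IsComplete F) {a b n : Fin 7}
    (hab : a ≠ b) (h : rho n = rho a + rho b) : IsComplete (subdivide F a b n) := by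
  have h' : realVec (rho n) = realVec (rho a) + realVec (rho b) := by
    rw [h]
    ext
    simp [realVec]
  intro x
  obtain ⟨c, hc, hx⟩ := hF x
  by_cases hcab : a ∈ c ∧ b ∈ c
  swap
  · exact ⟨c, Finset.mem_biUnion.2 ⟨c, hc, by simp [hcab]⟩, hx⟩
  obtain ⟨k, hk, rfl⟩ := (mem_hull_image_iff _ _ _).1 hx
  have aux : ∀ a b, realVec (rho n) = realVec (rho a) + realVec (rho b) → a ≠ b → a ∈ c → b ∈ c →
      k a ≤ k b → ∑ r ∈ c, k r • realVec (rho r) ∈ cone (insert n (c.erase a)) := by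
    intro a b h' hab ha hb hle
    rw [← Finset.add_sum_erase _ _ ha, ← Finset.add_sum_erase (c.erase a) _
      (Finset.mem_erase.2 ⟨hab.symm, hb⟩)]
    have : k a • realVec (rho a) + (k b • realVec (rho b) +
        ∑ r ∈ (c.erase a).erase b, k r • realVec (rho r)) = k a • realVec (rho n) +
        ((k b - k a) • realVec (rho b) +
        ∑ r ∈ (c.erase a).erase b, k r • realVec (rho r)) := by
      rw [h', smul_add, sub_smul]
      abel
    rw [this]
    refine add_mem (PointedCone.smul_mem _ (hk a) (rho_mem_cone (by simp))) (add_mem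
      (PointedCone.smul_mem _ (sub_nonneg.2 hle) (rho_mem_cone (by simp [hab.symm, hb])))
      (sum_mem fun r hr => PointedCone.smul_mem _ (hk r) (rho_mem_cone ?_)))
    exact Finset.mem_insert_of_mem (Finset.mem_of_mem_erase hr)
  rcases le_total (k a) (k b) with hle | hle
  · exact ⟨_, Finset.mem_biUnion.2 ⟨c, hc, by simp [hcab]⟩, aux a b h' hab hcab.1 hcab.2 hle⟩
  · exact ⟨_, Finset.mem_biUnion.2 ⟨c, hc, by simp [hcab]⟩,
      aux b a (by rw [h', add_comm]) hab.symm hcab.2 hcab.1 hle⟩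

lemma mem_cone_of_nonneg {s : Finset (Fin 7)} (k : Fin 7 → ℝ) (hk : ∀ r ∈ s, 0 ≤ k r)
    {x : Fin 3 → ℝ} (hx : x = ∑ r ∈ s, k r • realVec (rho r)) : x ∈ cone s := by
  rw [hx]
  exact sum_mem fun r hr => PointedCone.smul_mem _ (hk r hr) (rho_mem_cone hr)

/-- The four cones distinguish which of 0, `x 0`, `x 1`, `x 2` is smallest; since ρ₁ = (-1, -1, -1),
minus this minimum is the coefficient of ρ₁. -/
lemma isComplete₀ : IsComplete facets₀ := by
  intro x
  by_cases h : 0 ≤ x 0 ∧ 0 ≤ x 1 ∧ 0 ≤ x 2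
  · refine ⟨{3, 4, 5}, by decide, mem_cone_of_nonneg ![0, 0, 0, x 0, x 1, x 2, 0] ?_ ?_⟩
    · simpa using h
    · ext i
      fin_cases i <;> simp [realVec, rho]
  by_cases h0 : x 0 ≤ x 1 ∧ x 0 ≤ x 2 ∧ x 0 ≤ 0
  · refine ⟨{1, 4, 5}, by decide,
      mem_cone_of_nonneg ![0, -x 0, 0, 0, x 1 - x 0, x 2 - x 0, 0] ?_ ?_⟩
    · simpa using ⟨h0.2.2, h0.1, h0.2.1⟩
    · ext i
      fin_cases i <;> simp [realVec, rho]
  by_cases h1 : x 1 ≤ x 0 ∧ x 1 ≤ x 2 ∧ x 1 ≤ 0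
  · refine ⟨{1, 3, 5}, by decide,
      mem_cone_of_nonneg ![0, -x 1, 0, x 0 - x 1, 0, x 2 - x 1, 0] ?_ ?_⟩
    · simpa using ⟨h1.2.2, h1.1, h1.2.1⟩
    · ext i
      fin_cases i <;> simp [realVec, rho]
  · have h2 : x 2 ≤ 0 ∧ x 2 ≤ x 0 ∧ x 2 ≤ x 1 := by grind
    refine ⟨{1, 3, 4}, by decide,
      mem_cone_of_nonneg ![0, -x 2, 0, x 0 - x 2, x 1 - x 2, 0, 0] ?_ ?_⟩
    · simpa using h2
    · ext i
      fin_cases i <;> simp [realVec, rho]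

lemma isComplete₃ : IsComplete facets₃ :=
  ((isComplete₀.subdivide (by decide) (by decide)).subdivide (by decide) (by decide)).subdivide
    (by decide) (by decide)

/-! ### The quotient fan -/

lemma mem_affineFan_iff {σ : Cone 6} : σ ∈ affineFan ↔ ∃ I : Finset (Fin 6),
    σ = PointedCone.hull ℝ ((fun i => Pi.single i (1 : ℝ)) '' (I : Set (Fin 6))) := by
  have hpos : PointedCone.positive ℝ (Fin 6 → ℝ) = PointedCone.hull ℝ
      ((fun i => Pi.single i (1 : ℝ)) '' ((Finset.univ : Finset (Fin 6)) : Set (Fin 6))) := by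
    ext x
    rw [mem_hull_image_iff, PointedCone.mem_positive]
    constructor
    · intro h
      refine ⟨x, h, ?_⟩
      ext i
      simp [Finset.sum_apply, Pi.single_apply]
    · rintro ⟨c, hc, rfl⟩ i
      simpa [Finset.sum_apply, Pi.single_apply] using hc i
  constructor
  · intro h
    have h : σ.IsFaceOf (PointedCone.positive ℝ (Fin 6 → ℝ)) := h
    rw [hpos] at h
    obtain ⟨I, -, hI⟩ := exists_eq_hull_of_isFaceOf h
    exact ⟨I, hI⟩
  · rintro ⟨I, rfl⟩
    have key : ∀ x, x ∈ PointedCone.hull ℝ ((fun i => Pi.single i (1 : ℝ)) '' (I : Set (Fin 6))) ↔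
        0 ≤ x ∧ ∀ i ∉ I, x i = 0 := by
      intro x
      rw [mem_hull_image_iff]
      constructor
      · rintro ⟨c, hc, rfl⟩
        refine ⟨fun i => ?_, fun i hi => ?_⟩
        · simp only [Finset.sum_apply, Pi.smul_apply, Pi.single_apply, smul_eq_mul, mul_ite, mul_one,
            mul_zero, Finset.sum_ite_eq, Pi.zero_apply]
          split_ifs
          exacts [hc i, le_rfl]
        · simp [Finset.sum_apply, Pi.single_apply, hi]
      · rintro ⟨h, h'⟩
        refine ⟨x, h, ?_⟩
        ext i
        by_cases hi : i ∈ I <;> simp [Finset.sum_apply, Pi.single_apply, hi, h' i]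
    change PointedCone.IsFaceOf _ _
    refine ⟨fun x hx => (PointedCone.mem_positive ℝ _).2 ((key x).1 hx).1, fun {x y a} hx hy ha h => ?_⟩
    have hx := (PointedCone.mem_positive ℝ _).1 hx
    have hy := (PointedCone.mem_positive ℝ _).1 hy
    refine (key x).2 ⟨hx, fun i hi => ?_⟩
    have h1 := ((key _).1 h).2 i hi
    have h2 := hx i
    have h3 := hy i
    simp only [Pi.add_apply, Pi.smul_apply, smul_eq_mul, Pi.zero_apply] at h1 h2 h3
    have h4 := mul_nonneg ha.le h2
    have h5 : a * x i = 0 := by linarith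
    exact (mul_eq_zero.1 h5).resolve_left ha.ne'

/-- The columns of the matrix are ρ₀, …, ρ₅; of the seven rays only ρ₆ is missing. -/
lemma realMap_projMatrix_single (i : Fin 6) :
    realMap projMatrix (Pi.single i (1 : ℝ)) = realVec (rho i.castSucc) := by
  ext j
  fin_cases i <;> fin_cases j <;> simp [realMap, realVec, rho, projMatrix]

lemma map_hull_single (I : Finset (Fin 6)) :
    PointedCone.map (realMap projMatrix)
      (PointedCone.hull ℝ ((fun i => Pi.single i (1 : ℝ)) '' (I : Set (Fin 6)))) =
      cone (I.map Fin.castSuccEmb) := by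
  rw [PointedCone.map, PointedCone.hull, Submodule.map_span, cone, PointedCone.hull]
  congr 1
  ext x
  simp only [Set.mem_image, Finset.coe_map, exists_exists_and_eq_and]
  refine exists_congr fun i => and_congr_right fun _ => ?_
  rw [Fin.castSuccEmb_apply, ← realMap_projMatrix_single]
  rfl

lemma exists_map_castSucc {I : Finset (Fin 7)} (h : 6 ∉ I) :
    ∃ J : Finset (Fin 6), I = J.map Fin.castSuccEmb := by
  refine ⟨Finset.univ.filter fun j => j.castSucc ∈ I, ?_⟩
  ext i
  simp only [Finset.mem_map, Finset.mem_filter, Finset.mem_univ, true_and, Fin.castSuccEmb_apply]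
  refine ⟨fun hi => ?_, ?_⟩
  · have : i ≠ Fin.last 6 := by
      rintro rfl
      exact h hi
    exact ⟨i.castPred this, by simpa using hi, by simp⟩
  · rintro ⟨j, hj, rfl⟩
    exact hj

lemma exists_projected_iff {p : Cone 3 → Prop} :
    (∃ σ ∈ affineFan, p (PointedCone.map (realMap projMatrix) σ)) ↔
      ∃ I : Finset (Fin 7), 6 ∉ I ∧ p (cone I) := by
  constructor
  · rintro ⟨σ, hσ, hp⟩
    obtain ⟨I, rfl⟩ := mem_affineFan_iff.1 hσ
    rw [map_hull_single] at hp
    exact ⟨_, by simp [Fin.ext_iff]; omega, hp⟩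
  · rintro ⟨I, hI, hp⟩
    obtain ⟨J, rfl⟩ := exists_map_castSucc hI
    exact ⟨_, mem_affineFan_iff.2 ⟨J, rfl⟩, by rwa [map_hull_single]⟩

lemma covers_of_mem_relInt {s I : Finset (Fin 7)} (hs : s ∈ faces facets₃) (hI : 6 ∉ I)
    {x : Fin 3 → ℝ} (hxs : x ∈ relInt s) (hxI : x ∈ cone I) : Covers I s :=
  (covers_or_separates s hs I hI).elim id fun ⟨_, _, hm⟩ => absurd hxI (hm.notMem hxs)

/-- Let `y` lie in all projected cones through `x`, and let `t` be a face with `y` in its relative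
interior. Every `I` covering `s` has `x`, hence `y`, in its cone, so it covers `t`; therefore `t ⊆
s`. -/
lemma sInf_projected {s : Finset (Fin 7)} (hs : s ∈ faces facets₃) {x : Fin 3 → ℝ}
    (hx : x ∈ relInt s) : sInf {D | ∃ σ ∈ affineFan,
      D = PointedCone.map (realMap projMatrix) σ ∧ x ∈ D} = cone s := by
  refine le_antisymm (fun y hy => ?_) (le_sInf ?_)
  · obtain ⟨c, hc, hyc⟩ := isComplete₃ y
    obtain ⟨t, htc, hyt⟩ := exists_mem_relInt hyc
    have ht : t ∈ faces facets₃ := ⟨c, hc, htc⟩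
    refine cone_mono (subset_of_covers s hs t ht fun I hI hcov => ?_) (relInt_subset_cone _ hyt)
    refine covers_of_mem_relInt ht hI hyt (Submodule.mem_sInf.1 hy (cone I) ?_)
    exact (exists_projected_iff (p := fun C => cone I = C ∧ x ∈ cone I)).2
      ⟨I, hI, rfl, hcov.cone_le (relInt_subset_cone _ hx)⟩
  · rintro D hD
    obtain ⟨I, hI, rfl, hxI⟩ := (exists_projected_iff (p := fun C => D = C ∧ x ∈ D)).1 hD
    exact (covers_of_mem_relInt hs hI hx hxI).cone_le

lemma mem_combFan_iff {C : Cone 3} : C ∈ combFan ↔ ∃ s ∈ faces facets₃, C = cone s := by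
  constructor
  · rintro ⟨x, -, rfl⟩
    obtain ⟨c, hc, hyc⟩ := isComplete₃ x
    obtain ⟨t, htc, hyt⟩ := exists_mem_relInt hyc
    exact ⟨t, ⟨c, hc, htc⟩, sInf_projected ⟨c, hc, htc⟩ hyt⟩
  · rintro ⟨s, hs, rfl⟩
    refine ⟨_, ?_, (sInf_projected hs (sum_mem_relInt s)).symm⟩
    -- The point must also lie in some projected cone; the image of the whole orthant contains all
    -- seven rays.
    refine (exists_projected_iff (p := fun C => _ ∈ C)).2 ⟨{0, 1, 2, 3, 4, 5}, by decide, ?_⟩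
    refine Covers.cone_le (s := s) ?_ (relInt_subset_cone _ (sum_mem_relInt s))
    have : ∀ r : Fin 7, r ∈ ({0, 1, 2, 3, 4, 5} : Finset (Fin 7)) ∨ ∃ p ∈ rayRelations,
        p.1 = r ∧ p.2 ⊆ {0, 1, 2, 3, 4, 5} := by decide +kernel
    exact fun r _ => this r

/-- The forms `dualVec c r` compute the coefficients in the lattice basis, and these are nonnegative
for both `x` and `-x`. -/
lemma neg_mem_cone {c : Finset (Fin 7)} (hc : Unimodular c) {x : Fin 3 → ℝ}
    (hx : x ∈ cone c) (hx' : -x ∈ cone c) : x = 0 := by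
  obtain ⟨k, hk, rfl⟩ := (mem_hull_image_iff _ _ _).1 hx
  refine Finset.sum_eq_zero fun r hr => ?_
  have h : ∀ y ∈ cone c, 0 ≤ pairing (dualVec c r) y := fun y hy => by
    rw [pairing_apply]
    refine mem_dualMonoid_cone.2 (fun r' hr' => ?_) y hy
    rw [hc.dual r hr r' hr']
    split_ifs <;> norm_num
  have h1 := h _ hx'
  rw [map_neg, map_sum, Finset.sum_congr rfl (g := fun i => if r = i then k i else 0)] at h1
  · rw [Finset.sum_ite_eq, if_pos hr] at h1
    rw [le_antisymm (by linarith) (hk r), zero_smul]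
  · intro i hi
    rw [map_smul, pairing_realVec, hc.dual r hr i hi]
    split_ifs <;> simp

lemma isFan_combFan : IsFan combFan where
  finite := by
    have : combFan = cone '' faces facets₃ := by
      ext C
      simp only [mem_combFan_iff, Set.mem_image, eq_comm (a := C)]
    rw [this]
    exact (Set.toFinite _).image _
  nonempty := ⟨cone ∅, mem_combFan_iff.2 ⟨∅, by decide, rfl⟩⟩
  rational := by
    intro σ hσ
    obtain ⟨s, -, rfl⟩ := mem_combFan_iff.1 hσ
    refine ⟨s.image rho, ?_⟩
    rw [cone, Finset.coe_image, Set.image_image]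
  stronglyConvex := by
    intro σ hσ x hx hx'
    obtain ⟨s, ⟨c, hc, hsc⟩, rfl⟩ := mem_combFan_iff.1 hσ
    exact neg_mem_cone (unimodular₃ c hc) (cone_mono hsc hx) (cone_mono hsc hx')
  face_mem := by
    intro σ hσ τ hτ
    obtain ⟨s, hs, rfl⟩ := mem_combFan_iff.1 hσ
    obtain ⟨t, ht, rfl⟩ := exists_eq_hull_of_isFaceOf hτ
    exact mem_combFan_iff.2 ⟨t, faces_mono hs ht, rfl⟩
  inter_face := by
    intro σ hσ τ hτ
    obtain ⟨s, hs, rfl⟩ := mem_combFan_iff.1 hσ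
    obtain ⟨t, ht, rfl⟩ := mem_combFan_iff.1 hτ
    rw [cone_inf hs ht]
    obtain ⟨c, hc, hsc⟩ := hs
    exact isFaceOf_cone (unimodular₃ c hc) hsc Finset.inter_subset_left

/-- A coordinate equal to ±1 makes the vector primitive and reveals any scaling factor. -/
lemma exists_abs_rho_eq_one (r : Fin 7) : ∃ i, rho r i * rho r i = 1 := by
  revert r
  decide

/-- Any ray of `s` lies on the half-line of `v`, so ρ_r = k v with k ≥ 0. A coordinate ±1 of ρ_r
turns this into an integral multiple v = (v_i ρ_{r,i}) ρ_r; primitivity makes the factor ±1 and k ≥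
0 excludes -1. -/
lemma ray_eq_cone_iff {v : Fin 3 → ℤ} (hv : IsPrimitive v) {s : Finset (Fin 7)}
    (h : ray v = cone s) : ∃ r, v = rho r := by
  have hv0 : v ≠ 0 := by
    rintro rfl
    exact not_isUnit_zero (hv 0 0 (by simp))
  obtain rfl | ⟨r, hr⟩ := s.eq_empty_or_nonempty
  · have : realVec v ∈ cone ∅ := by
      rw [← h]
      exact PointedCone.subset_hull rfl
    obtain ⟨k, -, hk⟩ := (mem_hull_image_iff _ _ _).1 this
    refine absurd (funext fun i => ?_) hv0
    have := congrFun hk i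
    simpa [realVec] using this
  refine ⟨r, ?_⟩
  have hrv : realVec (rho r) ∈ ray v := by
    rw [h]
    exact rho_mem_cone hr
  have : ray v = PointedCone.hull ℝ
      ((fun _ : Unit => realVec v) '' (({()} : Finset Unit) : Set Unit)) := by
    simp [ray]
  rw [this, mem_hull_image_iff] at hrv
  obtain ⟨k, hk, hkv⟩ := hrv
  simp only [Finset.sum_singleton] at hkv
  have hk' : ∀ i, (rho r i : ℝ) = k () * v i := fun i => by
    have := congrFun hkv i
    simpa [realVec] using this
  obtain ⟨i, hi⟩ := exists_abs_rho_eq_one r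
  have hi' : (rho r i : ℝ) * rho r i = 1 := by exact_mod_cast hi
  have hvr : v = (v i * rho r i) • rho r := by
    ext j
    have h1 : (v j : ℝ) = v i * rho r i * rho r j := by
      have : (v j : ℝ) * (rho r i * rho r i) = v i * rho r i * rho r j := by
        rw [hk' i, hk' j]
        ring
      rwa [hi', mul_one] at this
    simpa using (by exact_mod_cast h1 : v j = v i * rho r i * rho r j)
  have hu := hv _ _ hvr
  rcases Int.isUnit_iff.1 hu with h1 | h1
  · rw [hvr, h1, one_smul]
  · exfalso
    have h2 : (v i : ℝ) * rho r i = -1 := by exact_mod_cast h1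
    have h3 : k () * (v i * v i) = -1 := by
      rw [← h2, hk' i]
      ring
    nlinarith [hk (), mul_self_nonneg (v i : ℝ), mul_nonneg (hk ()) (mul_self_nonneg (v i : ℝ))]

lemma isPrimitive_rho (r : Fin 7) : IsPrimitive (rho r) := by
  intro k w h
  obtain ⟨i, hi⟩ := exists_abs_rho_eq_one r
  have h1 : rho r i = k * w i := by
    simpa using congrFun h i
  refine IsUnit.of_mul_eq_one (w i * rho r i) ?_
  rw [← mul_assoc, ← h1, hi]

lemma rayGenerators_combFan : rayGenerators combFan = Set.range rho := by
  ext v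
  constructor
  · rintro ⟨hv, hr⟩
    obtain ⟨s, -, hs⟩ := mem_combFan_iff.1 hr
    obtain ⟨r, rfl⟩ := ray_eq_cone_iff hv hs
    exact ⟨r, rfl⟩
  · rintro ⟨r, rfl⟩
    refine ⟨isPrimitive_rho r, mem_combFan_iff.2 ⟨{r}, ?_, by simp [ray, cone]⟩⟩
    revert r
    decide +kernel

/-- `projMatrix` is the cokernel of the inclusion of `N(H)` in `N(T)`. -/
lemma projMatrix_exact : Function.Surjective projMatrix.mulVecLin ∧
    LinearMap.ker projMatrix.mulVecLin = LinearMap.range conjWeights := by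
  constructor
  · intro v
    refine ⟨![0, 0, 0, v 0, v 1, v 2], ?_⟩
    ext i
    fin_cases i <;> simp [projMatrix, Matrix.mulVec, dotProduct, Fin.sum_univ_succ]
  · ext y
    rw [LinearMap.mem_ker, LinearMap.mem_range]
    constructor
    · intro h
      have h0 := congrFun h 0
      have h1 := congrFun h 1
      have h2 := congrFun h 2
      simp [projMatrix, Matrix.mulVec, dotProduct, Fin.sum_univ_succ] at h0 h1 h2
      -- The entries `y 0`, `y 1`, `y 2` are the successive differences of the weights; starting
      -- from weight 0, the weights are their partial sums.
      refine ⟨![0, y 0, y 0 + y 1, y 0 + y 1 + y 2], ?_⟩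
      ext k
      fin_cases k <;> simp [conjWeights, entry] <;> omega
    · rintro ⟨a, rfl⟩
      ext i
      fin_cases i <;>
        simp [projMatrix, Matrix.mulVec, dotProduct, Fin.sum_univ_succ, conjWeights, entry]

end

/-! ### Affine toric charts and the inclusions between them. -/

section

/-! ### The rings of the charts -/

/-- The character `χᵐ` as a function on a chart. -/
def chi {n : ℕ} {σ : Cone n} {m : Fin n → ℤ} (h : m ∈ dualMonoid σ) : chartRing σ :=
  AddMonoidAlgebra.single ⟨m, h⟩ 1

lemma chi_congr {n : ℕ} {σ : Cone n} {m m' : Fin n → ℤ} {h : m ∈ dualMonoid σ}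
    {h' : m' ∈ dualMonoid σ} (e : m = m') : chi h = chi h' := by
  subst e
  rfl

lemma chi_zero {n : ℕ} {σ : Cone n} : chi (zero_mem (dualMonoid σ)) = 1 := rfl

lemma chi_add {n : ℕ} {σ : Cone n} {m m' : Fin n → ℤ} (h : m ∈ dualMonoid σ)
    (h' : m' ∈ dualMonoid σ) : chi (add_mem h h') = chi h * chi h' := by
  rw [chi, chi, chi, AddMonoidAlgebra.single_mul_single, one_mul]
  rfl

lemma chi_nsmul {n : ℕ} {σ : Cone n} {m : Fin n → ℤ} (h : m ∈ dualMonoid σ) (k : ℕ) :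
    chi (nsmul_mem h k) = chi h ^ k := by
  rw [chi, chi, AddMonoidAlgebra.single_pow, one_pow]
  rfl

lemma isUnit_chi {n : ℕ} {σ : Cone n} {m : Fin n → ℤ} (h : m ∈ dualMonoid σ)
    (h' : -m ∈ dualMonoid σ) : IsUnit (chi h) := by
  refine IsUnit.of_mul_eq_one (chi h') ?_
  rw [← chi_add, ← chi_zero]
  exact chi_congr (add_neg_cancel m)

/-- The inclusion `ℂ[σ^∨ ∩ M] ⊆ ℂ[τ^∨ ∩ M]` for `τ ⊆ σ`. -/
def chartHom {n : ℕ} {τ σ : Cone n} (h : τ ≤ σ) : chartRing σ →ₐ[ℂ] chartRing τ :=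
  AddMonoidAlgebra.mapDomainAlgHom ℂ ℂ (AddSubmonoid.inclusion (dualMonoid_anti h))

lemma chartMap_eq {n : ℕ} {τ σ : Cone n} (h : τ ≤ σ) :
    chartMap h = Spec.map (CommRingCat.ofHom (chartHom h).toRingHom) := rfl

lemma chartHom_chi {n : ℕ} {τ σ : Cone n} (h : τ ≤ σ) {m : Fin n → ℤ} (hm : m ∈ dualMonoid σ) :
    chartHom h (chi hm) = chi (dualMonoid_anti h hm) :=
  AddMonoidAlgebra.mapDomain_single

lemma chartHom_injective {n : ℕ} {τ σ : Cone n} (h : τ ≤ σ) :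
    Function.Injective (chartHom h) :=
  AddMonoidAlgebra.mapDomain_injective
    (AddSubmonoid.inclusion_injective (dualMonoid_anti h))

lemma single_eq_algebraMap_mul_chi {n : ℕ} {σ : Cone n} (m : dualMonoid σ) (a : ℂ) :
    (AddMonoidAlgebra.single m a : chartRing σ) = algebraMap ℂ _ a * chi m.2 := by
  rw [chi, AddMonoidAlgebra.coe_algebraMap]
  simp [AddMonoidAlgebra.single_mul_single]

lemma chartRing_ringHom_ext {n : ℕ} {σ : Cone n} {B : Type*} [Semiring B]
    {f g : chartRing σ →+* B} (h : ∀ a, f (algebraMap ℂ _ a) = g (algebraMap ℂ _ a))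
    (h' : ∀ m (hm : m ∈ dualMonoid σ), f (chi hm) = g (chi hm)) : f = g := by
  refine AddMonoidAlgebra.ringHom_ext (fun a => h a) fun m => h' m.1 m.2

lemma chartRing_algHom_ext {n : ℕ} {σ : Cone n} {B : Type*} [Semiring B] [Algebra ℂ B]
    {f g : chartRing σ →ₐ[ℂ] B} (h : ∀ m (hm : m ∈ dualMonoid σ), f (chi hm) = g (chi hm)) :
    f = g :=
  AlgHom.coe_ringHom_injective <| chartRing_ringHom_ext
    (fun a => (f.commutes a).trans (g.commutes a).symm) h

lemma chartHom_refl {n : ℕ} (σ : Cone n) : chartHom (le_refl σ) = AlgHom.id ℂ _ :=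
  chartRing_algHom_ext fun _ hm => chartHom_chi _ hm

lemma chartHom_comp {n : ℕ} {υ τ σ : Cone n} (h : υ ≤ τ) (h' : τ ≤ σ) :
    (chartHom h).comp (chartHom h') = chartHom (h.trans h') :=
  chartRing_algHom_ext fun _ hm => by
    rw [AlgHom.comp_apply, chartHom_chi, chartHom_chi, chartHom_chi]

@[simp]
lemma chartMap_refl {n : ℕ} (σ : Cone n) : chartMap (le_refl σ) = 𝟙 _ := by
  rw [chartMap_eq, chartHom_refl]
  exact Spec.map_id _

lemma chartMap_comp {n : ℕ} {υ τ σ : Cone n} (h : υ ≤ τ) (h' : τ ≤ σ) :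
    chartMap h ≫ chartMap h' = chartMap (h.trans h') := by
  rw [chartMap_eq (h.trans h'), ← chartHom_comp h h']
  exact (Spec.map_comp _ _).symm

lemma chartMap_comp_assoc {n : ℕ} {υ τ σ : Cone n} (h : υ ≤ τ) (h' : τ ≤ σ) {Z : Scheme.{0}}
    (f : chart σ ⟶ Z) : chartMap h ≫ chartMap h' ≫ f = chartMap (h.trans h') ≫ f := by
  rw [← Category.assoc, chartMap_comp]

lemma dualVec_mem {c : Finset (Fin 7)} (hc : Unimodular c) {t : Finset (Fin 7)} (ht : t ⊆ c)
    {r : Fin 7} (hr : r ∈ c) : dualVec c r ∈ dualMonoid (cone t) :=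
  mem_dualMonoid_cone.2 fun r' hr' => by
    rw [hc.dual r hr r' (ht hr')]
    split_ifs <;> norm_num

lemma neg_dualVec_mem {c : Finset (Fin 7)} (hc : Unimodular c) {t : Finset (Fin 7)} (ht : t ⊆ c)
    {r : Fin 7} (hr : r ∈ c) (hrt : r ∉ t) : -dualVec c r ∈ dualMonoid (cone t) :=
  mem_dualMonoid_cone.2 fun r' hr' => by
    rw [neg_dotProduct, hc.dual r hr r' (ht hr'), if_neg, neg_zero]
    rintro rfl
    exact hrt hr'

lemma sum_dualVec {c : Finset (Fin 7)} (hc : Unimodular c) (m : Fin 3 → ℤ) :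
    m = ∑ r ∈ c, (m ⬝ᵥ rho r) • dualVec c r := by
  ext i
  simp only [Finset.sum_apply, Pi.smul_apply, smul_eq_mul, dotProduct, Finset.sum_mul]
  rw [Finset.sum_comm]
  have : ∀ j, ∑ r ∈ c, m j * rho r j * dualVec c r i = if i = j then m j else 0 := fun j => by
    rw [← mul_boole, ← hc.span i j, Finset.mul_sum]
    exact Finset.sum_congr rfl fun r _ => by ring
  simp [this]

/-- The monoid of a face `t` of a unimodular set is generated by the dual basis and the negatives of
the dual vectors of rays outside `t`. -/
lemma dualMonoid_cone_le {c : Finset (Fin 7)} (hc : Unimodular c) {t : Finset (Fin 7)}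
    {S : AddSubmonoid (Fin 3 → ℤ)} (h : ∀ r ∈ c, dualVec c r ∈ S)
    (h' : ∀ r ∈ c, r ∉ t → -dualVec c r ∈ S) : dualMonoid (cone t) ≤ S := by
  intro m hm
  rw [sum_dualVec hc m]
  refine sum_mem fun r hr => ?_
  obtain ⟨k, hk⟩ := (m ⬝ᵥ rho r).eq_nat_or_neg
  by_cases hrt : r ∈ t
  · have h0 := mem_dualMonoid_cone.1 hm r hrt
    obtain ⟨k, hk⟩ := Int.eq_ofNat_of_zero_le h0
    rw [hk, natCast_zsmul]
    exact nsmul_mem (h r hr) k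
  · rcases hk with hk | hk
    · rw [hk, natCast_zsmul]
      exact nsmul_mem (h r hr) k
    · rw [hk, neg_smul, ← smul_neg, natCast_zsmul]
      exact nsmul_mem (h' r hr hrt) k

/-- The negative generators of the monoid need no separate hypothesis: they give inverses, and
homomorphisms agreeing on a unit agree on its inverse. -/
lemma chartRing_cone_ringHom_ext {c : Finset (Fin 7)} (hc : Unimodular c) {t : Finset (Fin 7)}
    (ht : t ⊆ c) {B : Type*} [Ring B] {f g : chartRing (cone t) →+* B}
    (h : ∀ a, f (algebraMap ℂ _ a) = g (algebraMap ℂ _ a))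
    (h' : ∀ r (hr : r ∈ c), f (chi (dualVec_mem hc ht hr)) = g (chi (dualVec_mem hc ht hr))) :
    f = g := by
  refine chartRing_ringHom_ext h fun m hm => ?_
  let S : AddSubmonoid (Fin 3 → ℤ) :=
    { carrier := {m | ∃ hm : m ∈ dualMonoid (cone t), f (chi hm) = g (chi hm)}
      zero_mem' := ⟨zero_mem _, by rw [chi_zero, map_one, map_one]⟩
      add_mem' := by
        rintro a b ⟨ha, ha'⟩ ⟨hb, hb'⟩
        exact ⟨add_mem ha hb, by rw [chi_add, map_mul, map_mul, ha', hb']⟩ }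
  have key : dualMonoid (cone t) ≤ S := by
    refine dualMonoid_cone_le hc (fun r hr => ⟨_, h' r hr⟩) fun r hr hrt => ?_
    have hn := neg_dualVec_mem hc ht hr hrt
    have hp := dualVec_mem hc ht hr
    refine ⟨hn, ?_⟩
    have h1 : chi hn * chi hp = 1 := by
      rw [← chi_add, ← chi_zero]
      exact chi_congr (neg_add_cancel _)
    have h2 : chi hp * chi hn = 1 := by rw [mul_comm, h1]
    calc f (chi hn) = f (chi hn) * (g (chi hp) * g (chi hn)) := by
          rw [← map_mul g, h2, map_one, mul_one]
      _ = g (chi hn) := by rw [← mul_assoc, ← h' r hr, ← map_mul, h1, map_one, one_mul]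
  exact (key hm).2

/-- The homomorphism from the ring of a chart with prescribed values: `b r` on the elements of
the dual basis for `r ∈ t`, and the unit `u r` for `r ∈ w`. -/
def chartLift (t w : Finset (Fin 7)) {B : Type*} [CommRing B] [Algebra ℂ B] (b : Fin 7 → B)
    (u : Fin 7 → Bˣ) : chartRing (cone t) →ₐ[ℂ] B :=
  AddMonoidAlgebra.lift ℂ B (dualMonoid (cone t))
    -- On `t` the pairings are nonnegative, so `toNat` loses nothing and is additive; on `w` they
    -- may have either sign, which is why units are required there.
    { toFun m := (∏ r ∈ t, b r ^ (m.toAdd.1 ⬝ᵥ rho r).toNat) *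
        ∏ r ∈ w, ((u r ^ (m.toAdd.1 ⬝ᵥ rho r) : Bˣ) : B)
      map_one' := by simp
      map_mul' m m' := by
        have h := mem_dualMonoid_cone.1 m.toAdd.2
        have h' := mem_dualMonoid_cone.1 m'.toAdd.2
        simp only [toAdd_mul, AddSubmonoid.coe_add, add_dotProduct]
        rw [mul_mul_mul_comm, ← Finset.prod_mul_distrib, ← Finset.prod_mul_distrib]
        congr 1
        · refine Finset.prod_congr rfl fun r hr => ?_
          rw [Int.toNat_add (h r hr) (h' r hr), pow_add]
        · refine Finset.prod_congr rfl fun r hr => ?_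
          rw [zpow_add, Units.val_mul] }

lemma chartLift_chi (t w : Finset (Fin 7)) {B : Type*} [CommRing B] [Algebra ℂ B] (b : Fin 7 → B)
    (u : Fin 7 → Bˣ) {m : Fin 3 → ℤ} (hm : m ∈ dualMonoid (cone t)) :
    chartLift t w b u (chi hm) = (∏ r ∈ t, b r ^ (m ⬝ᵥ rho r).toNat) *
      ∏ r ∈ w, ((u r ^ (m ⬝ᵥ rho r) : Bˣ) : B) := by
  rw [chi, chartLift, AddMonoidAlgebra.lift_single, one_smul]
  rfl

lemma chartLift_chi_dualVec {c : Finset (Fin 7)} (hc : Unimodular c) {B : Type*} [CommRing B]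
    [Algebra ℂ B] (b : Fin 7 → B) (u : Fin 7 → Bˣ) {r : Fin 7} (hr : r ∈ c) :
    chartLift c ∅ b u (chi (dualVec_mem hc subset_rfl hr)) = b r := by
  rw [chartLift_chi, Finset.prod_empty, mul_one,
    Finset.prod_congr rfl (g := fun i => if r = i then b i else 1)]
  · simp [hr]
  · intro i hi
    rw [hc.dual r hr i hi]
    split_ifs <;> simp

/-- The chart of a three-dimensional unimodular cone is affine space. -/
def chartRingEquiv {c : Finset (Fin 7)} (hc : Unimodular c) :
    chartRing (cone c) ≃ₐ[ℂ] MvPolynomial c ℂ :=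
  AlgEquiv.ofAlgHom
    (chartLift c ∅ (fun r => if h : r ∈ c then MvPolynomial.X ⟨r, h⟩ else 0) 1)
    (MvPolynomial.aeval fun r => chi (dualVec_mem hc subset_rfl r.2))
    (by
      ext r : 1
      rw [AlgHom.comp_apply, MvPolynomial.aeval_X, chartLift_chi_dualVec hc _ _ r.2, dif_pos r.2]
      rfl)
    (by
      apply AlgHom.coe_ringHom_injective
      refine chartRing_cone_ringHom_ext hc subset_rfl (fun a => ?_) fun r hr => ?_
      · change MvPolynomial.aeval _ (chartLift _ _ _ _ _) = _
        rw [AlgHom.commutes, AlgHom.commutes]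
        rfl
      change MvPolynomial.aeval _ (chartLift _ _ _ _ _) = _
      rw [chartLift_chi_dualVec hc _ _ hr, dif_pos hr, MvPolynomial.aeval_X]
      rfl)

/-! ### Localization of charts -/

lemma faceForm_mem {c : Finset (Fin 7)} (hc : Unimodular c) {s : Finset (Fin 7)} (hs : s ⊆ c)
    (t : Finset (Fin 7)) : faceForm c t ∈ dualMonoid (cone s) :=
  mem_dualMonoid_cone.2 fun r hr => by
    rw [faceForm_dotProduct hc t (hs hr)]
    split_ifs <;> norm_num

/-- The face form is 0 on `t` and 1 on the other rays of `s`, so adding a large multiple of it to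
any element of the dual monoid of `t` lands in the dual monoid of `s`. -/
lemma isLocalization_chartHom {c : Finset (Fin 7)} (hc : Unimodular c) {s t : Finset (Fin 7)}
    (hs : s ⊆ c) (hts : t ⊆ s) :
    letI := (chartHom (cone_mono hts)).toRingHom.toAlgebra
    IsLocalization.Away (chi (faceForm_mem hc hs t)) (chartRing (cone t)) := by
  let := (chartHom (cone_mono hts)).toRingHom.toAlgebra
  have hmap : ∀ x, algebraMap (chartRing (cone s)) (chartRing (cone t)) x =
    chartHom (cone_mono hts) x := fun _ => rfl
  have hunit : IsUnit (algebraMap (chartRing (cone s)) (chartRing (cone t))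
      (chi (faceForm_mem hc hs t))) := by
    rw [hmap, chartHom_chi]
    refine isUnit_chi _ (mem_dualMonoid_cone.2 fun r hr => ?_)
    rw [neg_dotProduct, faceForm_dotProduct hc t (hs (hts hr)), if_pos hr, neg_zero]
  refine ⟨⟨?_, ?_, ?_⟩⟩
  · rintro ⟨_, k, rfl⟩
    simpa using hunit.pow k
  · suffices h : ∀ z : chartRing (cone t), ∃ (x : chartRing (cone s)) (k : ℕ),
        z * chartHom (cone_mono hts) (chi (faceForm_mem hc hs t) ^ k) =
          chartHom (cone_mono hts) x by
      intro z
      obtain ⟨x, k, h⟩ := h z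
      exact ⟨⟨x, ⟨_, k, rfl⟩⟩, h⟩
    intro z
    induction z using AddMonoidAlgebra.induction_linear with
    | zero => exact ⟨0, 0, by simp⟩
    | add f g hf hg =>
      obtain ⟨x, k, hx⟩ := hf
      obtain ⟨y, l, hy⟩ := hg
      refine ⟨x * chi (faceForm_mem hc hs t) ^ l + y * chi (faceForm_mem hc hs t) ^ k, k + l, ?_⟩
      rw [map_add, map_mul, map_mul, ← hx, ← hy, pow_add, map_mul]
      ring
    | single m a =>
      obtain ⟨m, hm⟩ := m
      -- This multiple compensates every negative value of `m` on the rays of `s`.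
      let k : ℕ := ∑ r ∈ s, (m ⬝ᵥ rho r).natAbs
      have hk : m + k • faceForm c t ∈ dualMonoid (cone s) := by
        refine mem_dualMonoid_cone.2 fun r hr => ?_
        rw [add_dotProduct, smul_dotProduct, faceForm_dotProduct hc t (hs hr)]
        split_ifs with hrt
        · simpa using mem_dualMonoid_cone.1 hm r hrt
        · have : (m ⬝ᵥ rho r).natAbs ≤ k :=
            Finset.single_le_sum (f := fun r => (m ⬝ᵥ rho r).natAbs) (fun _ _ => Nat.zero_le _) hr
          simp only [nsmul_eq_mul, mul_one]
          omega
      refine ⟨algebraMap ℂ _ a * chi hk, k, ?_⟩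
      rw [single_eq_algebraMap_mul_chi, map_mul, map_pow, chartHom_chi, chartHom_chi,
        AlgHom.commutes, mul_assoc, ← chi_nsmul, ← chi_add]
  · intro x y h
    exact ⟨1, by rw [chartHom_injective (cone_mono hts) h]⟩

/-- The function `f` on an affine chart vanishes at the point `x`. -/
def Vanishes {n : ℕ} {σ : Cone n} (f : chartRing σ) (x : chart σ) : Prop :=
  f ∈ (show PrimeSpectrum (chartRing σ) from x).asIdeal

lemma vanishes_mul {n : ℕ} {σ : Cone n} {f g : chartRing σ} {x : chart σ} :
    Vanishes (f * g) x ↔ Vanishes f x ∨ Vanishes g x :=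
  (show PrimeSpectrum (chartRing σ) from x).isPrime.mul_mem_iff_mem_or_mem

lemma not_vanishes_of_isUnit {n : ℕ} {σ : Cone n} {f : chartRing σ} (hf : IsUnit f)
    (x : chart σ) : ¬ Vanishes f x := fun h =>
  (show PrimeSpectrum (chartRing σ) from x).isPrime.ne_top (Ideal.eq_top_of_isUnit_mem _ h hf)

lemma vanishes_chartMap {n : ℕ} {τ σ : Cone n} (h : τ ≤ σ) {f : chartRing σ} {y : chart τ} :
    Vanishes f (chartMap h y) ↔ Vanishes (chartHom h f) y := Iff.rfl

lemma isOpenImmersion_chartMap {c : Finset (Fin 7)} (hc : Unimodular c) {s t : Finset (Fin 7)}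
    (hs : s ⊆ c) (hts : t ⊆ s) : IsOpenImmersion (chartMap (cone_mono hts)) := by
  let := (chartHom (cone_mono hts)).toRingHom.toAlgebra
  have := isLocalization_chartHom hc hs hts
  exact IsOpenImmersion.of_isLocalization (R := chartRing (cone s)) (S := chartRing (cone t))
    (chi (faceForm_mem hc hs t))

lemma mem_range_chartMap_iff_faceForm {c : Finset (Fin 7)} (hc : Unimodular c)
    {s t : Finset (Fin 7)} (hs : s ⊆ c) (hts : t ⊆ s) {x : chart (cone s)} :
    x ∈ Set.range (chartMap (cone_mono hts)) ↔ ¬ Vanishes (chi (faceForm_mem hc hs t)) x := by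
  let := (chartHom (cone_mono hts)).toRingHom.toAlgebra
  have := isLocalization_chartHom hc hs hts
  have h := PrimeSpectrum.localization_away_comap_range (chartRing (cone t))
    (chi (faceForm_mem hc hs t))
  exact Set.ext_iff.1 h x

/-- By integrality `m` is at least 1 on the rays of `s` outside `t`, so the function of the face
form divides χᵐ. -/
lemma mem_range_chartMap {c : Finset (Fin 7)} (hc : Unimodular c) {s t : Finset (Fin 7)}
    (hs : s ⊆ c) (hts : t ⊆ s) {x : chart (cone s)} {m : Fin 3 → ℤ}
    (hm : m ∈ dualMonoid (cone s)) (hmt : ∀ r ∈ s, m ⬝ᵥ rho r = 0 → r ∈ t)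
    (hx : ¬ Vanishes (chi hm) x) : x ∈ Set.range (chartMap (cone_mono hts)) := by
  rw [mem_range_chartMap_iff_faceForm hc hs hts]
  have h : m - faceForm c t ∈ dualMonoid (cone s) := mem_dualMonoid_cone.2 fun r hr => by
    rw [sub_dotProduct, faceForm_dotProduct hc t (hs hr)]
    have h0 := mem_dualMonoid_cone.1 hm r hr
    split_ifs with hrt
    · simpa using h0
    · have := mt (hmt r hr) hrt
      omega
  intro h0
  refine hx ?_
  rw [← chi_congr (h := add_mem (faceForm_mem hc hs t) h) (add_sub_cancel _ _),
    chi_add (faceForm_mem hc hs t) h, vanishes_mul]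
  exact Or.inl h0

lemma not_vanishes_of_mem_range {s t : Finset (Fin 7)} (hts : t ⊆ s) {x : chart (cone s)}
    {m : Fin 3 → ℤ} (hm : m ∈ dualMonoid (cone s)) (hmt : ∀ r ∈ t, m ⬝ᵥ rho r = 0)
    (hx : x ∈ Set.range (chartMap (cone_mono hts))) : ¬ Vanishes (chi hm) x := by
  obtain ⟨y, rfl⟩ := hx
  rw [vanishes_chartMap, chartHom_chi]
  refine not_vanishes_of_isUnit (isUnit_chi _ (mem_dualMonoid_cone.2 fun r hr => ?_)) y
  rw [neg_dotProduct, hmt r hr, neg_zero]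

/-- The function of the face form is the product of the coordinates of the rays of `c` outside `t`;
those of rays outside `s` are already units on the chart. -/
lemma mem_range_chartMap_iff {c : Finset (Fin 7)} (hc : Unimodular c) {s t : Finset (Fin 7)}
    (hs : s ⊆ c) (hts : t ⊆ s) {x : chart (cone s)} :
    x ∈ Set.range (chartMap (cone_mono hts)) ↔
      ∀ r (hr : r ∈ c), r ∈ s → r ∉ t → ¬ Vanishes (chi (dualVec_mem hc hs hr)) x := by
  constructor
  · intro h r hr hrs hrt
    refine not_vanishes_of_mem_range hts _ (fun r' hr' => ?_) h
    rw [hc.dual r hr r' (hs (hts hr')), if_neg]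
    rintro rfl
    exact hrt hr'
  · intro h
    rw [mem_range_chartMap_iff_faceForm hc hs hts]
    have key : ∀ w : Finset (Fin 7), ∀ hw : w ⊆ c \ t,
        ∃ hm : ∑ r ∈ w, dualVec c r ∈ dualMonoid (cone s), ¬ Vanishes (chi hm) x := by
      intro w hw
      induction w using Finset.induction_on with
      | empty =>
        refine ⟨by rw [Finset.sum_empty]; exact zero_mem _, ?_⟩
        rw [chi_congr (h' := zero_mem _) Finset.sum_empty, chi_zero]
        exact not_vanishes_of_isUnit isUnit_one x
      | insert r w hr ih =>
        obtain ⟨hm, hx⟩ := ih ((Finset.subset_insert _ _).trans hw)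
        have hrc := Finset.mem_sdiff.1 (hw (Finset.mem_insert_self r w))
        have h1 := dualVec_mem hc hs hrc.1
        refine ⟨by rw [Finset.sum_insert hr]; exact add_mem h1 hm, ?_⟩
        rw [chi_congr (h' := add_mem h1 hm) (Finset.sum_insert hr), chi_add h1 hm, vanishes_mul, not_or]
        refine ⟨?_, hx⟩
        by_cases hrs : r ∈ s
        · exact h r hrc.1 hrs hrc.2
        · exact not_vanishes_of_isUnit (isUnit_chi _ (neg_dualVec_mem hc hs hrc.1 hrs)) x
    exact (key _ subset_rfl).2

lemma range_chartMap_inter {c : Finset (Fin 7)} (hc : Unimodular c) {s t t' : Finset (Fin 7)}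
    (hs : s ⊆ c) (hts : t ⊆ s) (hts' : t' ⊆ s) {x : chart (cone s)}
    (hx : x ∈ Set.range (chartMap (cone_mono hts)))
    (hx' : x ∈ Set.range (chartMap (cone_mono hts'))) :
    x ∈ Set.range (chartMap (cone_mono (Finset.inter_subset_left.trans hts : t ∩ t' ⊆ s))) := by
  rw [mem_range_chartMap_iff hc hs hts] at hx
  rw [mem_range_chartMap_iff hc hs hts'] at hx'
  rw [mem_range_chartMap_iff hc hs (Finset.inter_subset_left.trans hts)]
  intro r hr hrs hrt
  by_cases h : r ∈ t
  · exact hx' r hr hrs fun h' => hrt (Finset.mem_inter.2 ⟨h, h'⟩)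
  · exact hx r hr hrs h

end

/-! ### Gluing toric varieties, orbits, and toric morphisms of subdivisions. -/

section

/-! ### Toric varieties of simplicial complexes -/

/-- The intersection of two faces, as a face. -/
abbrev faceInter {F : Finset (Finset (Fin 7))} (t u : faces F) : faces F :=
  ⟨t.1 ∩ u.1, faces_mono t.2 Finset.inter_subset_left⟩

/-- `X` is the toric variety of the fan of the cones spanned by the faces of the complex `F`. -/
structure IsToric (F : Finset (Finset (Fin 7))) (X : Scheme.{0}) (s : X ⟶ SpecC)
    (ι : ∀ t : faces F, chart (cone t.1) ⟶ X) : Prop where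
  unimodular : ∀ c ∈ F, Unimodular c
  openImmersion : ∀ t, IsOpenImmersion (ι t)
  structureMap : ∀ t, ι t ≫ s = chartToSpecC (cone t.1)
  compatible : ∀ (t u : faces F) (h : t.1 ⊆ u.1), chartMap (cone_mono h) ≫ ι u = ι t
  cover : ∀ x : X, ∃ t, x ∈ Set.range (ι t)
  inter : ∀ (t u : faces F) (x : X), x ∈ Set.range (ι t) → x ∈ Set.range (ι u) →
    x ∈ Set.range (ι (faceInter t u))

/-- The diagram of the charts of a complex. -/
def chartFunctor (F : Finset (Finset (Fin 7))) : faces F ⥤ Scheme.{0} where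
  obj t := chart (cone t.1)
  map f := chartMap (cone_mono (leOfHom f))
  map_id _ := chartMap_refl _
  map_comp _ _ := (chartMap_comp _ _).symm

lemma isOpenImmersion_chartFunctor_map {F : Finset (Finset (Fin 7))}
    (hF : ∀ c ∈ F, Unimodular c) {t u : faces F} (f : t ⟶ u) :
    IsOpenImmersion ((chartFunctor F).map f) := by
  obtain ⟨c, hc, huc⟩ := u.2
  exact isOpenImmersion_chartMap (hF c hc) huc (leOfHom f)

/-- Two charts inside a third meet exactly in the chart of the intersection face. This is what makes
the colimit of the charts a gluing along open subschemes. -/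
lemma isLocallyDirected_chartFunctor {F : Finset (Finset (Fin 7))}
    (hF : ∀ c ∈ F, Unimodular c) : (chartFunctor F ⋙ Scheme.forget).IsLocallyDirected := by
  constructor
  intro t u v f g x y hxy
  obtain ⟨c, hc, hvc⟩ := v.2
  have hf : t.1 ⊆ v.1 := leOfHom f
  have hg : u.1 ⊆ v.1 := leOfHom g
  have hxy : chartMap (cone_mono hf) x = chartMap (cone_mono hg) y := hxy
  obtain ⟨z, hz⟩ := range_chartMap_inter (hF c hc) hvc hf hg ⟨x, rfl⟩ ⟨y, hxy.symm⟩
  have ht : t.1 ∩ u.1 ⊆ t.1 := Finset.inter_subset_left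
  have hu : t.1 ∩ u.1 ⊆ u.1 := Finset.inter_subset_right
  refine ⟨faceInter t u, homOfLE ht, homOfLE hu, z, ?_, ?_⟩
  · have := isOpenImmersion_chartMap (hF c hc) hvc hf
    refine (chartMap (cone_mono hf)).isOpenEmbedding.injective ?_
    change (chartMap (cone_mono ht) ≫ chartMap (cone_mono hf)) z = _
    rw [chartMap_comp, ← hz]
  · have := isOpenImmersion_chartMap (hF c hc) hvc hg
    refine (chartMap (cone_mono hg)).isOpenEmbedding.injective ?_
    change (chartMap (cone_mono hu) ≫ chartMap (cone_mono hg)) z = _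
    rw [chartMap_comp, ← hxy, ← hz]

lemma chartMap_chartToSpecC {n : ℕ} {τ σ : Cone n} (h : τ ≤ σ) :
    chartMap h ≫ chartToSpecC σ = chartToSpecC τ := by
  rw [chartMap_eq, chartToSpecC, chartToSpecC]
  refine (Spec.map_comp _ _).symm.trans ?_
  congr 2
  exact congrArg CommRingCat.ofHom (RingHom.ext fun a => (chartHom h).commutes a)

/-- The existence of the toric variety of a complex, with its universal property. -/
lemma exists_isToric {F : Finset (Finset (Fin 7))} (hF : ∀ c ∈ F, Unimodular c) :
    ∃ (X : Scheme.{0}) (s : X ⟶ SpecC) (ι : ∀ t : faces F, chart (cone t.1) ⟶ X),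
      IsToric F X s ι ∧ ∀ (Y : Scheme.{0}) (g : ∀ t : faces F, chart (cone t.1) ⟶ Y),
        (∀ (t u : faces F) (h : t.1 ⊆ u.1), chartMap (cone_mono h) ≫ g u = g t) →
        ∃ f : X ⟶ Y, ∀ t, ι t ≫ f = g t := by
  have : ∀ {t u : faces F} (f : t ⟶ u), IsOpenImmersion ((chartFunctor F).map f) :=
    fun f => isOpenImmersion_chartFunctor_map hF f
  have := isLocallyDirected_chartFunctor hF
  have hdesc : ∀ (Y : Scheme.{0}) (g : ∀ t : faces F, chart (cone t.1) ⟶ Y),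
      (∀ (t u : faces F) (h : t.1 ⊆ u.1), chartMap (cone_mono h) ≫ g u = g t) →
      ∃ f : colimit (chartFunctor F) ⟶ Y, ∀ t, colimit.ι (chartFunctor F) t ≫ f = g t :=
    fun Y g hg => by
      let α : chartFunctor F ⟶ (Functor.const _).obj Y :=
        { app := g
          naturality := fun t u f => (hg t u (leOfHom f)).trans (Category.comp_id _).symm }
      exact ⟨colimit.desc (chartFunctor F) ⟨Y, α⟩, fun t => colimit.ι_desc _ _⟩
  obtain ⟨s, hs⟩ := hdesc SpecC (fun t => chartToSpecC _) fun t u h => chartMap_chartToSpecC _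
  have hw : ∀ (t u : faces F) (h : t.1 ⊆ u.1),
      chartMap (cone_mono h) ≫ colimit.ι (chartFunctor F) u = colimit.ι (chartFunctor F) t :=
    fun t u h => colimit.w (chartFunctor F) (homOfLE h : t ⟶ u)
  refine ⟨colimit (chartFunctor F), s, colimit.ι (chartFunctor F), ⟨hF,
    fun t => (inferInstance : IsOpenImmersion (colimit.ι (chartFunctor F) t)), hs, hw,
    fun x => ?_, ?_⟩, hdesc⟩
  · obtain ⟨t, y, h⟩ := Scheme.IsLocallyDirected.ι_jointly_surjective (chartFunctor F) x
    exact ⟨t, y, h⟩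
  · rintro t u _ ⟨x, rfl⟩ ⟨y, h⟩
    obtain ⟨k, fi, fj, z, hz, hz'⟩ := (Scheme.IsLocallyDirected.ι_eq_ι_iff (chartFunctor F)).1 h.symm
    have hk : k.1 ⊆ (faceInter t u).1 := Finset.subset_inter (leOfHom fi) (leOfHom fj)
    refine ⟨chartMap (cone_mono hk) z, ?_⟩
    have h₁ := congrArg (fun f => f z) (hw k (faceInter t u) hk)
    have h₂ := congrArg (fun f => f z) (colimit.w (chartFunctor F) fi)
    exact h₁.trans (h₂.symm.trans (congrArg (colimit.ι (chartFunctor F) t) hz))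

namespace IsToric

variable {F : Finset (Finset (Fin 7))} {X : Scheme.{0}} {s : X ⟶ SpecC}
  {ι : ∀ t : faces F, chart (cone t.1) ⟶ X}

lemma range_subset (h : IsToric F X s ι) {t u : faces F} (htu : t.1 ⊆ u.1) :
    Set.range (ι t) ⊆ Set.range (ι u) := by
  rintro _ ⟨x, rfl⟩
  exact ⟨chartMap (cone_mono htu) x, by rw [← Scheme.Hom.comp_apply, h.compatible _ _ htu]⟩

/-- The facets as faces. -/
abbrev facet {c : Finset (Fin 7)} (hc : c ∈ F) : faces F := ⟨c, c, hc, subset_rfl⟩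

lemma exists_facet (h : IsToric F X s ι) (x : X) :
    ∃ (c : Finset (Fin 7)) (hc : c ∈ F), x ∈ Set.range (ι (facet hc)) := by
  obtain ⟨t, ht⟩ := h.cover x
  obtain ⟨c, hc, htc⟩ := t.2
  exact ⟨c, hc, h.range_subset htc ht⟩

lemma mem_range_iff (h : IsToric F X s ι) {t u : faces F} (htu : t.1 ⊆ u.1)
    {x : chart (cone u.1)} :
    ι u x ∈ Set.range (ι t) ↔ x ∈ Set.range (chartMap (cone_mono htu)) := by
  have := h.openImmersion u
  constructor
  · rintro ⟨y, hy⟩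
    refine ⟨y, (ι u).isOpenEmbedding.injective ?_⟩
    rw [← hy, ← h.compatible t u htu, Scheme.Hom.comp_apply]
  · rintro ⟨y, rfl⟩
    exact ⟨y, by rw [← Scheme.Hom.comp_apply, h.compatible _ _ htu]⟩

/-- The cover by the charts of the facets. -/
def openCover (h : IsToric F X s ι) : X.OpenCover where
  I₀ := F
  X c := chart (cone c)
  f c := ι (facet c.2)
  mem₀ := by
    rw [Scheme.presieve₀_mem_precoverage_iff]
    refine ⟨fun x => ?_, fun c => h.openImmersion _⟩
    obtain ⟨c, hc, hx⟩ := h.exists_facet x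
    exact ⟨⟨c, hc⟩, hx⟩

lemma hom_ext (h : IsToric F X s ι) {Y : Scheme.{0}} {f g : X ⟶ Y}
    (hfg : ∀ c (hc : c ∈ F), ι (facet hc) ≫ f = ι (facet hc) ≫ g) : f = g :=
  h.openCover.hom_ext f g fun c => hfg c.1 c.2

end IsToric

end

section

namespace IsToric

variable {F : Finset (Finset (Fin 7))} {X : Scheme.{0}} {s : X ⟶ SpecC}
  {ι : ∀ t : faces F, chart (cone t.1) ⟶ X}

/-! ### Orbits -/

/-- The chart of the orbit through a point: the smallest chart containing it. -/
lemma exists_orbit (h : IsToric F X s ι) (x : X) :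
    ∃ t : faces F, x ∈ Set.range (ι t) ∧ ∀ u : faces F, x ∈ Set.range (ι u) → t.1 ⊆ u.1 := by
  -- For a face of least cardinality whose chart contains the point, intersecting with another such
  -- face cannot make it smaller.
  obtain ⟨t, ht, hmin⟩ := (measure fun t : faces F => t.1.card).wf.has_min
    {t | x ∈ Set.range (ι t)} (h.cover x)
  refine ⟨t, ht, fun u hu => ?_⟩
  have h1 := hmin _ (h.inter t u x ht hu)
  have h2 : (t.1 ∩ u.1).card ≥ t.1.card := not_lt.1 h1
  exact (Finset.eq_of_subset_of_card_le Finset.inter_subset_left h2) ▸ Finset.inter_subset_right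

/-- The closure of the orbit of the face `τ`. -/
def orbitClosure (ι : ∀ t : faces F, chart (cone t.1) ⟶ X) (τ : Finset (Fin 7)) : Set X :=
  {x | ∀ t : faces F, x ∈ Set.range (ι t) → τ ⊆ t.1}

lemma isClosed_orbitClosure (h : IsToric F X s ι) (τ : Finset (Fin 7)) :
    IsClosed (orbitClosure ι τ) := by
  have : orbitClosure ι τ = (⋃ t : {t : faces F // ¬ τ ⊆ t.1}, Set.range (ι t.1))ᶜ := by
    ext x
    rw [Set.mem_compl_iff, Set.mem_iUnion, not_exists]
    exact ⟨fun h1 t h2 => t.2 (h1 t.1 h2), fun h1 t h2 => by_contra fun h3 => h1 ⟨t, h3⟩ h2⟩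
  rw [this, isClosed_compl_iff]
  refine isOpen_iUnion fun t => ?_
  have := h.openImmersion t
  exact (ι t.1).isOpenEmbedding.isOpen_range

lemma mem_orbitClosure_iff_of_orbit {x : X} {t : faces F} (ht : x ∈ Set.range (ι t))
    (hmin : ∀ u : faces F, x ∈ Set.range (ι u) → t.1 ⊆ u.1) {τ : Finset (Fin 7)} :
    x ∈ orbitClosure ι τ ↔ τ ⊆ t.1 :=
  ⟨fun h => h t ht, fun h u hu => h.trans (hmin u hu)⟩

/-- If the coordinate of some `r ∈ τ` did not vanish, the point would lie in the chart of `c.erase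
r`, which does not contain `τ`. In coordinates, the closure is a coordinate subspace. -/
lemma mem_orbitClosure_iff (h : IsToric F X s ι) {c : Finset (Fin 7)} (hc : c ∈ F)
    (x : chart (cone c)) (τ : Finset (Fin 7)) : ι (facet hc) x ∈ orbitClosure ι τ ↔
      τ ⊆ c ∧ ∀ r (hr : r ∈ c), r ∈ τ →
        Vanishes (chi (dualVec_mem (h.unimodular c hc) subset_rfl hr)) x := by
  have hu := h.unimodular c hc
  constructor
  · refine fun hx => ⟨hx (facet hc) ⟨x, rfl⟩, fun r hr hrτ => by_contra fun hv => ?_⟩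
    have h1 : x ∈ Set.range (chartMap (cone_mono (Finset.erase_subset r c))) := by
      rw [mem_range_chartMap_iff hu subset_rfl (Finset.erase_subset r c)]
      intro r' hr' _ hrr
      obtain rfl : r' = r := by
        by_contra hne
        exact hrr (Finset.mem_erase.2 ⟨hne, hr'⟩)
      exact hv
    have h2 := hx ⟨c.erase r, c, hc, Finset.erase_subset _ _⟩
      ((h.mem_range_iff (u := facet hc) (Finset.erase_subset r c)).2 h1) hrτ
    exact Finset.notMem_erase r c h2
  · rintro ⟨hτ, hv⟩ t ht r hr
    by_contra hrt
    have h1 := h.inter (facet hc) t _ ⟨x, rfl⟩ ht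
    rw [h.mem_range_iff (u := facet hc) Finset.inter_subset_left] at h1
    have h2 := (mem_range_chartMap_iff hu subset_rfl Finset.inter_subset_left).1 h1 r (hτ hr) (hτ hr)
      fun h3 => hrt (Finset.mem_inter.1 h3).2
    exact h2 (hv r (hτ hr) hr)

/-- Take the point with coordinates 0 at the rays of `τ` and 1 at the others, as the kernel of an
evaluation into ℂ. -/
lemma exists_vanishes_iff {c : Finset (Fin 7)} (hc : Unimodular c) (τ : Finset (Fin 7)) :
    ∃ x : chart (cone c), ∀ r (hr : r ∈ c),
      Vanishes (chi (dualVec_mem hc subset_rfl hr)) x ↔ r ∈ τ := by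
  classical
  let f := chartLift c ∅ (B := ℂ) (fun r => if r ∈ τ then 0 else 1) 1
  refine ⟨(⟨RingHom.ker f.toRingHom, RingHom.ker_isPrime _⟩ : PrimeSpectrum (chartRing (cone c))),
    fun r hr => ?_⟩
  change f (chi _) = 0 ↔ _
  rw [chartLift_chi_dualVec hc _ _ hr]
  split_ifs with h <;> simp [h]

/-- Every face is the face of an orbit. -/
lemma exists_mem_orbit (h : IsToric F X s ι) (τ : faces F) :
    ∃ x ∈ Set.range (ι τ), ∀ u : faces F, x ∈ Set.range (ι u) → τ.1 ⊆ u.1 := by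
  obtain ⟨c, hc, hτ⟩ := τ.2
  have hu := h.unimodular c hc
  obtain ⟨x, hx⟩ := exists_vanishes_iff hu τ.1
  refine ⟨ι (facet hc) x, ?_, (h.mem_orbitClosure_iff hc x τ.1).2 ⟨hτ, fun r hr => (hx r hr).2⟩⟩
  rw [h.mem_range_iff (u := facet hc) hτ]
  exact (mem_range_chartMap_iff hu subset_rfl hτ).2 fun r hr _ hrt => mt (hx r hr).1 hrt

/-- A character that does not vanish at a point is trivial on the cone of its orbit. -/
lemma dotProduct_eq_zero_of_orbit (h : IsToric F X s ι) {t : faces F} {z : chart (cone t.1)}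
    (hmin : ∀ u : faces F, ι t z ∈ Set.range (ι u) → t.1 ⊆ u.1) {m : Fin 3 → ℤ}
    (hm : m ∈ dualMonoid (cone t.1)) (hz : ¬ Vanishes (chi hm) z) :
    ∀ r ∈ t.1, m ⬝ᵥ rho r = 0 := by
  intro r hr
  obtain ⟨c, hc, htc⟩ := t.2
  have huc := h.unimodular c hc
  by_contra hne
  refine hz ?_
  have hpos : 0 < m ⬝ᵥ rho r := lt_of_le_of_ne (mem_dualMonoid_cone.1 hm r hr) (Ne.symm hne)
  -- As `m` is a positive integer on ρ_r, the coordinate of `r` divides χᵐ. That coordinate vanishes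
  -- at the point, since otherwise the chart of a smaller face would contain it.
  have hsub : m - dualVec c r ∈ dualMonoid (cone t.1) := mem_dualMonoid_cone.2 fun q hq => by
    rw [sub_dotProduct, huc.dual r (htc hr) q (htc hq)]
    have := mem_dualMonoid_cone.1 hm q hq
    split_ifs with e
    · subst e
      omega
    · omega
  have hd := dualVec_mem huc htc (htc hr)
  rw [← chi_congr (h := add_mem hd hsub) (add_sub_cancel _ _), chi_add hd hsub, vanishes_mul]
  left
  by_contra hv
  have h3 : z ∈ Set.range (chartMap (cone_mono (Finset.erase_subset r t.1))) := by
    refine (mem_range_chartMap_iff huc htc (Finset.erase_subset r t.1)).2 ?_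
    intro r' hr' hrt hrr
    obtain rfl : r' = r := by
      by_contra hne
      exact hrr (Finset.mem_erase.2 ⟨hne, hrt⟩)
    exact hv
  have h4 := hmin ⟨t.1.erase r, faces_mono t.2 (Finset.erase_subset _ _)⟩
    ((h.mem_range_iff (Finset.erase_subset r t.1)).2 h3) hr
  exact Finset.notMem_erase r _ h4

end IsToric

/-! ### Toric morphisms of star subdivisions -/

/-- The smallest face containing the image of a face of the star subdivision. -/
def carrier (a b n : Fin 7) (s : Finset (Fin 7)) : Finset (Fin 7) :=
  if n ∈ s then insert a (insert b (s.erase n)) else s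

/-- The complex has a star subdivision along the edge `{a, b}` with new vertex `n`. -/
structure IsSubdivision (F F' : Finset (Finset (Fin 7))) (a b n : Fin 7) : Prop where
  eq : F' = subdivide F a b n
  ne : a ≠ b
  notMem : ∀ c ∈ F, n ∉ c
  sum : rho n = rho a + rho b

variable {a b n : Fin 7}

lemma carrier_mono {s t : Finset (Fin 7)} (h : s ⊆ t) : carrier a b n s ⊆ carrier a b n t := by
  unfold carrier
  split_ifs with h1 h2 h2
  · exact Finset.insert_subset_insert _ (Finset.insert_subset_insert _ (Finset.erase_subset_erase _ h))
  · exact absurd (h h1) h2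
  · intro r hr
    have : r ≠ n := fun e => h1 (e ▸ hr)
    simp [this, h hr]
  · exact h

lemma cone_le_carrier (h : rho n = rho a + rho b) (s : Finset (Fin 7)) :
    cone s ≤ cone (carrier a b n s) := by
  refine cone_le fun r hr => ?_
  unfold carrier
  split_ifs with hn
  · by_cases hrn : r = n
    · have : realVec (rho n) = realVec (rho a) + realVec (rho b) := by
        rw [h]
        ext
        simp [realVec]
      rw [hrn, this]
      exact add_mem (rho_mem_cone (by simp)) (rho_mem_cone (by simp))
    · exact rho_mem_cone (by simp [hrn, hr])
  · exact rho_mem_cone hr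

lemma IsSubdivision.carrier_mem {F F' : Finset (Finset (Fin 7))} (h : IsSubdivision F F' a b n)
    {s : Finset (Fin 7)} (hs : s ∈ faces F') : carrier a b n s ∈ faces F := by
  obtain ⟨c', hc', hsc⟩ := hs
  rw [h.eq] at hc'
  obtain ⟨c, hc, hcc⟩ := Finset.mem_biUnion.1 hc'
  refine ⟨c, hc, (carrier_mono hsc).trans ?_⟩
  have hn := h.notMem c hc
  split_ifs at hcc with hab
  · rcases Finset.mem_insert.1 hcc with rfl | hcc
    · intro r
      simp only [carrier, Finset.mem_insert_self, if_true, Finset.mem_insert, Finset.mem_erase]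
      rintro (rfl | rfl | ⟨h1, h2 | h2⟩)
      exacts [hab.1, hab.2, absurd h2 h1, h2.2]
    · rw [Finset.mem_singleton.1 hcc]
      intro r
      simp only [carrier, Finset.mem_insert_self, if_true, Finset.mem_insert, Finset.mem_erase]
      rintro (rfl | rfl | ⟨h1, h2 | h2⟩)
      exacts [hab.1, hab.2, absurd h2 h1, h2.2]
  · rw [Finset.mem_singleton.1 hcc, carrier, if_neg hn]

/-- The carrier as a face. -/
abbrev IsSubdivision.carrierFace {F F' : Finset (Finset (Fin 7))} (h : IsSubdivision F F' a b n)
    (t : faces F') : faces F := ⟨carrier a b n t.1, h.carrier_mem t.2⟩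

/-- `p` is the toric morphism of a star subdivision. -/
structure IsToricMap {F F' : Finset (Finset (Fin 7))} {X X' : Scheme.{0}}
    (h : IsSubdivision F F' a b n) (ι : ∀ t : faces F, chart (cone t.1) ⟶ X)
    (ι' : ∀ t : faces F', chart (cone t.1) ⟶ X') (p : X' ⟶ X) : Prop where
  comp : ∀ t : faces F', ι' t ≫ p = chartMap (cone_le_carrier h.sum t.1) ≫ ι (h.carrierFace t)

lemma exists_isToricMap {F F' : Finset (Finset (Fin 7))} (hF : IsSubdivision F F' a b n)
    (hF' : ∀ c ∈ F', Unimodular c) {X : Scheme.{0}} {s : X ⟶ SpecC}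
    {ι : ∀ t : faces F, chart (cone t.1) ⟶ X} (h : IsToric F X s ι) :
    ∃ (X' : Scheme.{0}) (p : X' ⟶ X) (ι' : ∀ t : faces F', chart (cone t.1) ⟶ X'),
      IsToric F' X' (p ≫ s) ι' ∧ IsToricMap hF ι ι' p := by
  obtain ⟨X', s', ι', h', hdesc⟩ := exists_isToric hF'
  obtain ⟨p, hp⟩ := hdesc X (fun t => chartMap (cone_le_carrier hF.sum t.1) ≫ ι (hF.carrierFace t)) <| by
    intro t u htu
    have h1 := h.compatible (hF.carrierFace t) (hF.carrierFace u) (carrier_mono htu)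
    rw [← h1, chartMap_comp_assoc]
    exact (chartMap_comp_assoc _ _ _).symm
  have hs : p ≫ s = s' := h'.hom_ext fun c hc => by
    rw [← Category.assoc, hp, h'.structureMap, Category.assoc, h.structureMap]
    exact chartMap_chartToSpecC _
  exact ⟨X', p, ι', hs ▸ h', ⟨hp⟩⟩

namespace IsToricMap

variable {F F' : Finset (Finset (Fin 7))} {hF : IsSubdivision F F' a b n} {X X' : Scheme.{0}}
  {s : X ⟶ SpecC} {s' : X' ⟶ SpecC} {ι : ∀ t : faces F, chart (cone t.1) ⟶ X}
  {ι' : ∀ t : faces F', chart (cone t.1) ⟶ X'} {p : X' ⟶ X}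

/-- The orbit of the image of a point. -/
lemma orbit_image (hp : IsToricMap hF ι ι' p) (h : IsToric F X s ι) (h' : IsToric F' X' s' ι')
    {x : X'} {t : faces F'} (ht : x ∈ Set.range (ι' t))
    (hmin : ∀ u : faces F', x ∈ Set.range (ι' u) → t.1 ⊆ u.1) :
    p x ∈ Set.range (ι (hF.carrierFace t)) ∧
      ∀ u : faces F, p x ∈ Set.range (ι u) → (hF.carrierFace t).1 ⊆ u.1 := by
  obtain ⟨z, rfl⟩ := ht
  have hz : p (ι' t z) = ι (hF.carrierFace t) (chartMap (cone_le_carrier hF.sum t.1) z) := by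
    have := congrArg (fun f => f z) (hp.comp t)
    exact this
  rw [hz]
  refine ⟨⟨_, rfl⟩, fun u hu => ?_⟩
  have h1 := h.inter _ u _ ⟨_, rfl⟩ hu
  rw [h.mem_range_iff Finset.inter_subset_left] at h1
  obtain ⟨c, hc, htc⟩ := (hF.carrierFace t).2
  have huc := h.unimodular c hc
  rw [mem_range_chartMap_iff_faceForm huc htc Finset.inter_subset_left] at h1
  -- On the carrier, this form vanishes exactly at the rays of `u`. Its character is nonzero at the
  -- image of the point, so its pullback is nonzero at `z`, and the form is orthogonal to all of
  -- `t`.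
  set m := faceForm c ((hF.carrierFace t).1 ∩ u.1) with hm
  have hm0 : m ∈ dualMonoid (cone (hF.carrierFace t).1) := faceForm_mem huc htc _
  have hmt : m ∈ dualMonoid (cone t.1) := dualMonoid_anti (cone_le_carrier hF.sum t.1) hm0
  have h2 : ¬ Vanishes (chi hmt) z := by
    rw [vanishes_chartMap, chartHom_chi] at h1
    exact h1
  have hzero := h'.dotProduct_eq_zero_of_orbit hmin hmt h2
  have hmem : ∀ r ∈ (hF.carrierFace t).1, m ⬝ᵥ rho r = 0 → r ∈ u.1 := by
    intro r hr h0
    rw [hm, faceForm_dotProduct huc _ (htc hr)] at h0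
    split_ifs at h0 with h3
    · exact (Finset.mem_inter.1 h3).2
    · exact absurd h0 one_ne_zero
  intro r hr
  refine hmem r hr ?_
  have hnn := mem_dualMonoid_cone.1 hm0
  have hr' : r ∈ carrier a b n t.1 := hr
  -- If the new ray belongs to `t`, the values at `a` and `b` are nonnegative with sum the value at
  -- `n`, which is zero; so both vanish.
  by_cases hn : n ∈ t.1
  · have h5 := hzero n hn
    rw [hF.sum, dotProduct_add] at h5
    have ha := hnn a (by change a ∈ carrier a b n t.1; simp [carrier, hn])
    have hb := hnn b (by change b ∈ carrier a b n t.1; simp [carrier, hn])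
    simp only [carrier, hn, if_true, Finset.mem_insert, Finset.mem_erase] at hr'
    rcases hr' with rfl | rfl | hr'
    · omega
    · omega
    · exact hzero r hr'.2
  · rw [carrier, if_neg hn] at hr'
    exact hzero r hr'

lemma mem_preimage_range_iff (hp : IsToricMap hF ι ι' p) (h : IsToric F X s ι)
    (h' : IsToric F' X' s' ι') (u : faces F) (x : X') : p x ∈ Set.range (ι u) ↔
      ∃ t : faces F', carrier a b n t.1 ⊆ u.1 ∧ x ∈ Set.range (ι' t) := by
  constructor
  · intro hx
    obtain ⟨t, ht, hmin⟩ := h'.exists_orbit x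
    exact ⟨t, (hp.orbit_image h h' ht hmin).2 u hx, ht⟩
  · rintro ⟨t, ht, z, rfl⟩
    refine h.range_subset (t := hF.carrierFace t) ht
      ⟨chartMap (cone_le_carrier hF.sum t.1) z, ?_⟩
    exact (congrArg (fun f => f z) (hp.comp t)).symm

end IsToricMap

end

/-! ### Evaluation of homogeneous coordinates and morphisms to projective space. -/

section

/-! ### Morphisms to projective spaces -/

variable {N : ℕ}

/-- The ring of the standard affine chart of projective space. -/
abbrev AwayX (i : Fin (N + 1)) : Type :=
  HomogeneousLocalization.Away (stdGrading N) (MvPolynomial.X i)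

lemma X_mem_stdGrading (i : Fin (N + 1)) :
    (MvPolynomial.X i : MvPolynomial (Fin (N + 1)) ℂ) ∈ stdGrading N 1 :=
  MvPolynomial.isHomogeneous_X ℂ i

/-- The constants in the ring of the standard affine chart. -/
def awayConst (i : Fin (N + 1)) : ℂ →+* AwayX i :=
  (HomogeneousLocalization.fromZeroRingHom (stdGrading N) _).comp (algebraMap ℂ (stdGrading N 0))

instance (i : Fin (N + 1)) : Algebra ℂ (AwayX i) := (awayConst i).toAlgebra

/-- The function `y_k / y_i`. -/
def awayRatio (i k : Fin (N + 1)) : AwayX i :=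
  HomogeneousLocalization.Away.mk _ (X_mem_stdGrading i) 1 (MvPolynomial.X k) (X_mem_stdGrading k)

/-- The standard affine chart of projective space. -/
def awayEmb (i : Fin (N + 1)) : Spec (CommRingCat.of (AwayX i)) ⟶ projSpace N :=
  Proj.awayι (stdGrading N) (MvPolynomial.X i) (X_mem_stdGrading i) Nat.one_pos

instance (i : Fin (N + 1)) : IsOpenImmersion (awayEmb i) :=
  inferInstanceAs (IsOpenImmersion
    (Proj.awayι (stdGrading N) (MvPolynomial.X i) (X_mem_stdGrading i) Nat.one_pos))

/-- The open subset `y_i ≠ 0`. -/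
def coordOpen (i : Fin (N + 1)) : (projSpace N).Opens :=
  Proj.basicOpen (stdGrading N) (MvPolynomial.X i)

lemma opensRange_awayEmb (i : Fin (N + 1)) : (awayEmb i).opensRange = coordOpen i :=
  Proj.opensRange_awayι _ _ _ _

lemma mem_coordLocus_iff {I : Set (Fin (N + 1))} {x : projSpace N} :
    x ∈ coordLocus I ↔ ∀ i ∈ I, x ∉ coordOpen i := by
  constructor
  · intro h i hi h'
    exact h' (h ⟨i, hi, rfl⟩)
  · rintro h _ ⟨i, hi, rfl⟩
    by_contra h'
    exact h i hi h'

lemma adjoin_X_eq_top : Algebra.adjoin (stdGrading N 0)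
    (Set.range (MvPolynomial.X : Fin (N + 1) → MvPolynomial (Fin (N + 1)) ℂ)) = ⊤ := by
  rw [eq_top_iff]
  rintro p -
  induction p using MvPolynomial.induction_on with
  | C a => exact Subalgebra.algebraMap_mem _ (algebraMap ℂ (stdGrading N 0) a)
  | add p q hp hq => exact add_mem hp hq
  | mul_X p i hp => exact mul_mem hp (Algebra.subset_adjoin ⟨i, rfl⟩)

lemma iSup_coordOpen : ⨆ i, coordOpen (N := N) i = ⊤ :=
  Proj.iSup_basicOpen_eq_top' (stdGrading N) MvPolynomial.X
    (fun i => ⟨1, MvPolynomial.isHomogeneous_X ℂ i⟩) adjoin_X_eq_top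

lemma exists_mem_coordOpen (x : projSpace N) : ∃ i, x ∈ coordOpen i := by
  have h : x ∈ ⨆ i, coordOpen (N := N) i := by
    rw [iSup_coordOpen]
    trivial
  exact TopologicalSpace.Opens.mem_iSup.1 h

/-- The cover of projective space by the standard affine charts. -/
def projCover (N : ℕ) : (projSpace N).OpenCover where
  I₀ := Fin (N + 1)
  X i := Spec (CommRingCat.of (AwayX i))
  f i := awayEmb i
  mem₀ := by
    rw [Scheme.presieve₀_mem_precoverage_iff]
    refine ⟨fun x => ?_, fun i => inferInstance⟩
    obtain ⟨i, hi⟩ := exists_mem_coordOpen x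
    rw [← opensRange_awayEmb] at hi
    exact ⟨i, hi⟩

lemma aeval_mul_of_isHomogeneous {B : Type*} [CommRing B] [Algebra ℂ B] {n : ℕ}
    {f : MvPolynomial (Fin (N + 1)) ℂ} (hf : f.IsHomogeneous n) (u : B) (b : Fin (N + 1) → B) :
    MvPolynomial.aeval (fun k => u * b k) f = u ^ n * MvPolynomial.aeval b f := by
  rw [MvPolynomial.aeval_def, MvPolynomial.aeval_def, MvPolynomial.eval₂_eq', MvPolynomial.eval₂_eq',
    Finset.mul_sum]
  refine Finset.sum_congr rfl fun d hd => ?_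
  have h : ∑ k, d k = n := by
    have := hf (MvPolynomial.mem_support_iff.1 hd)
    rw [Finsupp.weight_apply, Finsupp.sum_fintype _ _ (by simp)] at this
    simpa using this
  simp only [mul_pow, Finset.prod_mul_distrib]
  rw [Finset.prod_pow_eq_pow_sum, h]
  ring

lemma val_awayRatio (i k : Fin (N + 1)) : (awayRatio i k).val *
      algebraMap (MvPolynomial (Fin (N + 1)) ℂ) (Localization.Away (MvPolynomial.X i))
        (MvPolynomial.X i) =
    algebraMap (MvPolynomial (Fin (N + 1)) ℂ) (Localization.Away (MvPolynomial.X i))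
      (MvPolynomial.X k) := by
  rw [awayRatio, HomogeneousLocalization.Away.val_mk, ← Localization.mk_one_eq_algebraMap,
    ← Localization.mk_one_eq_algebraMap, Localization.mk_mul, Localization.mk_eq_mk_iff,
    Localization.r_iff_exists]
  exact ⟨1, by simp [mul_comm]⟩

lemma val_algebraMap (i : Fin (N + 1)) (a : ℂ) : (algebraMap ℂ (AwayX i) a).val =
    algebraMap ℂ (Localization.Away (MvPolynomial.X i)) a := by
  rfl

/-- A fraction f / X_iⁿ of degree zero is f evaluated at the ratios X_k / X_i. Hence homomorphisms
from the chart ring are determined by constants and ratios. -/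
lemma away_eq_aeval (i : Fin (N + 1)) (n : ℕ) (f : MvPolynomial (Fin (N + 1)) ℂ)
    (hf : f ∈ stdGrading N (n • 1)) :
    HomogeneousLocalization.Away.mk _ (X_mem_stdGrading i) n f hf =
      MvPolynomial.aeval (awayRatio i) f := by
  let φ : AwayX i →ₐ[ℂ] Localization.Away (MvPolynomial.X i : MvPolynomial (Fin (N + 1)) ℂ) :=
    { algebraMap (AwayX i) _ with commutes' := val_algebraMap i }
  have hφ : ∀ x, φ x = x.val := fun _ => rfl
  apply HomogeneousLocalization.val_injective
  have hu : IsUnit (algebraMap (MvPolynomial (Fin (N + 1)) ℂ)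
      (Localization.Away (MvPolynomial.X i)) (MvPolynomial.X i)) :=
    IsLocalization.Away.algebraMap_isUnit (S := Localization.Away
      (MvPolynomial.X i : MvPolynomial (Fin (N + 1)) ℂ)) (MvPolynomial.X i)
  refine (hu.pow n).mul_left_cancel ?_
  have hn : f.IsHomogeneous n := by simpa using hf
  rw [← hφ (MvPolynomial.aeval _ f), MvPolynomial.comp_aeval_apply,
    ← aeval_mul_of_isHomogeneous hn]
  have : (fun k => algebraMap (MvPolynomial (Fin (N + 1)) ℂ)
      (Localization.Away (MvPolynomial.X i)) (MvPolynomial.X i) * φ (awayRatio i k)) =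
      fun k => algebraMap (MvPolynomial (Fin (N + 1)) ℂ) _ (MvPolynomial.X k) := by
    ext k
    rw [mul_comm, hφ, val_awayRatio]
  rw [this]
  have h2 := MvPolynomial.comp_aeval_apply (R := ℂ) (MvPolynomial.X (R := ℂ) (σ := Fin (N + 1)))
    (IsScalarTower.toAlgHom ℂ (MvPolynomial (Fin (N + 1)) ℂ)
      (Localization.Away (MvPolynomial.X i : MvPolynomial (Fin (N + 1)) ℂ))) f
  rw [MvPolynomial.aeval_X_left_apply] at h2
  refine Eq.trans ?_ h2
  rw [HomogeneousLocalization.Away.val_mk, ← map_pow, ← Localization.mk_one_eq_algebraMap,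
    Localization.mk_mul]
  change _ = algebraMap _ _ f
  rw [← Localization.mk_one_eq_algebraMap, Localization.mk_eq_mk_iff,
    Localization.r_iff_exists]
  exact ⟨1, by simp⟩

lemma awayX_ringHom_ext {i : Fin (N + 1)} {B : Type*} [CommRing B] {f g : AwayX i →+* B}
    (h : ∀ a, f (algebraMap ℂ _ a) = g (algebraMap ℂ _ a))
    (h' : ∀ k, f (awayRatio i k) = g (awayRatio i k)) : f = g := by
  have key : f.comp (MvPolynomial.aeval (R := ℂ) (awayRatio i)).toRingHom =
      g.comp (MvPolynomial.aeval (R := ℂ) (awayRatio i)).toRingHom := by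
    apply MvPolynomial.ringHom_ext
    · intro a
      simpa using h a
    · intro k
      simpa using h' k
  ext x
  obtain ⟨n, a, ha, rfl⟩ :=
    HomogeneousLocalization.Away.mk_surjective _ (X_mem_stdGrading i) x
  rw [away_eq_aeval]
  exact RingHom.congr_fun key a

/-- Evaluation of the functions on a standard affine chart at homogeneous coordinates. -/
def awayEval {B : Type*} [CommRing B] [Algebra ℂ B] (b : Fin (N + 1) → B) (i : Fin (N + 1))
    (hi : IsUnit (b i)) : AwayX i →+* B :=
  (Localization.awayLift (MvPolynomial.aeval b).toRingHom (MvPolynomial.X i) (by simpa)).comp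
    (algebraMap (AwayX i) (Localization.Away (MvPolynomial.X i : MvPolynomial (Fin (N + 1)) ℂ)))

lemma awayEval_algebraMap {B : Type*} [CommRing B] [Algebra ℂ B] (b : Fin (N + 1) → B)
    (i : Fin (N + 1)) (hi : IsUnit (b i)) (a : ℂ) :
    awayEval b i hi (algebraMap ℂ _ a) = algebraMap ℂ B a := by
  change Localization.awayLift (MvPolynomial.aeval b).toRingHom (MvPolynomial.X i) (by simpa)
    (algebraMap ℂ (AwayX i) a).val = _
  rw [val_algebraMap, IsScalarTower.algebraMap_apply ℂ (MvPolynomial (Fin (N + 1)) ℂ)]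
  refine (IsLocalization.Away.lift_eq (MvPolynomial.X i) (g := (MvPolynomial.aeval b).toRingHom)
    _ _).trans ?_
  simp

lemma awayEval_ratio {B : Type*} [CommRing B] [Algebra ℂ B] (b : Fin (N + 1) → B)
    (i : Fin (N + 1)) (hi : IsUnit (b i)) (k : Fin (N + 1)) :
    awayEval b i hi (awayRatio i k) * b i = b k := by
  have h1 : ∀ j, Localization.awayLift (MvPolynomial.aeval b).toRingHom (MvPolynomial.X i)
      (by simpa) (algebraMap _ _ (MvPolynomial.X j : MvPolynomial (Fin (N + 1)) ℂ)) = b j := fun j =>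
    (IsLocalization.Away.lift_eq (MvPolynomial.X i) (g := (MvPolynomial.aeval b).toRingHom)
      _ _).trans (by simp)
  have h2 := congrArg (Localization.awayLift (MvPolynomial.aeval b).toRingHom (MvPolynomial.X i)
      (by simpa)) (val_awayRatio i k)
  rw [map_mul, h1, h1] at h2
  exact h2

lemma awayEval_unique {B : Type*} [CommRing B] [Algebra ℂ B] {b : Fin (N + 1) → B}
    {i : Fin (N + 1)} (hi : IsUnit (b i)) {f : AwayX i →+* B}
    (h : ∀ a, f (algebraMap ℂ _ a) = algebraMap ℂ B a)
    (h' : ∀ k, f (awayRatio i k) * b i = b k) : f = awayEval b i hi :=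
  awayX_ringHom_ext (fun a => (h a).trans (awayEval_algebraMap b i hi a).symm) fun k =>
    hi.mul_right_cancel ((h' k).trans (awayEval_ratio b i hi k).symm)

/-- The morphism to projective space given by homogeneous coordinates. -/
def toProj {B : Type} [CommRing B] [Algebra ℂ B] (b : Fin (N + 1) → B) (i : Fin (N + 1))
    (hi : IsUnit (b i)) : Spec (CommRingCat.of B) ⟶ projSpace N :=
  Spec.map (CommRingCat.ofHom (awayEval b i hi)) ≫ awayEmb i

lemma torusToProjSpace_eq (n : ℕ) : torusToProjSpace n =
    toProj (Fin.cons 1 fun i : Fin n => AddMonoidAlgebra.single (Pi.single i (1 : ℤ)) (1 : ℂ)) 0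
      (by simp) := rfl

lemma map_toProj {B B' : Type} [CommRing B] [Algebra ℂ B] [CommRing B'] [Algebra ℂ B']
    (φ : B →ₐ[ℂ] B') (b : Fin (N + 1) → B) (i : Fin (N + 1)) (hi : IsUnit (b i)) :
    Spec.map (CommRingCat.ofHom φ.toRingHom) ≫ toProj b i hi =
      toProj (fun k => φ (b k)) i (hi.map φ) := by
  rw [toProj, toProj, ← Category.assoc, ← Spec.map_comp, ← CommRingCat.ofHom_comp]
  congr 3
  refine awayEval_unique (b := fun k => φ (b k)) (hi.map φ) (fun a => ?_) fun k => ?_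
  · change φ (awayEval b i hi _) = _
    rw [awayEval_algebraMap, AlgHom.commutes]
  · change φ (awayEval b i hi _) * _ = _
    rw [← map_mul, awayEval_ratio]

lemma awayEmb_structure (i : Fin (N + 1)) : awayEmb i ≫ projSpaceToSpecC N =
    Spec.map (CommRingCat.ofHom (algebraMap ℂ (AwayX i))) :=
  (Proj.awayι_toSpecZero_assoc (stdGrading N) _ (X_mem_stdGrading i) Nat.one_pos _).trans
    (Spec.map_comp _ _).symm

lemma toProj_structure {B : Type} [CommRing B] [Algebra ℂ B] (b : Fin (N + 1) → B)
    (i : Fin (N + 1)) (hi : IsUnit (b i)) : toProj b i hi ≫ projSpaceToSpecC N =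
      Spec.map (CommRingCat.ofHom (algebraMap ℂ B)) := by
  rw [toProj, Category.assoc, awayEmb_structure, ← Spec.map_comp, ← CommRingCat.ofHom_comp]
  congr 2
  ext a
  exact awayEval_algebraMap b i hi a

end

/-! ### Independence of the choice of chart, and localization on the target. -/

section

variable {N : ℕ}

lemma awayEval_smul {B : Type*} [CommRing B] [Algebra ℂ B] (b : Fin (N + 1) → B)
    {u : B} (hu : IsUnit u) (i : Fin (N + 1)) (hi : IsUnit (b i)) :
    awayEval b i hi = awayEval (fun k => u * b k) i (hu.mul hi) :=
  awayEval_unique (b := fun k => u * b k) (hu.mul hi) (awayEval_algebraMap b i hi) fun k => by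
    rw [mul_left_comm, awayEval_ratio]

lemma toProj_smul {B : Type} [CommRing B] [Algebra ℂ B] (b : Fin (N + 1) → B)
    {u : B} (hu : IsUnit u) (i : Fin (N + 1)) (hi : IsUnit (b i)) :
    toProj b i hi = toProj (fun k => u * b k) i (hu.mul hi) := by
  rw [toProj, toProj, awayEval_smul b hu]

/-- Evaluation of homogeneous fractions at homogeneous coordinates. -/
def fractionEval {B : Type*} [CommRing B] [Algebra ℂ B] (b : Fin (N + 1) → B)
    (f : MvPolynomial (Fin (N + 1)) ℂ) (hf : IsUnit ((MvPolynomial.aeval b).toRingHom f)) :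
    HomogeneousLocalization.Away (stdGrading N) f →+* B :=
  (Localization.awayLift (MvPolynomial.aeval b).toRingHom f hf).comp
    (algebraMap (HomogeneousLocalization.Away (stdGrading N) f) (Localization.Away f))

lemma fractionEval_comp_awayMap {B : Type*} [CommRing B] [Algebra ℂ B] (b : Fin (N + 1) → B)
    {f g x : MvPolynomial (Fin (N + 1)) ℂ} {m : ℕ} (hg : g ∈ stdGrading N m) (hx : x = f * g)
    (hb : IsUnit ((MvPolynomial.aeval b).toRingHom x))
    (hf : IsUnit ((MvPolynomial.aeval b).toRingHom f)) :
    (fractionEval b x hb).comp (HomogeneousLocalization.awayMap (stdGrading N) hg hx) =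
      fractionEval b f hf := by
  have key : (Localization.awayLift (MvPolynomial.aeval b).toRingHom x hb).comp
      (Localization.awayLift (algebraMap _ (Localization.Away x)) f
        (isUnit_of_dvd_unit (map_dvd _ ⟨_, hx⟩) (IsLocalization.Away.algebraMap_isUnit x))) =
      Localization.awayLift (MvPolynomial.aeval b).toRingHom f hf := by
    apply IsLocalization.ringHom_ext (M := Submonoid.powers f)
    refine RingHom.ext fun p => ?_
    simp only [RingHom.comp_apply]
    rw [Localization.awayLift, Localization.awayLift, Localization.awayLift,
      IsLocalization.Away.lift_eq, IsLocalization.Away.lift_eq, IsLocalization.Away.lift_eq]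
  ext z
  change Localization.awayLift _ _ hb
    (HomogeneousLocalization.awayMap (stdGrading N) hg hx z).val = _
  rw [HomogeneousLocalization.val_awayMap]
  exact RingHom.congr_fun key z.val

/-- Both morphisms factor through the open subset where the product of the two coordinates is
nonzero, by the same evaluation of homogeneous fractions. -/
lemma toProj_index {B : Type} [CommRing B] [Algebra ℂ B] (b : Fin (N + 1) → B)
    (i j : Fin (N + 1)) (hi : IsUnit (b i)) (hj : IsUnit (b j)) :
    toProj b i hi = toProj b j hj := by
  have hij : IsUnit ((MvPolynomial.aeval b).toRingHom
      (MvPolynomial.X i * MvPolynomial.X j : MvPolynomial (Fin (N + 1)) ℂ)) := by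
    simpa using ⟨hi, hj⟩
  have h : ∀ (k l : Fin (N + 1)) (hk : IsUnit (b k))
      (hx : (MvPolynomial.X i * MvPolynomial.X j : MvPolynomial (Fin (N + 1)) ℂ) =
        MvPolynomial.X k * MvPolynomial.X l),
      toProj b k hk = Spec.map (CommRingCat.ofHom (fractionEval b _ hij)) ≫
        Proj.awayι (stdGrading N) (MvPolynomial.X i * MvPolynomial.X j)
          (SetLike.mul_mem_graded (X_mem_stdGrading i) (X_mem_stdGrading j)) (by simp) := by
    intro k l hk hx
    have h1 := Proj.SpecMap_awayMap_awayι (stdGrading N) (X_mem_stdGrading k) Nat.one_pos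
      (X_mem_stdGrading l) hx
    have h2 := fractionEval_comp_awayMap b (X_mem_stdGrading l) hx hij (by simpa using hk)
    refine Eq.trans ?_ (congrArg (fun f => Spec.map (CommRingCat.ofHom
      (fractionEval b _ hij)) ≫ f) h1)
    refine Eq.trans ?_ (Category.assoc _ _ _)
    refine congrArg (fun f => f ≫ awayEmb k) (Eq.trans ?_ (Spec.map_comp _ _))
    exact congrArg (fun f => Spec.map (CommRingCat.ofHom f)) h2.symm
  rw [h i j hi rfl, h j i hj (mul_comm _ _)]

lemma toProj_mem_coordOpen {B : Type} [CommRing B] [Algebra ℂ B] (b : Fin (N + 1) → B)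
    (i : Fin (N + 1)) (hi : IsUnit (b i)) (k : Fin (N + 1))
    (y : PrimeSpectrum B) : toProj b i hi y ∈ coordOpen k ↔ b k ∉ y.asIdeal := by
  have h1 : awayEmb i ⁻¹ᵁ coordOpen k = PrimeSpectrum.basicOpen
      (HomogeneousLocalization.Away.isLocalizationElem (X_mem_stdGrading i) (X_mem_stdGrading k)) :=
    Proj.awayι_preimage_basicOpen (stdGrading N) (X_mem_stdGrading i) Nat.one_pos
      (X_mem_stdGrading k) Nat.one_pos
  have h2 : HomogeneousLocalization.Away.isLocalizationElem (X_mem_stdGrading i)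
      (X_mem_stdGrading k) = awayRatio i k := by
    ext
    rw [HomogeneousLocalization.Away.isLocalizationElem, awayRatio]
    simp [HomogeneousLocalization.Away.val_mk]
  have h3 : toProj b i hi y ∈ coordOpen k ↔ awayEval b i hi (awayRatio i k) ∉ y.asIdeal := by
    rw [h2] at h1
    change Spec.map (CommRingCat.ofHom (awayEval b i hi)) y ∈ awayEmb i ⁻¹ᵁ coordOpen k ↔ _
    rw [h1]
    rfl
  rw [h3, ← awayEval_ratio b i hi k, not_iff_not]
  exact ⟨fun h => y.asIdeal.mul_mem_right _ h, fun h => (y.isPrime.mem_or_mem h).resolve_right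
    fun h' => y.isPrime.ne_top (Ideal.eq_top_of_isUnit_mem _ h' hi)⟩

/-- When the chart `e` contains the whole preimage of `y_i ≠ 0`, the morphism `p` is over that
affine open the spectrum of one evaluation homomorphism. -/
lemma isPullback_toProj {X : Scheme.{0}} {p : X ⟶ projSpace N} {B : Type} [CommRing B]
    [Algebra ℂ B] {e : Spec (CommRingCat.of B) ⟶ X} [IsOpenImmersion e] {b : Fin (N + 1) → B}
    {i : Fin (N + 1)} {hi : IsUnit (b i)} (h : e ≫ p = toProj b i hi)
    (h' : ∀ x, p x ∈ coordOpen i → x ∈ Set.range e) :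
    IsPullback (Spec.map (CommRingCat.ofHom (awayEval b i hi))) e (awayEmb i) p := by
  refine IsOpenImmersion.isPullback _ _ _ _ h ?_
  rw [opensRange_awayEmb]
  ext x
  refine ⟨fun hx => h' x hx, ?_⟩
  rintro ⟨y, rfl⟩
  change p (e y) ∈ coordOpen i
  have h1 : p (e y) = toProj b i hi y := congrArg (fun f => f y) h
  rw [h1]
  refine (toProj_mem_coordOpen b i hi i y).2 ?_
  exact fun h2 => y.isPrime.ne_top (Ideal.eq_top_of_isUnit_mem _ h2 hi)

/-- Any model of the fiber product over each standard chart may be used to test a property local on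
the target. -/
lemma mem_of_forall_isPullback {P : MorphismProperty Scheme.{0}} [IsZariskiLocalAtTarget P]
    {X : Scheme.{0}} {p : X ⟶ projSpace N}
    (h : ∀ i, ∃ (V : Scheme.{0}) (g : V ⟶ Spec (CommRingCat.of (AwayX i))) (e : V ⟶ X),
      IsPullback g e (awayEmb i) p ∧ P g) : P p := by
  refine IsZariskiLocalAtTarget.of_openCover (projCover N) fun i => ?_
  obtain ⟨V, g, e, hg, hP⟩ := h i
  have : (hg.flip.isoPullback).inv ≫ g = pullback.snd p (awayEmb i) := hg.flip.isoPullback_inv_snd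
  change P (pullback.snd p (awayEmb i))
  rw [← this]
  exact (P.cancel_left_of_respectsIso _ _).2 hP

end

section

/-! ### Morphisms to projective spaces given by lattice points -/

variable {N : ℕ}

/-- The lattice point `A i` is minimal on the cone spanned by `t`. -/
def IsMinimalOn (A : Fin (N + 1) → Fin 3 → ℤ) (i : Fin (N + 1)) (t : Finset (Fin 7)) : Prop :=
  ∀ k, ∀ r ∈ t, 0 ≤ (A k - A i) ⬝ᵥ rho r

/-- The vector `m` is a sum of two differences with the lattice point `A i`. -/
def IsGenerated (A : Fin (N + 1) → Fin 3 → ℤ) (i : Fin (N + 1)) (m : Fin 3 → ℤ) : Prop :=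
  ∃ k l, (A k - A i) + (A l - A i) = m

instance (A : Fin (N + 1) → Fin 3 → ℤ) (i t) : Decidable (IsMinimalOn A i t) :=
  inferInstanceAs (Decidable (∀ k, ∀ r ∈ t, 0 ≤ (A k - A i) ⬝ᵥ rho r))

instance (A : Fin (N + 1) → Fin 3 → ℤ) (i m) : Decidable (IsGenerated A i m) :=
  inferInstanceAs (Decidable (∃ k l, (A k - A i) + (A l - A i) = m))

/-- The face `τ` of `c` is the largest face on which the lattice point `A i` is minimal, and the
differences with `A i` generate the ring of the chart of `τ`. -/
def IsNormalFace (F : Finset (Finset (Fin 7))) (A : Fin (N + 1) → Fin 3 → ℤ) (i : Fin (N + 1))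
    (c τ : Finset (Fin 7)) : Prop :=
  IsMinimalOn A i τ ∧ (∀ c' ∈ F, ∀ t ∈ c'.powerset, IsMinimalOn A i t → t ⊆ τ) ∧
    (∀ r ∈ c, IsGenerated A i (dualVec c r)) ∧ ∀ r ∈ c \ τ, IsGenerated A i (-dualVec c r)

instance (F) (A : Fin (N + 1) → Fin 3 → ℤ) (i c τ) : Decidable (IsNormalFace F A i c τ) :=
  inferInstanceAs (Decidable (IsMinimalOn A i τ ∧
    (∀ c' ∈ F, ∀ t ∈ c'.powerset, IsMinimalOn A i t → t ⊆ τ) ∧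
    (∀ r ∈ c, IsGenerated A i (dualVec c r)) ∧ ∀ r ∈ c \ τ, IsGenerated A i (-dualVec c r)))

/-- The fan of the complex `F` is the normal fan of the convex hull of the lattice points `A`,
and these points generate the rings of the charts. -/
structure IsVeryAmple (F : Finset (Finset (Fin 7))) (A : Fin (N + 1) → Fin 3 → ℤ) : Prop where
  exists_minimal : ∀ c ∈ F, ∃ i, IsMinimalOn A i c
  exists_face : ∀ i, ∃ c ∈ F, ∃ τ ∈ c.powerset, IsNormalFace F A i c τ

lemma IsMinimalOn.mono {A : Fin (N + 1) → Fin 3 → ℤ} {i : Fin (N + 1)} {t u : Finset (Fin 7)}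
    (h : IsMinimalOn A i u) (htu : t ⊆ u) : IsMinimalOn A i t := fun k r hr => h k r (htu hr)

lemma IsMinimalOn.mem {A : Fin (N + 1) → Fin 3 → ℤ} {i : Fin (N + 1)} {t : Finset (Fin 7)}
    (h : IsMinimalOn A i t) (k : Fin (N + 1)) : A k - A i ∈ dualMonoid (cone t) :=
  mem_dualMonoid_cone.2 (h k)

/-- The homogeneous coordinates on a chart. -/
def chartCoord {A : Fin (N + 1) → Fin 3 → ℤ} {i : Fin (N + 1)} {t : Finset (Fin 7)}
    (h : IsMinimalOn A i t) (k : Fin (N + 1)) : chartRing (cone t) := chi (h.mem k)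

lemma chartCoord_self {A : Fin (N + 1) → Fin 3 → ℤ} {i : Fin (N + 1)} {t : Finset (Fin 7)}
    (h : IsMinimalOn A i t) : chartCoord h i = 1 :=
  chi_congr (h' := zero_mem _) (sub_self _)

lemma isUnit_chartCoord_self {A : Fin (N + 1) → Fin 3 → ℤ} {i : Fin (N + 1)} {t : Finset (Fin 7)}
    (h : IsMinimalOn A i t) : IsUnit (chartCoord h i) := by
  rw [chartCoord_self]
  exact isUnit_one

/-- The morphism of a chart to projective space given by lattice points. -/
def chartToProj {A : Fin (N + 1) → Fin 3 → ℤ} {i : Fin (N + 1)} {t : Finset (Fin 7)}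
    (h : IsMinimalOn A i t) : chart (cone t) ⟶ projSpace N :=
  toProj (chartCoord h) i (isUnit_chartCoord_self h)

/-- Changing the minimal point multiplies all coordinates by the character of `A i - A j`, a unit
because both points are minimal on `t`. -/
lemma chartToProj_index {A : Fin (N + 1) → Fin 3 → ℤ} {i j : Fin (N + 1)} {t : Finset (Fin 7)}
    (h : IsMinimalOn A i t) (h' : IsMinimalOn A j t) : chartToProj h = chartToProj h' := by
  have hu : IsUnit (chi (h'.mem i)) :=
    isUnit_chi _ (by rw [neg_sub]; exact h.mem j)
  have hk : (fun k => chi (h'.mem i) * chartCoord h k) = chartCoord h' := by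
    ext1 k
    rw [chartCoord, ← chi_add]
    exact chi_congr (by abel)
  have h1 := toProj_smul (chartCoord h) hu i (isUnit_chartCoord_self h)
  have h2 := toProj_index (fun k => chi (h'.mem i) * chartCoord h k) i j
    (hu.mul (isUnit_chartCoord_self h)) ((congrFun hk j).symm ▸ isUnit_chartCoord_self h')
  refine h1.trans (h2.trans ?_)
  rw [chartToProj]
  congr 1

lemma map_chartCoord {A : Fin (N + 1) → Fin 3 → ℤ} {i : Fin (N + 1)} {t u : Finset (Fin 7)}
    (h : IsMinimalOn A i u) (htu : t ⊆ u) (k : Fin (N + 1)) :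
    chartHom (cone_mono htu) (chartCoord h k) = chartCoord (h.mono htu) k :=
  chartHom_chi _ _

lemma chartMap_chartToProj {A : Fin (N + 1) → Fin 3 → ℤ} {i j : Fin (N + 1)} {t u : Finset (Fin 7)}
    (h : IsMinimalOn A i u) (h' : IsMinimalOn A j t) (htu : t ⊆ u) :
    chartMap (cone_mono htu) ≫ chartToProj h = chartToProj h' := by
  rw [← chartToProj_index (h.mono htu) h']
  refine (map_toProj (chartHom (cone_mono htu)) (chartCoord h) i (isUnit_chartCoord_self h)).trans ?_
  rw [chartToProj]
  congr 1
  exact funext fun k => map_chartCoord h htu k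

lemma chartToProj_structure {A : Fin (N + 1) → Fin 3 → ℤ} {i : Fin (N + 1)} {t : Finset (Fin 7)}
    (h : IsMinimalOn A i t) : chartToProj h ≫ projSpaceToSpecC N = chartToSpecC (cone t) :=
  toProj_structure _ _ _

lemma IsVeryAmple.exists_minimal_face {F : Finset (Finset (Fin 7))} {A : Fin (N + 1) → Fin 3 → ℤ}
    (hA : IsVeryAmple F A) (t : faces F) : ∃ i, IsMinimalOn A i t.1 := by
  obtain ⟨c, hc, htc⟩ := t.2
  obtain ⟨i, hi⟩ := hA.exists_minimal c hc
  exact ⟨i, hi.mono htc⟩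

/-- The morphism of a toric variety to projective space is given by lattice points. -/
def IsLatticeMap {F : Finset (Finset (Fin 7))} {X : Scheme.{0}} (A : Fin (N + 1) → Fin 3 → ℤ)
    (ι : ∀ t : faces F, chart (cone t.1) ⟶ X) (p : X ⟶ projSpace N) : Prop :=
  ∀ (t : faces F) (i : Fin (N + 1)) (h : IsMinimalOn A i t.1), ι t ≫ p = chartToProj h

lemma IsToric.exists_isLatticeMap {F : Finset (Finset (Fin 7))} {X : Scheme.{0}} {s : X ⟶ SpecC}
    {ι : ∀ t : faces F, chart (cone t.1) ⟶ X} (h : IsToric F X s ι)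
    {A : Fin (N + 1) → Fin 3 → ℤ} (hA : IsVeryAmple F A) :
    ∃ p : X ⟶ projSpace N, IsLatticeMap A ι p ∧ p ≫ projSpaceToSpecC N = s := by
  choose i hi using hA.exists_minimal_face
  have hcov : ∀ c d : F, pullback.fst (ι (facet c.2)) (ι (facet d.2)) ≫ chartToProj (hi (facet c.2)) =
      pullback.snd (ι (facet c.2)) (ι (facet d.2)) ≫ chartToProj (hi (facet d.2)) := by
    intro c d
    have hc := h.openImmersion (facet c.2)
    have hd := h.openImmersion (facet d.2)
    have hcd := h.openImmersion (faceInter (facet c.2) (facet d.2))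
    -- The overlap of two facet charts lies in the chart of the common face, where both local
    -- morphisms are given by the same lattice points.
    have hr : Set.range (pullback.fst (ι (facet c.2)) (ι (facet d.2)) ≫ ι (facet c.2)) ⊆
        Set.range (ι (faceInter (facet c.2) (facet d.2))) := by
      rintro _ ⟨y, rfl⟩
      refine h.inter _ _ _ ⟨pullback.fst (ι (facet c.2)) (ι (facet d.2)) y, rfl⟩
        ⟨pullback.snd (ι (facet c.2)) (ι (facet d.2)) y, ?_⟩
      rw [pullback.condition]
      rfl
    let l := IsOpenImmersion.lift _ _ hr
    have hl := IsOpenImmersion.lift_fac _ _ hr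
    have h1 : pullback.fst (ι (facet c.2)) (ι (facet d.2)) =
        l ≫ chartMap (cone_mono Finset.inter_subset_left) := by
      rw [← cancel_mono (ι (facet c.2)), Category.assoc]
      rw [h.compatible (faceInter (facet c.2) (facet d.2)) (facet c.2) Finset.inter_subset_left]
      exact hl.symm
    have h2 : pullback.snd (ι (facet c.2)) (ι (facet d.2)) =
        l ≫ chartMap (cone_mono Finset.inter_subset_right) := by
      rw [← cancel_mono (ι (facet d.2)), Category.assoc, ← pullback.condition]
      rw [h.compatible (faceInter (facet c.2) (facet d.2)) (facet d.2) Finset.inter_subset_right]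
      exact hl.symm
    rw [h1, h2, Category.assoc, Category.assoc]
    rw [chartMap_chartToProj (hi (facet c.2)) (hi (faceInter (facet c.2) (facet d.2)))
      Finset.inter_subset_left, chartMap_chartToProj (hi (facet d.2))
      (hi (faceInter (facet c.2) (facet d.2))) Finset.inter_subset_right]
  let p := h.openCover.glueMorphisms (fun c : F => chartToProj (hi (facet c.2))) hcov
  have hp : ∀ c : F, ι (facet c.2) ≫ p = chartToProj (hi (facet c.2)) := fun c =>
    h.openCover.ι_glueMorphisms (fun c : F => chartToProj (hi (facet c.2))) hcov c
  refine ⟨p, fun t j hj => ?_, h.hom_ext fun c hc => ?_⟩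
  · obtain ⟨c, hc, htc⟩ := t.2
    rw [← h.compatible t (facet hc) htc, Category.assoc]
    rw [hp ⟨c, hc⟩]
    exact chartMap_chartToProj _ _ htc
  · rw [← Category.assoc, hp ⟨c, hc⟩, h.structureMap]
    exact chartToProj_structure _

namespace IsLatticeMap

variable {F : Finset (Finset (Fin 7))} {X : Scheme.{0}} {s : X ⟶ SpecC}
  {ι : ∀ t : faces F, chart (cone t.1) ⟶ X} {A : Fin (N + 1) → Fin 3 → ℤ} {p : X ⟶ projSpace N}

/-- A coordinate that is nonzero at a point of the orbit of `t` belongs to a lattice point with the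
same values on the rays of `t` as a minimal one, so it is itself minimal. -/
lemma isMinimalOn_of_mem_coordOpen (hp : IsLatticeMap A ι p) (h : IsToric F X s ι)
    (hA : IsVeryAmple F A) {x : X} {i : Fin (N + 1)} (hx : p x ∈ coordOpen i) {t : faces F}
    (ht : x ∈ Set.range (ι t)) (hmin : ∀ u : faces F, x ∈ Set.range (ι u) → t.1 ⊆ u.1) :
    IsMinimalOn A i t.1 := by
  obtain ⟨z, rfl⟩ := ht
  obtain ⟨j, hj⟩ := hA.exists_minimal_face t
  have h1 : p (ι t z) = chartToProj hj z := congrArg (fun f => f z) (hp t j hj)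
  rw [h1] at hx
  have h2 : ¬ Vanishes (chi (hj.mem i)) z :=
    (toProj_mem_coordOpen (chartCoord hj) j (isUnit_chartCoord_self hj) i z).1 hx
  have h3 := h.dotProduct_eq_zero_of_orbit hmin (hj.mem i) h2
  intro k r hr
  have h4 := hj k r hr
  have h5 := h3 r hr
  rw [sub_dotProduct] at h4 h5 ⊢
  omega

/-- The preimage of `y_i ≠ 0` is the chart of the largest face on which `A i` is minimal. -/
lemma exists_isPullback (hp : IsLatticeMap A ι p) (h : IsToric F X s ι) (hA : IsVeryAmple F A)
    (i : Fin (N + 1)) : ∃ c ∈ F, ∃ (τ : faces F) (hi : IsMinimalOn A i τ.1), τ.1 ⊆ c ∧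
      IsNormalFace F A i c τ.1 ∧
      IsPullback (Spec.map (CommRingCat.ofHom (awayEval (chartCoord hi) i
        (isUnit_chartCoord_self hi)))) (ι τ) (awayEmb i) p := by
  obtain ⟨c, hc, τ, hτ, hn⟩ := hA.exists_face i
  obtain ⟨hi, hmax, hgen⟩ := hn
  have hτ := Finset.mem_powerset.1 hτ
  let T : faces F := ⟨τ, c, hc, hτ⟩
  refine ⟨c, hc, T, hi, hτ, ⟨hi, hmax, hgen⟩, ?_⟩
  have : IsOpenImmersion (X := Spec (CommRingCat.of (chartRing (cone τ)))) (Y := X) (ι T) :=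
    h.openImmersion T
  refine isPullback_toProj (hp T i hi) fun x hx => ?_
  obtain ⟨t, ht, hmin⟩ := h.exists_orbit x
  obtain ⟨c', hc', htc'⟩ := t.2
  exact h.range_subset (hmax c' hc' t.1 (Finset.mem_powerset.2 htc')
    (hp.isMinimalOn_of_mem_coordOpen h hA hx ht hmin)) ht

/-- The ratios map to the characters of the differences with `A i`; these differences generate the
monoid, and the characters span the ring. -/
lemma surjective_awayEval {c τ : Finset (Fin 7)} (hc : Unimodular c) {i : Fin (N + 1)}
    (hi : IsMinimalOn A i τ)
    (hgen : IsNormalFace F A i c τ) :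
    Function.Surjective (awayEval (chartCoord hi) i (isUnit_chartCoord_self hi)) := by
  set f := awayEval (chartCoord hi) i (isUnit_chartCoord_self hi)
  have hf : ∀ k, f (awayRatio i k) = chi (hi.mem k) := fun k => by
    have := awayEval_ratio (chartCoord hi) i (isUnit_chartCoord_self hi) k
    rwa [chartCoord_self, mul_one] at this
  let S : AddSubmonoid (Fin 3 → ℤ) :=
    { carrier := {m | ∃ (hm : m ∈ dualMonoid (cone τ)) (y : AwayX i), f y = chi hm}
      zero_mem' := ⟨zero_mem _, 1, map_one f⟩
      add_mem' := by
        rintro a b ⟨ha, y, hy⟩ ⟨hb, z, hz⟩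
        exact ⟨add_mem ha hb, y * z, by rw [map_mul, hy, hz, chi_add ha hb]⟩ }
  have hS : ∀ m, IsGenerated A i m → m ∈ S := by
    rintro _ ⟨k, l, rfl⟩
    exact add_mem ⟨hi.mem k, _, hf k⟩ ⟨hi.mem l, _, hf l⟩
  have key := dualMonoid_cone_le hc (t := τ) (S := S) (fun r hr => hS _ (hgen.2.2.1 r hr))
    fun r hr hrt => hS _ (hgen.2.2.2 r (Finset.mem_sdiff.2 ⟨hr, hrt⟩))
  intro z
  induction z using AddMonoidAlgebra.induction_linear with
  | zero => exact ⟨0, map_zero f⟩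
  | add x y hx hy =>
    obtain ⟨x, rfl⟩ := hx
    obtain ⟨y, rfl⟩ := hy
    exact ⟨x + y, map_add f x y⟩
  | single m a =>
    obtain ⟨hm, y, hy⟩ := key m.2
    refine ⟨algebraMap ℂ _ a * y, ?_⟩
    rw [map_mul, hy, single_eq_algebraMap_mul_chi, awayEval_algebraMap]

lemma isClosedImmersion (hp : IsLatticeMap A ι p) (h : IsToric F X s ι) (hA : IsVeryAmple F A) :
    IsClosedImmersion p := by
  refine mem_of_forall_isPullback (P := @IsClosedImmersion) fun i => ?_
  obtain ⟨c, hc, τ, hi, hτ, hgen, hpb⟩ := hp.exists_isPullback h hA i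
  exact ⟨_, _, _, hpb, IsClosedImmersion.spec_of_surjective _
    (surjective_awayEval (h.unimodular c hc) hi hgen)⟩

end IsLatticeMap

lemma IsToric.isProjective {F : Finset (Finset (Fin 7))} {X : Scheme.{0}} {s : X ⟶ SpecC}
    {ι : ∀ t : faces F, chart (cone t.1) ⟶ X} (h : IsToric F X s ι)
    {A : Fin (N + 1) → Fin 3 → ℤ} (hA : IsVeryAmple F A) : IsProjective s := by
  obtain ⟨p, hp, hs⟩ := h.exists_isLatticeMap hA
  exact ⟨N, p, hp.isClosedImmersion h hA, hs⟩

/-- The lattice points on the edges of the polytope of a very ample divisor. -/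
def polytopePoints : Fin (18 + 1) → Fin 3 → ℤ :=
  ![![0, 0, 0], ![0, 0, 1], ![0, 0, 2], ![0, 1, 0], ![0, 1, 2], ![0, 2, 0], ![0, 2, 1], ![0, 3, 0],
    ![1, 0, 0], ![1, 0, 2], ![1, 1, 2], ![1, 3, 0], ![2, 0, 0], ![2, 0, 1], ![2, 2, 1], ![2, 3, 0],
    ![3, 0, 0], ![3, 1, 0], ![3, 2, 0]]

/-- The polytope is given by x, y, z ≥ 0, z ≤ 2, x + z ≤ 3, y + z ≤ 3 and x + y + z ≤ 5. It has ten
vertices, one for each facet of the complex; the other nine points are interior to edges and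
correspond to two-dimensional cones. -/
lemma isVeryAmple_polytopePoints : IsVeryAmple facets₃ polytopePoints :=
  ⟨by decide +kernel, by decide +kernel⟩

/-- The vertices of the standard simplex. -/
def simplexPoints : Fin (3 + 1) → Fin 3 → ℤ := ![![0, 0, 0], ![1, 0, 0], ![0, 1, 0], ![0, 0, 1]]

lemma isVeryAmple_simplexPoints : IsVeryAmple facets₀ simplexPoints :=
  ⟨by decide +kernel, by decide +kernel⟩

end

section

/-! ### Projective space as a toric variety -/

/-- The homogeneous coordinates of `ℙ³` vanishing on the divisors of the rays. -/
def coordOfRay : Fin 7 → Fin (3 + 1) := ![0, 0, 0, 1, 2, 3, 0]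

/-- The rays of the fan of `ℙ³`. -/
def rayOfCoord : Fin (3 + 1) → Fin 7 := ![1, 3, 4, 5]

lemma awayRatio_self {N : ℕ} (i : Fin (N + 1)) : awayRatio i i = 1 := by
  have h := val_awayRatio i i
  have hu := IsLocalization.Away.algebraMap_isUnit (S := Localization.Away
    (MvPolynomial.X i : MvPolynomial (Fin (N + 1)) ℂ))
    (MvPolynomial.X i : MvPolynomial (Fin (N + 1)) ℂ)
  apply HomogeneousLocalization.val_injective
  refine hu.mul_right_cancel ?_
  rw [h, HomogeneousLocalization.val_one, one_mul]

/-- Every point is a vertex, and its differences with the other vertices are exactly the dual basis.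
So the evaluation is an isomorphism and not merely surjective. -/
lemma isNormalFace_simplexPoints : ∀ i, ∀ c ∈ facets₀, ∀ τ ∈ c.powerset,
    IsNormalFace facets₀ simplexPoints i c τ → τ = c ∧ ∀ k, k ≠ i → ∃ r ∈ c,
      simplexPoints k - simplexPoints i = dualVec c r ∧ coordOfRay r = k := by
  decide +kernel

lemma isMinimalOn_simplexPoints : ∀ c ∈ facets₀, ∀ t ∈ c.powerset, ∀ i,
    IsMinimalOn simplexPoints i t ↔ rayOfCoord i ∉ t := by decide +kernel

lemma bijective_awayEval_simplexPoints {c : Finset (Fin 7)} (hc : c ∈ facets₀) {i : Fin (3 + 1)}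
    {τ : Finset (Fin 7)} (hτ : τ ⊆ c) (hi : IsMinimalOn simplexPoints i τ)
    (hn : IsNormalFace facets₀ simplexPoints i c τ) :
    Function.Bijective (awayEval (chartCoord hi) i (isUnit_chartCoord_self hi)) := by
  have hu := unimodular₀ c hc
  refine ⟨?_, IsLatticeMap.surjective_awayEval hu hi hn⟩
  obtain ⟨rfl, hk⟩ := isNormalFace_simplexPoints i c hc τ (Finset.mem_powerset.2 hτ) hn
  -- The inverse sends the coordinate of a ray to the ratio of the corresponding homogeneous
  -- coordinate by y_i. The values of `coordOfRay` at the rays 0, 2, 6 do not matter, since these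
  -- lie in no facet of `facets₀`.
  let g : chartRing (cone τ) →ₐ[ℂ] AwayX i := chartLift τ ∅ (fun r => awayRatio i (coordOfRay r)) 1
  have hunit : awayRatio i i = 1 := awayRatio_self i
  have h1 : g.toRingHom.comp (awayEval (chartCoord hi) i (isUnit_chartCoord_self hi)) =
      RingHom.id _ := by
    refine awayX_ringHom_ext (fun a => ?_) fun k => ?_
    · change g (awayEval _ _ _ _) = _
      rw [awayEval_algebraMap, AlgHom.commutes]
      rfl
    · have h2 := awayEval_ratio (chartCoord hi) i (isUnit_chartCoord_self hi) k
      rw [chartCoord_self, mul_one] at h2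
      change g (awayEval _ _ _ _) = awayRatio i k
      rw [h2]
      by_cases hki : k = i
      · subst hki
        rw [chartCoord_self, map_one, hunit]
      · obtain ⟨r, hr, h3, rfl⟩ := hk k hki
        rw [chartCoord, chi_congr (h' := dualVec_mem hu subset_rfl hr) h3]
        exact chartLift_chi_dualVec hu _ _ hr
  exact Function.LeftInverse.injective (g := g) fun x => RingHom.congr_fun h1 x

lemma IsToric.of_isIso {F : Finset (Finset (Fin 7))} {X Y : Scheme.{0}} {p : X ⟶ Y} [IsIso p]
    {s : Y ⟶ SpecC} {ι : ∀ t : faces F, chart (cone t.1) ⟶ X} (h : IsToric F X (p ≫ s) ι) :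
    IsToric F Y s (fun t => ι t ≫ p) := by
  have hr : ∀ (t : faces F) (y : Y), y ∈ Set.range (ι t ≫ p) ↔ inv p y ∈ Set.range (ι t) := by
    intro t y
    constructor
    · rintro ⟨z, rfl⟩
      refine ⟨z, ?_⟩
      have : (ι t ≫ p) ≫ inv p = ι t := by simp
      exact (congrArg (fun f => f z) this).symm
    · rintro ⟨z, hz⟩
      refine ⟨z, ?_⟩
      have h1 : (ι t ≫ p) z = p (ι t z) := rfl
      have h2 : inv p ≫ p = 𝟙 _ := by simp
      rw [h1, hz]
      exact congrArg (fun f => f y) h2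
  refine ⟨h.unimodular, fun t => ?_, fun t => ?_, fun t u htu => ?_, fun y => ?_, fun t u y => ?_⟩
  · have := h.openImmersion t
    infer_instance
  · rw [Category.assoc, h.structureMap]
  · rw [← Category.assoc, h.compatible t u htu]
  · obtain ⟨t, ht⟩ := h.cover (inv p y)
    exact ⟨t, (hr t y).2 ht⟩
  · rw [hr, hr, hr]
    exact h.inter t u _

/-- The toric charts of `ℙ³`. -/
lemma exists_isToric_projSpace : ∃ ι : ∀ t : faces facets₀, chart (cone t.1) ⟶ projSpace 3,
    IsToric facets₀ (projSpace 3) (projSpaceToSpecC 3) ι ∧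
      ∀ (t : faces facets₀) (i : Fin (3 + 1)) (h : IsMinimalOn simplexPoints i t.1),
        ι t = chartToProj h := by
  obtain ⟨X, s, ι, h, -⟩ := exists_isToric unimodular₀
  obtain ⟨p, hp, rfl⟩ := h.exists_isLatticeMap isVeryAmple_simplexPoints
  have : IsIso p := by
    refine mem_of_forall_isPullback (P := MorphismProperty.isomorphisms Scheme.{0}) fun i => ?_
    obtain ⟨c, hc, τ, hi, hτ, hn, hpb⟩ := hp.exists_isPullback h isVeryAmple_simplexPoints i
    refine ⟨_, _, _, hpb, ?_⟩
    have := (ConcreteCategory.isIso_iff_bijective (CommRingCat.ofHom (awayEval (chartCoord hi) i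
      (isUnit_chartCoord_self hi)))).2 (bijective_awayEval_simplexPoints hc hτ hi hn)
    change IsIso (Spec.map (CommRingCat.ofHom (awayEval (chartCoord hi) i
      (isUnit_chartCoord_self hi))))
    infer_instance
  exact ⟨fun t => ι t ≫ p, h.of_isIso, fun t i hi => hp t i hi⟩

/-- On the torus the character of the vertex `i` is a unit; multiplying all coordinates by it gives
1, t₁, t₂, t₃. -/
lemma torusToChart_chartToProj {t : Finset (Fin 7)} {i : Fin (3 + 1)}
    (h : IsMinimalOn simplexPoints i t) :
    torusToChart (cone t) ≫ chartToProj h = torusToProjSpace 3 := by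
  let φ : chartRing (cone t) →ₐ[ℂ] AddMonoidAlgebra ℂ (Fin 3 → ℤ) :=
    AddMonoidAlgebra.mapDomainAlgHom ℂ ℂ (dualMonoid (cone t)).subtype
  have hφ : ∀ k, φ (chartCoord h k) = AddMonoidAlgebra.single (simplexPoints k - simplexPoints i) 1 :=
    fun k => AddMonoidAlgebra.mapDomain_single
  have h1 := map_toProj φ (chartCoord h) i (isUnit_chartCoord_self h)
  refine Eq.trans h1 ?_
  have hu : IsUnit (AddMonoidAlgebra.single (simplexPoints i) (1 : ℂ)) := by
    refine IsUnit.of_mul_eq_one (AddMonoidAlgebra.single (-simplexPoints i) (1 : ℂ)) ?_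
    rw [AddMonoidAlgebra.single_mul_single, add_neg_cancel, mul_one]
    rfl
  have hk : (fun k => AddMonoidAlgebra.single (simplexPoints i) (1 : ℂ) * φ (chartCoord h k)) =
      Fin.cons 1 fun i : Fin 3 => AddMonoidAlgebra.single (Pi.single i (1 : ℤ)) (1 : ℂ) := by
    ext1 k
    rw [hφ, AddMonoidAlgebra.single_mul_single, add_sub_cancel, mul_one]
    refine Fin.cases ?_ (fun j => ?_) k
    · rw [Fin.cons_zero]
      change AddMonoidAlgebra.single _ _ = AddMonoidAlgebra.single 0 1
      congr 1
      decide
    · rw [Fin.cons_succ]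
      congr 1
      revert j
      decide
  rw [toProj_smul _ hu, torusToProjSpace_eq]
  have h0 : IsUnit ((fun k => AddMonoidAlgebra.single (simplexPoints i) (1 : ℂ) *
      φ (chartCoord h k)) 0) := by
    rw [hk]
    exact isUnit_one
  rw [toProj_index _ i 0 _ h0]
  congr 1

/-- The coordinate y_i is nonzero on the orbit of `t` exactly when the vertex `i` is minimal on `t`,
that is, when the ray of y_i is not in `t`. -/
lemma mem_coordLocus_iff_of_orbit {ι : ∀ t : faces facets₀, chart (cone t.1) ⟶ projSpace 3}
    (h : IsToric facets₀ (projSpace 3) (projSpaceToSpecC 3) ι)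
    (hι : ∀ (t : faces facets₀) (i : Fin (3 + 1)) (h : IsMinimalOn simplexPoints i t.1),
      ι t = chartToProj h) {x : projSpace 3} {t : faces facets₀} (ht : x ∈ Set.range (ι t))
    (hmin : ∀ u : faces facets₀, x ∈ Set.range (ι u) → t.1 ⊆ u.1) (I : Set (Fin (3 + 1))) :
    x ∈ coordLocus I ↔ ∀ i ∈ I, rayOfCoord i ∈ t.1 := by
  have hp : IsLatticeMap simplexPoints ι (𝟙 (projSpace 3)) := fun t i hi => by
    rw [Category.comp_id, hι t i hi]
  rw [mem_coordLocus_iff]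
  refine forall₂_congr fun i hi => ?_
  obtain ⟨c, hc, htc⟩ := t.2
  rw [not_iff_comm, ← isMinimalOn_simplexPoints c hc t.1 (Finset.mem_powerset.2 htc) i]
  constructor
  · intro h1
    obtain ⟨z, rfl⟩ := ht
    rw [hι t i h1]
    refine (toProj_mem_coordOpen (chartCoord h1) i (isUnit_chartCoord_self h1) i z).2 fun h2 => ?_
    exact not_vanishes_of_isUnit (isUnit_chartCoord_self h1) z h2
  · exact fun h1 => hp.isMinimalOn_of_mem_coordOpen h isVeryAmple_simplexPoints h1 ht hmin

end

/-! ### Ideal sheaves on affine charts and the centers of the blowups. -/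

section

/-! ### Ideal sheaves on affine schemes and effective Cartier divisors -/

/-- The ideal of an ideal sheaf on an affine scheme. -/
def specIdeal {R : CommRingCat.{0}} (I : (Spec R).IdealSheafData) : Ideal R :=
  (I.ideal ⟨⊤, isAffineOpen_top _⟩).comap (Scheme.ΓSpecIso R).inv.hom

lemma map_specIdeal {R : CommRingCat.{0}} (I : (Spec R).IdealSheafData) :
    I.ideal ⟨⊤, isAffineOpen_top _⟩ = (specIdeal I).comap (Scheme.ΓSpecIso R).hom.hom := by
  rw [specIdeal, Ideal.comap_comap, ← CommRingCat.hom_comp, Iso.hom_inv_id]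
  rfl

lemma specIdeal_le_iff {R : CommRingCat.{0}} {I J : (Spec R).IdealSheafData} :
    specIdeal I ≤ specIdeal J ↔ I ≤ J := by
  constructor
  · intro h
    refine Scheme.IdealSheafData.le_of_isAffine ?_
    rw [map_specIdeal, map_specIdeal]
    exact Ideal.comap_mono h
  · exact fun h => Ideal.comap_mono (h _)

lemma exists_specIdeal_eq {R : CommRingCat.{0}} (I : Ideal R) :
    ∃ J : (Spec R).IdealSheafData, specIdeal J = I := by
  refine ⟨Scheme.IdealSheafData.equivOfIsAffine.symm (I.comap (Scheme.ΓSpecIso R).hom.hom), ?_⟩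
  rw [specIdeal, ← Scheme.IdealSheafData.equivOfIsAffine_apply, OrderRingIso.apply_symm_apply,
    Ideal.comap_comap, ← CommRingCat.hom_comp, Iso.inv_hom_id]
  rfl

lemma specIdeal_map {R S : CommRingCat.{0}} (φ : R ⟶ S) (I : (Spec S).IdealSheafData) :
    specIdeal (I.map (Spec.map φ)) = (specIdeal I).comap φ.hom := by
  rw [specIdeal, Scheme.IdealSheafData.ideal_map_of_isAffineHom, specIdeal, Ideal.comap_comap,
    Ideal.comap_comap, ← CommRingCat.hom_comp, ← CommRingCat.hom_comp]
  have h : (Scheme.ΓSpecIso R).inv ≫ (Spec.map φ).app ⊤ = φ ≫ (Scheme.ΓSpecIso S).inv :=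
    (Scheme.ΓSpecIso_inv_naturality φ).symm
  exact congrArg (fun f => (I.ideal ⟨⊤, isAffineOpen_top _⟩).comap (CommRingCat.Hom.hom f)) h

/-- Pullback of ideal sheaves is left adjoint to pushforward, as extension of ideals is to
contraction; so the statement follows from that for pushforwards. -/
lemma specIdeal_comap {R S : CommRingCat.{0}} (φ : R ⟶ S) (J : (Spec R).IdealSheafData) :
    specIdeal (J.comap (Spec.map φ)) = (specIdeal J).map φ.hom := by
  refine le_antisymm ?_ ?_
  · obtain ⟨I, hI⟩ := exists_specIdeal_eq ((specIdeal J).map φ.hom)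
    rw [← hI, specIdeal_le_iff, ← Scheme.IdealSheafData.le_map_iff_comap_le, ← specIdeal_le_iff,
      specIdeal_map, hI]
    exact Ideal.le_comap_map
  · rw [Ideal.map_le_iff_le_comap, ← specIdeal_map, specIdeal_le_iff]
    exact Scheme.IdealSheafData.le_map_comap _ _

lemma specIdeal_ker {R S : CommRingCat.{0}} (φ : R ⟶ S) :
    specIdeal (Spec.map φ).ker = RingHom.ker φ.hom := by
  rw [← Scheme.IdealSheafData.map_bot, specIdeal_map, RingHom.ker]
  congr 1
  rw [specIdeal, Scheme.IdealSheafData.ideal_bot]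
  change Ideal.comap _ ⊥ = ⊥
  rw [← RingHom.ker, RingHom.ker_eq_bot_iff_eq_zero]
  intro x hx
  have : (Scheme.ΓSpecIso S).hom ((Scheme.ΓSpecIso S).inv x) = x := by simp
  rw [← this]
  change (Scheme.ΓSpecIso S).hom ((Scheme.ΓSpecIso S).inv.hom x) = 0
  rw [hx, map_zero]

lemma exists_specIdeal_comap_eq {R : CommRingCat.{0}} {Y : Scheme.{0}} (k : Spec R ⟶ Y)
    [IsOpenImmersion k] : ∃ e : R ≃+* Γ(Y, k ''ᵁ ⊤), ∀ I : Y.IdealSheafData,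
      specIdeal (I.comap k) =
        (I.ideal ⟨k ''ᵁ ⊤, (isAffineOpen_top _).image_of_isOpenImmersion k⟩).comap e.toRingHom := by
  let i : R ≅ Γ(Y, k ''ᵁ ⊤) := (Scheme.ΓSpecIso R).symm ≪≫ (k.appIso ⊤).symm
  refine ⟨i.commRingCatIsoToRingEquiv, fun I => ?_⟩
  rw [specIdeal, Scheme.IdealSheafData.ideal_comap_of_isOpenImmersion, Ideal.comap_comap]
  rfl

/-- The ideal is generated by one nonzerodivisor. -/
def IsInvertiblePrincipal {R : Type*} [CommRing R] (I : Ideal R) : Prop :=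
  ∃ f ∈ nonZeroDivisors R, I = Ideal.span {f}

lemma IsInvertiblePrincipal.map_equiv {R S : Type*} [CommRing R] [CommRing S] (e : R ≃+* S)
    {I : Ideal R} (h : IsInvertiblePrincipal I) : IsInvertiblePrincipal (I.map e.toRingHom) := by
  obtain ⟨f, hf, rfl⟩ := h
  refine ⟨e f, ?_, by rw [Ideal.map_span, Set.image_singleton]; rfl⟩
  exact (MulEquivClass.map_nonZeroDivisors e).le ⟨f, hf, rfl⟩

lemma IsInvertiblePrincipal.comap_iff {R S : Type*} [CommRing R] [CommRing S] (e : R ≃+* S)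
    {I : Ideal S} : IsInvertiblePrincipal (I.comap e.toRingHom) ↔ IsInvertiblePrincipal I := by
  constructor
  · intro h
    have := h.map_equiv e
    rwa [Ideal.map_comap_of_surjective e.toRingHom e.surjective] at this
  · intro h
    have := h.map_equiv e.symm
    have h2 : I.map e.symm.toRingHom = I.comap e.toRingHom := Ideal.map_symm e
    rwa [h2] at this

lemma isInvertiblePrincipal_ideal_congr {Y : Scheme.{0}} (I : Y.IdealSheafData)
    {U V : Y.affineOpens} (h : U = V) :
    IsInvertiblePrincipal (I.ideal U) ↔ IsInvertiblePrincipal (I.ideal V) := by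
  subst h
  rfl

/-- The criterion for an effective Cartier divisor in terms of affine charts. -/
lemma isEffectiveCartier_iff {E Y : Scheme.{0}} (i : E ⟶ Y) :
    IsEffectiveCartier i ↔ IsClosedImmersion i ∧ ∀ y : Y, ∃ (R : CommRingCat.{0}) (k : Spec R ⟶ Y),
      IsOpenImmersion k ∧ y ∈ Set.range k ∧ IsInvertiblePrincipal (specIdeal (i.ker.comap k)) := by
  refine and_congr_right fun _ => forall_congr' fun y => ?_
  constructor
  · rintro ⟨U, hy, hf⟩
    refine ⟨Γ(Y, U), U.2.fromSpec, U.2.isOpenImmersion_fromSpec, ?_, ?_⟩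
    · rw [U.2.range_fromSpec]
      exact hy
    · have := U.2.isOpenImmersion_fromSpec
      obtain ⟨e, he⟩ := exists_specIdeal_comap_eq U.2.fromSpec
      rw [he, IsInvertiblePrincipal.comap_iff]
      have hU : U = ⟨U.2.fromSpec ''ᵁ ⊤, (isAffineOpen_top _).image_of_isOpenImmersion _⟩ :=
        Subtype.ext (((Scheme.Hom.image_top_eq_opensRange _).trans U.2.opensRange_fromSpec).symm)
      exact (isInvertiblePrincipal_ideal_congr _ hU).1 hf
  · rintro ⟨R, k, _, hy, hf⟩
    obtain ⟨e, he⟩ := exists_specIdeal_comap_eq k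
    rw [he, IsInvertiblePrincipal.comap_iff] at hf
    exact ⟨⟨k ''ᵁ ⊤, (isAffineOpen_top _).image_of_isOpenImmersion k⟩, by simpa using hy, hf⟩

end

section

/-! ### The rational curves of the walls -/

lemma awayEmb_mem_coordOpen {N : ℕ} (i k : Fin (N + 1)) (y : PrimeSpectrum (AwayX (N := N) i)) :
    awayEmb i y ∈ coordOpen k ↔ awayRatio i k ∉ y.asIdeal := by
  have h1 : awayEmb i ⁻¹ᵁ coordOpen k = PrimeSpectrum.basicOpen
      (HomogeneousLocalization.Away.isLocalizationElem (X_mem_stdGrading i) (X_mem_stdGrading k)) :=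
    Proj.awayι_preimage_basicOpen (stdGrading N) (X_mem_stdGrading i) Nat.one_pos
      (X_mem_stdGrading k) Nat.one_pos
  have h2 : HomogeneousLocalization.Away.isLocalizationElem (X_mem_stdGrading i)
      (X_mem_stdGrading k) = awayRatio i k := by
    ext
    rw [HomogeneousLocalization.Away.isLocalizationElem, awayRatio]
    simp [HomogeneousLocalization.Away.val_mk]
  rw [h2] at h1
  change y ∈ awayEmb i ⁻¹ᵁ coordOpen k ↔ _
  rw [h1]
  rfl

lemma aeval_awayRatio_surjective {N : ℕ} (i : Fin (N + 1)) :
    Function.Surjective (MvPolynomial.aeval (R := ℂ) (awayRatio i)) := fun x => by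
  obtain ⟨n, a, ha, rfl⟩ := HomogeneousLocalization.Away.mk_surjective _ (X_mem_stdGrading i) x
  exact ⟨a, (away_eq_aeval i n a ha).symm⟩

lemma awayMap_ratio_mul {N : ℕ} (i k : Fin (N + 1))
    {x : MvPolynomial (Fin (N + 1)) ℂ} (hx : x = MvPolynomial.X i * MvPolynomial.X k)
    (hx' : x = MvPolynomial.X k * MvPolynomial.X i) :
    HomogeneousLocalization.awayMap (stdGrading N) (X_mem_stdGrading k) hx (awayRatio i k) *
      HomogeneousLocalization.awayMap (stdGrading N) (X_mem_stdGrading i) hx' (awayRatio k i) = 1 := by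
  apply HomogeneousLocalization.val_injective
  have hu : IsUnit (algebraMap (MvPolynomial (Fin (N + 1)) ℂ) (Localization.Away x) x) :=
    IsLocalization.Away.algebraMap_isUnit x
  have key : ∀ (i k : Fin (N + 1)) (hx : x = MvPolynomial.X i * MvPolynomial.X k),
      (HomogeneousLocalization.awayMap (stdGrading N) (X_mem_stdGrading k) hx (awayRatio i k)).val *
        algebraMap (MvPolynomial (Fin (N + 1)) ℂ) (Localization.Away x) (MvPolynomial.X i) =
        algebraMap (MvPolynomial (Fin (N + 1)) ℂ) (Localization.Away x) (MvPolynomial.X k) := by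
    intro i k hx
    have h1 := congrArg (Localization.awayLift (algebraMap _ (Localization.Away x))
      (MvPolynomial.X i) (isUnit_of_dvd_unit (map_dvd _ ⟨_, hx⟩) hu)) (val_awayRatio i k)
    rw [map_mul, ← HomogeneousLocalization.val_awayMap (hx := hx) (hg := X_mem_stdGrading k)] at h1
    rw [Localization.awayLift, IsLocalization.Away.lift_eq, IsLocalization.Away.lift_eq] at h1
    exact h1
  have h1 := key i k hx
  have h2 := key k i hx'
  rw [HomogeneousLocalization.val_mul, HomogeneousLocalization.val_one]
  have h3 : IsUnit (algebraMap (MvPolynomial (Fin (N + 1)) ℂ) (Localization.Away x)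
      (MvPolynomial.X i)) := isUnit_of_dvd_unit (map_dvd _ ⟨_, hx⟩) hu
  refine h3.mul_right_cancel ?_
  rw [mul_right_comm, h1, mul_comm, h2, one_mul]

/-- The edge `{a, b}` of the complex lies in exactly the two facets `{a, b, d 0}` and
`{a, b, d 1}`, and the four rays satisfy a wall relation. -/
structure IsWall (F : Finset (Finset (Fin 7))) (a b : Fin 7) (d : Fin 2 → Fin 7) (p q : ℤ) :
    Prop where
  mem : ∀ i, {a, b, d i} ∈ F
  exists_eq : ∀ c ∈ F, a ∈ c → b ∈ c → ∃ i, c = {a, b, d i}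
  ne_left : ∀ i, d i ≠ a
  ne_right : ∀ i, d i ≠ b
  ne : a ≠ b
  ne_opposite : ∀ i, d (i + 1) ≠ d i
  relation : rho (d 0) + rho (d 1) = p • rho a + q • rho b

/-- The homomorphism of the chart `{a, b, e}` onto the coordinate ring of the invariant curve. -/
def wallHom (a b e : Fin 7) {B : Type*} [CommRing B] [Algebra ℂ B] (u : B) :
    chartRing (cone {a, b, e}) →ₐ[ℂ] B :=
  chartLift {a, b, e} ∅ (fun r => if r = e then u else 0) 1

lemma wallHom_chi_dualVec {a b e : Fin 7} (hc : Unimodular {a, b, e}) {B : Type*} [CommRing B]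
    [Algebra ℂ B] (u : B) {r : Fin 7} (hr : r ∈ ({a, b, e} : Finset (Fin 7))) :
    wallHom a b e u (chi (dualVec_mem hc subset_rfl hr)) = if r = e then u else 0 :=
  chartLift_chi_dualVec hc _ _ hr

lemma comp_wallHom {a b e : Fin 7} {B B' : Type*} [CommRing B] [Algebra ℂ B] [CommRing B']
    [Algebra ℂ B'] (f : B →ₐ[ℂ] B') (u : B) : f.comp (wallHom a b e u) = wallHom a b e (f u) := by
  refine chartRing_algHom_ext fun m hm => ?_
  rw [AlgHom.comp_apply, wallHom, wallHom, chartLift_chi, chartLift_chi]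
  simp only [Finset.prod_empty, mul_one, map_prod, map_pow]
  refine Finset.prod_congr rfl fun r _ => ?_
  split_ifs <;> simp

/-- The homomorphism of the chart `{a, b}` onto the coordinate ring of the orbit. -/
def edgeHom (a b e : Fin 7) {B : Type*} [CommRing B] [Algebra ℂ B] (u : Bˣ) :
    chartRing (cone {a, b}) →ₐ[ℂ] B :=
  chartLift {a, b} {e} 0 (fun _ => u)

lemma edge_subset (a b e : Fin 7) : ({a, b} : Finset (Fin 7)) ⊆ {a, b, e} :=
  Finset.insert_subset_insert _ (by simp)

/-- Where the parameter of the curve is invertible, the curve lies in the open chart of the edge,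
which is shared by the two facets. -/
lemma wallHom_eq {a b e : Fin 7} (hab : a ≠ b) (hea : e ≠ a) (heb : e ≠ b) {B : Type*} [CommRing B]
    [Algebra ℂ B] (u : Bˣ) : wallHom a b e (u : B) =
      (edgeHom a b e u).comp (chartHom (cone_mono (edge_subset a b e))) := by
  refine chartRing_algHom_ext fun m hm => ?_
  have hm' := mem_dualMonoid_cone.1 hm e (by simp)
  rw [AlgHom.comp_apply, chartHom_chi, wallHom, edgeHom, chartLift_chi, chartLift_chi]
  rw [Finset.prod_empty, mul_one, Finset.prod_singleton, Finset.prod_insert (by simp [hab, hea.symm]),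
    Finset.prod_pair heb.symm, Finset.prod_pair hab, if_neg hea.symm, if_neg heb.symm, if_pos rfl,
    ← mul_assoc]
  congr 1
  obtain ⟨n, hn⟩ := Int.eq_ofNat_of_zero_le hm'
  rw [hn]
  simp

/-- Only characters orthogonal to ρ_a and ρ_b survive on the orbit of the edge. On these the wall
relation gives opposite pairings with the two remaining rays, so the parameters seen from the two
sides are inverse, as on the projective line. -/
lemma edgeHom_opposite {F : Finset (Finset (Fin 7))} {a b : Fin 7} {d : Fin 2 → Fin 7} {p q : ℤ}
    (w : IsWall F a b d p q) (i : Fin 2) {B : Type*} [CommRing B] [Algebra ℂ B] (u : Bˣ) :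
    edgeHom a b (d (i + 1)) u⁻¹ = edgeHom a b (d i) u := by
  refine chartRing_algHom_ext fun m hm => ?_
  rw [edgeHom, edgeHom, chartLift_chi, chartLift_chi, Finset.prod_singleton, Finset.prod_singleton,
    Finset.prod_pair w.ne]
  have ha := mem_dualMonoid_cone.1 hm a (by simp)
  have hb := mem_dualMonoid_cone.1 hm b (by simp)
  by_cases h : m ⬝ᵥ rho a = 0 ∧ m ⬝ᵥ rho b = 0
  · have h1 := congrArg (m ⬝ᵥ ·) w.relation
    simp only [dotProduct_add, dotProduct_smul, h.1, h.2, smul_zero, add_zero] at h1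
    have h2 : m ⬝ᵥ rho (d (i + 1)) = - (m ⬝ᵥ rho (d i)) := by
      fin_cases i <;> simp <;> omega
    rw [h2, inv_zpow', neg_neg]
  · have h3 : (0 : B) ^ (m ⬝ᵥ rho a).toNat * 0 ^ (m ⬝ᵥ rho b).toNat = 0 := by
      rcases not_and_or.1 h with h | h
      · have : (m ⬝ᵥ rho a).toNat ≠ 0 := by omega
        rw [zero_pow this, zero_mul]
      · have : (m ⬝ᵥ rho b).toNat ≠ 0 := by omega
        rw [zero_pow this, mul_zero]
    simp only [Pi.zero_apply]
    rw [h3, zero_mul, zero_mul]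

/-- Evaluation of the functions on a standard affine chart of the projective line. -/
def curveEval {B : Type*} [CommRing B] [Algebra ℂ B] (i : Fin 2) (v : B) :
    AwayX (N := 1) i →+* B :=
  awayEval (fun k => if k = i then 1 else v) i (by simp)

lemma curveEval_algebraMap {B : Type*} [CommRing B] [Algebra ℂ B] (i : Fin 2) (v : B) (z : ℂ) :
    curveEval i v (algebraMap ℂ _ z) = algebraMap ℂ B z := awayEval_algebraMap _ _ _ _

lemma curveEval_ratio {B : Type*} [CommRing B] [Algebra ℂ B] (i : Fin 2) (v : B) :
    curveEval i v (awayRatio (N := 1) i (i + 1)) = v := by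
  have h1 := awayEval_ratio (N := 1) (fun k => if k = i then 1 else v) i (by simp) (i + 1)
  have h2 : i + 1 ≠ i := by fin_cases i <;> decide
  have h3 : curveEval i v (awayRatio (N := 1) i (i + 1)) * 1 = v := by
    refine Eq.trans ?_ (h1.trans (if_neg h2))
    exact congrArg _ (if_pos rfl).symm
  rwa [mul_one] at h3

/-- Evaluating the parameter at the class of the third coordinate gives a map whose composite with
`wallHom` is the quotient map by the ideal of the two coordinates. Hence the kernel lies in that
ideal. -/
lemma ker_wallHom {a b e : Fin 7} (hc : Unimodular {a, b, e}) (hea : e ≠ a) (heb : e ≠ b)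
    (i : Fin 2) (ha : a ∈ ({a, b, e} : Finset (Fin 7))) (hb : b ∈ ({a, b, e} : Finset (Fin 7))) :
    RingHom.ker (wallHom a b e (awayRatio (N := 1) i (i + 1))) =
      Ideal.span {chi (dualVec_mem hc subset_rfl ha), chi (dualVec_mem hc subset_rfl hb)} := by
  set I := Ideal.span {chi (dualVec_mem hc subset_rfl ha), chi (dualVec_mem hc subset_rfl hb)}
  have he : e ∈ ({a, b, e} : Finset (Fin 7)) := by simp
  refine le_antisymm ?_ ?_
  · have hψ : (curveEval i (Ideal.Quotient.mk I (chi (dualVec_mem hc subset_rfl he)))).comp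
        (wallHom a b e (awayRatio (N := 1) i (i + 1))).toRingHom = Ideal.Quotient.mk I := by
      refine chartRing_cone_ringHom_ext hc subset_rfl (fun z => ?_) fun r hr => ?_
      · change curveEval i _ (wallHom a b e _ _) = _
        rw [AlgHom.commutes, curveEval_algebraMap]
        rfl
      · change curveEval i _ (wallHom a b e _ _) = _
        rw [wallHom_chi_dualVec hc _ hr]
        split_ifs with h
        · subst h
          exact curveEval_ratio _ _
        · rw [map_zero]
          symm
          rw [Ideal.Quotient.eq_zero_iff_mem]
          have hr' := hr
          simp only [Finset.mem_insert, Finset.mem_singleton] at hr'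
          rcases hr' with rfl | rfl | rfl
          · exact Ideal.subset_span (Or.inl rfl)
          · exact Ideal.subset_span (Or.inr rfl)
          · exact absurd rfl h
    intro z hz
    rw [← Ideal.Quotient.eq_zero_iff_mem, ← hψ]
    have hz' : wallHom a b e (awayRatio (N := 1) i (i + 1)) z = 0 := hz
    change curveEval i _ (wallHom a b e (awayRatio (N := 1) i (i + 1)) z) = 0
    rw [hz', map_zero]
  · rw [Ideal.span_le]
    intro z hz
    have hz' : z = chi (dualVec_mem hc subset_rfl ha) ∨ z = chi (dualVec_mem hc subset_rfl hb) := hz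
    change wallHom a b e (awayRatio (N := 1) i (i + 1)) z = 0
    rcases hz' with h | h
    · rw [h, wallHom_chi_dualVec hc _ ha, if_neg hea.symm]
    · rw [h, wallHom_chi_dualVec hc _ hb, if_neg heb.symm]

lemma wallHom_surjective {a b e : Fin 7} (hc : Unimodular {a, b, e}) (i : Fin 2) :
    Function.Surjective (wallHom a b e (awayRatio (N := 1) i (i + 1))) := by
  intro z
  obtain ⟨f, rfl⟩ := aeval_awayRatio_surjective (N := 1) i z
  have he : e ∈ ({a, b, e} : Finset (Fin 7)) := by simp
  refine ⟨MvPolynomial.aeval (fun k => if k = i then 1 else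
    chi (dualVec_mem hc subset_rfl he)) f, ?_⟩
  rw [MvPolynomial.comp_aeval_apply]
  congr 2
  ext k : 1
  by_cases hk : k = i
  · rw [if_pos hk, map_one, hk, awayRatio_self]
  · rw [if_neg hk, wallHom_chi_dualVec hc _ he, if_pos rfl]
    congr 1
    revert hk
    fin_cases i <;> fin_cases k <;> simp

end

/-! ### The invariant curve of an edge, embedded as a projective line. -/

section

lemma eq_or_eq_add_one (i k : Fin 2) : k = i ∨ k = i + 1 := by
  fin_cases i <;> fin_cases k <;> simp

lemma val_awayMap_algebraMap {N : ℕ} {i : Fin (N + 1)} {x g : MvPolynomial (Fin (N + 1)) ℂ}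
    {m : ℕ} (hg : g ∈ stdGrading N m) (hx : x = MvPolynomial.X i * g) (z : ℂ) :
    (HomogeneousLocalization.awayMap (stdGrading N) hg hx (algebraMap ℂ (AwayX i) z)).val =
      algebraMap ℂ (Localization.Away x) z := by
  rw [HomogeneousLocalization.val_awayMap, val_algebraMap,
    IsScalarTower.algebraMap_apply ℂ (MvPolynomial (Fin (N + 1)) ℂ), Localization.awayLift,
    IsLocalization.Away.lift_eq, ← IsScalarTower.algebraMap_apply]

variable {F : Finset (Finset (Fin 7))} {a b : Fin 7} {d : Fin 2 → Fin 7} {p q : ℤ}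
  {X : Scheme.{0}} {s : X ⟶ SpecC} {ι : ∀ t : faces F, chart (cone t.1) ⟶ X}

/-- The chart of the invariant curve in a facet. -/
def wallMap (a b e : Fin 7) (i : Fin 2) :
    Spec (CommRingCat.of (AwayX (N := 1) i)) ⟶ chart (cone {a, b, e}) :=
  Spec.map (CommRingCat.ofHom (wallHom a b e (awayRatio (N := 1) i (i + 1))).toRingHom)

/-- The morphism `j` is the invariant curve of the edge `{a, b}`. -/
def IsWallCurve (w : IsWall F a b d p q) (ι : ∀ t : faces F, chart (cone t.1) ⟶ X)
    (j : projSpace 1 ⟶ X) : Prop :=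
  ∀ i, awayEmb i ≫ j = wallMap a b (d i) i ≫ ι (IsToric.facet (w.mem i))

lemma edge_mem (w : IsWall F a b d p q) : {a, b} ∈ faces F :=
  ⟨_, w.mem 0, edge_subset _ _ _⟩

lemma wallMap_overlap (w : IsWall F a b d p q) (h : IsToric F X s ι) {B : Type} [CommRing B]
    [Algebra ℂ B] (u : Bˣ) (i : Fin 2) (f : AwayX (N := 1) i →ₐ[ℂ] B)
    (hf : f (awayRatio (N := 1) i (i + 1)) = u) :
    Spec.map (CommRingCat.ofHom f.toRingHom) ≫ wallMap a b (d i) i ≫ ι (IsToric.facet (w.mem i)) =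
      Spec.map (CommRingCat.ofHom (edgeHom a b (d i) u).toRingHom) ≫ ι ⟨{a, b}, edge_mem w⟩ := by
  have h1 := comp_wallHom (a := a) (b := b) (e := d i) f (awayRatio (N := 1) i (i + 1))
  rw [hf, wallHom_eq w.ne (w.ne_left i) (w.ne_right i)] at h1
  have h2 := h.compatible ⟨{a, b}, edge_mem w⟩ (IsToric.facet (w.mem i)) (edge_subset _ _ _)
  rw [← h2, chartMap_eq]
  refine (Category.assoc _ _ _).symm.trans (Eq.trans ?_ (Category.assoc _ _ _))
  refine congrArg (fun f => f ≫ ι (IsToric.facet (w.mem i))) ?_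
  refine (Spec.map_comp _ _).symm.trans (Eq.trans ?_ (Spec.map_comp _ _))
  exact congrArg (fun f : chartRing (cone {a, b, d i}) →ₐ[ℂ] B =>
    Spec.map (CommRingCat.ofHom f.toRingHom)) h1

lemma exists_isWallCurve (w : IsWall F a b d p q) (h : IsToric F X s ι) :
    ∃ j, IsWallCurve w ι j := by
  let g : ∀ i : Fin 2, Spec (CommRingCat.of (AwayX (N := 1) i)) ⟶ X :=
    fun i => wallMap a b (d i) i ≫ ι (IsToric.facet (w.mem i))
  have hg : ∀ x y : Fin 2, pullback.fst (awayEmb (N := 1) x) (awayEmb y) ≫ g x =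
      pullback.snd (awayEmb (N := 1) x) (awayEmb y) ≫ g y := by
    intro i k
    rcases eq_or_eq_add_one i k with rfl | rfl
    · have : pullback.fst (awayEmb (N := 1) k) (awayEmb k) = pullback.snd _ _ := by
        rw [← cancel_mono (awayEmb (N := 1) k), pullback.condition]
      rw [this]
    · let x : MvPolynomial (Fin 2) ℂ := MvPolynomial.X i * MvPolynomial.X (i + 1)
      have hx : x = MvPolynomial.X i * MvPolynomial.X (i + 1) := rfl
      have hx' : x = MvPolynomial.X (i + 1) * MvPolynomial.X i := mul_comm _ _
      let L := HomogeneousLocalization.Away (stdGrading 1) x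
      let f₁ := HomogeneousLocalization.awayMap (stdGrading 1) (X_mem_stdGrading (N := 1) (i + 1)) hx
      let f₂ := HomogeneousLocalization.awayMap (stdGrading 1) (X_mem_stdGrading (N := 1) i) hx'
      let : Algebra ℂ L := (f₁.comp (algebraMap ℂ (AwayX (N := 1) i))).toAlgebra
      let φ₁ : AwayX (N := 1) i →ₐ[ℂ] L := { f₁ with commutes' := fun _ => rfl }
      let φ₂ : AwayX (N := 1) (i + 1) →ₐ[ℂ] L := { f₂ with
        commutes' := fun z => HomogeneousLocalization.val_injective _
          ((val_awayMap_algebraMap (N := 1) (X_mem_stdGrading i) hx' z).trans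
            (val_awayMap_algebraMap (N := 1) (X_mem_stdGrading (i + 1)) hx z).symm) }
      -- On the overlap of the two standard charts the affine coordinates are inverse units,
      -- matching the inversion in `edgeHom_opposite`.
      have hmul : φ₁ (awayRatio (N := 1) i (i + 1)) * φ₂ (awayRatio (N := 1) (i + 1) i) = 1 :=
        awayMap_ratio_mul (N := 1) i (i + 1) hx hx'
      let u : Lˣ := ⟨_, _, hmul, (mul_comm _ _).trans hmul⟩
      have h₁ := wallMap_overlap w h u i φ₁ rfl
      have hi : i + 1 + 1 = i := by fin_cases i <;> rfl
      have h₂ := wallMap_overlap w h u⁻¹ (i + 1) φ₂ (by rw [hi]; rfl)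
      rw [edgeHom_opposite w i u, ← h₁] at h₂
      have e₁ := Proj.pullbackAwayιIso_inv_fst_assoc (stdGrading 1) (X_mem_stdGrading (N := 1) i)
        Nat.one_pos (X_mem_stdGrading (N := 1) (i + 1)) Nat.one_pos hx (g i)
      have e₂ := Proj.pullbackAwayιIso_inv_snd_assoc (stdGrading 1) (X_mem_stdGrading (N := 1) i)
        Nat.one_pos (X_mem_stdGrading (N := 1) (i + 1)) Nat.one_pos hx (g (i + 1))
      let e := Proj.pullbackAwayιIso (stdGrading 1) (X_mem_stdGrading (N := 1) i)
        Nat.one_pos (X_mem_stdGrading (N := 1) (i + 1)) Nat.one_pos hx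
      have : Epi e.inv := inferInstance
      exact (cancel_epi e.inv).1 (e₁.trans (h₂.symm.trans e₂.symm))
  refine ⟨(projCover 1).glueMorphisms g hg, fun i => ?_⟩
  exact (projCover 1).ι_glueMorphisms g hg i

namespace IsWallCurve

variable {w : IsWall F a b d p q} {j : projSpace 1 ⟶ X}

lemma apply (hj : IsWallCurve w ι j) (i : Fin 2) (y : Spec (CommRingCat.of (AwayX (N := 1) i))) :
    j (awayEmb i y) = ι (IsToric.facet (w.mem i)) (wallMap a b (d i) i y) :=
  congrArg (fun f => f y) (hj i)

lemma comp_structure (hj : IsWallCurve w ι j) (h : IsToric F X s ι) :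
    j ≫ s = projSpaceToSpecC 1 := by
  refine (projCover 1).hom_ext _ _ fun (i : Fin 2) => ?_
  change awayEmb (N := 1) i ≫ j ≫ s = awayEmb (N := 1) i ≫ projSpaceToSpecC 1
  rw [← Category.assoc, hj i, Category.assoc, h.structureMap, awayEmb_structure]
  refine (Spec.map_comp _ _).symm.trans (congrArg Spec.map ?_)
  refine congrArg CommRingCat.ofHom (RingHom.ext fun z => ?_)
  exact (wallHom a b (d i) (awayRatio (N := 1) i (i + 1))).commutes z

lemma exists_awayEmb (x : projSpace 1) : ∃ (i : Fin 2) (y : _), awayEmb (N := 1) i y = x := by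
  obtain ⟨i, hi⟩ := exists_mem_coordOpen (N := 1) x
  rw [← opensRange_awayEmb] at hi
  exact ⟨i, hi⟩

lemma vanishes_wallMap (hc : ∀ c ∈ F, Unimodular c) (w : IsWall F a b d p q) {i : Fin 2}
    {r : Fin 7} (hr : r ∈ ({a, b, d i} : Finset (Fin 7)))
    (y : PrimeSpectrum (AwayX (N := 1) i)) :
    Vanishes (chi (dualVec_mem (hc _ (w.mem i)) subset_rfl hr)) (wallMap a b (d i) i y) ↔
      (r = d i → awayRatio (N := 1) i (i + 1) ∈ y.asIdeal) := by
  change wallHom a b (d i) (awayRatio (N := 1) i (i + 1)) (chi _) ∈ y.asIdeal ↔ _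
  rw [wallHom_chi_dualVec (hc _ (w.mem i)) _ hr]
  split_ifs with h
  · simp [h]
  · simp [h]

lemma mem_orbitClosure (hj : IsWallCurve w ι j) (h : IsToric F X s ι) (x : projSpace 1) :
    j x ∈ IsToric.orbitClosure ι {a, b} := by
  obtain ⟨i, y, rfl⟩ := exists_awayEmb x
  rw [hj.apply, h.mem_orbitClosure_iff (w.mem i)]
  refine ⟨edge_subset _ _ _, fun r hr hab => ?_⟩
  refine (vanishes_wallMap h.unimodular w hr y).2 ?_
  rintro rfl
  simp only [Finset.mem_insert, Finset.mem_singleton] at hab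
  exact (hab.elim (w.ne_left i) (w.ne_right i)).elim

lemma range_eq (hj : IsWallCurve w ι j) (h : IsToric F X s ι) :
    Set.range j = IsToric.orbitClosure ι {a, b} := by
  refine Set.Subset.antisymm ?_ fun z hz => ?_
  · rintro _ ⟨x, rfl⟩
    exact hj.mem_orbitClosure h x
  · obtain ⟨c, hc, v, rfl⟩ := h.exists_facet z
    obtain ⟨hsub, hv⟩ := (h.mem_orbitClosure_iff hc v _).1 hz
    obtain ⟨i, rfl⟩ := w.exists_eq c hc (hsub (by simp)) (hsub (by simp))
    have hu := h.unimodular _ hc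
    have hmem : v ∈ Set.range (wallMap a b (d i) i) := by
      have h1 := range_comap_of_surjective _
        (wallHom a b (d i) (awayRatio (N := 1) i (i + 1))).toRingHom (wallHom_surjective hu i)
      change v ∈ Set.range (PrimeSpectrum.comap
        (wallHom a b (d i) (awayRatio (N := 1) i (i + 1))).toRingHom)
      rw [h1]
      refine (show RingHom.ker (wallHom a b (d i) (awayRatio (N := 1) i (i + 1))) ≤
        PrimeSpectrum.asIdeal (R := chartRing (cone {a, b, d i})) v from ?_)
      rw [ker_wallHom hu (w.ne_left i) (w.ne_right i) i (by simp) (by simp)]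
      refine Ideal.span_le.2 ?_
      intro g hg
      have hg' : g = _ ∨ g = _ := hg
      rcases hg' with rfl | rfl
      · exact hv a (by simp) (by simp)
      · exact hv b (by simp) (by simp)
    obtain ⟨y, rfl⟩ := hmem
    exact ⟨awayEmb (N := 1) i y, hj.apply i y⟩

/-- The curve meets the chart of one of the two facets in exactly one standard affine line. A point
of the other line with image in this chart lies in the chart of the edge, so its parameter is
nonzero and it belongs to both lines. -/
lemma isPullback (hj : IsWallCurve w ι j) (h : IsToric F X s ι) (i : Fin 2) :
    IsPullback (wallMap a b (d i) i) (awayEmb (N := 1) i) (ι (IsToric.facet (w.mem i))) j := by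
  have := h.openImmersion (IsToric.facet (w.mem i))
  refine IsOpenImmersion.isPullback _ _ _ _ (hj i) ?_
  rw [opensRange_awayEmb]
  ext x
  symm
  refine ⟨fun hx => ?_, fun hx => ?_⟩
  · rw [← opensRange_awayEmb] at hx
    obtain ⟨y, rfl⟩ := hx
    exact ⟨_, (hj.apply i y).symm⟩
  · obtain ⟨k, y, rfl⟩ := exists_awayEmb x
    rcases eq_or_eq_add_one i k with rfl | rfl
    · rw [SetLike.mem_coe, ← opensRange_awayEmb]
      exact ⟨y, rfl⟩
    · have hx : ι (IsToric.facet (w.mem (i + 1))) (wallMap a b (d (i + 1)) (i + 1) y) ∈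
          Set.range (ι (IsToric.facet (w.mem i))) := by
        rw [← hj.apply]
        exact hx
      have h1 := h.inter _ _ _ ⟨_, rfl⟩ hx
      rw [h.mem_range_iff Finset.inter_subset_left,
        mem_range_chartMap_iff (h.unimodular _ (w.mem (i + 1))) subset_rfl
          Finset.inter_subset_left] at h1
      have h2 := h1 (d (i + 1)) (by simp) (by simp) (by
        simp [w.ne_left, w.ne_right, w.ne_opposite])
      rw [not_iff_not.2 (vanishes_wallMap h.unimodular w (by simp) y)] at h2
      have hi : i + 1 + 1 = i := by fin_cases i <;> rfl
      rw [hi] at h2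
      exact (awayEmb_mem_coordOpen (N := 1) (i + 1) i y).2 fun h3 => h2 fun _ => h3

lemma edge_subset_of_mem (hj : IsWallCurve w ι j) (h : IsToric F X s ι) {c : Finset (Fin 7)}
    (hc : c ∈ F) (x : projSpace 1) (hx : j x ∈ Set.range (ι (IsToric.facet hc))) :
    ∃ i, c = {a, b, d i} := by
  have h1 := hj.mem_orbitClosure h x _ hx
  exact w.exists_eq c hc (h1 (by simp)) (h1 (by simp))

lemma isEmpty_pullback (hj : IsWallCurve w ι j) (h : IsToric F X s ι) {c : Finset (Fin 7)}
    (hc : c ∈ F) (hn : ∀ i, c ≠ {a, b, d i}) :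
    IsEmpty ↥(pullback (ι (IsToric.facet hc)) j) := by
  refine ⟨fun z => ?_⟩
  obtain ⟨i, hi⟩ := hj.edge_subset_of_mem h hc (pullback.snd (ι (IsToric.facet hc)) j z)
    ⟨pullback.fst (ι (IsToric.facet hc)) j z, by
      rw [← Scheme.Hom.comp_apply, pullback.condition, Scheme.Hom.comp_apply]⟩
  exact hn i hi

/-- Over a facet containing the edge the curve is the spectrum of a surjection; over any other facet
its preimage is empty. -/
lemma isClosedImmersion (hj : IsWallCurve w ι j) (h : IsToric F X s ι) : IsClosedImmersion j := by
  refine IsZariskiLocalAtTarget.of_openCover (P := @IsClosedImmersion) h.openCover fun c => ?_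
  change IsClosedImmersion (pullback.snd j (ι (IsToric.facet c.2)))
  rw [← pullbackSymmetry_hom_comp_fst]
  refine (MorphismProperty.cancel_left_of_respectsIso @IsClosedImmersion _ _).2 ?_
  by_cases hn : ∃ i, c.1 = {a, b, d i}
  · obtain ⟨c, hc⟩ := c
    obtain ⟨i, hi⟩ := hn
    dsimp at hi
    subst hi
    have h1 : (hj.isPullback h i).isoPullback.inv ≫ wallMap a b (d i) i =
      pullback.fst (ι (IsToric.facet hc)) j := (hj.isPullback h i).isoPullback_inv_fst
    rw [← h1]
    refine (MorphismProperty.cancel_left_of_respectsIso @IsClosedImmersion _ _).2 ?_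
    exact IsClosedImmersion.spec_of_surjective _ (wallHom_surjective (h.unimodular _ hc) i)
  · have := hj.isEmpty_pullback h c.2 (not_exists.1 hn)
    infer_instance

lemma specIdeal_ker_comap (hj : IsWallCurve w ι j) (h : IsToric F X s ι) {c : Finset (Fin 7)}
    (hc : c ∈ F) (ha : a ∈ c) (hb : b ∈ c) :
    specIdeal (R := CommRingCat.of (chartRing (cone c))) (j.ker.comap (ι (IsToric.facet hc))) =
      Ideal.span {chi (dualVec_mem (h.unimodular _ hc) subset_rfl ha),
        chi (dualVec_mem (h.unimodular _ hc) subset_rfl hb)} := by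
  have := hj.isClosedImmersion h
  obtain ⟨i, rfl⟩ := w.exists_eq c hc ha hb
  have h1 : (hj.isPullback h i).isoPullback.inv ≫ wallMap a b (d i) i =
      pullback.fst (ι (IsToric.facet hc)) j := (hj.isPullback h i).isoPullback_inv_fst
  have h2 : j.ker.comap (ι (IsToric.facet hc)) = (wallMap a b (d i) i).ker := by
    rw [← Scheme.IdealSheafData.ker_fst_of_isClosedImmersion, ← h1, Scheme.Hom.ker_comp_of_isIso]
  exact (congrArg (specIdeal (R := CommRingCat.of (chartRing (cone {a, b, d i})))) h2).trans <|
    (specIdeal_ker _).trans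
    (ker_wallHom (h.unimodular _ hc) (w.ne_left i) (w.ne_right i) i ha hb)

lemma ker_comap_eq_top (hj : IsWallCurve w ι j) (h : IsToric F X s ι) {c : Finset (Fin 7)}
    (hc : c ∈ F) (hn : ¬ (a ∈ c ∧ b ∈ c)) : j.ker.comap (ι (IsToric.facet hc)) = ⊤ := by
  have := hj.isClosedImmersion h
  rw [← Scheme.IdealSheafData.ker_fst_of_isClosedImmersion, Scheme.Hom.ker_eq_top_iff_isEmpty]
  refine hj.isEmpty_pullback h hc ?_
  rintro i rfl
  exact hn (by simp)

end IsWallCurve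

end

section

/-! ### Blowups by local lifting -/

lemma IsInvertiblePrincipal.map_localization {R S : Type*} [CommRing R] [CommRing S] [Algebra R S]
    (M : Submonoid R) [IsLocalization M S] {I : Ideal R} (h : IsInvertiblePrincipal I) :
    IsInvertiblePrincipal (I.map (algebraMap R S)) := by
  obtain ⟨f, hf, rfl⟩ := h
  refine ⟨algebraMap R S f, IsLocalization.map_nonZeroDivisors_le M S ⟨f, hf, rfl⟩, ?_⟩
  rw [Ideal.map_span, Set.image_singleton]

/-- The inclusion of a principal open subset. -/
abbrev awayMap (R : CommRingCat.{0}) (r : R) : Spec (CommRingCat.of (Localization.Away r)) ⟶ Spec R :=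
  Spec.map (CommRingCat.ofHom (algebraMap R (Localization.Away r)))

instance (R : CommRingCat.{0}) (r : R) : IsOpenImmersion (awayMap R r) :=
  IsOpenImmersion.of_isLocalization r

lemma range_awayMap (R : CommRingCat.{0}) (r : R) :
    Set.range (awayMap R r) = {x : PrimeSpectrum R | r ∉ x.asIdeal} :=
  PrimeSpectrum.localization_away_comap_range (Localization.Away r) r

lemma exists_range_subset {W : Scheme.{0}} {R : CommRingCat.{0}} (k : Spec R ⟶ W)
    [IsOpenImmersion k] {U : Set W} (hU : IsOpen U) {y : W} (hy : y ∈ Set.range k) (hyU : y ∈ U) :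
    ∃ r : R, y ∈ Set.range (awayMap R r ≫ k) ∧ Set.range (awayMap R r ≫ k) ⊆ U := by
  obtain ⟨x, rfl⟩ := hy
  obtain ⟨_, ⟨r, rfl⟩, hx, hr⟩ := PrimeSpectrum.isTopologicalBasis_basic_opens.isOpen_iff.1
    (hU.preimage k.continuous) x hyU
  refine ⟨r, ?_, ?_⟩
  · obtain ⟨z, rfl⟩ := (range_awayMap R r).ge hx
    exact ⟨z, rfl⟩
  · rintro _ ⟨z, rfl⟩
    exact hr ((range_awayMap R r).le ⟨z, rfl⟩)

/-- The inverse image of an ideal sheaf is locally generated by one nonzerodivisor. -/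
def IsLocallyInvertible {W X : Scheme.{0}} (J : X.IdealSheafData) (g : W ⟶ X) : Prop :=
  ∀ y : W, ∃ (R : CommRingCat.{0}) (k : Spec R ⟶ W),
    IsOpenImmersion k ∧ y ∈ Set.range k ∧ IsInvertiblePrincipal (specIdeal (J.comap (k ≫ g)))

lemma isEffectiveCartier_pullback_iff {W X Z : Scheme.{0}} (g : W ⟶ X) (j : Z ⟶ X)
    [IsClosedImmersion j] :
    IsEffectiveCartier (pullback.fst g j) ↔ IsLocallyInvertible j.ker g := by
  have : IsClosedImmersion (pullback.fst g j) := inferInstance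
  rw [isEffectiveCartier_iff, and_iff_right this]
  simp only [Scheme.IdealSheafData.ker_fst_of_isClosedImmersion, IsLocallyInvertible,
    Scheme.IdealSheafData.comap_comp]

lemma IsInvertiblePrincipal.shrink {X : Scheme.{0}} {J : X.IdealSheafData} {R : CommRingCat.{0}}
    {g : Spec R ⟶ X} (h : IsInvertiblePrincipal (specIdeal (J.comap g))) (r : R) :
    IsInvertiblePrincipal (specIdeal (J.comap (awayMap R r ≫ g))) := by
  rw [Scheme.IdealSheafData.comap_comp, specIdeal_comap]
  exact h.map_localization (Submonoid.powers r)

namespace IsLocallyInvertible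

variable {W X : Scheme.{0}} {J : X.IdealSheafData} {g : W ⟶ X}

lemma exists_subset (h : IsLocallyInvertible J g) {y : W} {U : Set W} (hU : IsOpen U)
    (hy : y ∈ U) : ∃ (R : CommRingCat.{0}) (k : Spec R ⟶ W), IsOpenImmersion k ∧
      y ∈ Set.range k ∧ Set.range k ⊆ U ∧ IsInvertiblePrincipal (specIdeal (J.comap (k ≫ g))) := by
  obtain ⟨R, k, _, hk, hI⟩ := h y
  obtain ⟨r, h1, h2⟩ := exists_range_subset k hU hk hy
  refine ⟨_, awayMap R r ≫ k, inferInstance, h1, h2, ?_⟩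
  rw [Category.assoc]
  exact hI.shrink r

lemma comp (h : IsLocallyInvertible J g) {W' : Scheme.{0}} (e : W' ⟶ W) [IsOpenImmersion e] :
    IsLocallyInvertible J (e ≫ g) := by
  intro y
  obtain ⟨R, k, _, hk, hsub, hI⟩ := h.exists_subset e.isOpenEmbedding.isOpen_range ⟨y, rfl⟩
  have hfac := IsOpenImmersion.lift_fac e k hsub
  have : IsOpenImmersion (IsOpenImmersion.lift e k hsub ≫ e) := by
    rw [hfac]
    assumption
  refine ⟨R, IsOpenImmersion.lift e k hsub, IsOpenImmersion.of_comp _ e, ?_, ?_⟩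
  · obtain ⟨z, hz⟩ := hk
    refine ⟨z, e.isOpenEmbedding.injective ?_⟩
    rw [← Scheme.Hom.comp_apply, hfac, hz]
  · rw [← Category.assoc, hfac]
    exact hI

/-- The local hypotheses range over all schemes `W`, so uniqueness applies to the overlaps of the
cover on which lifts exist, and the local lifts glue. -/
lemma existsUnique_lift {X' : Scheme.{0}} {p : X' ⟶ X}
    (huniq : ∀ (W : Scheme.{0}) (g : W ⟶ X) (h₁ h₂ : W ⟶ X'), IsLocallyInvertible J g →
      h₁ ≫ p = g → h₂ ≫ p = g → ∀ y : W, ∃ (R : CommRingCat.{0}) (k : Spec R ⟶ W),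
        IsOpenImmersion k ∧ y ∈ Set.range k ∧ k ≫ h₁ = k ≫ h₂)
    (hlocal : ∀ (W : Scheme.{0}) (g : W ⟶ X), IsLocallyInvertible J g → ∀ y : W,
      ∃ (R : CommRingCat.{0}) (k : Spec R ⟶ W) (h : Spec R ⟶ X'),
        IsOpenImmersion k ∧ y ∈ Set.range k ∧ h ≫ p = k ≫ g)
    (h : IsLocallyInvertible J g) : ∃! f : W ⟶ X', f ≫ p = g := by
  let cov : ∀ (W : Scheme.{0}) (R : W → CommRingCat.{0}) (k : ∀ y, Spec (R y) ⟶ W)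
      (_ : ∀ y, IsOpenImmersion (k y)) (_ : ∀ y, y ∈ Set.range (k y)), W.OpenCover :=
    fun W R k hk hy =>
      { I₀ := W, X := fun y => Spec (R y), f := k
        mem₀ := by
          rw [Scheme.presieve₀_mem_precoverage_iff]
          exact ⟨fun y => ⟨y, hy y⟩, hk⟩ }
  have huniq' : ∀ (W : Scheme.{0}) (g : W ⟶ X) (h₁ h₂ : W ⟶ X'), IsLocallyInvertible J g →
      h₁ ≫ p = g → h₂ ≫ p = g → h₁ = h₂ := by
    intro W g h₁ h₂ hg e₁ e₂
    choose R k hk hy hkh using huniq W g h₁ h₂ hg e₁ e₂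
    exact (cov W R k hk hy).hom_ext _ _ hkh
  choose R k f hk hy hf using hlocal W g h
  have hglue : ∀ x y : W, pullback.fst (k x) (k y) ≫ f x = pullback.snd (k x) (k y) ≫ f y := by
    intro x y
    refine huniq' _ (pullback.fst (k x) (k y) ≫ k x ≫ g) _ _ ?_ ?_ ?_
    · have := hk x
      have := hk y
      exact (h.comp (k x)).comp (pullback.fst (k x) (k y))
    · rw [Category.assoc, hf]
    · rw [Category.assoc, hf, pullback.condition_assoc]
  refine ⟨(cov W R k hk hy).glueMorphisms f hglue, ?_, fun f' hf' => ?_⟩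
  · refine (cov W R k hk hy).hom_ext _ _ fun y => ?_
    rw [← Category.assoc, (cov W R k hk hy).ι_glueMorphisms f hglue y]
    exact hf y
  · refine (cov W R k hk hy).hom_ext _ _ fun y => ?_
    rw [(cov W R k hk hy).ι_glueMorphisms f hglue y]
    have := hk y
    exact huniq' _ (k y ≫ g) _ _ (h.comp (k y)) (by
      rw [Category.assoc, hf']) (hf y)

end IsLocallyInvertible

/-- For a pair of elements generating an invertible principal ideal, locally one of the two
divides the other. -/
lemma exists_dvd_of_isInvertiblePrincipal {R : Type*} [CommRing R] {x y : R}
    (h : IsInvertiblePrincipal (Ideal.span {x, y})) (P : PrimeSpectrum R) :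
    ∃ r ∉ P.asIdeal, x ∣ r * y ∨ y ∣ r * x := by
  obtain ⟨f, hf, hI⟩ := h
  have hx : x ∈ Ideal.span {f} := hI ▸ Ideal.subset_span (Or.inl rfl)
  have hy : y ∈ Ideal.span {f} := hI ▸ Ideal.subset_span (Or.inr rfl)
  have hf' : f ∈ Ideal.span {x, y} := hI ▸ Ideal.subset_span rfl
  obtain ⟨α, rfl⟩ := Ideal.mem_span_singleton.1 hx
  obtain ⟨β, rfl⟩ := Ideal.mem_span_singleton.1 hy
  obtain ⟨s, t, hst⟩ := Ideal.mem_span_pair.1 hf'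
  -- Cancelling the nonzerodivisor f in f = s(αf) + t(βf). So α and β are not both in the prime, and
  -- α y = β x makes the one outside it the required multiplier.
  have h1 : s * α + t * β = 1 := by
    have : (s * α + t * β - 1) * f = 0 := by linear_combination hst
    exact sub_eq_zero.1 ((mem_nonZeroDivisors_iff.1 hf).2 _ this)
  by_cases hα : α ∈ P.asIdeal
  · refine ⟨β, fun hβ => P.isPrime.ne_top <| (Ideal.eq_top_iff_one _).2 <|
      h1 ▸ add_mem (Ideal.mul_mem_left _ _ hα) (Ideal.mul_mem_left _ _ hβ), Or.inr ⟨α, by ring⟩⟩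
  · exact ⟨α, hα, Or.inl ⟨β, by ring⟩⟩

/-- A generator of an invertible principal ideal is a nonzerodivisor. -/
lemma mem_nonZeroDivisors_of_isInvertiblePrincipal {R : Type*} [CommRing R] {x : R}
    (h : IsInvertiblePrincipal (Ideal.span {x})) : x ∈ nonZeroDivisors R := by
  obtain ⟨f, hf, hI⟩ := h
  have hf' : f ∈ Ideal.span {x} := hI ▸ Ideal.subset_span rfl
  obtain ⟨α, rfl⟩ := Ideal.mem_span_singleton.1 hf'
  exact (mul_mem_nonZeroDivisors.1 hf).1

end

section

/-! ### The charts of a star subdivision -/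

instance {n : ℕ} (σ : Cone n) : IsDomain (chartRing σ) := by
  have hinj : Function.Injective
      (AddMonoidAlgebra.mapDomainRingHom ℂ (dualMonoid σ).subtype) :=
    AddMonoidAlgebra.mapDomain_injective (dualMonoid σ).subtype_injective
  exact hinj.isDomain _

/-- `c` is a unimodular facet with distinct rays `x` and `y`, whose sum is the new ray `n`. -/
structure IsBlownFacet (c : Finset (Fin 7)) (n x y : Fin 7) : Prop where
  unimodular : Unimodular c
  left : x ∈ c
  right : y ∈ c
  ne : x ≠ y
  notMem : n ∉ c
  sum : rho n = rho x + rho y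

/-- The facet of the subdivision in which the new ray replaces `x`. -/
abbrev replaced (c : Finset (Fin 7)) (n x : Fin 7) : Finset (Fin 7) := insert n (c.erase x)

namespace IsBlownFacet

variable {c : Finset (Fin 7)} {n x y : Fin 7}

lemma cone_le (h : IsBlownFacet c n x y) : cone (replaced c n x) ≤ cone c := by
  refine (cone_le_carrier h.sum _).trans (cone_mono ?_)
  intro r
  simp only [carrier, replaced, Finset.mem_insert_self, if_true, Finset.mem_insert, Finset.mem_erase]
  rintro (rfl | rfl | ⟨h1, h2 | h2⟩)
  exacts [h.left, h.right, absurd h2 h1, h2.2]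

lemma dotProduct_new (h : IsBlownFacet c n x y) (m : Fin 3 → ℤ) :
    m ⬝ᵥ rho n = m ⬝ᵥ rho x + m ⬝ᵥ rho y := by
  rw [h.sum, dotProduct_add]

/-- In the basis where `n` replaces `x`, the dual vector of `n` is `dualVec c x`, and that of `y` is
this difference. So the new coordinates are x_x and the quotient x_y / x_x, the other coordinate
being unchanged. -/
lemma sub_dotProduct_of_mem (h : IsBlownFacet c n x y) {r : Fin 7} (hr : r ∈ replaced c n x) :
    (dualVec c y - dualVec c x) ⬝ᵥ rho r = if r = y then 1 else 0 := by
  have hd := h.unimodular.dual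
  have hx := h.left
  have hy := h.right
  have hxy := h.ne
  rcases Finset.mem_insert.1 hr with rfl | hr
  · have hry : r ≠ y := fun e => h.notMem (e ▸ hy)
    rw [h.dotProduct_new, sub_dotProduct, sub_dotProduct, hd y hy x hx, hd y hy y hy, hd x hx x hx,
      hd x hx y hy]
    simp [hxy, hxy.symm, hry]
  · obtain ⟨h1, h2⟩ := Finset.mem_erase.1 hr
    rw [sub_dotProduct, hd y hy r h2, hd x hx r h2, if_neg h1.symm, sub_zero]
    simp only [eq_comm]

lemma sub_mem (h : IsBlownFacet c n x y) :
    dualVec c y - dualVec c x ∈ dualMonoid (cone (replaced c n x)) :=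
  mem_dualMonoid_cone.2 fun r hr => by
    rw [h.sub_dotProduct_of_mem hr]
    split_ifs <;> norm_num

/-- The coordinate of a ray in the chart of the facet. -/
abbrev coord (h : IsBlownFacet c n x y) {r : Fin 7} (hr : r ∈ c) : chartRing (cone c) :=
  chi (dualVec_mem h.unimodular subset_rfl hr)

lemma chartHom_coord (h : IsBlownFacet c n x y) :
    chartHom h.cone_le (h.coord h.right) = chartHom h.cone_le (h.coord h.left) * chi h.sub_mem := by
  rw [chartHom_chi, chartHom_chi, ← chi_add]
  exact chi_congr (add_sub_cancel _ _).symm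

lemma map_span (h : IsBlownFacet c n x y) :
    (Ideal.span {h.coord h.left, h.coord h.right}).map (chartHom h.cone_le).toRingHom =
      Ideal.span {chartHom h.cone_le (h.coord h.left)} := by
  rw [Ideal.map_span, Set.image_pair]
  change Ideal.span {chartHom h.cone_le (h.coord h.left), chartHom h.cone_le (h.coord h.right)} = _
  refine le_antisymm (Ideal.span_le.2 ?_) (Ideal.span_mono (by simp))
  rintro _ (rfl | rfl)
  · exact Ideal.subset_span rfl
  · rw [h.chartHom_coord]
    exact Ideal.mul_mem_right _ _ (Ideal.subset_span rfl)

/-- Only the pairing with ρ_x can be negative, and the condition at the new ray bounds it below by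
minus the pairing with ρ_y. -/
lemma exists_add_mem (h : IsBlownFacet c n x y) {m : Fin 3 → ℤ}
    (hm : m ∈ dualMonoid (cone (replaced c n x))) :
    ∃ k : ℕ, m + k • dualVec c x ∈ dualMonoid (cone c) := by
  have hm' := mem_dualMonoid_cone.1 hm
  refine ⟨(m ⬝ᵥ rho y).toNat, mem_dualMonoid_cone.2 fun r hr => ?_⟩
  rw [add_dotProduct, smul_dotProduct, h.unimodular.dual x h.left r hr]
  split_ifs with e
  · subst e
    have h1 := hm' n (Finset.mem_insert_self _ _)
    rw [h.dotProduct_new] at h1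
    simp only [nsmul_eq_mul, mul_one]
    omega
  · rw [smul_zero, add_zero]
    exact hm' r (Finset.mem_insert_of_mem (Finset.mem_erase.2 ⟨Ne.symm e, hr⟩))

/-- A power of the exceptional equation moves every character into the ring of the original chart,
and it can be cancelled because it is a nonzerodivisor. -/
lemma hom_ext (h : IsBlownFacet c n x y) {S : Type*} [CommRing S]
    {f g : chartRing (cone (replaced c n x)) →+* S}
    (hfg : f.comp (chartHom h.cone_le).toRingHom = g.comp (chartHom h.cone_le).toRingHom)
    (hf : f (chartHom h.cone_le (h.coord h.left)) ∈ nonZeroDivisors S) : f = g := by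
  have hfg' : ∀ z, f (chartHom h.cone_le z) = g (chartHom h.cone_le z) := RingHom.congr_fun hfg
  refine chartRing_ringHom_ext (fun a => ?_) fun m hm => ?_
  · have := hfg' (algebraMap ℂ _ a)
    rwa [AlgHom.commutes] at this
  · obtain ⟨k, hk⟩ := h.exists_add_mem hm
    have hx : dualVec c x ∈ dualMonoid (cone (replaced c n x)) :=
      dualMonoid_anti h.cone_le (dualVec_mem h.unimodular subset_rfl h.left)
    have h1 : chartHom h.cone_le (chi hk) =
        chi hm * chartHom h.cone_le (h.coord h.left) ^ k := by
      rw [chartHom_chi, chartHom_chi, ← chi_nsmul, ← chi_add]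
    have h2 := hfg' (chi hk)
    rw [h1, map_mul, map_mul, map_pow, map_pow, ← hfg' (h.coord h.left)] at h2
    exact (mul_cancel_right_mem_nonZeroDivisors (pow_mem hf k)).1 h2

/-- The quotient of the two images plays the part of x_y / x_x: it becomes the value at `y`, while
`n` receives the image of the coordinate of `x`. -/
lemma exists_lift (h : IsBlownFacet c n x y) {S : Type*} [CommRing S]
    (φ : chartRing (cone c) →+* S) (hφ : φ (h.coord h.left) ∣ φ (h.coord h.right)) :
    ∃ ψ : chartRing (cone (replaced c n x)) →+* S, ψ.comp (chartHom h.cone_le).toRingHom = φ := by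
  obtain ⟨q, hq⟩ := hφ
  let : Algebra ℂ S := (φ.comp (algebraMap ℂ _)).toAlgebra
  have hd := h.unimodular.dual
  let v : Fin 7 → S := fun r => if r = n then φ (h.coord h.left) else if r = y then q else
    if hr : r ∈ c then φ (h.coord hr) else 0
  refine ⟨(chartLift (replaced c n x) ∅ v 1).toRingHom,
    chartRing_cone_ringHom_ext h.unimodular subset_rfl (fun a => ?_) fun r hr => ?_⟩
  · change chartLift (replaced c n x) ∅ v 1 (chartHom h.cone_le _) = _
    rw [AlgHom.commutes, AlgHom.commutes]
    rfl
  change chartLift (replaced c n x) ∅ v 1 (chartHom h.cone_le _) = _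
  have hv : ∀ r ∈ c, ∏ i ∈ c.erase x, v i ^ (dualVec c r ⬝ᵥ rho i).toNat =
      if r = x then 1 else v r := by
    intro r hr
    rw [Finset.prod_congr rfl (g := fun i => if i = r then v i else 1)]
    · rw [Finset.prod_ite_eq']
      by_cases e : r = x <;> simp [e, hr]
    · intro i hi
      rw [hd r hr i (Finset.mem_of_mem_erase hi)]
      simp only [eq_comm (a := r)]
      split_ifs <;> simp
  have hn : n ∉ c.erase x := fun e => h.notMem (Finset.mem_of_mem_erase e)
  rw [chartHom_chi, chartLift_chi, Finset.prod_empty, mul_one, Finset.prod_insert hn, hv r hr,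
    h.dotProduct_new, hd r hr x h.left, hd r hr y h.right]
  have hvn : v n = φ (h.coord h.left) := if_pos rfl
  have hyn : y ≠ n := fun e => h.notMem (e ▸ h.right)
  have hrn : r ≠ n := fun e => h.notMem (e ▸ hr)
  by_cases e : r = x
  · subst e
    simp [h.ne, hvn]
  · by_cases e' : r = y
    · subst e'
      have hvr : v r = q := (if_neg hrn).trans (if_pos rfl)
      simp [h.ne.symm, hvn, hvr, hq]
    · have hvr : v r = φ (h.coord hr) :=
        (if_neg hrn).trans ((if_neg e').trans (dif_pos hr))
      simp [e, e', hvr]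

lemma mem_range_of_not_vanishes (h : IsBlownFacet c n x y) (hu : Unimodular (replaced c n x))
    {z : chart (cone (replaced c n x))} (hz : ¬ Vanishes (chi h.sub_mem) z) :
    z ∈ Set.range (chartMap (cone_mono (Finset.erase_subset y (replaced c n x)))) := by
  refine mem_range_chartMap hu subset_rfl (Finset.erase_subset y _) h.sub_mem (fun r hr h0 => ?_) hz
  rw [h.sub_dotProduct_of_mem hr] at h0
  refine Finset.mem_erase.2 ⟨fun e => ?_, hr⟩
  rw [if_pos e] at h0
  exact one_ne_zero h0

end IsBlownFacet

end

section

/-! ### Star subdivisions are blowups -/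

/-- The morphism to a chart given by a ring homomorphism. -/
abbrev chartPoint {σ : Cone 3} {R : CommRingCat.{0}} (φ : chartRing σ →+* R) : Spec R ⟶ chart σ :=
  Spec.map (CommRingCat.ofHom φ)

lemma exists_chartPoint {σ : Cone 3} {Y : Scheme.{0}} (e : chart σ ⟶ Y) [IsOpenImmersion e]
    {R : CommRingCat.{0}} (k : Spec R ⟶ Y) (hk : Set.range k ⊆ Set.range e) :
    ∃ φ : chartRing σ →+* R, k = chartPoint φ ≫ e := by
  obtain ⟨l, hl⟩ : ∃ l : Spec R ⟶ chart σ, l ≫ e = k :=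
    ⟨IsOpenImmersion.lift e k hk, IsOpenImmersion.lift_fac _ _ _⟩
  refine ⟨(Spec.preimage (R := CommRingCat.of (chartRing σ)) l).hom, ?_⟩
  have h1 : chartPoint (Spec.preimage (R := CommRingCat.of (chartRing σ)) l).hom = l :=
    Spec.map_preimage _
  rw [h1, hl]

lemma chartPoint_injective {σ : Cone 3} {R : CommRingCat.{0}} {φ ψ : chartRing σ →+* R}
    (h : chartPoint φ = chartPoint ψ) : φ = ψ :=
  congrArg CommRingCat.Hom.hom (Spec.map_injective h)

lemma chartPoint_chartMap {σ τ : Cone 3} (h : τ ≤ σ) {R : CommRingCat.{0}}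
    (φ : chartRing τ →+* R) :
    chartPoint φ ≫ chartMap h = chartPoint (φ.comp (chartHom h).toRingHom) :=
  (Spec.map_comp _ _).symm

namespace IsToricMap

variable {F F' : Finset (Finset (Fin 7))} {a b n : Fin 7} {hF : IsSubdivision F F' a b n}
  {X X' : Scheme.{0}} {s : X ⟶ SpecC} {s' : X' ⟶ SpecC}
  {ι : ∀ t : faces F, chart (cone t.1) ⟶ X} {ι' : ∀ t : faces F', chart (cone t.1) ⟶ X'}
  {p : X' ⟶ X}

lemma comp_of_carrier_subset (hp : IsToricMap hF ι ι' p) (h : IsToric F X s ι) {t : faces F'}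
    {u : faces F} (htu : carrier a b n t.1 ⊆ u.1) (hle : cone t.1 ≤ cone u.1) :
    ι' t ≫ p = chartMap hle ≫ ι u := by
  rw [hp.comp, ← h.compatible (hF.carrierFace t) u htu, chartMap_comp_assoc]

end IsToricMap

/-- The two elements `x`, `y` are `a`, `b` in some order. -/
def IsSwap (a b x y : Fin 7) : Prop := (x = a ∧ y = b) ∨ (x = b ∧ y = a)

lemma IsSwap.symm {a b x y : Fin 7} (h : IsSwap a b x y) : IsSwap a b y x :=
  Or.symm (h.imp And.symm And.symm)

lemma IsBlownFacet.symm {c : Finset (Fin 7)} {n x y : Fin 7} (h : IsBlownFacet c n x y) :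
    IsBlownFacet c n y x :=
  ⟨h.unimodular, h.right, h.left, h.ne.symm, h.notMem, h.sum.trans (add_comm _ _)⟩

namespace IsSubdivision

variable {F F' : Finset (Finset (Fin 7))} {a b n : Fin 7}

lemma isBlownFacet (hF : IsSubdivision F F' a b n) {c : Finset (Fin 7)} (hc : c ∈ F)
    (hu : Unimodular c) (ha : a ∈ c) (hb : b ∈ c) {x y : Fin 7} (hxy : IsSwap a b x y) :
    IsBlownFacet c n x y := by
  have h : IsBlownFacet c n a b := ⟨hu, ha, hb, hF.ne, hF.notMem c hc, hF.sum⟩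
  rcases hxy with ⟨rfl, rfl⟩ | ⟨rfl, rfl⟩
  exacts [h, h.symm]

lemma replaced_mem (hF : IsSubdivision F F' a b n) {c : Finset (Fin 7)} (hc : c ∈ F)
    (ha : a ∈ c) (hb : b ∈ c) {x y : Fin 7} (hxy : IsSwap a b x y) : replaced c n x ∈ F' := by
  rw [hF.eq]
  refine Finset.mem_biUnion.2 ⟨c, hc, ?_⟩
  rw [if_pos ⟨ha, hb⟩]
  rcases hxy with ⟨rfl, rfl⟩ | ⟨rfl, rfl⟩ <;> simp [replaced]

lemma mem_of_not_mem (hF : IsSubdivision F F' a b n) {c : Finset (Fin 7)} (hc : c ∈ F)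
    (hab : ¬ (a ∈ c ∧ b ∈ c)) : c ∈ F' := by
  rw [hF.eq]
  refine Finset.mem_biUnion.2 ⟨c, hc, ?_⟩
  rw [if_neg hab]
  exact Finset.mem_singleton_self c

lemma cases_facet (hF : IsSubdivision F F' a b n) {c' : Finset (Fin 7)} (hc' : c' ∈ F') :
    (c' ∈ F ∧ ¬ (a ∈ c' ∧ b ∈ c')) ∨
      ∃ c ∈ F, a ∈ c ∧ b ∈ c ∧ ∃ x y, IsSwap a b x y ∧ c' = replaced c n x := by
  rw [hF.eq] at hc'
  obtain ⟨c, hc, hcc⟩ := Finset.mem_biUnion.1 hc'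
  split_ifs at hcc with hab
  · refine Or.inr ⟨c, hc, hab.1, hab.2, ?_⟩
    rcases Finset.mem_insert.1 hcc with h | h
    · exact ⟨a, b, Or.inl ⟨rfl, rfl⟩, h⟩
    · exact ⟨b, a, Or.inr ⟨rfl, rfl⟩, Finset.mem_singleton.1 h⟩
  · obtain rfl := Finset.mem_singleton.1 hcc
    exact Or.inl ⟨hc, hab⟩

lemma not_both_mem (hF : IsSubdivision F F' a b n) {t : Finset (Fin 7)} (ht : t ∈ faces F')
    {x y : Fin 7} (hxy : IsSwap a b x y) : x ∉ t ∨ y ∉ t := by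
  suffices ¬ (a ∈ t ∧ b ∈ t) by
    rcases hxy with ⟨rfl, rfl⟩ | ⟨rfl, rfl⟩ <;> tauto
  rintro ⟨ha, hb⟩
  obtain ⟨c', hc', htc⟩ := ht
  rcases hF.cases_facet hc' with h | ⟨c, hc, hac, hbc, x, y, hxy, rfl⟩
  · exact h.2 ⟨htc ha, htc hb⟩
  · have hn := hF.notMem c hc
    have hna : n ≠ a := fun e => hn (e ▸ hac)
    have hnb : n ≠ b := fun e => hn (e ▸ hbc)
    rcases hxy with ⟨rfl, rfl⟩ | ⟨rfl, rfl⟩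
    · simpa [replaced, hna.symm] using htc ha
    · simpa [replaced, hnb.symm] using htc hb

lemma mem_of_mem_carrier {t c : Finset (Fin 7)} (htc : carrier a b n t ⊆ c) {r : Fin 7}
    (hr : r ∈ t) (hrn : r ≠ n) : r ∈ c := by
  refine htc ?_
  unfold carrier
  split_ifs <;> simp [hr, hrn]

lemma subset_replaced {t c : Finset (Fin 7)} (htc : carrier a b n t ⊆ c) {x : Fin 7}
    (hx : x ∉ t) : t ⊆ replaced c n x := by
  intro r hr
  by_cases hrn : r = n
  · exact Finset.mem_insert.2 (Or.inl hrn)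
  · exact Finset.mem_insert_of_mem (Finset.mem_erase.2
      ⟨fun e => hx (e ▸ hr), mem_of_mem_carrier htc hr hrn⟩)

lemma carrier_replaced_subset {c : Finset (Fin 7)} (ha : a ∈ c) (hb : b ∈ c) (x : Fin 7) :
    carrier a b n (replaced c n x) ⊆ c := by
  intro r
  simp only [carrier, replaced, Finset.mem_insert_self, if_true, Finset.mem_insert, Finset.mem_erase]
  rintro (rfl | rfl | ⟨h1, h2 | h2⟩)
  exacts [ha, hb, absurd h2 h1, h2.2]

end IsSubdivision

section

variable {F F' : Finset (Finset (Fin 7))} {a b n : Fin 7} {hF : IsSubdivision F F' a b n}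
  {d : Fin 2 → Fin 7} {e₀ e₁ : ℤ} {w : IsWall F a b d e₀ e₁}
  {X X' : Scheme.{0}} {s : X ⟶ SpecC} {s' : X' ⟶ SpecC}
  {ι : ∀ t : faces F, chart (cone t.1) ⟶ X} {ι' : ∀ t : faces F', chart (cone t.1) ⟶ X'}
  {p : X' ⟶ X} {j : projSpace 1 ⟶ X}

lemma IsWallCurve.specIdeal_chartPoint (hj : IsWallCurve w ι j) (h : IsToric F X s ι)
    {c : Finset (Fin 7)} (hc : c ∈ F) {x y : Fin 7} (hxy : IsSwap a b x y)
    (hB : IsBlownFacet c n x y) {R : CommRingCat.{0}} (φ : chartRing (cone c) →+* R) :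
    specIdeal (j.ker.comap (chartPoint φ ≫ ι (IsToric.facet hc))) =
      Ideal.span {φ (hB.coord hB.left), φ (hB.coord hB.right)} := by
  have h1 : specIdeal (R := CommRingCat.of (chartRing (cone c)))
      (j.ker.comap (ι (IsToric.facet hc))) =
      Ideal.span {hB.coord hB.left, hB.coord hB.right} := by
    rcases hxy with ⟨rfl, rfl⟩ | ⟨rfl, rfl⟩
    · exact hj.specIdeal_ker_comap h hc hB.left hB.right
    · rw [Set.pair_comm]
      exact hj.specIdeal_ker_comap h hc hB.right hB.left
  rw [Scheme.IdealSheafData.comap_comp]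
  refine (specIdeal_comap (R := CommRingCat.of (chartRing (cone c))) _ _).trans ?_
  refine (congrArg (Ideal.map φ) h1).trans ?_
  exact (Ideal.map_span _ _).trans (congrArg _ (Set.image_pair _ _ _))

lemma specIdeal_top {R : CommRingCat.{0}} :
    specIdeal (⊤ : (Spec R).IdealSheafData) = Ideal.span {1} := by
  rw [Ideal.span_singleton_one, specIdeal, Scheme.IdealSheafData.ideal_top]
  rfl

/-- Over an unchanged facet the center is missed and its ideal is the unit ideal; in a chart with
the new ray the exceptional coordinate alone generates the pulled back ideal. -/
lemma IsToricMap.isLocallyInvertible (hp : IsToricMap hF ι ι' p) (h : IsToric F X s ι)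
    (h' : IsToric F' X' s' ι') (hj : IsWallCurve w ι j) : IsLocallyInvertible j.ker p := by
  intro y
  obtain ⟨c', hc', hy⟩ := h'.exists_facet y
  refine ⟨CommRingCat.of (chartRing (cone c')), ι' (IsToric.facet hc'),
    h'.openImmersion (IsToric.facet hc'), hy, ?_⟩
  rcases hF.cases_facet hc' with ⟨hc, hab⟩ | ⟨c, hc, hac, hbc, x, y, hxy, rfl⟩
  · refine ⟨1, one_mem _, Eq.trans ?_ specIdeal_top⟩
    refine congrArg _ ?_
    have hn := hF.notMem _ hc
    have h1 := hp.comp_of_carrier_subset h (t := IsToric.facet hc') (u := IsToric.facet hc)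
      (by rw [carrier, if_neg hn]) le_rfl
    have h2 : j.ker.comap (chartMap le_rfl ≫ ι (IsToric.facet hc)) = ⊤ := by
      rw [Scheme.IdealSheafData.comap_comp, hj.ker_comap_eq_top h hc hab]
      exact Scheme.IdealSheafData.comap_top _
    exact (congrArg j.ker.comap h1).trans h2
  · have hB := hF.isBlownFacet hc (h.unimodular c hc) hac hbc hxy
    refine ⟨chartHom hB.cone_le (hB.coord hB.left), ?_, ?_⟩
    · refine mem_nonZeroDivisors_of_ne_zero ?_
      rw [chartHom_chi]
      simp [chi]
    · have h1 := hp.comp_of_carrier_subset h (t := IsToric.facet hc') (u := IsToric.facet hc)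
        (IsSubdivision.carrier_replaced_subset hac hbc x) hB.cone_le
      have h2 := hj.specIdeal_chartPoint h hc hxy hB
        (R := CommRingCat.of (chartRing (cone (replaced c n x)))) (chartHom hB.cone_le).toRingHom
      refine (congrArg (fun f => specIdeal (R := CommRingCat.of _) (j.ker.comap f)) h1).trans
        (h2.trans ?_)
      refine Eq.trans ?_ hB.map_span
      rw [Ideal.map_span, Set.image_pair]

end

end

/-! ### The universal property of the blowup for a star subdivision. -/

section

namespace IsToricMap

variable {F F' : Finset (Finset (Fin 7))} {a b n : Fin 7} {hF : IsSubdivision F F' a b n}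
  {d : Fin 2 → Fin 7} {e₀ e₁ : ℤ} {w : IsWall F a b d e₀ e₁}
  {X X' : Scheme.{0}} {s : X ⟶ SpecC} {s' : X' ⟶ SpecC}
  {ι : ∀ t : faces F, chart (cone t.1) ⟶ X} {ι' : ∀ t : faces F', chart (cone t.1) ⟶ X'}
  {p : X' ⟶ X} {j : projSpace 1 ⟶ X}

/-- After shrinking, one of the two pulled back equations divides the other, which selects one of
the two charts over the facet. A facet without the edge is also a facet of the subdivision. -/
lemma exists_local_lift (hp : IsToricMap hF ι ι' p) (h : IsToric F X s ι)
    (hj : IsWallCurve w ι j) {W : Scheme.{0}} {g : W ⟶ X}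
    (hg : IsLocallyInvertible j.ker g) (y : W) :
    ∃ (R : CommRingCat.{0}) (k : Spec R ⟶ W) (f : Spec R ⟶ X'),
      IsOpenImmersion k ∧ y ∈ Set.range k ∧ f ≫ p = k ≫ g := by
  obtain ⟨c, hc, hy⟩ := h.exists_facet (g y)
  have := h.openImmersion (IsToric.facet hc)
  obtain ⟨R, k, _, hk, hsub, hI⟩ := hg.exists_subset (y := y)
    ((ι (IsToric.facet hc)).isOpenEmbedding.isOpen_range.preimage g.continuous) hy
  obtain ⟨φ, hφ⟩ := exists_chartPoint (ι (IsToric.facet hc)) (k ≫ g) (by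
    rintro _ ⟨z, rfl⟩
    exact hsub ⟨z, rfl⟩)
  by_cases hab : a ∈ c ∧ b ∈ c
  · have key : ∀ x y : Fin 7, IsSwap a b x y → ∀ (hB : IsBlownFacet c n x y) (r : R),
        φ (hB.coord hB.left) ∣ r * φ (hB.coord hB.right) →
        ∃ f : Spec (CommRingCat.of (Localization.Away r)) ⟶ X', f ≫ p = awayMap R r ≫ k ≫ g := by
      intro x y hxy hB r hdvd
      let S := CommRingCat.of (Localization.Away r)
      have hunit : IsUnit (algebraMap R S r) :=
        IsLocalization.Away.algebraMap_isUnit (S := Localization.Away r) r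
      obtain ⟨ψ, hψ⟩ := hB.exists_lift ((algebraMap R S).comp φ) (by
        have := map_dvd (algebraMap R S) hdvd
        rw [map_mul] at this
        exact (hunit.dvd_mul_left).1 this)
      have hmem := hF.replaced_mem hc hab.1 hab.2 hxy
      refine ⟨chartPoint (R := S) ψ ≫ ι' (IsToric.facet hmem), ?_⟩
      have h1 := hp.comp_of_carrier_subset h (t := IsToric.facet hmem) (u := IsToric.facet hc)
        (IsSubdivision.carrier_replaced_subset hab.1 hab.2 x) hB.cone_le
      have h2 : chartPoint (R := S) ψ ≫ chartMap hB.cone_le = awayMap R r ≫ chartPoint φ := by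
        rw [chartPoint_chartMap, hψ]
        exact Spec.map_comp _ _
      rw [hφ, Category.assoc, h1]
      refine (Category.assoc _ _ _).symm.trans (Eq.trans ?_ (Category.assoc _ _ _))
      exact congrArg (fun f => f ≫ ι (IsToric.facet hc)) h2
    have hB := hF.isBlownFacet hc (h.unimodular c hc) hab.1 hab.2 (Or.inl ⟨rfl, rfl⟩)
    rw [hφ, hj.specIdeal_chartPoint h hc (Or.inl ⟨rfl, rfl⟩) hB] at hI
    obtain ⟨z, rfl⟩ := hk
    obtain ⟨r, hr, hdvd⟩ := exists_dvd_of_isInvertiblePrincipal hI z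
    obtain ⟨v, rfl⟩ := (range_awayMap R r).ge hr
    obtain ⟨f, hf⟩ : ∃ f : Spec (CommRingCat.of (Localization.Away r)) ⟶ X',
        f ≫ p = awayMap R r ≫ k ≫ g := by
      rcases hdvd with hdvd | hdvd
      · exact key a b (Or.inl ⟨rfl, rfl⟩) hB r hdvd
      · exact key b a (Or.inr ⟨rfl, rfl⟩) hB.symm r hdvd
    exact ⟨_, awayMap R r ≫ k, f, inferInstance, ⟨v, rfl⟩, hf.trans (Category.assoc _ _ _).symm⟩
  · have hc' := hF.mem_of_not_mem hc hab
    refine ⟨R, k, chartPoint φ ≫ ι' (IsToric.facet hc'), inferInstance, hk, ?_⟩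
    have h1 := hp.comp_of_carrier_subset h (t := IsToric.facet hc') (u := IsToric.facet hc)
      (by rw [carrier, if_neg (hF.notMem _ hc)]) le_rfl
    rw [Category.assoc, h1, chartMap_refl, Category.id_comp, hφ]

/-- Once both lifts land in one chart near the point, they are ring homomorphisms with equal
restriction, and `hext` compares them. -/
lemma exists_eq_of_mem_range (hp : IsToricMap hF ι ι' p) (h : IsToric F X s ι)
    (h' : IsToric F' X' s' ι') {J : X.IdealSheafData} {W : Scheme.{0}} {g : W ⟶ X}
    (hg : IsLocallyInvertible J g) {f₁ f₂ : W ⟶ X'} (h₁ : f₁ ≫ p = g) (h₂ : f₂ ≫ p = g)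
    {c' c : Finset (Fin 7)} (hc' : c' ∈ F') (hc : c ∈ F) (hle : cone c' ≤ cone c)
    (hcar : carrier a b n c' ⊆ c)
    (hext : ∀ (R : CommRingCat.{0}) (ψ₁ ψ₂ : chartRing (cone c') →+* R),
      ψ₁.comp (chartHom hle).toRingHom = ψ₂.comp (chartHom hle).toRingHom →
      IsInvertiblePrincipal (specIdeal (J.comap
        (chartPoint (ψ₁.comp (chartHom hle).toRingHom) ≫ ι (IsToric.facet hc)))) → ψ₁ = ψ₂)
    {y : W} (hy₁ : f₁ y ∈ Set.range (ι' (IsToric.facet hc')))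
    (hy₂ : f₂ y ∈ Set.range (ι' (IsToric.facet hc'))) :
    ∃ (R : CommRingCat.{0}) (k : Spec R ⟶ W),
        IsOpenImmersion k ∧ y ∈ Set.range k ∧ k ≫ f₁ = k ≫ f₂ := by
  have := h'.openImmersion (IsToric.facet hc')
  have := h.openImmersion (IsToric.facet hc)
  have hopen := (ι' (IsToric.facet hc')).isOpenEmbedding.isOpen_range
  obtain ⟨R, k, hk, hy, hsub, hI⟩ := hg.exists_subset (y := y)
    ((hopen.preimage f₁.continuous).inter (hopen.preimage f₂.continuous)) ⟨hy₁, hy₂⟩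
  obtain ⟨ψ₁, hψ₁⟩ := exists_chartPoint (ι' (IsToric.facet hc')) (k ≫ f₁) (by
    rintro _ ⟨z, rfl⟩
    exact (hsub ⟨z, rfl⟩).1)
  obtain ⟨ψ₂, hψ₂⟩ := exists_chartPoint (ι' (IsToric.facet hc')) (k ≫ f₂) (by
    rintro _ ⟨z, rfl⟩
    exact (hsub ⟨z, rfl⟩).2)
  have hcomp := hp.comp_of_carrier_subset h (t := IsToric.facet hc') (u := IsToric.facet hc) hcar hle
  have key : ∀ (f : W ⟶ X') (ψ : chartRing (cone c') →+* R), f ≫ p = g →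
      k ≫ f = chartPoint ψ ≫ ι' (IsToric.facet hc') →
      k ≫ g = chartPoint (ψ.comp (chartHom hle).toRingHom) ≫ ι (IsToric.facet hc) := by
    intro f ψ hf hψ
    rw [← hf, ← Category.assoc, hψ, Category.assoc, hcomp, ← chartPoint_chartMap hle]
    exact (Category.assoc _ _ _).symm
  have e₁ := key f₁ ψ₁ h₁ hψ₁
  have e₂ := key f₂ ψ₂ h₂ hψ₂
  have h3 : chartPoint (ψ₁.comp (chartHom hle).toRingHom) =
      chartPoint (ψ₂.comp (chartHom hle).toRingHom) :=
    (cancel_mono (ι (IsToric.facet hc))).1 (e₁.symm.trans e₂)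
  have h4 := hext R ψ₁ ψ₂ (chartPoint_injective h3) (e₁ ▸ hI)
  exact ⟨R, k, hk, hy, by rw [hψ₁, hψ₂, h4]⟩

/-- The two charts of a blown up facet. -/
lemma mem_range_replaced (hp : IsToricMap hF ι ι' p) (h : IsToric F X s ι)
    (h' : IsToric F' X' s' ι') (hj : IsWallCurve w ι j) {W : Scheme.{0}} {g : W ⟶ X}
    (hg : IsLocallyInvertible j.ker g) {f₁ f₂ : W ⟶ X'} (h₁ : f₁ ≫ p = g) (h₂ : f₂ ≫ p = g)
    {c : Finset (Fin 7)} (hc : c ∈ F) {x y : Fin 7} (hxy : IsSwap a b x y)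
    (hB : IsBlownFacet c n x y) (hcx : replaced c n x ∈ F') (hcy : replaced c n y ∈ F')
    (ha : a ∈ c) (hb : b ∈ c) {z : W} (hz₁ : f₁ z ∈ Set.range (ι' (IsToric.facet hcx)))
    (hz₂ : f₂ z ∈ Set.range (ι' (IsToric.facet hcy))) :
    f₂ z ∈ Set.range (ι' (IsToric.facet hcx)) := by
  have := h'.openImmersion (IsToric.facet hcx)
  have := h'.openImmersion (IsToric.facet hcy)
  have := h.openImmersion (IsToric.facet hc)
  have hox := (ι' (IsToric.facet hcx)).isOpenEmbedding.isOpen_range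
  have hoy := (ι' (IsToric.facet hcy)).isOpenEmbedding.isOpen_range
  obtain ⟨R, k, hk, ⟨v, rfl⟩, hsub, hI⟩ := hg.exists_subset (y := z)
    ((hox.preimage f₁.continuous).inter (hoy.preimage f₂.continuous)) ⟨hz₁, hz₂⟩
  obtain ⟨ψ₁, hψ₁⟩ := exists_chartPoint (ι' (IsToric.facet hcx)) (k ≫ f₁) (by
    rintro _ ⟨z, rfl⟩
    exact (hsub ⟨z, rfl⟩).1)
  obtain ⟨ψ₂, hψ₂⟩ := exists_chartPoint (ι' (IsToric.facet hcy)) (k ≫ f₂) (by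
    rintro _ ⟨z, rfl⟩
    exact (hsub ⟨z, rfl⟩).2)
  have e₁ : k ≫ g = chartPoint (ψ₁.comp (chartHom hB.cone_le).toRingHom) ≫ ι (IsToric.facet hc) := by
    have hcomp := hp.comp_of_carrier_subset h (t := IsToric.facet hcx) (u := IsToric.facet hc)
      (IsSubdivision.carrier_replaced_subset ha hb x) hB.cone_le
    rw [← h₁, ← Category.assoc, hψ₁, Category.assoc, hcomp, ← chartPoint_chartMap hB.cone_le]
    exact (Category.assoc _ _ _).symm
  have e₂ : k ≫ g = chartPoint (ψ₂.comp (chartHom hB.symm.cone_le).toRingHom) ≫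
      ι (IsToric.facet hc) := by
    have hcomp := hp.comp_of_carrier_subset h (t := IsToric.facet hcy) (u := IsToric.facet hc)
      (IsSubdivision.carrier_replaced_subset ha hb y) hB.symm.cone_le
    rw [← h₂, ← Category.assoc, hψ₂, Category.assoc, hcomp, ← chartPoint_chartMap hB.symm.cone_le]
    exact (Category.assoc _ _ _).symm
  have h3 : chartPoint (ψ₁.comp (chartHom hB.cone_le).toRingHom) =
      chartPoint (ψ₂.comp (chartHom hB.symm.cone_le).toRingHom) :=
    (cancel_mono (ι (IsToric.facet hc))).1 (e₁.symm.trans e₂)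
  have h4 : ∀ u, ψ₁ (chartHom hB.cone_le u) = ψ₂ (chartHom hB.symm.cone_le u) :=
    RingHom.congr_fun (chartPoint_injective h3)
  have hright : ψ₁ (chartHom hB.cone_le (hB.coord hB.right)) =
      ψ₁ (chartHom hB.cone_le (hB.coord hB.left)) * ψ₁ (chi hB.sub_mem) := by
    rw [hB.chartHom_coord, map_mul]
  have hleft : ψ₁ (chartHom hB.cone_le (hB.coord hB.left)) =
      ψ₁ (chartHom hB.cone_le (hB.coord hB.right)) * ψ₂ (chi hB.symm.sub_mem) := by
    rw [h4, h4, ← map_mul]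
    exact congrArg ψ₂ hB.symm.chartHom_coord
  rw [e₁, hj.specIdeal_chartPoint h hc hxy hB] at hI
  have hI' : IsInvertiblePrincipal
      (Ideal.span {ψ₁ (chartHom hB.cone_le (hB.coord hB.left))}) := by
    convert hI using 1
    refine le_antisymm (Ideal.span_mono fun u hu => Or.inl hu) (Ideal.span_le.2 ?_)
    rintro _ (rfl | rfl)
    · exact Ideal.subset_span rfl
    · refine Ideal.mem_span_singleton.2 ⟨_, hright⟩
  have hnzd := mem_nonZeroDivisors_of_isInvertiblePrincipal hI'
  -- The two quotients multiply to 1: each expresses one equation by the other, and the first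
  -- equation is a nonzerodivisor.
  have hunit : IsUnit (ψ₂ (chi hB.symm.sub_mem)) := by
    refine IsUnit.of_mul_eq_one (ψ₁ (chi hB.sub_mem)) ?_
    rw [hright, mul_assoc] at hleft
    rw [mul_comm]
    refine (mul_cancel_left_mem_nonZeroDivisors hnzd).1 ?_
    rw [← hleft, mul_one]
  have h5 : f₂ (k v) = ι' (IsToric.facet hcy) (chartPoint ψ₂ v) := congrArg (fun f => f v) hψ₂
  have h6 : ¬ Vanishes (chi hB.symm.sub_mem) (chartPoint ψ₂ v) := fun h6 =>
    (show PrimeSpectrum R from v).isPrime.ne_top (Ideal.eq_top_of_isUnit_mem _ h6 hunit)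
  -- Since the quotient is invertible, the point lies in the chart of the face common to both new
  -- facets, spanned by `n` and the rays of `c` other than `x` and `y`.
  have h7 := hB.symm.mem_range_of_not_vanishes (h'.unimodular _ hcy) h6
  rw [h5]
  refine h'.range_subset (t := ⟨(replaced c n y).erase x, _, hcy, Finset.erase_subset _ _⟩)
    (u := IsToric.facet hcx) ?_
    ((h'.mem_range_iff (u := IsToric.facet hcy) (Finset.erase_subset x _)).2 h7)
  intro r
  simp only [replaced, Finset.mem_erase, Finset.mem_insert]
  tauto

/-- The point `f₂ y` has image in the chart of `c`, so it lies in the chart of a face with carrier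
in `c`. Such a face misses an end of the subdivided edge, which places `f₂ y` in the chart
containing `f₁ y` or in its companion; `mem_range_replaced` reduces the second case to the first. -/
lemma exists_local_eq (hp : IsToricMap hF ι ι' p) (h : IsToric F X s ι)
    (h' : IsToric F' X' s' ι') (hj : IsWallCurve w ι j) {W : Scheme.{0}} {g : W ⟶ X}
    {f₁ f₂ : W ⟶ X'} (hg : IsLocallyInvertible j.ker g) (h₁ : f₁ ≫ p = g) (h₂ : f₂ ≫ p = g)
    (y : W) : ∃ (R : CommRingCat.{0}) (k : Spec R ⟶ W),
        IsOpenImmersion k ∧ y ∈ Set.range k ∧ k ≫ f₁ = k ≫ f₂ := by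
  obtain ⟨c', hc', hy⟩ := h'.exists_facet (f₁ y)
  have hpy : ∀ f : W ⟶ X', f ≫ p = g → p (f y) = g y := fun f hf => congrArg (fun f => f y) hf
  rcases hF.cases_facet hc' with ⟨hc, hab⟩ | ⟨c, hc, hac, hbc, x, x', hxy, rfl⟩
  · have hcar : carrier a b n c' = c' := by rw [carrier, if_neg (hF.notMem _ hc)]
    refine hp.exists_eq_of_mem_range h h' hg h₁ h₂ hc' hc le_rfl hcar.le ?_ hy ?_
    · intro R ψ₁ ψ₂ hψ _
      rwa [chartHom_refl] at hψ
    · have h1 := (hp.mem_preimage_range_iff h h' (IsToric.facet hc) (f₁ y)).2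
        ⟨IsToric.facet hc', hcar.le, hy⟩
      rw [hpy f₁ h₁, ← hpy f₂ h₂, hp.mem_preimage_range_iff h h'] at h1
      obtain ⟨t, ht, hty⟩ := h1
      refine h'.range_subset (u := IsToric.facet hc') ?_ hty
      by_cases hn : n ∈ t.1
      · exact absurd ⟨ht (by simp [carrier, hn]), ht (by simp [carrier, hn])⟩ hab
      · have ht : carrier a b n t.1 ⊆ c' := ht
        rwa [carrier, if_neg hn] at ht
  · have hB := hF.isBlownFacet hc (h.unimodular c hc) hac hbc hxy
    have hcar := IsSubdivision.carrier_replaced_subset (n := n) hac hbc x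
    refine hp.exists_eq_of_mem_range h h' hg h₁ h₂ hc' hc hB.cone_le hcar ?_ hy ?_
    · intro R ψ₁ ψ₂ hψ hI
      refine hB.hom_ext hψ (mem_nonZeroDivisors_of_isInvertiblePrincipal ?_)
      rw [hj.specIdeal_chartPoint h hc hxy hB] at hI
      convert hI using 1
      refine le_antisymm (Ideal.span_mono fun u hu => Or.inl hu) (Ideal.span_le.2 ?_)
      rintro _ (rfl | rfl)
      · exact Ideal.subset_span rfl
      · refine Ideal.mem_span_singleton.2 ⟨ψ₁ (chi hB.sub_mem), ?_⟩
        rw [← map_mul, ← hB.chartHom_coord]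
        rfl
    · have h1 := (hp.mem_preimage_range_iff h h' (IsToric.facet hc) (f₁ y)).2
        ⟨IsToric.facet hc', hcar, hy⟩
      rw [hpy f₁ h₁, ← hpy f₂ h₂, hp.mem_preimage_range_iff h h'] at h1
      obtain ⟨t, ht, hty⟩ := h1
      rcases hF.not_both_mem t.2 hxy with hx | hx
      · exact h'.range_subset (u := IsToric.facet hc') (IsSubdivision.subset_replaced ht hx) hty
      · have hcy := hF.replaced_mem hc hac hbc hxy.symm
        exact hp.mem_range_replaced h h' hj hg h₁ h₂ hc hxy hB hc' hcy hac hbc hy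
          (h'.range_subset (u := IsToric.facet hcy) (IsSubdivision.subset_replaced ht hx) hty)

/-- The toric morphism of a star subdivision along an edge is the blowup along the invariant curve
of the edge. -/
lemma isBlowup (hp : IsToricMap hF ι ι' p) (h : IsToric F X s ι)
    (h' : IsToric F' X' s' ι') (hj : IsWallCurve w ι j) : IsBlowup p j := by
  have := hj.isClosedImmersion h
  refine ⟨this, (isEffectiveCartier_pullback_iff p j).2 (hp.isLocallyInvertible h h' hj),
    fun W g hg => ?_⟩
  refine ((isEffectiveCartier_pullback_iff g j).1 hg).existsUnique_lift ?_ ?_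
  · intro W g f₁ f₂ hg h₁ h₂ y
    exact hp.exists_local_eq h h' hj hg h₁ h₂ y
  · intro W g hg y
    exact hp.exists_local_lift h hj hg y

end IsToricMap

end

/-! ### Integrality, strict transforms and the tower of three blowups. -/

section

/-! ### Integrality -/

lemma isIntegral_of_openCover {X : Scheme.{0}} (𝒰 : X.OpenCover) [Nonempty 𝒰.I₀]
    [∀ i, IsIntegral (𝒰.X i)]
    (h : ∀ i j, ∃ x, x ∈ Set.range (𝒰.f i) ∧ x ∈ Set.range (𝒰.f j)) : IsIntegral X := by
  have : IsReduced X := IsReduced.of_openCover X 𝒰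
  have hcov : ∀ x, ∃ i, x ∈ Set.range (𝒰.f i) := fun x => ⟨𝒰.idx x, 𝒰.covers x⟩
  have : PreirreducibleSpace X := by
    refine ⟨IsPreirreducible.of_subset_iUnion (U := fun i => (𝒰.f i).opensRange) ?_ ?_
      isOpen_univ ?_⟩
    · intro i j _ hd
      obtain ⟨x, hi, hj⟩ := h i j
      have : x ∈ (⊥ : X.Opens) := hd (x := (𝒰.f i).opensRange ⊓ (𝒰.f j).opensRange)
        inf_le_left inf_le_right ⟨hi, hj⟩
      exact this
    · intro i
      have : IsPreirreducible (𝒰.f i '' Set.univ) :=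
        (PreirreducibleSpace.isPreirreducible_univ (X := 𝒰.X i)).image _
          (𝒰.f i).continuous.continuousOn
      rwa [Set.image_univ] at this
    · intro x _
      obtain ⟨i, hi⟩ := hcov x
      exact Set.mem_iUnion.2 ⟨i, hi⟩
  have : Nonempty X := by
    obtain ⟨i⟩ := ‹Nonempty 𝒰.I₀›
    exact (inferInstance : Nonempty (𝒰.X i)).map (𝒰.f i)
  have : IrreducibleSpace X := ⟨this⟩
  exact isIntegral_of_irreducibleSpace_of_isReduced X

instance {N : ℕ} (i : Fin (N + 1)) : IsDomain (AwayX i) := by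
  have : IsDomain (Localization.Away (MvPolynomial.X i : MvPolynomial (Fin (N + 1)) ℂ)) :=
    IsLocalization.isDomain_localization (powers_le_nonZeroDivisors_of_noZeroDivisors
      (MvPolynomial.X_ne_zero i))
  exact (HomogeneousLocalization.val_injective _).isDomain
    (algebraMap (AwayX i) (Localization.Away (MvPolynomial.X i : MvPolynomial (Fin (N + 1)) ℂ)))

lemma awayRatio_ne_zero {N : ℕ} (i k : Fin (N + 1)) : awayRatio i k ≠ 0 := by
  intro h
  have h1 := val_awayRatio i k
  rw [h, HomogeneousLocalization.val_zero, zero_mul] at h1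
  have hinj : Function.Injective (algebraMap (MvPolynomial (Fin (N + 1)) ℂ)
      (Localization.Away (MvPolynomial.X i : MvPolynomial (Fin (N + 1)) ℂ))) :=
    IsLocalization.injective _ (powers_le_nonZeroDivisors_of_noZeroDivisors
      (MvPolynomial.X_ne_zero i))
  exact MvPolynomial.X_ne_zero (R := ℂ) k (hinj (h1.symm.trans (map_zero _).symm))

instance (N : ℕ) : IsIntegral (projSpace N) := by
  have : Nonempty (projCover N).I₀ := ⟨(0 : Fin (N + 1))⟩
  have : ∀ i, IsIntegral ((projCover N).X i) := fun (i : Fin (N + 1)) =>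
    inferInstanceAs (IsIntegral (Spec (CommRingCat.of (AwayX (N := N) i))))
  refine isIntegral_of_openCover (projCover N) fun (i k : Fin (N + 1)) => ?_
  let y : PrimeSpectrum (AwayX (N := N) i) := ⟨⊥, Ideal.isPrime_bot⟩
  have h1 : awayEmb (N := N) i y ∈ coordOpen (N := N) k :=
    (awayEmb_mem_coordOpen (N := N) i k y).2 fun h => awayRatio_ne_zero (N := N) i k h
  rw [← opensRange_awayEmb] at h1
  exact ⟨_, ⟨y, rfl⟩, h1⟩

/-- The charts are spectra of domains and all contain the torus, the chart of the empty face. -/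
lemma IsToric.isIntegral {F : Finset (Finset (Fin 7))} {X : Scheme.{0}} {s : X ⟶ SpecC}
    {ι : ∀ t : faces F, chart (cone t.1) ⟶ X} (h : IsToric F X s ι) (hF : F.Nonempty) :
    IsIntegral X := by
  have : Nonempty h.openCover.I₀ := hF.to_subtype
  have : ∀ i, IsIntegral (h.openCover.X i) := fun i =>
    inferInstanceAs (IsIntegral (Spec (CommRingCat.of (chartRing (cone i.1)))))
  refine isIntegral_of_openCover h.openCover fun c c' => ?_
  have he : ∅ ∈ faces F := ⟨c.1, c.2, Finset.empty_subset _⟩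
  obtain ⟨x, hx, -⟩ := h.exists_mem_orbit ⟨∅, he⟩
  exact ⟨x, h.range_subset (u := IsToric.facet c.2) (Finset.empty_subset _) hx,
    h.range_subset (u := IsToric.facet c'.2) (Finset.empty_subset _) hx⟩

/-! ### Strict transforms -/

section

variable {F F' : Finset (Finset (Fin 7))} {a b n : Fin 7} {hF : IsSubdivision F F' a b n}
  {X X' : Scheme.{0}} {s : X ⟶ SpecC} {s' : X' ⟶ SpecC}
  {ι : ∀ t : faces F, chart (cone t.1) ⟶ X} {ι' : ∀ t : faces F', chart (cone t.1) ⟶ X'}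
  {p : X' ⟶ X}

lemma IsToricMap.mem_preimage_orbitClosure (hp : IsToricMap hF ι ι' p) (h : IsToric F X s ι)
    (h' : IsToric F' X' s' ι') {x : X'} {t : faces F'} (ht : x ∈ Set.range (ι' t))
    (hmin : ∀ u : faces F', x ∈ Set.range (ι' u) → t.1 ⊆ u.1) (τ : Finset (Fin 7)) :
    p x ∈ IsToric.orbitClosure ι τ ↔ τ ⊆ carrier a b n t.1 :=
  have h1 := hp.orbit_image h h' ht hmin
  IsToric.mem_orbitClosure_iff_of_orbit h1.1 h1.2

/-- Away from the center, the preimage of the closure of `τ` agrees with the closure of `τ'`, by a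
comparison of faces. The latter is irreducible and not inside the preimage of the center, so its
open part is dense in it. -/
lemma IsToricMap.strictTransform_orbitClosure (hp : IsToricMap hF ι ι' p) (h : IsToric F X s ι)
    (h' : IsToric F' X' s' ι') {τ σ τ' : Finset (Fin 7)} (hτ' : τ' ∈ faces F')
    (hirr : IsPreirreducible (IsToric.orbitClosure ι' τ'))
    (h₁ : ∀ c ∈ F', ∀ t ∈ c.powerset, ¬ σ ⊆ carrier a b n t →
      (τ ⊆ carrier a b n t ↔ τ' ⊆ t)) (h₂ : ¬ σ ⊆ carrier a b n τ') :
    strictTransform p (IsToric.orbitClosure ι σ) (IsToric.orbitClosure ι τ) =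
      IsToric.orbitClosure ι' τ' := by
  have key : p ⁻¹' (IsToric.orbitClosure ι τ \ IsToric.orbitClosure ι σ) =
      IsToric.orbitClosure ι' τ' ∩ (p ⁻¹' IsToric.orbitClosure ι σ)ᶜ := by
    ext x
    obtain ⟨t, ht, hmin⟩ := h'.exists_orbit x
    obtain ⟨c, hc, htc⟩ := t.2
    have h3 := h₁ c hc t.1 (Finset.mem_powerset.2 htc)
    change (p x ∈ IsToric.orbitClosure ι τ ∧ ¬ p x ∈ IsToric.orbitClosure ι σ) ↔
      (x ∈ IsToric.orbitClosure ι' τ' ∧ ¬ p x ∈ IsToric.orbitClosure ι σ)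
    rw [hp.mem_preimage_orbitClosure h h' ht hmin, hp.mem_preimage_orbitClosure h h' ht hmin,
      IsToric.mem_orbitClosure_iff_of_orbit ht hmin]
    exact and_congr_left h3
  rw [strictTransform, key]
  refine Set.Subset.antisymm
    (closure_minimal Set.inter_subset_left (h'.isClosed_orbitClosure τ')) ?_
  refine subset_closure_inter_of_isPreirreducible_of_isOpen hirr
    ((h.isClosed_orbitClosure σ).preimage p.continuous).isOpen_compl ?_
  obtain ⟨x, hx, hmin⟩ := h'.exists_mem_orbit ⟨τ', hτ'⟩
  refine ⟨x, (IsToric.mem_orbitClosure_iff_of_orbit hx hmin).2 subset_rfl, fun h4 => h₂ ?_⟩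
  exact (hp.mem_preimage_orbitClosure h h' hx hmin σ).1 h4

end

lemma IsWallCurve.isPreirreducible {F : Finset (Finset (Fin 7))} {a b : Fin 7}
    {d : Fin 2 → Fin 7} {p q : ℤ} {X : Scheme.{0}} {s : X ⟶ SpecC}
    {ι : ∀ t : faces F, chart (cone t.1) ⟶ X} {w : IsWall F a b d p q} {j : projSpace 1 ⟶ X}
    (hj : IsWallCurve w ι j) (h : IsToric F X s ι) :
    IsPreirreducible (IsToric.orbitClosure ι {a, b}) := by
  rw [← hj.range_eq h, ← Set.image_univ]
  exact (PreirreducibleSpace.isPreirreducible_univ (X := projSpace 1)).image _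
    j.continuous.continuousOn

/-! ### The tower of blowups -/

lemma isSubdivision₁ : IsSubdivision facets₀ facets₁ 1 4 0 :=
  ⟨rfl, by decide, by decide +kernel, by decide +kernel⟩

lemma isSubdivision₂ : IsSubdivision facets₁ facets₂ 1 3 2 :=
  ⟨rfl, by decide, by decide +kernel, by decide +kernel⟩

lemma isSubdivision₃ : IsSubdivision facets₂ facets₃ 0 3 6 :=
  ⟨rfl, by decide, by decide +kernel, by decide +kernel⟩

/-- The three centers of blowup, with relations ρ₅ + ρ₃ = -ρ₁ - ρ₄, ρ₅ + ρ₀ = -ρ₃ and ρ₄ + ρ₂ = ρ₀ +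
ρ₃. -/
lemma isWall₀ : IsWall facets₀ 1 4 ![5, 3] (-1) (-1) := by
  constructor <;> decide +kernel

lemma isWall₁ : IsWall facets₁ 1 3 ![5, 0] 0 (-1) := by
  constructor <;> decide +kernel

lemma isWall₂ : IsWall facets₂ 0 3 ![4, 2] 1 1 := by
  constructor <;> decide +kernel

lemma isBlowupAlongRationalCurve {F F' : Finset (Finset (Fin 7))} {a b n : Fin 7}
    {hF : IsSubdivision F F' a b n} {d : Fin 2 → Fin 7} {e₀ e₁ : ℤ} (w : IsWall F a b d e₀ e₁)
    {X X' : Scheme.{0}} {s : X ⟶ SpecC} {s' : X' ⟶ SpecC}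
    {ι : ∀ t : faces F, chart (cone t.1) ⟶ X} {ι' : ∀ t : faces F', chart (cone t.1) ⟶ X'}
    {p : X' ⟶ X} (hp : IsToricMap hF ι ι' p) (h : IsToric F X s ι) (h' : IsToric F' X' s' ι') :
    IsBlowupAlongRationalCurve p s (IsToric.orbitClosure ι {a, b}) := by
  obtain ⟨j, hj⟩ := exists_isWallCurve w h
  exact ⟨j, hj.comp_structure h, hj.range_eq h, hp.isBlowup h h' hj⟩

lemma torusToChart_chartMap {n : ℕ} {τ σ : Cone n} (h : τ ≤ σ) :
    torusToChart τ ≫ chartMap h = torusToChart σ := by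
  refine (Spec.map_comp _ _).symm.trans (congrArg Spec.map ?_)
  refine congrArg CommRingCat.ofHom (chartRing_ringHom_ext (fun a => ?_) fun m hm => ?_)
  · change AddMonoidAlgebra.mapDomainAlgHom ℂ ℂ (dualMonoid τ).subtype (chartHom h _) =
      AddMonoidAlgebra.mapDomainAlgHom ℂ ℂ (dualMonoid σ).subtype _
    rw [AlgHom.commutes, AlgHom.commutes, AlgHom.commutes]
  · change AddMonoidAlgebra.mapDomain (dualMonoid τ).subtype (chartHom h _) =
      AddMonoidAlgebra.mapDomain (dualMonoid σ).subtype _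
    rw [chartHom_chi]
    refine AddMonoidAlgebra.mapDomain_single.trans ?_
    exact (AddMonoidAlgebra.mapDomain_single (f := (dualMonoid σ).subtype) (a := ⟨m, hm⟩)).symm

/-- The tower of blowups over projective space. -/
lemma exists_tower : ∃ (X : Scheme.{0}) (ι : ∀ t : faces facets₃, chart (cone t.1) ⟶ X)
    (X₁ X₂ : Scheme.{0}) (pa : X₁ ⟶ projSpace 3) (pb : X₂ ⟶ X₁) (pd : X ⟶ X₂),
    IsToric facets₃ X (pd ≫ pb ≫ pa ≫ projSpaceToSpecC 3) ι ∧
    IsBlowupAlongRationalCurve pa (projSpaceToSpecC 3) (coordLocus {0, 2}) ∧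
    IsBlowupAlongRationalCurve pb (pa ≫ projSpaceToSpecC 3)
      (strictTransform pa (coordLocus {0, 2}) (coordLocus {0, 1})) ∧
    IsBlowupAlongRationalCurve pd (pb ≫ pa ≫ projSpaceToSpecC 3)
      (strictTransform pb (strictTransform pa (coordLocus {0, 2}) (coordLocus {0, 1}))
        (pa ⁻¹' coordLocus {0, 1, 2})) ∧
    ∀ t : faces facets₃, torusToChart (cone t.1) ≫ ι t ≫ pd ≫ pb ≫ pa = torusToProjSpace 3 := by
  obtain ⟨ι₀, h₀, hι₀⟩ := exists_isToric_projSpace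
  obtain ⟨X₁, pa, ι₁, h₁, hpa⟩ := exists_isToricMap isSubdivision₁ unimodular₁ h₀
  obtain ⟨X₂, pb, ι₂, h₂, hpb⟩ := exists_isToricMap isSubdivision₂ unimodular₂ h₁
  obtain ⟨X, pd, ι, h, hpd⟩ := exists_isToricMap isSubdivision₃ unimodular₃ h₂
  obtain ⟨j₁, hj₁⟩ := exists_isWallCurve isWall₁ h₁
  obtain ⟨j₂, hj₂⟩ := exists_isWallCurve isWall₂ h₂
  have hloc : ∀ (I : Set (Fin (3 + 1))) (τ : Finset (Fin 7)),
      (∀ t : Finset (Fin 7), (∀ i ∈ I, rayOfCoord i ∈ t) ↔ τ ⊆ t) →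
      coordLocus I = IsToric.orbitClosure ι₀ τ := by
    intro I τ hI
    ext x
    obtain ⟨t, ht, hmin⟩ := h₀.exists_orbit x
    rw [mem_coordLocus_iff_of_orbit h₀ hι₀ ht hmin,
      IsToric.mem_orbitClosure_iff_of_orbit ht hmin, hI]
  have hl₀ : coordLocus {0, 2} = IsToric.orbitClosure ι₀ {1, 4} :=
    hloc _ _ fun t => by simp [rayOfCoord, Finset.insert_subset_iff]
  have hl₁ : coordLocus {0, 1} = IsToric.orbitClosure ι₀ {1, 3} :=
    hloc _ _ fun t => by simp [rayOfCoord, Finset.insert_subset_iff]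
  have hl₂ : coordLocus {0, 1, 2} = IsToric.orbitClosure ι₀ {1, 3, 4} :=
    hloc _ _ fun t => by simp [rayOfCoord, Finset.insert_subset_iff]
  have hs₁ : strictTransform pa (coordLocus {0, 2}) (coordLocus {0, 1}) =
      IsToric.orbitClosure ι₁ {1, 3} := by
    rw [hl₀, hl₁]
    exact hpa.strictTransform_orbitClosure h₀ h₁ (by decide +kernel) (hj₁.isPreirreducible h₁)
      (by decide +kernel) (by decide +kernel)
  have hs₂ : strictTransform pb (strictTransform pa (coordLocus {0, 2}) (coordLocus {0, 1}))
      (pa ⁻¹' coordLocus {0, 1, 2}) = IsToric.orbitClosure ι₂ {0, 3} := by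
    -- The point P is the orbit of the face `{1, 3, 4}`. A carrier contains this face exactly when
    -- the face upstairs contains 0 and 3, so the fiber over P is an invariant curve.
    have hpre : pa ⁻¹' coordLocus {0, 1, 2} = IsToric.orbitClosure ι₁ {0, 3} := by
      ext x
      obtain ⟨t, ht, hmin⟩ := h₁.exists_orbit x
      obtain ⟨c, hc, htc⟩ := t.2
      rw [hl₂, Set.mem_preimage, hpa.mem_preimage_orbitClosure h₀ h₁ ht hmin,
        IsToric.mem_orbitClosure_iff_of_orbit ht hmin]
      have : ∀ c ∈ facets₁, ∀ t ∈ c.powerset,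
        {1, 3, 4} ⊆ carrier 1 4 0 t ↔ {0, 3} ⊆ t := by decide +kernel
      exact this c hc t.1 (Finset.mem_powerset.2 htc)
    rw [hs₁, hpre]
    exact hpb.strictTransform_orbitClosure h₁ h₂ (by decide +kernel) (hj₂.isPreirreducible h₂)
      (by decide +kernel) (by decide +kernel)
  refine ⟨X, ι, X₁, X₂, pa, pb, pd, h, ?_, ?_, ?_, fun t => ?_⟩
  · rw [hl₀]
    exact isBlowupAlongRationalCurve isWall₀ hpa h₀ h₁
  · rw [hs₁]
    exact isBlowupAlongRationalCurve isWall₁ hpb h₁ h₂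
  · rw [hs₂]
    exact isBlowupAlongRationalCurve isWall₂ hpd h₂ h
  · have e₃ := hpd.comp t
    have e₂ := hpb.comp (isSubdivision₃.carrierFace t)
    have e₁ := hpa.comp (isSubdivision₂.carrierFace (isSubdivision₃.carrierFace t))
    set u := isSubdivision₁.carrierFace (isSubdivision₂.carrierFace (isSubdivision₃.carrierFace t))
      with hu
    have hle : cone t.1 ≤ cone u.1 := (cone_le_carrier isSubdivision₃.sum _).trans
      ((cone_le_carrier isSubdivision₂.sum _).trans (cone_le_carrier isSubdivision₁.sum _))
    have e : ι t ≫ pd ≫ pb ≫ pa = chartMap hle ≫ ι₀ u := by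
      rw [← Category.assoc, e₃, Category.assoc, ← Category.assoc (ι₂ _), e₂, Category.assoc, e₁]
      rw [chartMap_comp_assoc]
      exact chartMap_comp_assoc _ _ _
    rw [e, ← Category.assoc, torusToChart_chartMap]
    obtain ⟨c, hc, huc⟩ := u.2
    obtain ⟨i, hi⟩ := isVeryAmple_simplexPoints.exists_minimal c hc
    have hi' := hi.mono huc
    rw [hι₀ u i hi', torusToChart_chartToProj]

end

section

/-! ### Smoothness, dimension and the toric charts -/

lemma IsToric.smooth {F : Finset (Finset (Fin 7))} {X : Scheme.{0}} {s : X ⟶ SpecC}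
    {ι : ∀ t : faces F, chart (cone t.1) ⟶ X} (h : IsToric F X s ι) : Smooth s := by
  have : IsZariskiLocalAtSource @Smooth.{0} :=
    HasRingHomProperty.instIsZariskiLocalAtSource (Q := RingHom.Smooth)
  refine (IsZariskiLocalAtSource.iff_of_openCover (P := @Smooth) h.openCover).2 fun i => ?_
  have hc := h.unimodular _ i.2
  have h1 : h.openCover.f i ≫ s = chartToSpecC (cone i.1) := h.structureMap _
  rw [h1]
  have : Algebra.Smooth ℂ (MvPolynomial i.1 ℂ) :=
    { formallySmooth := inferInstance, finitePresentation := inferInstance }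
  have : Algebra.Smooth ℂ (chartRing (cone i.1)) := Algebra.Smooth.of_equiv (chartRingEquiv hc).symm
  refine (HasRingHomProperty.Spec_iff (P := @Smooth)).2 ?_
  exact (RingHom.smooth_algebraMap).2 this

/-- The dimension is the supremum of the coheights of points, and coheight is unchanged by open
immersions. -/
lemma topologicalKrullDim_eq_of_openCover {X : Scheme.{0}} (𝒰 : X.OpenCover) [Nonempty 𝒰.I₀]
    (d : WithBot ℕ∞) (h : ∀ i, topologicalKrullDim (𝒰.X i) = d) : topologicalKrullDim X = d := by
  have key : ∀ Y : Scheme.{0}, topologicalKrullDim Y = Order.krullDim Y := fun Y =>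
    Order.krullDim_eq_of_orderIso irreducibleSetEquivPoints
  refine le_antisymm ?_ ?_
  · rw [key, Order.krullDim_eq_iSup_coheight]
    refine iSup_le fun x => ?_
    obtain ⟨y, hy⟩ := 𝒰.covers x
    rw [← h (𝒰.idx x), key]
    refine le_of_eq_of_le ?_ (Order.coheight_le_krullDim y)
    have h1 : Order.coheight (𝒰.f (𝒰.idx x) y) = Order.coheight y :=
      coheight_eq_of_isOpenImmersion _
    rw [← h1, hy]
  · obtain ⟨i⟩ := ‹Nonempty 𝒰.I₀›
    rw [← h i]
    exact (𝒰.f i).isOpenEmbedding.isInducing.topologicalKrullDim_le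

lemma IsToric.topologicalKrullDim_eq {F : Finset (Finset (Fin 7))} {X : Scheme.{0}} {s : X ⟶ SpecC}
    {ι : ∀ t : faces F, chart (cone t.1) ⟶ X} (h : IsToric F X s ι) (hF : F.Nonempty) :
    topologicalKrullDim X = 3 := by
  have : Nonempty h.openCover.I₀ := hF.to_subtype
  refine topologicalKrullDim_eq_of_openCover h.openCover 3 fun i => ?_
  have hc := h.unimodular _ i.2
  refine (PrimeSpectrum.topologicalKrullDim_eq_ringKrullDim (R := chartRing (cone i.1))).trans ?_
  rw [ringKrullDim_eq_of_ringEquiv (chartRingEquiv hc).toRingEquiv,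
    MvPolynomial.ringKrullDim_of_isNoetherianRing, ringKrullDim_eq_zero_of_field]
  have : Nat.card i.1 = 3 := by rw [Nat.card_eq_fintype_card, Fintype.card_coe]; exact hc.card
  rw [this]
  rfl

/-- The charts are reindexed by cones instead of faces: choose a face spanning each cone and
transport its chart along the equality of cones, which induces an isomorphism. -/
lemma exists_isToricVariety_combFan {X : Scheme.{0}} {s : X ⟶ SpecC}
    {ι : ∀ t : faces facets₃, chart (cone t.1) ⟶ X} (h : IsToric facets₃ X s ι) :
    ∃ κ : ∀ σ : combFan, chart σ.1 ⟶ X, IsToricVariety combFan X s κ ∧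
      ∀ σ : combFan, ∃ t : faces facets₃, ∃ e : σ.1 ≤ cone t.1, κ σ = chartMap e ≫ ι t := by
  have hex : ∀ σ : combFan, ∃ t : faces facets₃, σ.1 = cone t.1 := fun σ => by
    obtain ⟨t, ht, e⟩ := mem_combFan_iff.1 σ.2
    exact ⟨⟨t, ht⟩, e⟩
  choose t ht using hex
  have hle : ∀ σ σ' : combFan, σ.1 ≤ σ'.1 → (t σ).1 ⊆ (t σ').1 := fun σ σ' hσ => by
    rw [ht σ, ht σ'] at hσ
    exact (cone_le_iff (t σ').2 (t σ).2).1 hσ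
  have hr : ∀ σ : combFan, Set.range (chartMap (ht σ).le ≫ ι (t σ)) = Set.range (ι (t σ)) := by
    intro σ
    refine le_antisymm ?_ ?_
    · rintro _ ⟨x, rfl⟩
      exact ⟨chartMap (ht σ).le x, rfl⟩
    · rintro _ ⟨x, rfl⟩
      refine ⟨chartMap (ht σ).ge x, ?_⟩
      rw [← Scheme.Hom.comp_apply, chartMap_comp_assoc, chartMap_refl, Category.id_comp]
  refine ⟨fun σ => chartMap (ht σ).le ≫ ι (t σ), ⟨fun σ => ?_, fun σ => ?_, fun τ σ hτ => ?_,
    fun x => ?_, fun σ σ' x hx hx' => ?_⟩, fun σ => ⟨t σ, (ht σ).le, rfl⟩⟩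
  · have := h.openImmersion (t σ)
    have : IsIso (chartMap (ht σ).le) := ⟨chartMap (ht σ).ge, by
      rw [chartMap_comp, chartMap_refl], by rw [chartMap_comp, chartMap_refl]⟩
    infer_instance
  · rw [Category.assoc, h.structureMap, chartMap_chartToSpecC]
  · rw [chartMap_comp_assoc, ← h.compatible _ _ (hle _ _ hτ), chartMap_comp_assoc]
  · obtain ⟨u, hu⟩ := h.cover x
    let σ : combFan := ⟨cone u.1, mem_combFan_iff.2 ⟨_, u.2, rfl⟩⟩
    refine ⟨σ, ?_⟩
    rw [hr]
    exact h.range_subset ((cone_le_iff (t σ).2 u.2).1 (ht σ).le) hu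
  · rw [hr] at hx hx'
    let u := faceInter (t σ) (t σ')
    let τ : combFan := ⟨cone u.1, mem_combFan_iff.2 ⟨_, u.2, rfl⟩⟩
    refine ⟨τ, ?_, ?_, ?_⟩
    · exact (cone_mono Finset.inter_subset_left).trans (ht σ).ge
    · exact (cone_mono Finset.inter_subset_right).trans (ht σ').ge
    · rw [hr]
      exact h.range_subset ((cone_le_iff (t τ).2 u.2).1 (ht τ).le) (h.inter _ _ _ hx hx')

/-! ### The projective line -/

/-- The standard affine charts of the projective line are affine lines. -/
def curveRingEquiv (i : Fin 2) : Polynomial ℂ ≃+* AwayX (N := 1) i :=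
  RingEquiv.ofRingHom (Polynomial.aeval (awayRatio (N := 1) i (i + 1))).toRingHom
    (curveEval i Polynomial.X)
    (by
      refine awayX_ringHom_ext (N := 1) (fun z => ?_) fun k => ?_
      · change Polynomial.aeval (awayRatio (N := 1) i (i + 1))
          (curveEval i Polynomial.X _) = algebraMap ℂ _ z
        rw [curveEval_algebraMap]
        simp
      · change Polynomial.aeval (awayRatio (N := 1) i (i + 1))
          (curveEval i Polynomial.X _) = awayRatio (N := 1) i k
        obtain rfl | rfl := eq_or_eq_add_one i k
        · rw [awayRatio_self, map_one, map_one]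
        · rw [curveEval_ratio, Polynomial.aeval_X])
    (by
      refine Polynomial.ringHom_ext (fun z => ?_) ?_
      · change curveEval i _ (Polynomial.aeval _ (Polynomial.C z)) = _
        rw [Polynomial.aeval_C, curveEval_algebraMap]
        rfl
      · change curveEval i _ (Polynomial.aeval _ Polynomial.X) = _
        rw [Polynomial.aeval_X, curveEval_ratio]
        rfl)

lemma curveRingEquiv_apply (i : Fin 2) (f : Polynomial ℂ) :
    curveRingEquiv i f = Polynomial.aeval (awayRatio (N := 1) i (i + 1)) f := rfl

instance (i : Fin 2) : IsPrincipalIdealRing (AwayX (N := 1) i) :=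
  IsPrincipalIdealRing.of_surjective (curveRingEquiv i).toRingHom (curveRingEquiv i).surjective

lemma topologicalKrullDim_projSpace_one : topologicalKrullDim (projSpace 1) = 1 := by
  have : Nonempty (projCover 1).I₀ := ⟨(0 : Fin 2)⟩
  refine topologicalKrullDim_eq_of_openCover (projCover 1) 1 fun (i : Fin 2) => ?_
  refine (PrimeSpectrum.topologicalKrullDim_eq_ringKrullDim (R := AwayX (N := 1) i)).trans ?_
  rw [← ringKrullDim_eq_of_ringEquiv (curveRingEquiv i),
    Polynomial.ringKrullDim_of_isNoetherianRing, ringKrullDim_eq_zero_of_field, zero_add]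

instance : IsLocallyNoetherian (projSpace 1) := by
  refine (isLocallyNoetherian_iff_openCover (projCover 1)).2 fun (i : Fin 2) => ?_
  exact inferInstanceAs (IsLocallyNoetherian (Spec (CommRingCat.of (AwayX (N := 1) i))))

end

/-! ### Rational functions, degrees on the projective line, and the Picard number. -/

section

/-! ### Functions on affine charts as rational functions -/

section

variable {R : CommRingCat.{0}} {X : Scheme.{0}} (k : Spec R ⟶ X) [IsOpenImmersion k]

/-- The functions on an affine chart, as sections. -/
def chartSec : R ⟶ Γ(X, k ''ᵁ ⊤) := (Scheme.ΓSpecIso R).inv ≫ (k.appIso ⊤).inv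

lemma mem_image_top {x : X} (hx : x ∈ Set.range k) : x ∈ k ''ᵁ ⊤ := by
  obtain ⟨y, rfl⟩ := hx
  exact ⟨y, trivial, rfl⟩

/-- The germs of the functions on an affine chart. -/
def chartGerm (x : X) (hx : x ∈ Set.range k) : R →+* X.presheaf.stalk x :=
  (chartSec k ≫ X.presheaf.germ (k ''ᵁ ⊤) x (mem_image_top k hx)).hom

lemma chartGerm_apply (x : X) (hx : x ∈ Set.range k) (a : R) :
    chartGerm k x hx a = X.presheaf.germ (k ''ᵁ ⊤) x (mem_image_top k hx) (chartSec k a) := rfl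

lemma chartSec_appLE {S : CommRingCat.{0}} {C : Scheme.{0}} {e : Spec S ⟶ C} [IsOpenImmersion e]
    {j : C ⟶ X} {φ : R ⟶ S} (h : e ≫ j = Spec.map φ ≫ k) (hle : e ''ᵁ ⊤ ≤ j ⁻¹ᵁ (k ''ᵁ ⊤)) :
    chartSec k ≫ j.appLE (k ''ᵁ ⊤) (e ''ᵁ ⊤) hle = φ ≫ chartSec e := by
  have h1 : j.appLE (k ''ᵁ ⊤) (e ''ᵁ ⊤) hle ≫ (e.appIso ⊤).hom =
      (k.appIso ⊤).hom ≫ (Spec.map φ).appLE ⊤ ⊤ le_top := by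
    rw [Scheme.Hom.appIso_hom', Scheme.Hom.appIso_hom', Scheme.Hom.appLE_comp_appLE]
    refine Eq.trans ?_ (Scheme.Hom.appLE_comp_appLE (Spec.map φ) k (k ''ᵁ ⊤) ⊤ ⊤ _ _).symm
    simp only [h]
  rw [← cancel_mono (e.appIso ⊤).hom, Category.assoc, h1]
  simp only [chartSec, Category.assoc, Iso.inv_hom_id_assoc, Iso.inv_hom_id, Category.comp_id]
  have h2 : (Scheme.ΓSpecIso R).inv ≫ (Spec.map φ).app ⊤ = φ ≫ (Scheme.ΓSpecIso S).inv :=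
    (Scheme.ΓSpecIso_inv_naturality φ).symm
  rw [← h2, Scheme.Hom.app_eq_appLE]
  rfl

lemma stalkMap_chartGerm {S : CommRingCat.{0}} {C : Scheme.{0}} {e : Spec S ⟶ C}
    [IsOpenImmersion e] {j : C ⟶ X} {φ : R ⟶ S} (h : e ≫ j = Spec.map φ ≫ k) (p : C)
    (hp : p ∈ Set.range e) (hjp : j p ∈ Set.range k) (a : R) :
    (j.stalkMap p).hom (chartGerm k (j p) hjp a) = chartGerm e p hp (φ a) := by
  have hle : e ''ᵁ ⊤ ≤ j ⁻¹ᵁ (k ''ᵁ ⊤) := by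
    rintro _ ⟨y, -, rfl⟩
    refine mem_image_top k ⟨Spec.map φ y, ?_⟩
    exact (congrArg (fun f => f y) h).symm
  have h1 := chartSec_appLE k h hle
  rw [chartGerm_apply, chartGerm_apply]
  have h2 : chartSec e (φ a) = j.appLE (k ''ᵁ ⊤) (e ''ᵁ ⊤) hle (chartSec k a) :=
    (congrArg (fun f => f.hom a) h1).symm
  rw [h2]
  refine (Scheme.Hom.germ_stalkMap_apply j _ p (mem_image_top k hjp) _).trans ?_
  exact (TopCat.Presheaf.germ_res_apply C.presheaf (homOfLE hle) p (mem_image_top e hp) _).symm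

lemma chartGerm_comp {S : CommRingCat.{0}} {e : Spec S ⟶ X} [IsOpenImmersion e] {φ : R ⟶ S}
    (h : e = Spec.map φ ≫ k) (x : X) (he : x ∈ Set.range e) (hk : x ∈ Set.range k) (a : R) :
    chartGerm e x he (φ a) = chartGerm k x hk a := by
  have hle : e ''ᵁ ⊤ ≤ k ''ᵁ ⊤ := by
    rintro _ ⟨y, -, rfl⟩
    refine mem_image_top k ⟨Spec.map φ y, ?_⟩
    exact (congrArg (fun f => f y) h).symm
  have h1 := chartSec_appLE k (j := 𝟙 X) ((Category.comp_id e).trans h) hle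
  have h2 : chartSec e (φ a) = (𝟙 X : X ⟶ X).appLE (k ''ᵁ ⊤) (e ''ᵁ ⊤) hle (chartSec k a) :=
    (congrArg (fun f => f.hom a) h1).symm
  have h3 : (𝟙 X : X ⟶ X).appLE (k ''ᵁ ⊤) (e ''ᵁ ⊤) hle = X.presheaf.map (homOfLE hle).op := by
    simp only [Scheme.Hom.appLE, Scheme.Hom.id_app]
    exact Category.id_comp _
  rw [chartGerm_apply, chartGerm_apply, h2, h3]
  exact TopCat.Presheaf.germ_res_apply X.presheaf (homOfLE hle) x (mem_image_top e he) _

lemma stalkMap_chartGerm_self (y : Spec R) (a : R) :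
    (k.stalkMap y).hom (chartGerm k (k y) (Set.mem_range_self y) a) = (StructureSheaf.toStalk R y).hom a := by
  have h1 : chartSec k ≫ k.appLE (k ''ᵁ ⊤) ⊤ (Scheme.Hom.preimage_image_eq k ⊤).ge =
      (Scheme.ΓSpecIso R).inv := by
    rw [← Scheme.Hom.appIso_hom', chartSec, Category.assoc, Iso.inv_hom_id, Category.comp_id]
  refine (Scheme.Hom.germ_stalkMap_apply k _ y (mem_image_top k (Set.mem_range_self y)) (chartSec k a)).trans ?_
  refine (TopCat.Presheaf.germ_res_apply (Spec R).presheaf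
    (homOfLE (Scheme.Hom.preimage_image_eq k ⊤).ge) y trivial _).symm.trans ?_
  exact congrArg (fun f => (Spec R).presheaf.germ ⊤ y trivial (f.hom a)) h1

lemma isLocalization_of_ringEquiv {A B C : Type*} [CommRing A] [CommRing B] [CommRing C]
    (S : Submonoid A) (f : A →+* B) (g : A →+* C) (e : B ≃+* C) (he : ∀ a, e (f a) = g a)
    (hg : @IsLocalization A _ S C _ g.toAlgebra) : @IsLocalization A _ S B _ f.toAlgebra := by
  let _ := f.toAlgebra
  let _ := g.toAlgebra
  exact IsLocalization.isLocalization_of_algEquiv S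
    (AlgEquiv.ofRingEquiv (f := e.symm) fun a => e.symm_apply_eq.2 (he a).symm : C ≃ₐ[A] B)

instance (y : Spec R) : y.asIdeal.IsPrime := PrimeSpectrum.isPrime y

lemma isLocalization_chartGerm (y : Spec R) :
    @IsLocalization R _ y.asIdeal.primeCompl (X.presheaf.stalk (k y)) _
      (chartGerm k (k y) (Set.mem_range_self y)).toAlgebra :=
  isLocalization_of_ringEquiv _ _ (StructureSheaf.toStalk R y).hom
    (asIso (k.stalkMap y)).commRingCatIsoToRingEquiv (stalkMap_chartGerm_self k y)
    (StructureSheaf.IsLocalization.to_stalk R y)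

lemma isUnit_chartGerm_iff {y : Spec R} {a : R} :
    IsUnit (chartGerm k (k y) (Set.mem_range_self y) a) ↔ a ∉ y.asIdeal := by
  let _ : Algebra R (X.presheaf.stalk (k y)) := (chartGerm k (k y) (Set.mem_range_self y)).toAlgebra
  have : IsLocalization.AtPrime (X.presheaf.stalk (k y)) y.asIdeal := isLocalization_chartGerm k y
  exact IsLocalization.AtPrime.isUnit_to_map_iff (X.presheaf.stalk (k y)) y.asIdeal a

variable [IsIntegral X] [IsDomain R]

lemma genericPoint_mem_range : genericPoint X ∈ Set.range k :=
  ⟨genericPoint (Spec R), genericPoint_eq_of_isOpenImmersion k⟩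

/-- The rational functions given by the functions on an affine chart. -/
def chartFun : R →+* X.functionField := chartGerm k (genericPoint X) (genericPoint_mem_range k)

lemma algebraMap_chartGerm (x : X) (hx : x ∈ Set.range k) (a : R) :
    algebraMap (X.presheaf.stalk x) X.functionField (chartGerm k x hx a) = chartFun k a := by
  have := TopCat.Presheaf.germ_stalkSpecializes_apply X.presheaf (mem_image_top k hx)
    ((genericPoint_spec X).specializes (Set.mem_univ x)) (chartSec k a)
  exact this

lemma chartFun_injective : Function.Injective (chartFun k) := by
  refine (injective_iff_map_eq_zero _).2 fun a ha => ?_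
  by_contra h
  let y : Spec R := (⟨⊥, Ideal.isPrime_bot⟩ : PrimeSpectrum R)
  have hu : IsUnit (chartGerm k (k y) (Set.mem_range_self y) a) := (isUnit_chartGerm_iff k).2 (by simpa [y])
  have h1 := hu.map (algebraMap (X.presheaf.stalk (k y)) X.functionField)
  rw [algebraMap_chartGerm, ha] at h1
  exact not_isUnit_zero h1

/-- The rational functions given by the nonzero functions on an affine chart. -/
def chartUnit (a : R) (ha : a ≠ 0) : (X.functionField)ˣ :=
  Units.mk0 (chartFun k a) ((map_ne_zero_iff _ (chartFun_injective k)).2 ha)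

lemma chartUnit_mul {a b : R} (ha : a ≠ 0) (hb : b ≠ 0) :
    chartUnit k (a * b) (mul_ne_zero ha hb) = chartUnit k a ha * chartUnit k b hb :=
  Units.ext (map_mul _ _ _)

lemma chartUnit_mem_localUnits {y : Spec R} {a : R} (ha : a ≠ 0) :
    chartUnit k a ha ∈ localUnits X (k y) ↔ a ∉ y.asIdeal := by
  rw [← isUnit_chartGerm_iff k]
  constructor
  · rintro ⟨u, hu⟩
    have h1 : algebraMap (X.presheaf.stalk (k y)) X.functionField u =
        algebraMap (X.presheaf.stalk (k y)) X.functionField (chartGerm k (k y) (Set.mem_range_self y) a) := by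
      rw [algebraMap_chartGerm]
      exact congrArg Units.val hu
    rw [← IsFractionRing.injective _ _ h1]
    exact u.isUnit
  · rintro ⟨u, hu⟩
    refine ⟨u, Units.ext ?_⟩
    change algebraMap (X.presheaf.stalk (k y)) X.functionField u = chartFun k a
    rw [hu, algebraMap_chartGerm]

lemma exists_of_mem_localUnits {y : Spec R} {f : (X.functionField)ˣ}
    (hf : f ∈ localUnits X (k y)) : ∃ (a b : R) (ha : a ≠ 0) (hb : b ≠ 0), a ∉ y.asIdeal ∧
      b ∉ y.asIdeal ∧ f = chartUnit k a ha / chartUnit k b hb := by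
  obtain ⟨u, rfl⟩ := hf
  let _ : Algebra R (X.presheaf.stalk (k y)) := (chartGerm k (k y) (Set.mem_range_self y)).toAlgebra
  have : IsLocalization.AtPrime (X.presheaf.stalk (k y)) y.asIdeal := isLocalization_chartGerm k y
  obtain ⟨⟨a, b⟩, hab⟩ := IsLocalization.surj y.asIdeal.primeCompl u.1
  have hab : u.1 * chartGerm k (k y) (Set.mem_range_self y) b = chartGerm k (k y) (Set.mem_range_self y) a := hab
  have ha : a ∉ y.asIdeal := by
    rw [← isUnit_chartGerm_iff k, ← hab]
    exact u.isUnit.mul ((isUnit_chartGerm_iff k).2 b.2)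
  have h0 : ∀ a : R, a ∉ y.asIdeal → a ≠ 0 := by
    rintro a ha rfl
    exact ha (zero_mem _)
  refine ⟨a, b, h0 _ ha, h0 _ b.2, ha, b.2, eq_div_of_mul_eq' (Units.ext ?_)⟩
  have h1 := congrArg (algebraMap (X.presheaf.stalk (k y)) X.functionField) hab
  rw [map_mul, algebraMap_chartGerm, algebraMap_chartGerm] at h1
  exact h1

lemma exists_chartUnit_div (f : (X.functionField)ˣ) :
    ∃ (a b : R) (ha : a ≠ 0) (hb : b ≠ 0), f = chartUnit k a ha / chartUnit k b hb := by
  have hf : f ∈ localUnits X (k (genericPoint (Spec R))) := by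
    rw [genericPoint_eq_of_isOpenImmersion k]
    refine ⟨f, Units.ext ?_⟩
    change X.presheaf.stalkSpecializes _ f.1 = f.1
    rw [TopCat.Presheaf.stalkSpecializes_refl]
    rfl
  obtain ⟨a, b, ha, hb, -, -, h⟩ := exists_of_mem_localUnits k hf
  exact ⟨a, b, ha, hb, h⟩

end

lemma chartFun_comp {X : Scheme.{0}} [IsIntegral X] {R S : CommRingCat.{0}} [IsDomain R]
    [IsDomain S] (k : Spec R ⟶ X) [IsOpenImmersion k] {e : Spec S ⟶ X} [IsOpenImmersion e]
    {φ : R ⟶ S} (h : e = Spec.map φ ≫ k) (a : R) : chartFun e (φ a) = chartFun k a :=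
  chartGerm_comp k h _ _ _ a

end

section

/-! ### Degrees on the projective line -/

/-- The maximal ideal of the stalk is generated by the image of π, so the stalk is a discrete
valuation ring with this uniformizer; in particular the point has codimension one. -/
lemma ord_chartFun_eq_one {C : Scheme.{0}} [IsIntegral C] [IsLocallyNoetherian C]
    {S : CommRingCat.{0}} [IsDomain S] (k : Spec S ⟶ C) [IsOpenImmersion k] {y : Spec S} {π : S}
    (hπ : π ≠ 0) (hy : y.asIdeal = Ideal.span {π}) : Scheme.ord (chartFun k π) (k y) = 1 := by
  let _ : Algebra S (C.presheaf.stalk (k y)) := (chartGerm k (k y) (Set.mem_range_self y)).toAlgebra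
  have : IsLocalization.AtPrime (C.presheaf.stalk (k y)) y.asIdeal := isLocalization_chartGerm k y
  set ϖ := chartGerm k (k y) (Set.mem_range_self y) π with hϖ
  have hϖ0 : ϖ ≠ 0 := fun h => by
    have h1 := algebraMap_chartGerm k (k y) (Set.mem_range_self y) π
    rw [← hϖ, h, map_zero] at h1
    exact hπ ((map_eq_zero_iff _ (chartFun_injective k)).1 h1.symm)
  have hmax : IsLocalRing.maximalIdeal (C.presheaf.stalk (k y)) = Ideal.span {ϖ} := by
    rw [← IsLocalization.AtPrime.map_eq_maximalIdeal y.asIdeal, hy, Ideal.map_span,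
      Set.image_singleton]
    rfl
  have hf : ¬ IsField (C.presheaf.stalk (k y)) := fun h => by
    rw [IsLocalRing.isField_iff_maximalIdeal_eq, hmax, Ideal.span_singleton_eq_bot] at h
    exact hϖ0 h
  have hdvr : IsDiscreteValuationRing (C.presheaf.stalk (k y)) :=
    have h1 : IsDiscreteValuationRing (C.presheaf.stalk (k y)) ↔
        (IsLocalRing.maximalIdeal (C.presheaf.stalk (k y))).IsPrincipal :=
      (IsDiscreteValuationRing.TFAE (C.presheaf.stalk (k y)) hf).out 0 4
    h1.2 ⟨ϖ, hmax⟩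
  have hx : Order.coheight (k y) = 1 := by
    have h1 := ringKrullDim_stalk_eq_coheight (k y)
    rw [IsPrincipalIdealRing.ringKrullDim_eq_one _ hf] at h1
    exact_mod_cast h1.symm
  rw [Scheme.ord_eq_iff hx ((map_ne_zero_iff _ (chartFun_injective k)).2 hπ),
    ← algebraMap_chartGerm k (k y) (Set.mem_range_self y)]
  have : Ring.KrullDimLE 1 (C.presheaf.stalk (k y)) := krullDimLE_of_coheight_le hx.le
  exact Ring.ordFrac_irreducible
    ((IsDiscreteValuationRing.irreducible_iff_uniformizer _).2 hmax)

lemma ordUnits_eq_one {C : Scheme.{0}} [IsIntegral C] [IsLocallyNoetherian C] {x : C}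
    {f : (C.functionField)ˣ} (hf : f ∈ localUnits C x) : ordUnits C x f = 1 :=
  localUnits_le_ker_ordUnits C x hf

lemma isDomain_away {N : ℕ} {f : MvPolynomial (Fin (N + 1)) ℂ} (hf : f ≠ 0) :
    IsDomain (HomogeneousLocalization.Away (stdGrading N) f) := by
  have : IsDomain (Localization.Away f) :=
    IsLocalization.isDomain_localization (powers_le_nonZeroDivisors_of_noZeroDivisors hf)
  exact (HomogeneousLocalization.val_injective _).isDomain
    (algebraMap (HomogeneousLocalization.Away (stdGrading N) f) (Localization.Away f))

/-- The rational functions on the projective line given by the functions on a standard chart. -/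
abbrev lineFun (i : Fin 2) : AwayX (N := 1) i →+* (projSpace 1).functionField :=
  chartFun (R := CommRingCat.of (AwayX (N := 1) i)) (awayEmb (N := 1) i)

/-- The rational functions on the projective line given by the functions on a standard chart,
as units. -/
abbrev lineUnit (i : Fin 2) (a : AwayX (N := 1) i) (ha : a ≠ 0) : ((projSpace 1).functionField)ˣ :=
  chartUnit (R := CommRingCat.of (AwayX (N := 1) i)) (awayEmb (N := 1) i) a ha

/-- The overlap y₀y₁ ≠ 0 compares rational functions from the two standard charts: the coordinates
are inverse and the constants coincide. -/
lemma exists_overlap : ∃ (R : CommRingCat.{0}) (φ : ∀ i : Fin 2, AwayX (N := 1) i →+* R)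
    (μ : R →+* (projSpace 1).functionField), (∀ i a, μ (φ i a) = lineFun i a) ∧
    φ 0 (awayRatio (N := 1) 0 1) * φ 1 (awayRatio (N := 1) 1 0) = 1 ∧
    ∀ z : ℂ, φ 0 (algebraMap ℂ _ z) = φ 1 (algebraMap ℂ _ z) := by
  let x : MvPolynomial (Fin 2) ℂ := MvPolynomial.X 0 * MvPolynomial.X 1
  have hx0 : x ≠ 0 := mul_ne_zero (MvPolynomial.X_ne_zero _) (MvPolynomial.X_ne_zero _)
  have hx : ∀ i : Fin 2, x = MvPolynomial.X i * MvPolynomial.X (i + 1) := by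
    intro i
    fin_cases i
    · rfl
    · exact mul_comm _ _
  have := isDomain_away (N := 1) hx0
  let R := CommRingCat.of (HomogeneousLocalization.Away (stdGrading 1) x)
  let e : Spec R ⟶ projSpace 1 := Proj.awayι (stdGrading 1) x
    (SetLike.mul_mem_graded (X_mem_stdGrading 0) (X_mem_stdGrading 1)) (by simp)
  have : IsOpenImmersion e := inferInstanceAs (IsOpenImmersion (Proj.awayι (stdGrading 1) x _ _))
  have : IsDomain R := isDomain_away (N := 1) hx0
  let φ : ∀ i : Fin 2, AwayX (N := 1) i →+* R := fun i =>
    HomogeneousLocalization.awayMap (stdGrading 1) (X_mem_stdGrading (i + 1)) (hx i)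
  refine ⟨R, φ, chartFun e, fun i a => ?_, ?_, fun z => ?_⟩
  · refine chartFun_comp (R := CommRingCat.of (AwayX (N := 1) i)) (awayEmb (N := 1) i)
      (φ := CommRingCat.ofHom (φ i)) ?_ a
    exact (Proj.SpecMap_awayMap_awayι (stdGrading 1) (X_mem_stdGrading i) Nat.one_pos
      (X_mem_stdGrading (i + 1)) (hx i)).symm
  · exact awayMap_ratio_mul (N := 1) 0 1 (hx 0) (hx 1)
  · apply HomogeneousLocalization.val_injective
    exact (val_awayMap_algebraMap (N := 1) (X_mem_stdGrading 1) (hx 0) z).trans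
      (val_awayMap_algebraMap (N := 1) (X_mem_stdGrading 0) (hx 1) z).symm

lemma lineFun_ratio_mul :
    lineFun 0 (awayRatio (N := 1) 0 1) * lineFun 1 (awayRatio (N := 1) 1 0) = 1 := by
  obtain ⟨R, φ, μ, h, h1, -⟩ := exists_overlap
  rw [← h, ← h, ← map_mul, h1, map_one]

lemma lineFun_algebraMap (z : ℂ) : lineFun 0 (algebraMap ℂ _ z) = lineFun 1 (algebraMap ℂ _ z) := by
  obtain ⟨R, φ, μ, h, -, h1⟩ := exists_overlap
  rw [← h, ← h, h1]

/-- The coordinate centered at a point of a standard chart of the projective line. -/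
def lin (i : Fin 2) (z : ℂ) : AwayX (N := 1) i :=
  awayRatio (N := 1) i (i + 1) - algebraMap ℂ _ z

lemma curveRingEquiv_X_sub_C (i : Fin 2) (z : ℂ) :
    curveRingEquiv i (Polynomial.X - Polynomial.C z) = lin i z := by
  rw [curveRingEquiv_apply, map_sub, Polynomial.aeval_X, Polynomial.aeval_C, lin]

lemma lin_zero (i : Fin 2) : lin i 0 = awayRatio (N := 1) i (i + 1) := by
  rw [lin, map_zero, sub_zero]

lemma prime_lin (i : Fin 2) (z : ℂ) : Prime (lin i z) := by
  rw [← curveRingEquiv_X_sub_C]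
  exact (MulEquiv.prime_iff (curveRingEquiv i)).2 (Polynomial.prime_X_sub_C z)

/-- The closed points of a standard chart of the projective line. -/
def linPoint (i : Fin 2) (z : ℂ) : Spec (CommRingCat.of (AwayX (N := 1) i)) :=
  (⟨Ideal.span {lin i z}, (Ideal.span_singleton_prime (prime_lin i z).ne_zero).2 (prime_lin i z)⟩ :
    PrimeSpectrum (AwayX (N := 1) i))

lemma lin_mem_iff (i : Fin 2) (z : ℂ) (y : Spec (CommRingCat.of (AwayX (N := 1) i))) :
    lin i z ∈ (y : PrimeSpectrum (AwayX (N := 1) i)).asIdeal ↔ y = linPoint i z := by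
  constructor
  · intro h
    refine PrimeSpectrum.ext ?_
    have hm : (Ideal.span {lin i z}).IsMaximal :=
      PrincipalIdealRing.isMaximal_of_irreducible (prime_lin i z).irreducible
    exact (hm.eq_of_le (PrimeSpectrum.isPrime (R := AwayX (N := 1) i) y).ne_top
      ((Ideal.span_singleton_le_iff_mem _).2 h)).symm
  · rintro rfl
    exact Ideal.mem_span_singleton_self _

/-- The point of the projective line where `y₀` vanishes. -/
def infPoint : projSpace 1 := awayEmb (N := 1) 1 (linPoint 1 0)

lemma eq_infPoint_or (x : projSpace 1) : x = infPoint ↔ x ∉ Set.range (awayEmb (N := 1) 0) := by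
  have h1 : ∀ y, awayEmb (N := 1) 1 y ∉ Set.range (awayEmb (N := 1) 0) ↔ y = linPoint 1 0 := by
    intro y
    rw [← lin_mem_iff, lin_zero]
    have h2 := awayEmb_mem_coordOpen (N := 1) 1 0 y
    rw [← opensRange_awayEmb] at h2
    exact (not_congr h2).trans not_not
  constructor
  · rintro rfl
    exact (h1 _).2 rfl
  · intro h
    obtain ⟨i, y, rfl⟩ := IsWallCurve.exists_awayEmb x
    obtain rfl | rfl := eq_or_eq_add_one 0 i
    · exact absurd ⟨y, rfl⟩ h
    · exact congrArg _ ((h1 y).1 h)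

-- With w = y₀/y₁, the function y₁/y₀ - z equals (1 - zw)/w: a simple zero at z, a simple pole at
-- infinity, and a unit elsewhere.
open Classical in
lemma ordUnits_lin (z : ℂ) (p : projSpace 1) :
    (ordUnits _ p (lineUnit 0 (lin 0 z) (prime_lin 0 z).ne_zero)).toAdd =
      (Pi.single (awayEmb (N := 1) 0 (linPoint 0 z)) (1 : ℤ) : projSpace 1 → ℤ) p +
        (Pi.single infPoint (-1) : projSpace 1 → ℤ) p := by
  have hinj : Function.Injective (awayEmb (N := 1) 0) := (awayEmb (N := 1) 0).isOpenEmbedding.injective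
  by_cases hp : p = infPoint
  · have hne : p ≠ awayEmb (N := 1) 0 (linPoint 0 z) := fun h =>
      (eq_infPoint_or p).1 hp ⟨_, h.symm⟩
    rw [Pi.single_eq_of_ne hne, hp, Pi.single_eq_same]
    have h0 : 1 - algebraMap ℂ _ z * awayRatio (N := 1) 1 0 ∉
        (linPoint 1 0 : PrimeSpectrum (AwayX (N := 1) 1)).asIdeal := by
      intro h
      refine (PrimeSpectrum.isPrime (linPoint 1 0 : PrimeSpectrum (AwayX (N := 1) 1))).ne_top ?_
      rw [Ideal.eq_top_iff_one]
      have h1 : awayRatio (N := 1) 1 0 ∈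
          (linPoint 1 0 : PrimeSpectrum (AwayX (N := 1) 1)).asIdeal := by
        have := (lin_mem_iff 1 0 (linPoint 1 0)).2 rfl
        rwa [lin_zero] at this
      have h2 := add_mem h (Ideal.mul_mem_left _ (algebraMap ℂ _ z) h1)
      rwa [sub_add_cancel] at h2
    have h00 : 1 - algebraMap ℂ _ z * awayRatio (N := 1) 1 0 ≠ 0 := fun h =>
      h0 (h ▸ zero_mem _)
    have h1 : lineUnit 0 (lin 0 z) (prime_lin 0 z).ne_zero =
        lineUnit 1 _ h00 / lineUnit 1 (lin 1 0) (prime_lin 1 0).ne_zero := by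
      rw [eq_div_iff_mul_eq']
      refine Units.ext ?_
      change lineFun 0 (lin 0 z) * lineFun 1 (lin 1 0) = lineFun 1 _
      rw [lin_zero, lin, map_sub, sub_mul, map_sub, map_one, map_mul, lineFun_algebraMap]
      congr 1
      exact lineFun_ratio_mul
    rw [h1, map_div, ordUnits_eq_one (C := projSpace 1) (x := infPoint) (f := lineUnit 1 _ h00)
      ((chartUnit_mem_localUnits (R := CommRingCat.of (AwayX (N := 1) 1)) (awayEmb (N := 1) 1)
        (y := linPoint 1 0) h00).2 h0)]
    have h2 : Scheme.ord (lineFun 1 (lin 1 0)) infPoint = 1 :=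
      ord_chartFun_eq_one (S := CommRingCat.of (AwayX (N := 1) 1)) (awayEmb (N := 1) 1)
        (prime_lin 1 0).ne_zero (y := linPoint 1 0) rfl
    change 0 - Scheme.ord (lineFun 1 (lin 1 0)) infPoint = _
    rw [h2]
    rfl
  · rw [Pi.single_eq_of_ne hp, add_zero]
    rw [eq_infPoint_or, not_not] at hp
    obtain ⟨y, rfl⟩ := hp
    by_cases hy : y = linPoint 0 z
    · rw [hy, Pi.single_eq_same]
      exact ord_chartFun_eq_one (S := CommRingCat.of (AwayX (N := 1) 0)) (awayEmb (N := 1) 0)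
        (prime_lin 0 z).ne_zero (y := linPoint 0 z) rfl
    · rw [Pi.single_eq_of_ne (fun h => hy (hinj h)), ordUnits_eq_one, toAdd_one]
      refine (chartUnit_mem_localUnits (R := CommRingCat.of (AwayX (N := 1) 0))
        (awayEmb (N := 1) 0) (prime_lin 0 z).ne_zero).2 ?_
      exact (not_congr (lin_mem_iff 0 z y)).2 hy

open Classical in
lemma finsum_single {α : Type*} (a : α) (n : ℤ) : ∑ᶠ x, (Pi.single a n : α → ℤ) x = n := by
  rw [finsum_eq_single _ a fun x hx => Pi.single_eq_of_ne hx _, Pi.single_eq_same]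

open Classical in
lemma support_single_finite {α : Type*} (a : α) (n : ℤ) :
    (Function.support (Pi.single a n : α → ℤ)).Finite :=
  (Set.finite_singleton a).subset Pi.support_single_subset

/-- The rational functions on the projective line whose divisor has degree zero. -/
def degreeZero : Subgroup ((projSpace 1).functionField)ˣ where
  carrier := {f | (Function.support fun p => (ordUnits (projSpace 1) p f).toAdd).Finite ∧
    ∑ᶠ p, (ordUnits (projSpace 1) p f).toAdd = 0}
  one_mem' := by simp
  mul_mem' := by
    rintro f g ⟨hf, hf'⟩ ⟨hg, hg'⟩
    change Set.Finite _ ∧ _ = _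
    simp only [map_mul, toAdd_mul]
    refine ⟨(hf.union hg).subset (Function.support_add _ _), ?_⟩
    rw [finsum_add_distrib hf hg, hf', hg', add_zero]
  inv_mem' := by
    rintro f ⟨hf, hf'⟩
    change Set.Finite _ ∧ _ = _
    simp only [map_inv, toAdd_inv]
    refine ⟨?_, ?_⟩
    · rwa [Function.support_fun_neg]
    · rw [finsum_neg_distrib, hf', neg_zero]

lemma lin_mem_degreeZero (z : ℂ) : lineUnit 0 (lin 0 z) (prime_lin 0 z).ne_zero ∈ degreeZero := by
  classical
  change Set.Finite _ ∧ _ = _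
  simp only [ordUnits_lin]
  refine ⟨((support_single_finite _ _).union (support_single_finite _ _)).subset
    (Function.support_add _ _), ?_⟩
  rw [finsum_add_distrib (support_single_finite _ _) (support_single_finite _ _), finsum_single,
    finsum_single]
  rfl

lemma const_mem_degreeZero (z : ℂ) (hz : algebraMap ℂ (AwayX (N := 1) 0) z ≠ 0) :
    lineUnit 0 (algebraMap ℂ _ z) hz ∈ degreeZero := by
  have hz0 : z ≠ 0 := fun h => hz (by rw [h, map_zero])
  have hz1 : algebraMap ℂ (AwayX (N := 1) 1) z ≠ 0 := (map_ne_zero _).2 hz0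
  have h : ∀ p, ordUnits (projSpace 1) p (lineUnit 0 (algebraMap ℂ _ z) hz) = 1 := by
    intro p
    refine ordUnits_eq_one ?_
    have hi : ∀ (i : Fin 2) (hzi : algebraMap ℂ (AwayX (N := 1) i) z ≠ 0) (y),
        lineUnit i (algebraMap ℂ _ z) hzi ∈ localUnits (projSpace 1) (awayEmb (N := 1) i y) := by
      intro i hzi y
      refine (chartUnit_mem_localUnits (R := CommRingCat.of (AwayX (N := 1) i))
        (awayEmb (N := 1) i) hzi).2 fun h => ?_
      exact (PrimeSpectrum.isPrime (R := AwayX (N := 1) i) y).ne_top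
        (Ideal.eq_top_of_isUnit_mem _ h ((isUnit_iff_ne_zero.2 hz0).map (algebraMap ℂ _)))
    obtain ⟨i, y, rfl⟩ := IsWallCurve.exists_awayEmb p
    obtain rfl | rfl := eq_or_eq_add_one 0 i
    · exact hi 0 hz y
    · have h1 : lineUnit 0 (algebraMap ℂ _ z) hz = lineUnit 1 (algebraMap ℂ _ z) hz1 :=
        Units.ext (lineFun_algebraMap z)
      rw [h1]
      exact hi 1 hz1 y
  change Set.Finite _ ∧ _ = _
  simp only [h, toAdd_one]
  simp

/-- Polynomials over ℂ split, so every nonzero rational function is a quotient of products of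
constants and linear factors, all of which have degree zero. -/
lemma degreeZero_eq_top : degreeZero = ⊤ := by
  have key : ∀ n (f : Polynomial ℂ) (hf : f.natDegree = n) (h : curveRingEquiv 0 f ≠ 0),
      lineUnit 0 (curveRingEquiv 0 f) h ∈ degreeZero := by
    intro n
    induction n with
    | zero =>
      intro f hf h
      obtain ⟨z, rfl⟩ : ∃ z, Polynomial.C z = f := ⟨_, (Polynomial.eq_C_of_natDegree_eq_zero hf).symm⟩
      have h1 : curveRingEquiv 0 (Polynomial.C z) = algebraMap ℂ _ z := by
        rw [curveRingEquiv_apply, Polynomial.aeval_C]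
      simp only [h1]
      exact const_mem_degreeZero z _
    | succ n ih =>
      intro f hf h
      obtain ⟨z, hz⟩ := IsAlgClosed.exists_root f fun h => by
        rw [Polynomial.natDegree_eq_zero_iff_degree_le_zero.2 h.le] at hf
        omega
      obtain ⟨g, rfl⟩ := Polynomial.dvd_iff_isRoot.2 hz
      have hg : g ≠ 0 := by
        rintro rfl
        exact h (by rw [mul_zero, map_zero])
      have hg' : curveRingEquiv 0 g ≠ 0 := (map_ne_zero_iff _ (curveRingEquiv 0).injective).2 hg
      rw [Polynomial.natDegree_mul (Polynomial.X_sub_C_ne_zero z) hg,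
        Polynomial.natDegree_X_sub_C] at hf
      simp only [map_mul, curveRingEquiv_X_sub_C]
      have h2 := chartUnit_mul (R := CommRingCat.of (AwayX (N := 1) 0)) (awayEmb (N := 1) 0)
        (prime_lin 0 z).ne_zero hg'
      exact (congrArg (· ∈ degreeZero) h2).mpr
        (mul_mem (lin_mem_degreeZero z) (ih g (by omega) hg'))
  refine (Subgroup.eq_top_iff' _).2 fun f => ?_
  obtain ⟨a, b, ha, hb, rfl⟩ := exists_chartUnit_div (R := CommRingCat.of (AwayX (N := 1) 0))
    (awayEmb (N := 1) 0) f
  obtain ⟨a, rfl⟩ := (curveRingEquiv 0).surjective a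
  obtain ⟨b, rfl⟩ := (curveRingEquiv 0).surjective b
  exact div_mem (key _ a rfl ha) (key _ b rfl hb)

lemma divisorOrd_eq {C : Scheme.{0}} [IsIntegral C] [IsLocallyNoetherian C] {E : CartierDivisor C}
    {x : C} {f : (C.functionField)ˣ} (h : E.germ x = QuotientGroup.mk f) :
    divisorOrd C E x = (ordUnits C x f).toAdd := by
  rw [divisorOrd, h]
  rfl

/-- The degree of a divisor on the projective line given by a rational function twisted by a power
of the coordinate at infinity. -/
lemma curveDegree_eq {E : CartierDivisor (projSpace 1)} {g : ((projSpace 1).functionField)ˣ} {n : ℤ}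
    (h0 : ∀ y, E.germ (awayEmb (N := 1) 0 y) = QuotientGroup.mk g)
    (h1 : ∀ y, E.germ (awayEmb (N := 1) 1 y) =
      QuotientGroup.mk (g * lineUnit 1 (lin 1 0) (prime_lin 1 0).ne_zero ^ n)) :
    curveDegree (projSpace 1) E = n := by
  classical
  have key : ∀ p, divisorOrd (projSpace 1) E p = (ordUnits (projSpace 1) p g).toAdd +
      (Pi.single infPoint n : projSpace 1 → ℤ) p := by
    intro p
    by_cases hp : p = infPoint
    · have h5 : E.germ infPoint =
          QuotientGroup.mk (g * lineUnit 1 (lin 1 0) (prime_lin 1 0).ne_zero ^ n) := h1 _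
      rw [hp, divisorOrd_eq h5, map_mul, map_zpow, toAdd_mul, toAdd_zpow, Pi.single_eq_same]
      have h2 : Scheme.ord (lineFun 1 (lin 1 0)) infPoint = 1 :=
        ord_chartFun_eq_one (S := CommRingCat.of (AwayX (N := 1) 1)) (awayEmb (N := 1) 1)
          (prime_lin 1 0).ne_zero (y := linPoint 1 0) rfl
      have h3 : (ordUnits (projSpace 1) infPoint
          (lineUnit 1 (lin 1 0) (prime_lin 1 0).ne_zero)).toAdd = 1 := h2
      rw [h3, smul_eq_mul, mul_one]
    · rw [Pi.single_eq_of_ne hp, add_zero]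
      rw [eq_infPoint_or, not_not] at hp
      obtain ⟨y, rfl⟩ := hp
      exact divisorOrd_eq (h0 y)
  have hg : g ∈ degreeZero := degreeZero_eq_top ▸ Subgroup.mem_top g
  rw [curveDegree]
  simp only [key]
  rw [finsum_add_distrib hg.1 (support_single_finite _ _), hg.2, finsum_single, zero_add]

end

section

/-! ### Cartier divisors on factorial charts -/

section

variable {X : Scheme.{0}} [IsIntegral X]

lemma germ_add (D E : CartierDivisor X) (x : X) : (D + E).germ x = D.germ x * E.germ x := rfl

lemma germ_neg (D : CartierDivisor X) (x : X) : (-D).germ x = (D.germ x)⁻¹ := rfl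

lemma germ_sub (D E : CartierDivisor X) (x : X) : (D - E).germ x = D.germ x / E.germ x := by
  rw [sub_eq_add_neg, germ_add, germ_neg, div_eq_mul_inv]

lemma germ_principalDivisor (f : (X.functionField)ˣ) (x : X) :
    (principalDivisor X f).germ x = QuotientGroup.mk f := rfl

lemma germ_ext {D E : CartierDivisor X} (h : ∀ x, D.germ x = E.germ x) : D = E :=
  Additive.toMul.injective (Subtype.ext (funext h))

lemma principalDivisor_mul (f g : (X.functionField)ˣ) :
    principalDivisor X (f * g) = principalDivisor X f + principalDivisor X g := rfl

lemma principalDivisor_inv (f : (X.functionField)ˣ) :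
    principalDivisor X f⁻¹ = -principalDivisor X f := rfl

lemma principalDivisor_one : principalDivisor X 1 = 0 := rfl

lemma exists_germ_eq (D : CartierDivisor X) (x : X) :
    ∃ U : X.Opens, x ∈ U ∧ ∃ f : (X.functionField)ˣ, ∀ y ∈ U, D.germ y = QuotientGroup.mk f :=
  (Additive.toMul (α := cartierSubgroup X) D).2 x

variable {R : CommRingCat.{0}}

/-- The point of the spectrum given by a prime element. -/
def primePoint {p : R} (hp : Prime p) : Spec R :=
  (⟨Ideal.span {p}, (Ideal.span_singleton_prime hp.ne_zero).2 hp⟩ : PrimeSpectrum R)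

lemma mem_primePoint {p a : R} (hp : Prime p) : a ∈ (primePoint hp).asIdeal ↔ p ∣ a :=
  Ideal.mem_span_singleton

lemma exists_prime_dvd_mem [UniqueFactorizationMonoid R] {y : Spec R} {a : R} (ha : a ≠ 0) (hy : a ∈ y.asIdeal) :
    ∃ p, Prime p ∧ p ∣ a ∧ p ∈ y.asIdeal := by
  have hP : y.asIdeal.IsPrime := inferInstance
  induction a using UniqueFactorizationMonoid.induction_on_prime with
  | h₁ => exact absurd rfl ha
  | h₂ a h => exact absurd (Ideal.eq_top_of_isUnit_mem _ hy h) hP.ne_top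
  | h₃ a p h hp ih =>
    obtain h1 | h1 := hP.mem_or_mem hy
    · exact ⟨p, hp, dvd_mul_right _ _, h1⟩
    · obtain ⟨q, hq, hqa, hqy⟩ := ih h h1
      exact ⟨q, hq, hqa.mul_left _, hqy⟩

variable [IsDomain R]

lemma primePoint_eq {p q : R} (hp : Prime p) (hq : Prime q) (h : p ∣ q) :
    primePoint hp = primePoint hq :=
  PrimeSpectrum.ext (Ideal.span_singleton_eq_span_singleton.2 (hp.associated_of_dvd hq h))

variable (k : Spec R ⟶ X) [IsOpenImmersion k] [UniqueFactorizationMonoid R]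

/-- Write f in lowest terms. A prime vanishing at `y` that divides numerator or denominator would
have to divide both, since f is a unit at that prime. So neither vanishes at `y`. -/
lemma mem_localUnits_of_prime {f : (X.functionField)ˣ} {y : Spec R}
    (h : ∀ (p : R) (hp : Prime p), p ∈ y.asIdeal → f ∈ localUnits X (k (primePoint hp))) :
    f ∈ localUnits X (k y) := by
  obtain ⟨a, b, ha, hb, rfl⟩ := exists_chartUnit_div k f
  obtain ⟨a', b', c', hrel, rfl, rfl⟩ := UniqueFactorizationMonoid.exists_reduced_factors a ha b
  have hc := left_ne_zero_of_mul ha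
  have ha' := right_ne_zero_of_mul ha
  have hb' := right_ne_zero_of_mul hb
  rw [chartUnit_mul k hc ha', chartUnit_mul k hc hb', mul_div_mul_left_eq_div] at h ⊢
  have key : ∀ (p : R) (hp : Prime p), p ∈ y.asIdeal → (p ∣ a' ↔ p ∣ b') := by
    intro p hp hpy
    have h1 := h p hp hpy
    have h2 : ∀ {z : R} (hz : z ≠ 0), chartUnit k z hz ∈ localUnits X (k (primePoint hp)) ↔
        ¬ p ∣ z := fun hz => (chartUnit_mem_localUnits k hz).trans (not_congr (mem_primePoint hp))
    rw [← not_iff_not, ← h2 ha', ← h2 hb']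
    constructor
    · intro h3
      have h4 := div_mem h3 h1
      rwa [div_div_cancel] at h4
    · intro h3
      have h4 := mul_mem h1 h3
      rwa [div_mul_cancel] at h4
  have hnot : ∀ p, Prime p → p ∈ y.asIdeal → p ∣ a' → False := fun p hp hpy hpa =>
    hp.not_isUnit (hrel hpa ((key p hp hpy).1 hpa))
  refine div_mem ((chartUnit_mem_localUnits k ha').2 fun h1 => ?_)
    ((chartUnit_mem_localUnits k hb').2 fun h1 => ?_)
  · obtain ⟨p, hp, hpa, hpy⟩ := exists_prime_dvd_mem ha' h1
    exact hnot p hp hpy hpa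
  · obtain ⟨p, hp, hpb, hpy⟩ := exists_prime_dvd_mem hb' h1
    exact hnot p hp hpy ((key p hp hpy).2 hpb)

lemma exists_zpow_div_mem_localUnits (f : (X.functionField)ˣ) {p : R} (hp : Prime p) :
    ∃ n : ℤ, f / chartUnit k p hp.ne_zero ^ n ∈ localUnits X (k (primePoint hp)) := by
  have key : ∀ (a : R) (ha : a ≠ 0), ∃ n : ℕ,
      chartUnit k a ha / chartUnit k p hp.ne_zero ^ n ∈ localUnits X (k (primePoint hp)) := by
    intro a ha
    obtain ⟨c, hac, hc⟩ :=
      (FiniteMultiplicity.of_not_isUnit hp.not_isUnit ha).exists_eq_pow_mul_and_not_dvd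
    generalize multiplicity p a = n at hac
    subst hac
    refine ⟨n, ?_⟩
    have hc0 := right_ne_zero_of_mul ha
    have h1 : chartUnit k (p ^ n * c) ha / chartUnit k p hp.ne_zero ^ n = chartUnit k c hc0 := by
      rw [div_eq_iff_eq_mul']
      refine Units.ext ?_
      change chartFun k (p ^ n * c) = chartFun k p ^ n * chartFun k c
      rw [map_mul, map_pow]
    rw [h1]
    exact (chartUnit_mem_localUnits k hc0).2 fun h => hc ((mem_primePoint hp).1 h)
  obtain ⟨a, b, ha, hb, rfl⟩ := exists_chartUnit_div k f
  obtain ⟨n, hn⟩ := key a ha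
  obtain ⟨m, hm⟩ := key b hb
  refine ⟨n - m, ?_⟩
  have h1 := div_mem hn hm
  rwa [div_div_div_comm, ← zpow_natCast, ← zpow_natCast, div_eq_mul_inv (_ ^ _) (_ ^ _), ← zpow_sub] at h1

/-- A local equation near `k y` is also one at the points of the primes vanishing at `y`, because
these specialize to `y`; it is a unit there, hence at `y`. -/
lemma germ_eq_one_of_prime {D : CartierDivisor X}
    (h : ∀ (p : R) (hp : Prime p), D.germ (k (primePoint hp)) = 1) (y : Spec R) :
    D.germ (k y) = 1 := by
  obtain ⟨U, hU, f, hf⟩ := exists_germ_eq D (k y)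
  rw [hf _ hU, QuotientGroup.eq_one_iff]
  refine mem_localUnits_of_prime k fun p hp hpy => ?_
  have hs : primePoint hp ⤳ y :=
    (PrimeSpectrum.le_iff_specializes (primePoint hp) y).1
      ((Ideal.span_singleton_le_iff_mem _).2 hpy)
  have h1 := hf _ ((hs.map k.continuous).mem_open U.isOpen hU)
  rw [← QuotientGroup.eq_one_iff, ← h1, h p hp]

/-- A Cartier divisor that is trivial at all prime elements not dividing `d` is given by a product
of prime factors of `d`. -/
lemma exists_germ_eq_of_prime (H : Subgroup (X.functionField)ˣ) (d : R) (hd : d ≠ 0)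
    (hH : ∀ (p : R) (hp : Prime p), p ∣ d → chartUnit k p hp.ne_zero ∈ H) (D : CartierDivisor X)
    (h : ∀ (p : R) (hp : Prime p), ¬ p ∣ d → D.germ (k (primePoint hp)) = 1) :
    ∃ f ∈ H, ∀ y : Spec R, D.germ (k y) = QuotientGroup.mk f := by
  induction d using UniqueFactorizationMonoid.induction_on_prime generalizing D with
  | h₁ => exact absurd rfl hd
  | h₂ d hu =>
    exact ⟨1, one_mem H, germ_eq_one_of_prime k fun p hp =>
      h p hp fun hpd => hp.not_isUnit (isUnit_of_dvd_unit hpd hu)⟩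
  | h₃ d p hd' hp ih =>
    obtain ⟨U, hU, g, hg⟩ := exists_germ_eq D (k (primePoint hp))
    -- Subtracting the divisor of this power of p makes D trivial at p, so that the remaining factor
    -- of the product suffices.
    obtain ⟨n, hn⟩ := exists_zpow_div_mem_localUnits k g hp
    have hpn : chartUnit k p hp.ne_zero ^ n ∈ H := zpow_mem (hH p hp (dvd_mul_right _ _)) n
    obtain ⟨f, hf, hy⟩ := ih hd' (fun q hq hqd => hH q hq (hqd.mul_left _))
      (D - principalDivisor X (chartUnit k p hp.ne_zero ^ n)) (by
        intro q hq hqd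
        rw [germ_sub, germ_principalDivisor]
        by_cases hqp : q ∣ p
        · rw [primePoint_eq hq hp hqp, hg _ hU, ← QuotientGroup.mk_div, QuotientGroup.eq_one_iff]
          exact hn
        · rw [h q hq (fun h1 => (hq.dvd_or_dvd h1).elim hqp hqd), one_div, inv_eq_one,
            QuotientGroup.eq_one_iff]
          exact zpow_mem ((chartUnit_mem_localUnits k hp.ne_zero).2
            fun h1 => hqp ((mem_primePoint hq).1 h1)) n)
    refine ⟨f * chartUnit k p hp.ne_zero ^ n, mul_mem hf hpn, fun y => ?_⟩
    have h1 := hy y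
    rw [germ_sub, germ_principalDivisor, div_eq_iff_eq_mul] at h1
    rw [h1, QuotientGroup.mk_mul]

/-- Cartier divisors are principal on factorial charts. -/
lemma exists_germ_eq_of_factorial (D : CartierDivisor X) :
    ∃ f : (X.functionField)ˣ, ∀ y : Spec R, D.germ (k y) = QuotientGroup.mk f := by
  obtain ⟨U, hU, g, hg⟩ := exists_germ_eq D (genericPoint X)
  obtain ⟨a, b, ha, hb, rfl⟩ := exists_chartUnit_div k g
  obtain ⟨c, hc, hcU⟩ : ∃ c : R, c ≠ 0 ∧ ∀ y : Spec R, c ∉ y.asIdeal → k y ∈ U := by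
    have hopen : IsOpen (k ⁻¹' (U : Set X)) := U.isOpen.preimage k.continuous
    obtain ⟨η, hη⟩ := genericPoint_mem_range k
    obtain ⟨_, ⟨c, rfl⟩, hcη, hcU⟩ := PrimeSpectrum.isTopologicalBasis_basic_opens.exists_subset_of_mem_open
      (show η ∈ k ⁻¹' (U : Set X) by rw [Set.mem_preimage, hη]; exact hU) hopen
    exact ⟨c, fun h => hcη (h ▸ zero_mem _), fun y hy => hcU hy⟩
  -- Where c does not vanish, D has equation a/b; so D is trivial at every prime element not
  -- dividing cab.
  obtain ⟨f, -, hf⟩ := exists_germ_eq_of_prime k ⊤ (c * (a * b))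
    (mul_ne_zero hc (mul_ne_zero ha hb)) (fun _ _ _ => trivial) D fun p hp hpd => by
      rw [hg _ (hcU _ fun h => hpd (((mem_primePoint hp).1 h).mul_right _)),
        QuotientGroup.eq_one_iff]
      refine div_mem ((chartUnit_mem_localUnits k ha).2 fun h => ?_)
        ((chartUnit_mem_localUnits k hb).2 fun h => ?_)
      · exact hpd ((((mem_primePoint hp).1 h).mul_right _).mul_left _)
      · exact hpd ((((mem_primePoint hp).1 h).mul_left _).mul_left _)
  exact ⟨f, hf⟩

end

end

section

/-! ### Toric Cartier divisors -/

lemma chi_ne_zero {n : ℕ} {σ : Cone n} {m : Fin n → ℤ} (h : m ∈ dualMonoid σ) : chi h ≠ 0 := by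
  simp [chi]

lemma prime_chi_dualVec {c : Finset (Fin 7)} (hc : Unimodular c) {r : Fin 7} (hr : r ∈ c) :
    Prime (chi (dualVec_mem hc subset_rfl hr)) := by
  rw [← MulEquiv.prime_iff (chartRingEquiv hc).toMulEquiv]
  have h1 : (chartRingEquiv hc).toMulEquiv (chi (dualVec_mem hc subset_rfl hr)) =
      MvPolynomial.X ⟨r, hr⟩ := by
    change chartLift c ∅ _ _ _ = _
    rw [chartLift_chi_dualVec hc _ _ hr, dif_pos hr]
  rw [h1]
  exact MvPolynomial.X_prime

lemma chartRing_factorial {c : Finset (Fin 7)} (hc : Unimodular c) :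
    UniqueFactorizationMonoid (chartRing (cone c)) :=
  (chartRingEquiv hc).symm.toMulEquiv.uniqueFactorizationMonoid inferInstance

/-- The character on a maximal cone defining a toric divisor with given multiplicities. -/
def localWeight (c : Finset (Fin 7)) (φ : Fin 7 → ℤ) : Fin 3 → ℤ := ∑ r ∈ c, φ r • dualVec c r

lemma localWeight_dotProduct {c : Finset (Fin 7)} (hc : Unimodular c) (φ : Fin 7 → ℤ) {r : Fin 7}
    (hr : r ∈ c) : localWeight c φ ⬝ᵥ rho r = φ r := by
  rw [localWeight, sum_dotProduct, Finset.sum_eq_single_of_mem r hr]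
  · rw [smul_dotProduct, hc.dual r hr r hr, if_pos rfl, smul_eq_mul, mul_one]
  · intro r' hr' hne
    rw [smul_dotProduct, hc.dual r' hr' r hr, if_neg hne, smul_zero]

lemma localWeight_add (c : Finset (Fin 7)) (φ ψ : Fin 7 → ℤ) :
    localWeight c (φ + ψ) = localWeight c φ + localWeight c ψ := by
  simp only [localWeight, Pi.add_apply, add_smul, Finset.sum_add_distrib]

lemma mem_dualMonoid_empty (m : Fin 3 → ℤ) : m ∈ dualMonoid (cone ∅) :=
  mem_dualMonoid_cone.2 fun _ h => absurd h (Finset.notMem_empty _)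

namespace IsToric

variable {F : Finset (Finset (Fin 7))} {X : Scheme.{0}} {s : X ⟶ SpecC}
  {ι : ∀ t : faces F, chart (cone t.1) ⟶ X} [IsIntegral X]

lemma empty_mem (h : IsToric F X s ι) : ∅ ∈ faces F := by
  obtain ⟨t, -⟩ := h.cover (genericPoint X)
  exact faces_mono t.2 (Finset.empty_subset _)

/-- The charts as open immersions of spectra. -/
def emb (_ : IsToric F X s ι) (t : faces F) : Spec (CommRingCat.of (chartRing (cone t.1))) ⟶ X :=
  ι t

instance (h : IsToric F X s ι) (t : faces F) : IsOpenImmersion (h.emb t) := h.openImmersion t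

/-- The rational functions given by the functions on a chart. -/
def toFun (h : IsToric F X s ι) (t : faces F) : chartRing (cone t.1) →+* X.functionField :=
  chartFun (h.emb t)

/-- The rational functions given by the nonzero functions on a chart, as units. -/
def toUnit (h : IsToric F X s ι) (t : faces F) (a : chartRing (cone t.1)) (ha : a ≠ 0) :
    (X.functionField)ˣ :=
  chartUnit (h.emb t) a ha

lemma toUnit_mem_localUnits (h : IsToric F X s ι) {t : faces F} {a : chartRing (cone t.1)}
    (ha : a ≠ 0) {z : chart (cone t.1)} :
    h.toUnit t a ha ∈ localUnits X (ι t z) ↔ ¬ Vanishes a z :=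
  chartUnit_mem_localUnits (h.emb t) ha

lemma toFun_chartHom (h : IsToric F X s ι) {t u : faces F} (htu : t.1 ⊆ u.1)
    (a : chartRing (cone u.1)) : h.toFun t (chartHom (cone_mono htu) a) = h.toFun u a :=
  chartFun_comp (h.emb u) (e := h.emb t)
    (φ := CommRingCat.ofHom (chartHom (cone_mono htu)).toRingHom) (h.compatible t u htu).symm a

/-- The characters of the torus as rational functions. -/
def character (h : IsToric F X s ι) : (Fin 3 → ℤ) →+ Additive (X.functionField)ˣ where
  toFun m := Additive.ofMul
    (h.toUnit ⟨∅, h.empty_mem⟩ (chi (mem_dualMonoid_empty m)) (chi_ne_zero _))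
  map_zero' := congrArg Additive.ofMul (Units.ext (map_one (h.toFun ⟨∅, h.empty_mem⟩)))
  map_add' m m' := by
    refine congrArg Additive.ofMul (Units.ext ?_)
    change h.toFun ⟨∅, h.empty_mem⟩ _ = h.toFun ⟨∅, h.empty_mem⟩ _ * h.toFun ⟨∅, h.empty_mem⟩ _
    rw [← map_mul, ← chi_add]

lemma toUnit_chi (h : IsToric F X s ι) {t : faces F} {m : Fin 3 → ℤ}
    (hm : m ∈ dualMonoid (cone t.1)) :
    h.toUnit t (chi hm) (chi_ne_zero hm) = (h.character m).toMul := by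
  refine Units.ext ?_
  change h.toFun t (chi hm) = h.toFun ⟨∅, h.empty_mem⟩ (chi _)
  rw [← h.toFun_chartHom (t := ⟨∅, h.empty_mem⟩) (u := t) (Finset.empty_subset _), chartHom_chi]

lemma character_mem_localUnits (h : IsToric F X s ι) {t : faces F} {m : Fin 3 → ℤ}
    (hm : ∀ r ∈ t.1, m ⬝ᵥ rho r = 0) {x : X} (hx : x ∈ Set.range (ι t)) :
    (h.character m).toMul ∈ localUnits X x := by
  obtain ⟨z, rfl⟩ := hx
  rw [← h.toUnit_chi (mem_dualMonoid_cone.2 fun r hr => (hm r hr).ge), toUnit_mem_localUnits]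
  refine not_vanishes_of_isUnit (isUnit_chi _ (mem_dualMonoid_cone.2 fun r hr => ?_)) z
  rw [neg_dotProduct, hm r hr, neg_zero]

lemma dotProduct_eq_zero_of_character_mem (h : IsToric F X s ι) {r : Fin 7}
    (hr : {r} ∈ faces F) {m : Fin 3 → ℤ} {x : X} (hx : x ∈ Set.range (ι ⟨{r}, hr⟩))
    (hmin : ∀ u : faces F, x ∈ Set.range (ι u) → {r} ⊆ u.1)
    (hm : (h.character m).toMul ∈ localUnits X x) : m ⬝ᵥ rho r = 0 := by
  obtain ⟨z, rfl⟩ := hx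
  have key : ∀ m : Fin 3 → ℤ, (h.character m).toMul ∈ localUnits X (ι ⟨{r}, hr⟩ z) →
      0 ≤ m ⬝ᵥ rho r → m ⬝ᵥ rho r = 0 := by
    intro m hm h0
    have hm' : m ∈ dualMonoid (cone ({r} : Finset (Fin 7))) := mem_dualMonoid_cone.2 fun r' hr' => by
      rwa [Finset.mem_singleton.1 hr']
    rw [← h.toUnit_chi (t := ⟨{r}, hr⟩) hm', toUnit_mem_localUnits] at hm
    exact h.dotProduct_eq_zero_of_orbit hmin hm' hm r (Finset.mem_singleton_self r)
  obtain h0 | h0 := le_total 0 (m ⬝ᵥ rho r)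
  · exact key m hm h0
  · have h1 := key (-m) (by rw [map_neg]; exact inv_mem hm) (by rw [neg_dotProduct]; omega)
    rw [neg_dotProduct] at h1
    omega

/-- The character defining a toric divisor near a point. -/
def pointWeight (h : IsToric F X s ι) (φ : Fin 7 → ℤ) (x : X) : Fin 3 → ℤ :=
  localWeight (h.exists_facet x).choose φ

/-- The chosen facet is irrelevant: two local weights take the values `φ` on all common rays, so
their difference is a unit on the overlap. -/
lemma mk_pointWeight (h : IsToric F X s ι) (φ : Fin 7 → ℤ) {c : Finset (Fin 7)} (hc : c ∈ F) {x : X}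
    (hx : x ∈ Set.range (ι (facet hc))) :
    (QuotientGroup.mk (h.character (h.pointWeight φ x)).toMul :
      (X.functionField)ˣ ⧸ localUnits X x) =
      QuotientGroup.mk (h.character (localWeight c φ)).toMul := by
  obtain ⟨hc', hx'⟩ := (h.exists_facet x).choose_spec
  rw [QuotientGroup.eq_iff_div_mem, ← toMul_sub, ← map_sub]
  refine h.character_mem_localUnits (t := faceInter (facet hc') (facet hc)) (fun r hr => ?_)
    (h.inter _ _ _ hx' hx)
  have hr1 := (Finset.mem_inter.1 hr).1
  have hr2 := (Finset.mem_inter.1 hr).2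
  rw [sub_dotProduct, pointWeight, localWeight_dotProduct (h.unimodular _ hc') φ hr1,
    localWeight_dotProduct (h.unimodular _ hc) φ hr2, sub_self]

/-- The toric Cartier divisor with given multiplicities. -/
def divisor (h : IsToric F X s ι) (φ : Fin 7 → ℤ) : CartierDivisor X :=
  Additive.ofMul (α := cartierSubgroup X)
    ⟨fun x => QuotientGroup.mk (h.character (h.pointWeight φ x)).toMul, fun x => by
      obtain ⟨c, hc, hx⟩ := h.exists_facet x
      have := h.openImmersion (facet hc)
      exact ⟨(ι (facet hc)).opensRange, hx, _, fun y hy => h.mk_pointWeight φ hc hy⟩⟩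

lemma germ_divisor (h : IsToric F X s ι) (φ : Fin 7 → ℤ) {c : Finset (Fin 7)} (hc : c ∈ F) {x : X}
    (hx : x ∈ Set.range (ι (facet hc))) :
    (h.divisor φ).germ x = QuotientGroup.mk (h.character (localWeight c φ)).toMul :=
  h.mk_pointWeight φ hc hx

lemma divisor_add (h : IsToric F X s ι) (φ ψ : Fin 7 → ℤ) :
    h.divisor (φ + ψ) = h.divisor φ + h.divisor ψ := by
  refine germ_ext fun x => ?_
  obtain ⟨c, hc, hx⟩ := h.exists_facet x
  rw [germ_add, h.germ_divisor _ hc hx, h.germ_divisor _ hc hx, h.germ_divisor _ hc hx,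
    localWeight_add, map_add]
  rfl

/-- The rational functions that are a character times a unit on a chart. -/
def semiInvariants (h : IsToric F X s ι) (t : faces F) : Subgroup (X.functionField)ˣ where
  carrier := {f | ∃ m, ∀ y, f / (h.character m).toMul ∈ localUnits X (h.emb t y)}
  one_mem' := ⟨0, fun y => by
    rw [map_zero, toMul_zero, div_one]
    exact one_mem _⟩
  mul_mem' := by
    rintro f g ⟨m, hm⟩ ⟨m', hm'⟩
    refine ⟨m + m', fun y => ?_⟩
    rw [map_add, toMul_add, ← div_mul_div_comm]
    exact mul_mem (hm y) (hm' y)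
  inv_mem' := by
    rintro f ⟨m, hm⟩
    refine ⟨-m, fun y => ?_⟩
    rw [map_neg, toMul_neg, inv_div_inv, ← inv_div]
    exact inv_mem (hm y)

lemma chartUnit_mem_semiInvariants (h : IsToric F X s ι) {t : faces F} {m : Fin 3 → ℤ}
    (hm : m ∈ dualMonoid (cone t.1)) (hx : Prime (chi hm)) {p : chartRing (cone t.1)}
    (hp : Prime p) (hpx : p ∣ chi hm) :
    chartUnit (h.emb t) p hp.ne_zero ∈ h.semiInvariants t := by
  obtain ⟨u, hu⟩ := hp.associated_of_dvd hx hpx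
  refine ⟨m, fun y => ?_⟩
  rw [← h.toUnit_chi hm]
  have h1 : h.toUnit t (chi hm) (chi_ne_zero hm) =
      chartUnit (h.emb t) p hp.ne_zero * chartUnit (h.emb t) u.1 u.ne_zero := by
    refine Units.ext ?_
    change chartFun (h.emb t) (chi hm) = chartFun (h.emb t) p * chartFun (h.emb t) u.1
    rw [← hu]
    exact map_mul (chartFun (h.emb t)) p u.1
  rw [h1, div_mul_cancel_left]
  exact inv_mem ((chartUnit_mem_localUnits (h.emb t) u.ne_zero).2 fun h2 =>
    (PrimeSpectrum.isPrime y).ne_top (Ideal.eq_top_of_isUnit_mem _ h2 u.isUnit))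

/-- The coordinates of the chart of a maximal cone. -/
def coordChi {c : Finset (Fin 7)} (hu : Unimodular c) (r : c) : chartRing (cone c) :=
  chi (dualVec_mem hu subset_rfl r.2)

/-- The product of the coordinates of the chart of a maximal cone. -/
def coordProd {c : Finset (Fin 7)} (hu : Unimodular c) : chartRing (cone c) := ∏ r, coordChi hu r

lemma coordProd_ne_zero {c : Finset (Fin 7)} (hu : Unimodular c) : coordProd hu ≠ 0 :=
  Finset.prod_ne_zero_iff.2 fun _ _ => chi_ne_zero _

lemma dvd_prod_univ {R β : Type*} [CommRing R] [Fintype β] (f : β → R) (i : β) : f i ∣ ∏ j, f j :=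
  Finset.dvd_prod_of_mem f (Finset.mem_univ i)

lemma chi_dvd_coordProd {c : Finset (Fin 7)} (hu : Unimodular c) {r : Fin 7} (hr : r ∈ c) :
    chi (dualVec_mem hu subset_rfl hr) ∣ coordProd hu :=
  dvd_prod_univ (coordChi hu) ⟨r, hr⟩

lemma mem_range_torus (h : IsToric F X s ι) {c : Finset (Fin 7)} (hc : c ∈ F) {z : chart (cone c)}
    (hz : ¬ Vanishes (coordProd (h.unimodular c hc)) z) :
    ι (facet hc) z ∈ Set.range (ι ⟨∅, h.empty_mem⟩) := by
  refine (h.mem_range_iff (t := ⟨∅, h.empty_mem⟩) (u := facet hc) (Finset.empty_subset c)).2 ?_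
  refine (mem_range_chartMap_iff (h.unimodular c hc) subset_rfl (Finset.empty_subset c)).2
    fun r hr _ _ hv => hz ?_
  exact Ideal.mem_of_dvd _ (chi_dvd_coordProd (h.unimodular c hc) hr) hv

lemma primePoint_mem_torus (h : IsToric F X s ι) {c : Finset (Fin 7)} (hc : c ∈ F)
    {p : CommRingCat.of (chartRing (cone c))} (hp : Prime p)
    (hpd : ¬ p ∣ coordProd (h.unimodular c hc)) :
    h.emb (facet hc) (primePoint hp) ∈ Set.range (ι ⟨∅, h.empty_mem⟩) :=
  h.mem_range_torus hc (z := primePoint hp) fun hv => hpd ((mem_primePoint hp).1 hv)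

lemma prime_dvd_coordProd (h : IsToric F X s ι) {c : Finset (Fin 7)} (hc : c ∈ F)
    {p : CommRingCat.of (chartRing (cone c))} (hp : Prime p)
    (hpd : p ∣ coordProd (h.unimodular c hc)) :
    chartUnit (h.emb (facet hc)) p hp.ne_zero ∈ h.semiInvariants (facet hc) := by
  obtain ⟨r, -, hr⟩ := (hp.dvd_finsetProd_iff _).1 hpd
  exact h.chartUnit_mem_semiInvariants (t := facet hc) (dualVec_mem (h.unimodular c hc) subset_rfl r.2)
    (prime_chi_dualVec (h.unimodular c hc) r.2) hp hr

/-- A Cartier divisor that is trivial on the torus is given by characters on the charts. -/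
lemma exists_germ_eq_character (h : IsToric F X s ι) {D : CartierDivisor X}
    (hD : ∀ x ∈ Set.range (ι ⟨∅, h.empty_mem⟩), D.germ x = 1) {c : Finset (Fin 7)} (hc : c ∈ F) :
    ∃ m, ∀ x ∈ Set.range (ι (facet hc)), D.germ x = QuotientGroup.mk (h.character m).toMul := by
  have : UniqueFactorizationMonoid (CommRingCat.of (chartRing (cone c))) :=
    chartRing_factorial (h.unimodular c hc)
  have h1 := exists_germ_eq_of_prime (R := CommRingCat.of (chartRing (cone c)))
    (h.emb (facet hc)) (h.semiInvariants (facet hc)) (coordProd (h.unimodular c hc))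
    (coordProd_ne_zero _) (fun p hp hpd => h.prime_dvd_coordProd hc hp hpd) D
    (fun p hp hpd => hD _ (h.primePoint_mem_torus hc hp hpd))
  obtain ⟨f, ⟨m, hm⟩, hf⟩ := h1
  refine ⟨m, ?_⟩
  rintro _ ⟨y, rfl⟩
  exact (hf y).trans (QuotientGroup.eq_iff_div_mem.2 (hm y))

/-- Every Cartier divisor is linearly equivalent to a toric divisor. -/
lemma exists_eq_divisor_add (h : IsToric F X s ι) {c₀ : Finset (Fin 7)} (hc₀ : c₀ ∈ F)
    (D : CartierDivisor X) : ∃ (φ : Fin 7 → ℤ) (f : (X.functionField)ˣ), (∀ r ∈ c₀, φ r = 0) ∧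
      D = h.divisor φ + principalDivisor X f := by
  have hu := h.unimodular c₀ hc₀
  -- The chart of `c₀` is an affine space, so D is principal on it. Subtracting that principal
  -- divisor makes D trivial there, in particular on the torus.
  obtain ⟨f, hf⟩ : ∃ f : (X.functionField)ˣ, ∀ x ∈ Set.range (ι (facet hc₀)),
      D.germ x = QuotientGroup.mk f := by
    have : UniqueFactorizationMonoid (CommRingCat.of (chartRing (cone c₀))) := chartRing_factorial hu
    obtain ⟨f, hf⟩ := exists_germ_eq_of_factorial (R := CommRingCat.of (chartRing (cone c₀)))
      (h.emb (facet hc₀)) D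
    refine ⟨f, ?_⟩
    rintro _ ⟨y, rfl⟩
    exact hf y
  have hD : ∀ x ∈ Set.range (ι (facet hc₀)), (D - principalDivisor X f).germ x = 1 := by
    intro x hx
    rw [germ_sub, hf x hx]
    exact div_self' _
  have hT := fun {c} (hc : c ∈ F) => h.exists_germ_eq_character (D := D - principalDivisor X f)
    (fun x hx => hD x (h.range_subset (u := facet hc₀) (Finset.empty_subset _) hx)) hc
  choose! m hm using fun c (hc : c ∈ F) => hT hc
  -- Characters with the same germ at a point of the orbit of `r` have the same pairing with ρ_r. So
  -- the multiplicity along `r` does not depend on the facet.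
  have key : ∀ c (hc : c ∈ F) (n : Fin 3 → ℤ) (r : Fin 7) (hr : {r} ∈ faces F), r ∈ c →
      (∀ x ∈ Set.range (ι ⟨{r}, hr⟩), (D - principalDivisor X f).germ x =
        QuotientGroup.mk (h.character n).toMul) → m c ⬝ᵥ rho r = n ⬝ᵥ rho r := by
    intro c hc n r hr hrc hn
    obtain ⟨x, hx, hmin⟩ := h.exists_mem_orbit ⟨{r}, hr⟩
    have h1 := hm c hc x (h.range_subset (u := facet hc) (Finset.singleton_subset_iff.2 hrc) hx)
    rw [hn x hx, eq_comm, QuotientGroup.eq_iff_div_mem, ← toMul_sub, ← map_sub] at h1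
    have h2 := h.dotProduct_eq_zero_of_character_mem hr hx hmin h1
    rw [sub_dotProduct] at h2
    omega
  have hφ : ∀ r, ∃ n : ℤ, ∀ c ∈ F, r ∈ c → m c ⬝ᵥ rho r = n := by
    intro r
    by_cases hr : {r} ∈ faces F
    · obtain ⟨c', hc', hrc'⟩ := id hr
      refine ⟨m c' ⬝ᵥ rho r, fun c hc hrc => key c hc _ r hr hrc fun x hx => ?_⟩
      exact hm c' hc' x (h.range_subset (u := facet hc') hrc' hx)
    · exact ⟨0, fun c hc hrc => absurd ⟨c, hc, Finset.singleton_subset_iff.2 hrc⟩ hr⟩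
  choose φ hφ using hφ
  refine ⟨φ, f, fun r hr => ?_, ?_⟩
  · rw [← hφ r c₀ hc₀ hr]
    have hr' : {r} ∈ faces F := ⟨c₀, hc₀, Finset.singleton_subset_iff.2 hr⟩
    rw [key c₀ hc₀ 0 r hr' hr fun x hx => ?_, zero_dotProduct]
    rw [hD x (h.range_subset (u := facet hc₀) (Finset.singleton_subset_iff.2 hr) hx), map_zero]
    rfl
  · rw [← sub_eq_iff_eq_add]
    refine germ_ext fun x => ?_
    obtain ⟨c, hc, hx⟩ := h.exists_facet x
    rw [h.germ_divisor φ hc hx, hm c hc x hx]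
    have h1 : localWeight c φ = m c :=
      (Finset.sum_congr rfl fun r hr => by rw [hφ r c hc hr]).trans
        (sum_dualVec (h.unimodular c hc) (m c)).symm
    rw [h1]

end IsToric

end

section

/-! ### Intersection numbers with the invariant curves -/

section Restriction

variable {X C : Scheme.{0}} [IsIntegral X] [IsIntegral C]

lemma algebraMap_stalkSpecializes {x y : X} (hxy : x ⤳ y) (v : X.presheaf.stalk y) :
    algebraMap (X.presheaf.stalk x) X.functionField ((X.presheaf.stalkSpecializes hxy).hom v) =
      algebraMap (X.presheaf.stalk y) X.functionField v :=
  congrArg (fun f => f.hom v) (X.presheaf.stalkSpecializes_comp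
    ((genericPoint_spec X).specializes (Set.mem_univ x)) hxy)

/-- The inclusion of the units of a local ring in the rational functions. -/
def unitsToField (x : X) : (X.presheaf.stalk x)ˣ →* (X.functionField)ˣ :=
  Units.map (algebraMap (X.presheaf.stalk x) X.functionField).toMonoidHom

variable (j : C ⟶ X)

/-- The restriction to a curve of the rational functions that are units at its generic point. -/
def restrictUnits : (X.presheaf.stalk (j (genericPoint C)))ˣ →* (C.functionField)ˣ :=
  Units.map (j.stalkMap (genericPoint C)).hom.toMonoidHom

/-- Such a function comes from a unit of the local ring at `j p`, and restriction to the curve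
commutes with specialization from `p` to the generic point. -/
lemma restrictUnits_mem_localUnits {u : (X.presheaf.stalk (j (genericPoint C)))ˣ} {p : C}
    (h : unitsToField _ u ∈ localUnits X (j p)) : restrictUnits j u ∈ localUnits C p := by
  obtain ⟨v, hv⟩ := h
  have hs : genericPoint C ⤳ p := (genericPoint_spec C).specializes (Set.mem_univ p)
  have h1 : (X.presheaf.stalkSpecializes (hs.map j.continuous)).hom v = u := by
    apply IsFractionRing.injective (X.presheaf.stalk (j (genericPoint C))) X.functionField
    rw [algebraMap_stalkSpecializes]
    exact congrArg Units.val hv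
  refine ⟨Units.map (j.stalkMap p).hom.toMonoidHom v, Units.ext ?_⟩
  change (C.presheaf.stalkSpecializes _).hom ((j.stalkMap p).hom v) =
    (j.stalkMap (genericPoint C)).hom u
  rw [← h1]
  exact (Scheme.Hom.stalkSpecializes_stalkMap_apply j _ _ hs v.1).symm

variable {j}

/-- Two local equations that are units at the generic point of the curve differ by a unit at `j p`,
which restricts to a unit at `p`. Thus any admissible equation computes the restriction. -/
lemma IsRestriction.germ_eq {D : CartierDivisor X} {E : CartierDivisor C} (h : IsRestriction j D E)
    {p : C} {u : (X.presheaf.stalk (j (genericPoint C)))ˣ}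
    (hu : D.germ (j p) = QuotientGroup.mk (unitsToField _ u)) :
    E.germ p = QuotientGroup.mk (restrictUnits j u) := by
  obtain ⟨v, hv, hE⟩ := h p
  have hv' : D.germ (j p) = QuotientGroup.mk (unitsToField _ v) := hv
  rw [hu, QuotientGroup.eq_iff_div_mem, ← map_div] at hv'
  have h1 := restrictUnits_mem_localUnits j hv'
  rw [map_div, ← QuotientGroup.eq_iff_div_mem] at h1
  exact hE.trans h1.symm

lemma IsRestriction.exists_unit {D : CartierDivisor X} {E : CartierDivisor C}
    (h : IsRestriction j D E) {g : (X.functionField)ˣ}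
    (hg : D.germ (j (genericPoint C)) = QuotientGroup.mk g) : ∃ u, unitsToField (j (genericPoint C)) u = g := by
  obtain ⟨v, hv, -⟩ := h (genericPoint C)
  have hv' : D.germ (j (genericPoint C)) = QuotientGroup.mk (unitsToField _ v) := hv
  rw [hg, QuotientGroup.eq_iff_div_mem] at hv'
  obtain ⟨u, hu⟩ := hv'
  refine ⟨u * v, ?_⟩
  rw [map_mul]
  exact (congrArg (· * _) hu).trans (div_mul_cancel _ _)

lemma curveDegree_zero [IsLocallyNoetherian C] : curveDegree C 0 = 0 := by
  have h : ∀ p, divisorOrd C (0 : CartierDivisor C) p = 0 := fun p => by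
    have h1 : (0 : CartierDivisor C).germ p = QuotientGroup.mk 1 := rfl
    rw [divisorOrd_eq h1, map_one, toAdd_one]
  simp only [curveDegree, h, finsum_zero]

lemma numericallyTrivial_principalDivisor (f : (X.functionField)ˣ) :
    NumericallyTrivial (principalDivisor X f) := by
  intro C _ _ i _ _
  refine ⟨f, 0, fun p => ⟨1, ?_, ?_⟩, curveDegree_zero⟩
  · rw [sub_self, map_one]
    rfl
  · rw [map_one]
    rfl

lemma IntersectionNumber.of_add_principal [IsLocallyNoetherian C] {D : CartierDivisor X}
    {g : (X.functionField)ˣ} {n : ℤ} (h : IntersectionNumber j (D + principalDivisor X g) n) :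
    IntersectionNumber j D n := by
  obtain ⟨f, E, hE, hn⟩ := h
  refine ⟨f / g, E, ?_, hn⟩
  have h1 : D - principalDivisor X (f / g) = D + principalDivisor X g - principalDivisor X f := by
    rw [div_eq_mul_inv, principalDivisor_mul, principalDivisor_inv]
    abel
  rwa [h1]

end Restriction

variable {F : Finset (Finset (Fin 7))} {a b : Fin 7} {d : Fin 2 → Fin 7} {p q : ℤ}
  {X : Scheme.{0}} {s : X ⟶ SpecC} {ι : ∀ t : faces F, chart (cone t.1) ⟶ X}
  {w : IsWall F a b d p q} {j : projSpace 1 ⟶ X}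

/-- The degree on the curve of the edge `{a, b}` of the toric divisor with given multiplicities. -/
def wallDegree (a b : Fin 7) (d : Fin 2 → Fin 7) (p q : ℤ) (φ : Fin 7 → ℤ) : ℤ :=
  φ (d 0) + φ (d 1) - p * φ a - q * φ b

/-- The two weights agree on ρ_a and ρ_b, so they differ by a multiple of the dual vector of `d 1`;
the wall relation evaluates the multiple. -/
lemma localWeight_wall (w : IsWall F a b d p q) (hF : ∀ c ∈ F, Unimodular c) (φ : Fin 7 → ℤ) :
    localWeight {a, b, d 1} φ =
      localWeight {a, b, d 0} φ + wallDegree a b d p q φ • dualVec {a, b, d 1} (d 1) := by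
  have h0 := fun {r} => localWeight_dotProduct (hF _ (w.mem 0)) φ (r := r)
  have h1 := fun {r} => localWeight_dotProduct (hF _ (w.mem 1)) φ (r := r)
  rw [← sub_eq_iff_eq_add']
  refine (sum_dualVec (hF _ (w.mem 1)) _).trans ?_
  rw [Finset.sum_eq_single_of_mem (d 1) (by simp)]
  · have h2 : localWeight {a, b, d 0} φ ⬝ᵥ rho (d 1) = p * φ a + q * φ b - φ (d 0) := by
      rw [eq_sub_of_add_eq' w.relation, dotProduct_sub, dotProduct_add, dotProduct_smul,
        dotProduct_smul, h0 (by simp), h0 (by simp), h0 (by simp), smul_eq_mul, smul_eq_mul]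
    rw [sub_dotProduct, h1 (by simp), h2, wallDegree]
    congr 1
    ring
  · intro r hr hne
    have hr' : r ∈ ({a, b, d 0} : Finset (Fin 7)) := by
      simp only [Finset.mem_insert, Finset.mem_singleton] at hr ⊢
      tauto
    rw [sub_dotProduct, h1 hr, h0 hr', sub_self, zero_smul]

namespace IsWallCurve

lemma mem_range_facet (hj : IsWallCurve w ι j) (i : Fin 2)
    (y : Spec (CommRingCat.of (AwayX (N := 1) i))) :
    j (awayEmb (N := 1) i y) ∈ Set.range (ι (IsToric.facet (w.mem i))) :=
  ⟨_, (hj.apply i y).symm⟩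

lemma generic_mem_range_facet (hj : IsWallCurve w ι j) (i : Fin 2) :
    j (genericPoint (projSpace 1)) ∈ Set.range (ι (IsToric.facet (w.mem i))) := by
  obtain ⟨y, hy⟩ := genericPoint_mem_range (R := CommRingCat.of (AwayX (N := 1) i))
    (awayEmb (N := 1) i)
  rw [← hy]
  exact hj.mem_range_facet i y

variable [IsIntegral X]

/-- The coordinate of `d 1` restricts to the affine coordinate of the second standard chart, which
is nonzero at the generic point of the curve. -/
lemma exists_coord_unit (hj : IsWallCurve w ι j) (h : IsToric F X s ι) :
    ∃ u, unitsToField _ u = (h.character (dualVec {a, b, d 1} (d 1))).toMul ∧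
      restrictUnits j u = lineUnit 1 (lin 1 0) (prime_lin 1 0).ne_zero := by
  have hu := h.unimodular _ (w.mem 1)
  have hd : d 1 ∈ ({a, b, d 1} : Finset (Fin 7)) := by simp
  let x := chartGerm (h.emb (IsToric.facet (w.mem 1))) (j (genericPoint (projSpace 1)))
    (hj.generic_mem_range_facet 1) (chi (dualVec_mem hu subset_rfl hd))
  have h1 : (j.stalkMap (genericPoint (projSpace 1))).hom x = lineFun 1 (lin 1 0) := by
    refine (stalkMap_chartGerm (S := CommRingCat.of (AwayX (N := 1) 1))
      (h.emb (IsToric.facet (w.mem 1))) (e := awayEmb (N := 1) 1) (hj 1) _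
      (genericPoint_mem_range (R := CommRingCat.of (AwayX (N := 1) 1)) (awayEmb (N := 1) 1)) _
      (chi (dualVec_mem hu subset_rfl hd))).trans ?_
    refine congrArg (lineFun 1) ?_
    refine (wallHom_chi_dualVec hu _ hd).trans ?_
    rw [if_pos rfl, lin_zero]
  have h2 : IsUnit x := by
    refine isUnit_of_map_unit (j.stalkMap (genericPoint (projSpace 1))).hom x ?_
    rw [h1]
    exact (lineUnit 1 (lin 1 0) (prime_lin 1 0).ne_zero).isUnit
  refine ⟨h2.unit, ?_, Units.ext h1⟩
  rw [← h.toUnit_chi (t := IsToric.facet (w.mem 1)) (dualVec_mem hu subset_rfl hd)]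
  exact Units.ext (algebraMap_chartGerm (h.emb (IsToric.facet (w.mem 1))) _ _ _)

/-- The equations on the two charts differ by the coordinate at infinity to the power `wallDegree`.
In particular the intersection number, defined by an existence statement, is unique here. -/
lemma eq_wallDegree (hj : IsWallCurve w ι j) (h : IsToric F X s ι) {φ : Fin 7 → ℤ} {n : ℤ}
    (hn : IntersectionNumber j (h.divisor φ) n) : n = wallDegree a b d p q φ := by
  obtain ⟨f, E, hE, rfl⟩ := hn
  have hD : ∀ (i : Fin 2) {x : X}, x ∈ Set.range (ι (IsToric.facet (w.mem i))) →
      (h.divisor φ - principalDivisor X f).germ x =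
        QuotientGroup.mk ((h.character (localWeight {a, b, d i} φ)).toMul / f) := by
    intro i x hx
    rw [germ_sub, h.germ_divisor φ (w.mem i) hx]
    rfl
  obtain ⟨u, hu⟩ := hE.exists_unit (hD 0 (hj.generic_mem_range_facet 0))
  obtain ⟨v, hv, hv'⟩ := hj.exists_coord_unit h
  refine curveDegree_eq (g := restrictUnits j u) (fun y => ?_) fun y => ?_
  · refine hE.germ_eq ?_
    rw [hD 0 (hj.mem_range_facet 0 y), hu]
  · rw [← hv', ← map_zpow, ← map_mul]
    refine hE.germ_eq ?_
    rw [hD 1 (hj.mem_range_facet 1 y), map_mul, map_zpow, hu, hv,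
      localWeight_wall w h.unimodular φ, map_add, map_zsmul, toMul_add, toMul_zsmul,
      div_mul_eq_mul_div]

/-- The degree of a numerically trivial toric divisor on an invariant curve. -/
lemma wallDegree_eq_zero (hj : IsWallCurve w ι j) (h : IsToric F X s ι) {φ : Fin 7 → ℤ}
    {g : (X.functionField)ˣ}
    (hD : NumericallyTrivial (h.divisor φ + principalDivisor X g)) :
    wallDegree a b d p q φ = 0 :=
  (hj.eq_wallDegree h (hD (projSpace 1) j (hj.isClosedImmersion h)
    topologicalKrullDim_projSpace_one).of_add_principal).symm

end IsWallCurve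

lemma wallDegree_sub (a b : Fin 7) (d : Fin 2 → Fin 7) (p q : ℤ) (φ ψ : Fin 7 → ℤ) :
    wallDegree a b d p q (φ - ψ) = wallDegree a b d p q φ - wallDegree a b d p q ψ := by
  simp only [wallDegree, Pi.sub_apply]
  ring

lemma wallDegree_add (a b : Fin 7) (d : Fin 2 → Fin 7) (p q : ℤ) (φ ψ : Fin 7 → ℤ) :
    wallDegree a b d p q (φ + ψ) = wallDegree a b d p q φ + wallDegree a b d p q ψ := by
  simp only [wallDegree, Pi.add_apply]
  ring

/-- A sum of numerically trivial divisors that is a toric divisor up to linear equivalence has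
degree zero on the invariant curves. -/
lemma wallDegree_eq_zero_of_mem_span [IsIntegral X] (w : IsWall F a b d p q) (h : IsToric F X s ι)
    {c₀ : Finset (Fin 7)} (hc₀ : c₀ ∈ F) {φ : Fin 7 → ℤ}
    (hD : h.divisor φ ∈ Submodule.span ℤ {D : CartierDivisor X | NumericallyTrivial D}) :
    wallDegree a b d p q φ = 0 := by
  obtain ⟨j, hj⟩ := exists_isWallCurve w h
  -- Linearly equivalent toric divisors have equal degree: their difference is again toric, and it
  -- is principal, hence numerically trivial.
  have hdiv : ∀ φ ψ g, h.divisor φ = h.divisor ψ + principalDivisor X g →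
      wallDegree a b d p q φ = wallDegree a b d p q ψ := by
    intro φ ψ g hg
    rw [← sub_eq_zero, ← wallDegree_sub]
    refine hj.wallDegree_eq_zero h (g := g⁻¹) (φ := φ - ψ) ?_
    have h1 : h.divisor (φ - ψ) = principalDivisor X g := by
      have h2 := h.divisor_add (φ - ψ) ψ
      rw [sub_add_cancel, hg, add_comm] at h2
      exact (add_right_cancel h2).symm
    rw [h1, principalDivisor_inv, add_neg_cancel]
    exact numericallyTrivial_principalDivisor 1
  have key : ∀ D ∈ Submodule.span ℤ {D : CartierDivisor X | NumericallyTrivial D},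
      ∃ ψ g, D = h.divisor ψ + principalDivisor X g ∧ wallDegree a b d p q ψ = 0 := by
    have h0 : h.divisor 0 = 0 := by
      have := h.divisor_add 0 0
      rwa [add_zero, left_eq_add] at this
    have hadd : ∀ D E, (∃ ψ g, D = h.divisor ψ + principalDivisor X g ∧
        wallDegree a b d p q ψ = 0) → (∃ ψ g, E = h.divisor ψ + principalDivisor X g ∧
        wallDegree a b d p q ψ = 0) → ∃ ψ g, D + E = h.divisor ψ + principalDivisor X g ∧
        wallDegree a b d p q ψ = 0 := by
      rintro _ _ ⟨ψ, g, rfl, hψ⟩ ⟨ψ', g', rfl, hψ'⟩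
      refine ⟨ψ + ψ', g * g', ?_, by rw [wallDegree_add, hψ, hψ', add_zero]⟩
      rw [h.divisor_add, principalDivisor_mul]
      abel
    -- Numerical triviality is not visibly closed under addition, but divisors equivalent to a toric
    -- one of degree zero form a subgroup, and it contains all numerically trivial divisors.
    let P : AddSubgroup (CartierDivisor X) :=
      { carrier := {D | ∃ ψ g, D = h.divisor ψ + principalDivisor X g ∧
          wallDegree a b d p q ψ = 0}
        zero_mem' := ⟨0, 1, by rw [h0, principalDivisor_one, add_zero], by simp [wallDegree]⟩
        add_mem' := hadd _ _
        neg_mem' := by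
          rintro _ ⟨ψ, g, rfl, hψ⟩
          refine ⟨-ψ, g⁻¹, ?_, ?_⟩
          · have h1 := h.divisor_add ψ (-ψ)
            rw [add_neg_cancel, h0] at h1
            rw [principalDivisor_inv, neg_add, neg_eq_of_add_eq_zero_right h1.symm]
          · rw [← zero_sub, wallDegree_sub, hψ]
            simp [wallDegree] }
    intro D hD
    refine (Submodule.span_le (p := AddSubgroup.toIntSubmodule P)).2 (fun D hD => ?_) hD
    obtain ⟨ψ, g, -, rfl⟩ := h.exists_eq_divisor_add hc₀ D
    exact ⟨ψ, g, rfl, hj.wallDegree_eq_zero h hD⟩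
  obtain ⟨ψ, g, hg, hψ⟩ := key _ hD
  rw [hdiv φ ψ g hg, hψ]

/-! ### The Picard number -/

/-- For multiplicities v supported on ρ₀, ρ₁, ρ₂, ρ₆, the degrees on these four curves are v₃, v₂,
v₀ and v₁ + v₃ - v₀ - v₂; they vanish together only for v = 0. -/
lemma isWall_three_four : IsWall facets₃ 3 4 ![5, 6] 0 0 := by
  constructor <;> decide +kernel

lemma isWall_three_five : IsWall facets₃ 3 5 ![2, 4] 0 (-1) := by
  constructor <;> decide +kernel

lemma isWall_four_five : IsWall facets₃ 4 5 ![0, 3] 0 (-1) := by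
  constructor <;> decide +kernel

lemma isWall_zero_two : IsWall facets₃ 0 2 ![1, 6] 1 1 := by
  constructor <;> decide +kernel

/-- The functions on the rays that vanish on `ρ₃, ρ₄, ρ₅`. -/
def multiplicities : (Fin 4 → ℤ) →+ (Fin 7 → ℤ) where
  toFun v := ![v 0, v 1, v 2, 0, 0, 0, v 3]
  map_zero' := by
    ext r
    fin_cases r <;> rfl
  map_add' v v' := by
    ext r
    fin_cases r <;> rfl

lemma exists_multiplicities_eq {φ : Fin 7 → ℤ}
    (h : ∀ r ∈ ({3, 4, 5} : Finset (Fin 7)), φ r = 0) : ∃ v, multiplicities v = φ := by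
  refine ⟨![φ 0, φ 1, φ 2, φ 6], ?_⟩
  ext r
  fin_cases r
  · rfl
  · rfl
  · rfl
  · exact (h 3 (by decide)).symm
  · exact (h 4 (by decide)).symm
  · exact (h 5 (by decide)).symm
  · rfl

namespace IsToric

variable {s : X ⟶ SpecC} {ι : ∀ t : faces facets₃, chart (cone t.1) ⟶ X} [IsIntegral X]

/-- The numerical classes of the toric divisors. -/
def numClass (h : IsToric facets₃ X s ι) : (Fin 4 → ℤ) →+ NumClasses X :=
  (Submodule.mkQ _).toAddMonoidHom.comp
    ((AddMonoidHom.mk' h.divisor h.divisor_add).comp multiplicities)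

lemma numClass_injective (h : IsToric facets₃ X s ι) : Function.Injective h.numClass := by
  refine (injective_iff_map_eq_zero _).2 fun v hv => ?_
  have hmem : h.divisor (multiplicities v) ∈
      Submodule.span ℤ {D : CartierDivisor X | NumericallyTrivial D} :=
    (Submodule.Quotient.mk_eq_zero _).1 hv
  have hc : {3, 4, 5} ∈ facets₃ := by decide +kernel
  have h1 := wallDegree_eq_zero_of_mem_span isWall_three_four h hc hmem
  have h2 := wallDegree_eq_zero_of_mem_span isWall_three_five h hc hmem
  have h3 := wallDegree_eq_zero_of_mem_span isWall_four_five h hc hmem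
  have h4 := wallDegree_eq_zero_of_mem_span isWall_zero_two h hc hmem
  have e1 : (0 : ℤ) + v 3 - 0 * 0 - 0 * 0 = 0 := h1
  have e2 : v 2 + 0 - 0 * 0 - (-1) * 0 = 0 := h2
  have e3 : v 0 + 0 - 0 * 0 - (-1) * 0 = 0 := h3
  have e4 : v 1 + v 3 - 1 * v 0 - 1 * v 2 = 0 := h4
  ext i
  fin_cases i
  · change v 0 = 0
    omega
  · change v 1 = 0
    omega
  · change v 2 = 0
    omega
  · change v 3 = 0
    omega

lemma numClass_surjective (h : IsToric facets₃ X s ι) : Function.Surjective h.numClass := by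
  intro x
  obtain ⟨D, rfl⟩ := Submodule.Quotient.mk_surjective _ x
  obtain ⟨φ, f, hφ, rfl⟩ := h.exists_eq_divisor_add (c₀ := {3, 4, 5}) (by decide +kernel) D
  obtain ⟨v, rfl⟩ := exists_multiplicities_eq hφ
  refine ⟨v, ?_⟩
  refine (Submodule.Quotient.eq _).2 ?_
  change h.divisor (multiplicities v) - (h.divisor (multiplicities v) + principalDivisor X f) ∈ _
  rw [sub_add_cancel_left, ← principalDivisor_inv]
  exact Submodule.subset_span (numericallyTrivial_principalDivisor _)

/-- The Picard number of the combinatorial quotient. -/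
lemma picardNumber_eq (h : IsToric facets₃ X s ι) : picardNumber X = 4 := by
  have e : (Fin 4 → ℤ) ≃ₗ[ℤ] NumClasses X :=
    (AddEquiv.ofBijective h.numClass
      ⟨h.numClass_injective, h.numClass_surjective⟩).toIntLinearEquiv
  rw [picardNumber, ← e.finrank_eq, Module.finrank_fin_fun]

end IsToric

end

end FlagQuotient

end

open FlagQuotient in
theorem proposition4p1 :
    -- `projMatrix` is the cokernel of the inclusion of `N(H)` in `N(T)`
    (Function.Surjective projMatrix.mulVecLin ∧
      LinearMap.ker projMatrix.mulVecLin = LinearMap.range conjWeights) ∧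
    -- the quotient fan is a fan, with the seven rays listed
    IsFan combFan ∧
    Function.Injective rho ∧ rayGenerators combFan = Set.range rho ∧
    -- its toric variety
    ∃ (X : Scheme.{0}) (s : X ⟶ SpecC) (ι : ∀ σ : combFan, chart σ.1 ⟶ X),
      IsToricVariety combFan X s ι ∧
      Smooth s ∧ IsProjective s ∧ topologicalKrullDim X = 3 ∧
      (∃ _ : IsIntegral X, picardNumber X = 4) ∧
      -- the three blowups, along the line `y₀ = y₂ = 0`, the strict transform of the line
      -- `y₀ = y₁ = 0`, and the strict transform of the fiber over `[0 : 0 : 0 : 1]`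
      ∃ (X₁ X₂ : Scheme.{0}) (pa : X₁ ⟶ projSpace 3) (pb : X₂ ⟶ X₁) (pd : X ⟶ X₂),
        IsBlowupAlongRationalCurve pa (projSpaceToSpecC 3) (coordLocus {0, 2}) ∧
        IsBlowupAlongRationalCurve pb (pa ≫ projSpaceToSpecC 3)
          (strictTransform pa (coordLocus {0, 2}) (coordLocus {0, 1})) ∧
        IsBlowupAlongRationalCurve pd (pb ≫ pa ≫ projSpaceToSpecC 3)
          (strictTransform pb (strictTransform pa (coordLocus {0, 2}) (coordLocus {0, 1}))
            (pa ⁻¹' coordLocus {0, 1, 2})) ∧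
        pd ≫ pb ≫ pa ≫ projSpaceToSpecC 3 = s ∧
        -- the composition is the toric morphism extending the identity of the torus
        ∀ σ : combFan, torusToChart σ.1 ≫ ι σ ≫ pd ≫ pb ≫ pa = torusToProjSpace 3 := by
  obtain ⟨X, ι, X₁, X₂, pa, pb, pd, h, ha, hb, hd, ht⟩ := exists_tower
  obtain ⟨κ, hκ, hκι⟩ := exists_isToricVariety_combFan h
  have hne : facets₃.Nonempty := ⟨{3, 4, 5}, by decide +kernel⟩
  have hint := h.isIntegral hne
  refine ⟨projMatrix_exact, isFan_combFan, by decide, rayGenerators_combFan, X, _, κ, hκ,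
    h.smooth, h.isProjective isVeryAmple_polytopePoints, h.topologicalKrullDim_eq hne, ⟨hint, h.picardNumber_eq⟩,
    X₁, X₂, pa, pb, pd, ha, hb, hd, rfl, fun σ => ?_⟩
  obtain ⟨t, e, he⟩ := hκι σ
  rw [he, Category.assoc, ← Category.assoc, torusToChart_chartMap]
  exact ht t
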